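/- **Setting.** Write $x=(x_1,x_2)$ (also $(x,y)$) for points of the upper half plane $\mathbb{R}_2^+=\{x_2>0\}$, $\mathbb{R}_2^{++}=\{x_1,x_2>0\}$, and $|x|$ for the Euclidean length. Let $C_l>0$, $S\ge 1$, $r=1-C_l y$. Let $\omega$ be odd in $x_1$ and vanish for $|x|>S$. Let $\phi$ be the rescaled axisymmetric stream function of $\omega$: the classical solution, odd in $x_1$ and $C^2$ up to the solid boundary $y=0$, of $$-(\partial_{xx}+\partial_{yy})\phi+\frac{C_l}{r}\partial_y\phi+\frac{C_l^2}{r^2}\phi=r\,\omega\quad\text{in } |x_1|<C_l^{-1},\ 0<y<C_l^{-1},$$ continuous on the closed rectangle and vanishing on its boundary ($y=0$ is the solid boundary, $|x_1|=C_l^{-1}$ the ends of the period cell, $y=C_l^{-1}$ the symmetry axis). Put $\phi_1=r^{1/2}\phi$, $\Omega_1=r^{3/2}\omega$, $a=\frac34$, so that $-\Delta\phi_1=\Omega_1-\frac{aC_l^2}{r^2}\phi_1$. Let $$(-\Delta)^{-1}f(x)=-\frac1{2\pi}\int_{\mathbb{R}_2^+}\big(\log|x-y|-\log|(x_1-y_1,x_2+y_2)|\big)f(y)\,dy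 .$$ Fix cutoff functions $\chi,\eta:\overline{\mathbb{R}_2^+}\to[0,1]$ that are smooth up to the boundary, even in $x_1$, equal to $1$ for $|x|\le1$ and to $0$ for $|x|\ge2$. Put $R_i=4^{-i}C_l^{-1}$, $\chi_i(x)=\chi(x/R_i)$, $$Z_{1,i}=2\nabla\phi_1\cdot\nabla\chi_i+\phi_1\Delta\chi_i,\qquad Z_{2,i}=\frac{aC_l^2}{r^2}\phi_1\chi_i ,\qquad \kappa=-\frac{xy^3}{6}\,\eta$$ (so $-\Delta\kappa=xy$ near $0$). The space $X$ is given by $$\|\Omega\|_X=\max\big(\|\Omega\varphi_1\|_{L^\infty},\|\Omega\varphi_{g,1}\|_{L^\infty},[\Omega\psi_1]_{C^{1/2}_{g_1}}\big)\quad\text{on }\mathbb{R}_2^{++},\qquad [f]_{C^{1/2}_{g_1}}=\sup_{x,z\in\mathbb{R}_2^{++}}|(f(x)-f(z))\,g_1(x-z)|,$$ with $\psi_1=|x|^{-2}+0.5|x|^{-1}+0.2|x|^{-1/6}$, $\varphi_1=|x_1|^{-1/2}(|x|^{-2.4}+0.6|x|^{-1/2})+0.3|x|^{-1/6}$, $\varphi_{g,1}=\varphi_1+|x|^{1/16}$,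 $g_1(h)=g_{10}(h)/g_{10}(1,0)$ and $g_{10}(h)=\big(\sqrt{|h_1|+0.12|h_2|}+0.25\sqrt{|h_2|+0.01|h_1|}\big)^{-1}$. All norms $\|\cdot\|_{\infty}$ below are over $\mathbb{R}_2^+$. Then the following hold. The constants $\nu_1,\nu_2>0$, and those implied by $\lesssim$, depend only on the subscripts or arguments shown and on the fixed cutoffs $\chi,\eta$. **(1) Gradient.** Let $\alpha>0$, $\beta\in(0,1)$. There is $\nu_1(\alpha,\beta)<\frac1{32}$ such that, if $\omega$ is Hölder continuous (with some positive exponent) on $\mathbb{R}_2^+$ and $C_l(1+S)<\nu_1$, then $$|\nabla\phi_1|\,(|x|^{-1}+|x|^{-1+\beta})\lesssim_{\alpha,\beta}\|\Omega_1(|x|^{-\alpha}+|x|^\beta)\|_\infty\qquad(|x|\le 2R_2),$$ $$|\nabla\phi_1|\lesssim_{\alpha,\beta}\Big(\frac{S^{3-\beta}}{|x|^2}+|x|^{1-\beta}(C_lS)^{2-\beta}\Big)\|\Omega_1(|x|^{-\alpha}+|x|^\beta)\|_\infty\qquad(8S\le|x|\le R_1/2).$$ **(2) Hessian.** There are $\nu_2(\alpha,\beta)<\frac1{32}$,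 for $\alpha\in(0,1]$ and $\beta\in(0,1)$, such that, if $\omega$ is Hölder continuous on $\mathbb{R}_2^+$ and $C_l(1+S)<\nu_2(\alpha,\beta)$, then on $\mathbb{R}_2^+$ $$|\nabla^2(\phi_1\chi_3)-\nabla^2(-\Delta)^{-1}\Omega_1|\lesssim_{\alpha,\beta}C_l^\beta\,\|\Omega_1(|x|^{-\alpha}+|x|^\beta)\|_\infty ,$$ and moreover $\partial_{xy}\phi_1(0)=\partial_{xy}\phi(0)$ and $|\partial_{xy}\phi_1(0)-\partial_{xy}(-\Delta)^{-1}\Omega_1(0)|\lesssim_{\alpha,\beta}C_l^\beta\|\Omega_1(|x|^{-\alpha}+|x|^\beta)\|_\infty$. **(3) Error terms.** Moreover $\nu_2$ can be chosen so that in addition the following holds. If $\Omega_1\in X$ and $C_lS<\nu_2(1,\frac1{16})$, then, with $$Z=Z_{1,4}+Z_{2,4}-\partial_{xy}Z_{2,4}(0)\,(-\Delta\kappa),\qquad M=\|\Omega_1(|x|^{-1}+|x|^{1/16})\|_\infty+\|\chi_3\nabla^2(-\Delta)^{-1}\Omega_1\|_\infty ,$$ one has $$\|Z\|_X\lesssim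 C_lS\,M,\qquad \|\nabla Z\|_{L^\infty}\lesssim C_l\,M .$$ -/

import Mathlib

open scoped ENNReal NNReal

noncomputable section

namespace ElliEst

/-! Points of the plane are pairs `(x, y) = (x₁, x₂)`; `ℝ × ℝ` is used only as a set with its
smooth structure and Lebesgue measure, and lengths are the Euclidean ones below. -/

/-- The Euclidean length of a point of the plane. -/
def len (p : ℝ × ℝ) : ℝ := Real.sqrt (p.1 ^ 2 + p.2 ^ 2)

/-- The open upper half plane. -/
def halfPlane : Set (ℝ × ℝ) := {p | 0 < p.2}

/-- The closed upper half plane. -/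
def closedHalfPlane : Set (ℝ × ℝ) := {p | 0 ≤ p.2}

/-- The open first quadrant. -/
def quadrant : Set (ℝ × ℝ) := {p | 0 < p.1 ∧ 0 < p.2}

/-- The partial derivative in the first variable. -/
def dx (f : ℝ × ℝ → ℝ) (p : ℝ × ℝ) : ℝ := deriv (fun t => f (t, p.2)) p.1

/-- The partial derivative in the second variable. -/
def dy (f : ℝ × ℝ → ℝ) (p : ℝ × ℝ) : ℝ := deriv (fun t => f (p.1, t)) p.2

/-- The gradient, with the Euclidean norm. -/
def grad (f : ℝ × ℝ → ℝ) (p : ℝ × ℝ) : EuclideanSpace ℝ (Fin 2) := !₂[dx f p, dy f p]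

/-- The four second partial derivatives, with the Euclidean (Frobenius) norm. -/
def hess (f : ℝ × ℝ → ℝ) (p : ℝ × ℝ) : EuclideanSpace ℝ (Fin 4) :=
  !₂[dx (dx f) p, dx (dy f) p, dy (dx f) p, dy (dy f) p]

/-- The Laplacian. -/
def lap (f : ℝ × ℝ → ℝ) (p : ℝ × ℝ) : ℝ := dx (dx f) p + dy (dy f) p

/-- The mixed derivative `∂ₓ∂_y f` at the boundary point `0` of the upper half plane: the normal
derivative along the boundary is one-sided. Only values of `f` on `y ≥ 0` matter. -/
def dxyZero (f : ℝ × ℝ → ℝ) : ℝ :=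
  deriv (fun s => derivWithin (fun t => f (s, t)) (Set.Ici 0) 0) 0

/-- The Green potential `(-Δ)⁻¹ f` of the upper half plane with zero Dirichlet data. -/
def invLap (f : ℝ × ℝ → ℝ) (p : ℝ × ℝ) : ℝ :=
  -(1 / (2 * Real.pi)) * ∫ q in halfPlane,
    (Real.log (len (p.1 - q.1, p.2 - q.2)) - Real.log (len (p.1 - q.1, p.2 + q.2))) * f q

/-- `sup_{p ∈ D} |f p|`, with value `∞` if `f` is unbounded on `D`. It is used for functions that
are continuous on the open set `D`, where it is the `L^∞` norm. -/
def supNorm (D : Set (ℝ × ℝ)) (f : ℝ × ℝ → ℝ) : ℝ≥0∞ := ⨆ p ∈ D, ENNReal.ofReal |f p|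

/-! ### The weights and the space `X` -/

/-- `ψ₁ = |x|^{-2} + 0.5 |x|^{-1} + 0.2 |x|^{-1/6}`. -/
def psiOne (p : ℝ × ℝ) : ℝ :=
  len p ^ (-2 : ℝ) + 0.5 * len p ^ (-1 : ℝ) + 0.2 * len p ^ (-(1 / 6) : ℝ)

/-- `φ₁ = |x₁|^{-1/2} (|x|^{-2.4} + 0.6 |x|^{-1/2}) + 0.3 |x|^{-1/6}` (the decaying weight). -/
def phiOne (p : ℝ × ℝ) : ℝ :=
  |p.1| ^ (-(1 / 2) : ℝ) * (len p ^ (-2.4 : ℝ) + 0.6 * len p ^ (-(1 / 2) : ℝ))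
    + 0.3 * len p ^ (-(1 / 6) : ℝ)

/-- The growing weight `φ₁ + |x|^{1/16}`. -/
def phiGOne (p : ℝ × ℝ) : ℝ := phiOne p + len p ^ (1 / 16 : ℝ)

/-- `(√(|h₁| + q₁ |h₂|) + q₃ √(|h₂| + q₂ |h₁|))⁻¹` with `q = (0.12, 0.01, 0.25)`. -/
def gOneZero (h : ℝ × ℝ) : ℝ :=
  (Real.sqrt (|h.1| + 0.12 * |h.2|) + 0.25 * Real.sqrt (|h.2| + 0.01 * |h.1|))⁻¹

/-- The Hölder weight, normalized by `g₁(1, 0) = 1`. -/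
def gOne (h : ℝ × ℝ) : ℝ := gOneZero h * (gOneZero (1, 0))⁻¹

/-- The weighted `C^{1/2}` seminorm `sup_{x, z} |(f(x) - f(z)) g₁(x - z)|` over the quadrant. -/
def holderG (f : ℝ × ℝ → ℝ) : ℝ≥0∞ :=
  ⨆ p ∈ quadrant, ⨆ q ∈ quadrant, ENNReal.ofReal |(f p - f q) * gOne (p - q)|

/-- The norm of `X`; `f ∈ X` means `xNorm f < ∞`. -/
def xNorm (f : ℝ × ℝ → ℝ) : ℝ≥0∞ :=
  max (supNorm quadrant fun p => f p * phiOne p)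
    (max (supNorm quadrant fun p => f p * phiGOne p) (holderG fun p => f p * psiOne p))

/-- `‖Ω (|x|^{-α} + |x|^β)‖_∞`. -/
def wNorm (α β : ℝ) (f : ℝ × ℝ → ℝ) : ℝ≥0∞ :=
  supNorm halfPlane fun p => f p * (len p ^ (-α) + len p ^ β)

/-! ### The rescaled elliptic problem -/

/-- The rescaled distance to the symmetry axis, `r = 1 - C_l y`. -/
def rad (Cl : ℝ) (p : ℝ × ℝ) : ℝ := 1 - Cl * p.2

/-- The vorticity `ω` is odd in `x` and vanishes for `|(x, y)| > S`. -/
structure IsSource (S : ℝ) (ω : ℝ × ℝ → ℝ) : Prop where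
  odd : ∀ x y : ℝ, 0 < y → ω (-x, y) = -ω (x, y)
  supp : ∀ p ∈ halfPlane, S < len p → ω p = 0

/-- `φ` is the stream function of `ω`: the classical solution of
`-(φ_xx + φ_yy) + (C_l / r) φ_y + (C_l² / r²) φ = r ω` in the rescaled period cell
`|x| ≤ 1/C_l`, `0 ≤ y ≤ 1/C_l`, odd in `x`, vanishing on the solid boundary `y = 0`, on
`|x| = 1/C_l` (from oddness and periodicity in `z`) and on the symmetry axis `y = 1/C_l`, and
of class `C²` up to the solid boundary. -/
structure IsStream (Cl : ℝ) (ω φ : ℝ × ℝ → ℝ) : Prop where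
  cont : ContinuousOn φ {p | |p.1| ≤ 1 / Cl ∧ 0 ≤ p.2 ∧ p.2 ≤ 1 / Cl}
  smooth : ContDiffOn ℝ 2 φ {p | |p.1| < 1 / Cl ∧ 0 ≤ p.2 ∧ p.2 < 1 / Cl}
  odd : ∀ x y : ℝ, |x| ≤ 1 / Cl → 0 ≤ y → y ≤ 1 / Cl → φ (-x, y) = -φ (x, y)
  wall : ∀ x : ℝ, |x| ≤ 1 / Cl → φ (x, 0) = 0
  side : ∀ x y : ℝ, |x| = 1 / Cl → 0 ≤ y → y ≤ 1 / Cl → φ (x, y) = 0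
  axis : ∀ x : ℝ, |x| ≤ 1 / Cl → φ (x, 1 / Cl) = 0
  pde : ∀ p : ℝ × ℝ, |p.1| < 1 / Cl → 0 < p.2 → p.2 < 1 / Cl →
    -(dx (dx φ) p + dy (dy φ) p) + Cl / rad Cl p * dy φ p + Cl ^ 2 / rad Cl p ^ 2 * φ p
      = rad Cl p * ω p

/-- `Ω₁ = ω r^{3/2}`. -/
def OmOne (Cl : ℝ) (ω : ℝ × ℝ → ℝ) (p : ℝ × ℝ) : ℝ := ω p * rad Cl p ^ (3 / 2 : ℝ)

/-- `φ₁ = φ r^{1/2}`; it solves `-Δφ₁ = Ω₁ - (3/4) C_l² φ₁ / r²`. -/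
def streamOne (Cl : ℝ) (φ : ℝ × ℝ → ℝ) (p : ℝ × ℝ) : ℝ := φ p * rad Cl p ^ (1 / 2 : ℝ)

/-! ### Cutoffs and error terms -/

/-- Smooth cutoffs on the closed upper half plane, even in `x₁`, with values in `[0, 1]`, equal to
`1` for `|x| ≤ 1` and to `0` for `|x| ≥ 2`. -/
structure IsCutoff (χ : ℝ × ℝ → ℝ) : Prop where
  smooth : ContDiffOn ℝ ((⊤ : ℕ∞) : WithTop ℕ∞) χ closedHalfPlane
  mem_Icc : ∀ p ∈ closedHalfPlane, 0 ≤ χ p ∧ χ p ≤ 1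
  even : ∀ x y : ℝ, 0 ≤ y → χ (-x, y) = χ (x, y)
  one : ∀ p ∈ closedHalfPlane, len p ≤ 1 → χ p = 1
  zero : ∀ p ∈ closedHalfPlane, 2 ≤ len p → χ p = 0

/-- `R_i = 4^{-i} C_l⁻¹`. -/
def R (Cl : ℝ) (i : ℕ) : ℝ := ((4 : ℝ) ^ i)⁻¹ * Cl⁻¹

/-- `χ_i(x) = χ(x / R_i)`. -/
def cut (χ : ℝ × ℝ → ℝ) (Cl : ℝ) (i : ℕ) (p : ℝ × ℝ) : ℝ :=
  χ (p.1 / R Cl i, p.2 / R Cl i)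

/-- `Z_{1,i} = 2 ∇φ₁ · ∇χ_i + φ₁ Δχ_i`. -/
def ZOne (χ : ℝ × ℝ → ℝ) (Cl : ℝ) (φ : ℝ × ℝ → ℝ) (i : ℕ) (p : ℝ × ℝ) : ℝ :=
  2 * (dx (streamOne Cl φ) p * dx (cut χ Cl i) p + dy (streamOne Cl φ) p * dy (cut χ Cl i) p)
    + streamOne Cl φ p * lap (cut χ Cl i) p

/-- `Z_{2,i} = (a C_l² / r²) φ₁ χ_i` with `a = 3/4`. -/
def ZTwo (χ : ℝ × ℝ → ℝ) (Cl : ℝ) (φ : ℝ × ℝ → ℝ) (i : ℕ) (p : ℝ × ℝ) : ℝ :=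
  (3 / 4 : ℝ) * Cl ^ 2 / rad Cl p ^ 2 * streamOne Cl φ p * cut χ Cl i p

/-- `κ = -(x y³ / 6) η`, so that `-Δκ = x y` near the origin. -/
def kap (η : ℝ × ℝ → ℝ) (p : ℝ × ℝ) : ℝ := -(p.1 * p.2 ^ 3 / 6) * η p

/-- `Z = Z_{1,4} + Z_{2,4} - ∂_{xy} Z_{2,4}(0) (-Δκ)`. -/
def ZTot (χ η : ℝ × ℝ → ℝ) (Cl : ℝ) (φ : ℝ × ℝ → ℝ) (p : ℝ × ℝ) : ℝ :=
  ZOne χ Cl φ 4 p + ZTwo χ Cl φ 4 p - dxyZero (ZTwo χ Cl φ 4) * (-lap (kap η) p)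

/-- `M = ‖Ω₁ (|x|^{-1} + |x|^{1/16})‖_∞ + ‖χ₃ ∇²(-Δ)⁻¹ Ω₁‖_∞`. -/
def MTot (χ : ℝ × ℝ → ℝ) (Cl : ℝ) (ω : ℝ × ℝ → ℝ) : ℝ≥0∞ :=
  wNorm 1 (1 / 16) (OmOne Cl ω)
    + supNorm halfPlane fun p => cut χ Cl 3 p * ‖hess (invLap (OmOne Cl ω)) p‖

end ElliEst

end

open ElliEst

section

open Set Filter Topology MeasureTheory

namespace ElliEst

/-! ### Partial derivatives -/

/-! The factor r^{1/2} removes the first order term of the equation. Everything then concerns a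
solution u of -Δu + Vu = Ω in the cell with zero boundary values, where V = (3/4)C_l²/r² is positive
(`isReduced_streamOne`). Since V > 0 and u is odd, the maximum principle bounds u on the half x₁ ≥ 0
of the cell by any nonnegative W with -ΔW ≥ Ω (`IsReduced.le_barrier`). Write A for a bound of the
weighted source.

Two barriers give the size of u. A multiple of ∫₀^{xy} (1 + t^{α/2})^{-β/α} dt has -ΔW at least
A/(|x|^{-α} + |x|^β), because ΔF(xy) = F''(xy)|x|². It yields |u| ≲ A min(|x|², |x|^{2-β})
(`exists_size_bound`). Outside |x| = S the harmonic function (x+y)/|x|² yields |u| ≲ A S^{3-β}/|x|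
(`exists_far_bound`).

Derivatives are bounded by comparison as well. The part of u odd about a point lies below a
quadratic barrier on a box, which may end at the wall (`gradBound_of_box`); used at the scale |x|,
this proves the gradient estimates. Away from the source the equation is Δu = Vu with V independent
of x₁, so difference quotients in x₁ satisfy the same estimate, and u_yy is then read off from the
equation (`exists_hess_bound`).

For the Hessian, let ζ be a radial cutoff at radius 1/(32C_l). Green's representation formula
(`IsTest.invLap_eq`) applies to uζ, and -Δ(uζ) = Ω + F with F = -Vuζ - 2∇u·∇ζ - uΔζ; hence (-Δ)⁻¹Ω =
uζ - (-Δ)⁻¹F. The function F is C¹ up to the wall, vanishes there, lives on |x| ≤ 1/(16C_l) and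
satisfies |∇F| ≲ A C_l^{1+β}. Its odd reflection is therefore C¹, the Hessian of its potential is a
convolution of ∇F with kernels of size 1/|z|, and this is O(A C_l^β) (`contDiff_invLap`,
`exists_locSource_bound`). The functions uχ₃ and uζ differ only where |x| is comparable with 1/C_l,
where the Hessian bound for u applies.

For the error terms, Ω + F is odd in x₁ and O(A|x|). Expanding the antisymmetrized Green kernel
gives uζ = cxy + O(A|x|³) (`exists_expansion`), and the box estimate turns this into ∇(u - cxy) =
O(A|x|²), so that c = ∂_{xy}u(0) (`exists_stream_expansion`). Near 0 the error Z is Vu - (3/4)C_l² c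
xy, with gradient O(A C_l²|x|²). For |x| ≥ 1 its gradient is O(A C_l) and its size O(A C_l S
|x|^{-1/16}). These bounds and the vanishing of Z on x₁ = 0 control the norm of X
(`ErrBound.xNorm_le`). -/

lemma hasDerivAt_dx_fderiv {f : ℝ × ℝ → ℝ} {p : ℝ × ℝ} (h : DifferentiableAt ℝ f p) :
    HasDerivAt (fun t => f (t, p.2)) (fderiv ℝ f p (1, 0)) p.1 := by
  have h1 : HasDerivAt (fun t : ℝ => (t, p.2)) ((1 : ℝ), (0 : ℝ)) p.1 :=
    (hasDerivAt_id p.1).prodMk (hasDerivAt_const p.1 p.2)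
  exact HasFDerivAt.comp_hasDerivAt (f := fun t : ℝ => (t, p.2)) p.1 h.hasFDerivAt h1

lemma hasDerivAt_dy_fderiv {f : ℝ × ℝ → ℝ} {p : ℝ × ℝ} (h : DifferentiableAt ℝ f p) :
    HasDerivAt (fun t => f (p.1, t)) (fderiv ℝ f p (0, 1)) p.2 := by
  have h1 : HasDerivAt (fun t : ℝ => (p.1, t)) ((0 : ℝ), (1 : ℝ)) p.2 :=
    (hasDerivAt_const p.2 p.1).prodMk (hasDerivAt_id p.2)
  exact HasFDerivAt.comp_hasDerivAt (f := fun t : ℝ => (p.1, t)) p.2 h.hasFDerivAt h1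

lemma dx_eq_fderiv {f : ℝ × ℝ → ℝ} {p : ℝ × ℝ} (h : DifferentiableAt ℝ f p) :
    dx f p = fderiv ℝ f p (1, 0) := (hasDerivAt_dx_fderiv h).deriv

lemma dy_eq_fderiv {f : ℝ × ℝ → ℝ} {p : ℝ × ℝ} (h : DifferentiableAt ℝ f p) :
    dy f p = fderiv ℝ f p (0, 1) := (hasDerivAt_dy_fderiv h).deriv

lemma hasDerivAt_dx {f : ℝ × ℝ → ℝ} {p : ℝ × ℝ} (h : DifferentiableAt ℝ f p) :
    HasDerivAt (fun t => f (t, p.2)) (dx f p) p.1 := by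
  rw [dx_eq_fderiv h]; exact hasDerivAt_dx_fderiv h

lemma hasDerivAt_dy {f : ℝ × ℝ → ℝ} {p : ℝ × ℝ} (h : DifferentiableAt ℝ f p) :
    HasDerivAt (fun t => f (p.1, t)) (dy f p) p.2 := by
  rw [dy_eq_fderiv h]; exact hasDerivAt_dy_fderiv h

lemma dx_congr {f g : ℝ × ℝ → ℝ} {p : ℝ × ℝ} (h : f =ᶠ[𝓝 p] g) : dx f p = dx g p := by
  have hc : ContinuousAt (fun t : ℝ => (t, p.2)) p.1 := by fun_prop
  exact Filter.EventuallyEq.deriv_eq (hc.eventually h)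

lemma dy_congr {f g : ℝ × ℝ → ℝ} {p : ℝ × ℝ} (h : f =ᶠ[𝓝 p] g) : dy f p = dy g p := by
  have hc : ContinuousAt (fun t : ℝ => (p.1, t)) p.2 := by fun_prop
  exact Filter.EventuallyEq.deriv_eq (hc.eventually h)

lemma dx_eventuallyEq {f g : ℝ × ℝ → ℝ} {p : ℝ × ℝ} (h : f =ᶠ[𝓝 p] g) :
    dx f =ᶠ[𝓝 p] dx g := h.eventually_nhds.mono fun _ hq => dx_congr hq

lemma dy_eventuallyEq {f g : ℝ × ℝ → ℝ} {p : ℝ × ℝ} (h : f =ᶠ[𝓝 p] g) :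
    dy f =ᶠ[𝓝 p] dy g := h.eventually_nhds.mono fun _ hq => dy_congr hq

lemma lap_eventuallyEq {f g : ℝ × ℝ → ℝ} {p : ℝ × ℝ} (h : f =ᶠ[𝓝 p] g) :
    lap f =ᶠ[𝓝 p] lap g :=
  (dx_eventuallyEq (dx_eventuallyEq h)).add (dy_eventuallyEq (dy_eventuallyEq h))

lemma lap_congr {f g : ℝ × ℝ → ℝ} {p : ℝ × ℝ} (h : f =ᶠ[𝓝 p] g) : lap f p = lap g p :=
  (lap_eventuallyEq h).self_of_nhds

lemma hess_congr {f g : ℝ × ℝ → ℝ} {p : ℝ × ℝ} (h : f =ᶠ[𝓝 p] g) : hess f p = hess g p := by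
  unfold hess
  rw [dx_congr (dx_eventuallyEq h), dx_congr (dy_eventuallyEq h), dy_congr (dx_eventuallyEq h),
    dy_congr (dy_eventuallyEq h)]

/-- Being `C^n` at a point, with `n` a natural number. -/
lemma dx_eventuallyEq_fderiv {f : ℝ × ℝ → ℝ} {p : ℝ × ℝ} {n : ℕ} (h : ContDiffAt ℝ (n + 1 : ℕ) f p) :
    dx f =ᶠ[𝓝 p] fun q => fderiv ℝ f q (1, 0) := by
  filter_upwards [h.eventually (by simp)] with q hq
  exact dx_eq_fderiv (hq.differentiableAt (by simp))

lemma dy_eventuallyEq_fderiv {f : ℝ × ℝ → ℝ} {p : ℝ × ℝ} {n : ℕ} (h : ContDiffAt ℝ (n + 1 : ℕ) f p) :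
    dy f =ᶠ[𝓝 p] fun q => fderiv ℝ f q (0, 1) := by
  filter_upwards [h.eventually (by simp)] with q hq
  exact dy_eq_fderiv (hq.differentiableAt (by simp))

lemma contDiffAt_dx {f : ℝ × ℝ → ℝ} {p : ℝ × ℝ} {n : ℕ} (h : ContDiffAt ℝ (n + 1 : ℕ) f p) :
    ContDiffAt ℝ n (dx f) p := by
  refine ContDiffAt.congr_of_eventuallyEq ?_ (dx_eventuallyEq_fderiv h)
  exact (h.fderiv_right (m := n) (by norm_cast)).clm_apply contDiffAt_const

lemma contDiffAt_dy {f : ℝ × ℝ → ℝ} {p : ℝ × ℝ} {n : ℕ} (h : ContDiffAt ℝ (n + 1 : ℕ) f p) :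
    ContDiffAt ℝ n (dy f) p := by
  refine ContDiffAt.congr_of_eventuallyEq ?_ (dy_eventuallyEq_fderiv h)
  exact (h.fderiv_right (m := n) (by norm_cast)).clm_apply contDiffAt_const

lemma contDiffAt_dx_one {f : ℝ × ℝ → ℝ} {p : ℝ × ℝ} (h : ContDiffAt ℝ 2 f p) :
    ContDiffAt ℝ 1 (dx f) p := by
  exact_mod_cast contDiffAt_dx (n := 1) (by exact_mod_cast h)

lemma contDiffAt_dy_one {f : ℝ × ℝ → ℝ} {p : ℝ × ℝ} (h : ContDiffAt ℝ 2 f p) :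
    ContDiffAt ℝ 1 (dy f) p := by
  exact_mod_cast contDiffAt_dy (n := 1) (by exact_mod_cast h)

lemma dx_dy_comm {f : ℝ × ℝ → ℝ} {p : ℝ × ℝ} (h : ContDiffAt ℝ 2 f p) :
    dx (dy f) p = dy (dx f) p := by
  have h' : ContDiffAt ℝ (1 + 1 : ℕ) f p := by exact_mod_cast h
  have hd : DifferentiableAt ℝ (fderiv ℝ f) p :=
    (h.fderiv_right (m := 1) (by norm_num)).differentiableAt (by simp)
  rw [dx_congr (dy_eventuallyEq_fderiv h'), dy_congr (dx_eventuallyEq_fderiv h')]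
  rw [dx_eq_fderiv (hd.clm_apply (by fun_prop)), dy_eq_fderiv (hd.clm_apply (by fun_prop))]
  have e1 := fderiv_clm_apply hd (differentiableAt_const ((0 : ℝ), (1 : ℝ)))
  have e2 := fderiv_clm_apply hd (differentiableAt_const ((1 : ℝ), (0 : ℝ)))
  rw [e1, e2]
  have hs := (h.isSymmSndFDerivAt (by simp)) (1, 0) (0, 1)
  simpa using hs

lemma dx_add {f g : ℝ × ℝ → ℝ} {p : ℝ × ℝ} (hf : DifferentiableAt ℝ f p)
    (hg : DifferentiableAt ℝ g p) : dx (fun q => f q + g q) p = dx f p + dx g p :=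
  ((hasDerivAt_dx hf).add (hasDerivAt_dx hg)).deriv

lemma dy_add {f g : ℝ × ℝ → ℝ} {p : ℝ × ℝ} (hf : DifferentiableAt ℝ f p)
    (hg : DifferentiableAt ℝ g p) : dy (fun q => f q + g q) p = dy f p + dy g p :=
  ((hasDerivAt_dy hf).add (hasDerivAt_dy hg)).deriv

lemma dx_sub {f g : ℝ × ℝ → ℝ} {p : ℝ × ℝ} (hf : DifferentiableAt ℝ f p)
    (hg : DifferentiableAt ℝ g p) : dx (fun q => f q - g q) p = dx f p - dx g p :=
  ((hasDerivAt_dx hf).sub (hasDerivAt_dx hg)).deriv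

lemma dy_sub {f g : ℝ × ℝ → ℝ} {p : ℝ × ℝ} (hf : DifferentiableAt ℝ f p)
    (hg : DifferentiableAt ℝ g p) : dy (fun q => f q - g q) p = dy f p - dy g p :=
  ((hasDerivAt_dy hf).sub (hasDerivAt_dy hg)).deriv

lemma dx_mul {f g : ℝ × ℝ → ℝ} {p : ℝ × ℝ} (hf : DifferentiableAt ℝ f p)
    (hg : DifferentiableAt ℝ g p) : dx (fun q => f q * g q) p = dx f p * g p + f p * dx g p :=
  ((hasDerivAt_dx hf).mul (hasDerivAt_dx hg)).deriv

lemma dy_mul {f g : ℝ × ℝ → ℝ} {p : ℝ × ℝ} (hf : DifferentiableAt ℝ f p)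
    (hg : DifferentiableAt ℝ g p) : dy (fun q => f q * g q) p = dy f p * g p + f p * dy g p :=
  ((hasDerivAt_dy hf).mul (hasDerivAt_dy hg)).deriv

lemma dx_neg (f : ℝ × ℝ → ℝ) (p : ℝ × ℝ) : dx (fun q => -f q) p = -dx f p :=
  deriv.fun_neg

lemma dy_neg (f : ℝ × ℝ → ℝ) (p : ℝ × ℝ) : dy (fun q => -f q) p = -dy f p :=
  deriv.fun_neg

lemma dx_const_mul (c : ℝ) (f : ℝ × ℝ → ℝ) (p : ℝ × ℝ) :
    dx (fun q => c * f q) p = c * dx f p :=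
  deriv_const_mul_field c

lemma dy_const_mul (c : ℝ) (f : ℝ × ℝ → ℝ) (p : ℝ × ℝ) :
    dy (fun q => c * f q) p = c * dy f p :=
  deriv_const_mul_field c

lemma lap_neg (f : ℝ × ℝ → ℝ) (p : ℝ × ℝ) : lap (fun q => -f q) p = -lap f p := by
  have h1 : dx (fun q => -f q) = fun q => -dx f q := funext fun q => dx_neg f q
  have h2 : dy (fun q => -f q) = fun q => -dy f q := funext fun q => dy_neg f q
  unfold lap
  rw [h1, h2, dx_neg, dy_neg]; ring

lemma lap_const_mul (c : ℝ) (f : ℝ × ℝ → ℝ) (p : ℝ × ℝ) :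
    lap (fun q => c * f q) p = c * lap f p := by
  have h1 : dx (fun q => c * f q) = fun q => c * dx f q := funext fun q => dx_const_mul c f q
  have h2 : dy (fun q => c * f q) = fun q => c * dy f q := funext fun q => dy_const_mul c f q
  unfold lap
  rw [h1, h2, dx_const_mul, dy_const_mul]; ring

lemma contDiffAt_two_eventually {f : ℝ × ℝ → ℝ} {p : ℝ × ℝ} (h : ContDiffAt ℝ 2 f p) :
    ∀ᶠ q in 𝓝 p, DifferentiableAt ℝ f q := by
  filter_upwards [h.eventually (by simp)] with q hq
  exact hq.differentiableAt (by simp)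

lemma differentiableAt_dx {f : ℝ × ℝ → ℝ} {p : ℝ × ℝ} (h : ContDiffAt ℝ 2 f p) :
    DifferentiableAt ℝ (dx f) p := (contDiffAt_dx_one h).differentiableAt (by simp)

lemma differentiableAt_dy {f : ℝ × ℝ → ℝ} {p : ℝ × ℝ} (h : ContDiffAt ℝ 2 f p) :
    DifferentiableAt ℝ (dy f) p := (contDiffAt_dy_one h).differentiableAt (by simp)

lemma dx_sub_ev {f g : ℝ × ℝ → ℝ} {p : ℝ × ℝ} (hf : ContDiffAt ℝ 2 f p)
    (hg : ContDiffAt ℝ 2 g p) : dx (fun q => f q - g q) =ᶠ[𝓝 p] fun q => dx f q - dx g q := by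
  filter_upwards [contDiffAt_two_eventually hf, contDiffAt_two_eventually hg] with q h1 h2
  exact dx_sub h1 h2

lemma dy_sub_ev {f g : ℝ × ℝ → ℝ} {p : ℝ × ℝ} (hf : ContDiffAt ℝ 2 f p)
    (hg : ContDiffAt ℝ 2 g p) : dy (fun q => f q - g q) =ᶠ[𝓝 p] fun q => dy f q - dy g q := by
  filter_upwards [contDiffAt_two_eventually hf, contDiffAt_two_eventually hg] with q h1 h2
  exact dy_sub h1 h2

lemma dx_mul_ev {f g : ℝ × ℝ → ℝ} {p : ℝ × ℝ} (hf : ContDiffAt ℝ 2 f p)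
    (hg : ContDiffAt ℝ 2 g p) : dx (fun q => f q * g q) =ᶠ[𝓝 p] fun q => dx f q * g q + f q * dx g q := by
  filter_upwards [contDiffAt_two_eventually hf, contDiffAt_two_eventually hg] with q h1 h2
  exact dx_mul h1 h2

lemma dy_mul_ev {f g : ℝ × ℝ → ℝ} {p : ℝ × ℝ} (hf : ContDiffAt ℝ 2 f p)
    (hg : ContDiffAt ℝ 2 g p) : dy (fun q => f q * g q) =ᶠ[𝓝 p] fun q => dy f q * g q + f q * dy g q := by
  filter_upwards [contDiffAt_two_eventually hf, contDiffAt_two_eventually hg] with q h1 h2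
  exact dy_mul h1 h2

lemma lap_sub {f g : ℝ × ℝ → ℝ} {p : ℝ × ℝ} (hf : ContDiffAt ℝ 2 f p)
    (hg : ContDiffAt ℝ 2 g p) : lap (fun q => f q - g q) p = lap f p - lap g p := by
  unfold lap
  rw [dx_congr (dx_sub_ev hf hg), dy_congr (dy_sub_ev hf hg),
    dx_sub (differentiableAt_dx hf) (differentiableAt_dx hg),
    dy_sub (differentiableAt_dy hf) (differentiableAt_dy hg)]
  ring

lemma hess_sub {f g : ℝ × ℝ → ℝ} {p : ℝ × ℝ} (hf : ContDiffAt ℝ 2 f p)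
    (hg : ContDiffAt ℝ 2 g p) : hess (fun q => f q - g q) p = hess f p - hess g p := by
  unfold hess
  rw [dx_congr (dx_sub_ev hf hg), dy_congr (dy_sub_ev hf hg), dx_congr (dy_sub_ev hf hg),
    dy_congr (dx_sub_ev hf hg),
    dx_sub (differentiableAt_dx hf) (differentiableAt_dx hg),
    dy_sub (differentiableAt_dy hf) (differentiableAt_dy hg),
    dy_sub (differentiableAt_dx hf) (differentiableAt_dx hg),
    dx_sub (differentiableAt_dy hf) (differentiableAt_dy hg)]
  ext i; fin_cases i <;> simp

lemma lap_mul {f g : ℝ × ℝ → ℝ} {p : ℝ × ℝ} (hf : ContDiffAt ℝ 2 f p)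
    (hg : ContDiffAt ℝ 2 g p) : lap (fun q => f q * g q) p
    = f p * lap g p + g p * lap f p + 2 * (dx f p * dx g p + dy f p * dy g p) := by
  have f1 := hf.differentiableAt (by simp)
  have g1 := hg.differentiableAt (by simp)
  unfold lap
  rw [dx_congr (dx_mul_ev hf hg), dy_congr (dy_mul_ev hf hg),
    dx_add ((differentiableAt_dx hf).fun_mul g1) (f1.fun_mul (differentiableAt_dx hg)),
    dy_add ((differentiableAt_dy hf).fun_mul g1) (f1.fun_mul (differentiableAt_dy hg)),
    dx_mul (differentiableAt_dx hf) g1, dx_mul f1 (differentiableAt_dx hg),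
    dy_mul (differentiableAt_dy hf) g1, dy_mul f1 (differentiableAt_dy hg)]
  ring

/-! ### Scaling -/

lemma dx_scale (f : ℝ × ℝ → ℝ) (c : ℝ) :
    dx (fun q => f (q.1 / c, q.2 / c)) = fun p => c⁻¹ * dx f (p.1 / c, p.2 / c) := by
  funext p
  have := deriv_comp_mul_left c⁻¹ (fun t => f (t, p.2 / c)) p.1
  simp only [smul_eq_mul] at this
  simp only [dx, div_eq_mul_inv, mul_comm _ c⁻¹] at this ⊢
  exact this

lemma dy_scale (f : ℝ × ℝ → ℝ) (c : ℝ) :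
    dy (fun q => f (q.1 / c, q.2 / c)) = fun p => c⁻¹ * dy f (p.1 / c, p.2 / c) := by
  funext p
  have := deriv_comp_mul_left c⁻¹ (fun t => f (p.1 / c, t)) p.2
  simp only [smul_eq_mul] at this
  simp only [dy, div_eq_mul_inv, mul_comm _ c⁻¹] at this ⊢
  exact this

/-! ### Pointwise bounds on a function and its gradient -/

/-- `f` is differentiable at `p`, with `|f p| ≤ a` and first partial derivatives at most `b`. -/
structure GradBound (f : ℝ × ℝ → ℝ) (p : ℝ × ℝ) (a b : ℝ) : Prop where
  diff : DifferentiableAt ℝ f p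
  val : |f p| ≤ a
  dx_le : |dx f p| ≤ b
  dy_le : |dy f p| ≤ b

namespace GradBound

variable {f g : ℝ × ℝ → ℝ} {p : ℝ × ℝ} {a b a' b' : ℝ}

lemma nonneg_val (h : GradBound f p a b) : 0 ≤ a := (abs_nonneg _).trans h.val
lemma nonneg_der (h : GradBound f p a b) : 0 ≤ b := (abs_nonneg _).trans h.dx_le

lemma mono (h : GradBound f p a b) (ha : a ≤ a') (hb : b ≤ b') : GradBound f p a' b' :=
  ⟨h.diff, h.val.trans ha, h.dx_le.trans hb, h.dy_le.trans hb⟩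

lemma congr (h : GradBound f p a b) (e : g =ᶠ[𝓝 p] f) : GradBound g p a b :=
  ⟨h.diff.congr_of_eventuallyEq e, by rw [e.self_of_nhds]; exact h.val,
    by rw [dx_congr e]; exact h.dx_le, by rw [dy_congr e]; exact h.dy_le⟩

lemma add (h : GradBound f p a b) (h' : GradBound g p a' b') :
    GradBound (fun q => f q + g q) p (a + a') (b + b') :=
  ⟨h.diff.add h'.diff, (abs_add_le _ _).trans (add_le_add h.val h'.val),
    by rw [dx_add h.diff h'.diff]; exact (abs_add_le _ _).trans (add_le_add h.dx_le h'.dx_le),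
    by rw [dy_add h.diff h'.diff]; exact (abs_add_le _ _).trans (add_le_add h.dy_le h'.dy_le)⟩

lemma neg (h : GradBound f p a b) : GradBound (fun q => -f q) p a b :=
  ⟨h.diff.neg, by rw [abs_neg]; exact h.val, by rw [dx_neg, abs_neg]; exact h.dx_le,
    by rw [dy_neg, abs_neg]; exact h.dy_le⟩

lemma sub (h : GradBound f p a b) (h' : GradBound g p a' b') :
    GradBound (fun q => f q - g q) p (a + a') (b + b') := by
  simpa [sub_eq_add_neg] using h.add h'.neg

lemma mul (h : GradBound f p a b) (h' : GradBound g p a' b') :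
    GradBound (fun q => f q * g q) p (a * a') (b * a' + a * b') := by
  have key : ∀ s t : ℝ, |s| ≤ b → |t| ≤ b' → |s * g p + f p * t| ≤ b * a' + a * b' := by
    intro s t hs ht
    refine (abs_add_le _ _).trans (add_le_add ?_ ?_)
    · rw [abs_mul]; exact mul_le_mul hs h'.val (abs_nonneg _) h.nonneg_der
    · rw [abs_mul]; exact mul_le_mul h.val ht (abs_nonneg _) h.nonneg_val
  refine ⟨h.diff.mul h'.diff, ?_, ?_, ?_⟩
  · rw [abs_mul]; exact mul_le_mul h.val h'.val (abs_nonneg _) h.nonneg_val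
  · rw [dx_mul h.diff h'.diff]; exact key _ _ h.dx_le h'.dx_le
  · rw [dy_mul h.diff h'.diff]; exact key _ _ h.dy_le h'.dy_le

lemma const_mul (c : ℝ) (h : GradBound f p a b) :
    GradBound (fun q => c * f q) p (|c| * a) (|c| * b) :=
  ⟨h.diff.const_mul c, by rw [abs_mul]; exact mul_le_mul_of_nonneg_left h.val (abs_nonneg _),
    by rw [dx_const_mul, abs_mul]; exact mul_le_mul_of_nonneg_left h.dx_le (abs_nonneg _),
    by rw [dy_const_mul, abs_mul]; exact mul_le_mul_of_nonneg_left h.dy_le (abs_nonneg _)⟩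

lemma of_eventually_zero (e : f =ᶠ[𝓝 p] fun _ => 0) : GradBound f p 0 0 :=
  GradBound.congr (f := fun _ => 0)
    ⟨differentiableAt_const _, by simp, by simp [dx], by simp [dy]⟩ e

lemma norm_grad_le (h : GradBound f p a b) : ‖grad f p‖ ≤ 2 * b := by
  have hb := h.nonneg_der
  rw [EuclideanSpace.norm_eq, Real.sqrt_le_left (by positivity)]
  simp only [Fin.sum_univ_two, grad]
  have h1 := sq_le_sq' (abs_le.1 h.dx_le).1 (abs_le.1 h.dx_le).2
  have h2 := sq_le_sq' (abs_le.1 h.dy_le).1 (abs_le.1 h.dy_le).2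
  simp
  nlinarith

end GradBound

lemma norm_hess_le {f : ℝ × ℝ → ℝ} {p : ℝ × ℝ} {b : ℝ} (h1 : |dx (dx f) p| ≤ b)
    (h2 : |dx (dy f) p| ≤ b) (h3 : |dy (dx f) p| ≤ b) (h4 : |dy (dy f) p| ≤ b) :
    ‖hess f p‖ ≤ 2 * b := by
  have hb : 0 ≤ b := (abs_nonneg _).trans h1
  rw [EuclideanSpace.norm_eq, Real.sqrt_le_left (by positivity)]
  simp only [Fin.sum_univ_four, hess]
  have h1 := sq_le_sq' (abs_le.1 h1).1 (abs_le.1 h1).2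
  have h2 := sq_le_sq' (abs_le.1 h2).1 (abs_le.1 h2).2
  have h3 := sq_le_sq' (abs_le.1 h3).1 (abs_le.1 h3).2
  have h4 := sq_le_sq' (abs_le.1 h4).1 (abs_le.1 h4).2
  simp
  nlinarith

/-! ### Elementary facts about `len` -/

lemma len_nonneg (p : ℝ × ℝ) : 0 ≤ len p := Real.sqrt_nonneg _

lemma len_sq (p : ℝ × ℝ) : len p ^ 2 = p.1 ^ 2 + p.2 ^ 2 := Real.sq_sqrt (by positivity)

lemma abs_fst_le_len (p : ℝ × ℝ) : |p.1| ≤ len p := by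
  rw [len, ← Real.sqrt_sq_eq_abs]; exact Real.sqrt_le_sqrt (by nlinarith [sq_nonneg p.2])

lemma abs_snd_le_len (p : ℝ × ℝ) : |p.2| ≤ len p := by
  rw [len, ← Real.sqrt_sq_eq_abs]; exact Real.sqrt_le_sqrt (by nlinarith [sq_nonneg p.1])

lemma len_pos_of_mem {p : ℝ × ℝ} (hp : 0 < p.2) : 0 < len p :=
  lt_of_lt_of_le (abs_pos.2 hp.ne') (abs_snd_le_len p)

lemma len_le_add (p : ℝ × ℝ) : len p ≤ |p.1| + |p.2| := by
  rw [len, Real.sqrt_le_left (by positivity)]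
  nlinarith [abs_nonneg p.1, abs_nonneg p.2, sq_abs p.1, sq_abs p.2,
    mul_nonneg (abs_nonneg p.1) (abs_nonneg p.2)]

lemma continuous_len : Continuous len := by unfold len; fun_prop

lemma len_neg_fst (x y : ℝ) : len (-x, y) = len (x, y) := by simp [len]

lemma le_of_sq_le_sq' {a b : ℝ} (h : a ^ 2 ≤ b ^ 2) (hb : 0 ≤ b) : a ≤ b :=
  (abs_le_of_sq_le_sq' h hb).2

lemma len_triangle (p q : ℝ × ℝ) : len (p + q) ≤ len p + len q := by
  have h1 := len_nonneg p
  have h2 := len_nonneg q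
  have h3 : p.1 * q.1 + p.2 * q.2 ≤ len p * len q := by
    refine le_of_sq_le_sq' ?_ (by positivity)
    rw [mul_pow, len_sq, len_sq]; nlinarith [sq_nonneg (p.1 * q.2 - p.2 * q.1)]
  refine le_of_sq_le_sq' ?_ (by positivity)
  rw [len_sq]; simp only [Prod.fst_add, Prod.snd_add]
  nlinarith [len_sq p, len_sq q]

lemma isOpen_halfPlane : IsOpen halfPlane := isOpen_lt continuous_const continuous_snd

lemma isClosed_closedHalfPlane : IsClosed closedHalfPlane := isClosed_le continuous_const continuous_snd

/-! ### The maximum principle -/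

/-- A positive second derivative would make t a local minimum too; g would then be locally constant,
with second derivative zero. No differentiability is needed, since `deriv` takes the value 0 where
there is no derivative. -/
lemma deriv_deriv_nonpos_of_isLocalMax {g : ℝ → ℝ} {t : ℝ} (h : IsLocalMax g t)
    (hc : ContinuousAt g t) : deriv (deriv g) t ≤ 0 := by
  by_contra! hpos
  have hmin := isLocalMin_of_deriv_deriv_pos hpos h.deriv_eq_zero hc
  have he : g =ᶠ[𝓝 t] fun _ => g t := by
    filter_upwards [h, hmin] with s h1 h2 using le_antisymm h1 h2
  have : deriv (deriv g) t = 0 := by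
    rw [he.deriv.deriv_eq]; simp
  linarith

/-- A maximum principle on a compact set. -/
theorem nonpos_of_lap_pos {K U : Set (ℝ × ℝ)} (hK : IsCompact K) (hU : IsOpen U) (hUK : U ⊆ K)
    {f : ℝ × ℝ → ℝ} (hf : ContinuousOn f K) (hb : ∀ p ∈ K, p ∉ U → f p ≤ 0)
    (hlap : ∀ p ∈ U, 0 < f p → 0 < lap f p) : ∀ p ∈ K, f p ≤ 0 := by
  intro p hp
  obtain ⟨m, hmK, hm⟩ := hK.exists_isMaxOn ⟨p, hp⟩ hf
  by_contra! hpos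
  have hfm : 0 < f m := hpos.trans_le (hm hp)
  have hmU : m ∈ U := by
    by_contra h; exact absurd (hb m hmK h) (not_le.2 hfm)
  have hKm : K ∈ 𝓝 m := Filter.mem_of_superset (hU.mem_nhds hmU) hUK
  have hloc : IsLocalMax f m := hm.isLocalMax hKm
  have hcf : ContinuousAt f m := hf.continuousAt hKm
  have c1 : ContinuousAt (fun t : ℝ => (t, m.2)) m.1 := by fun_prop
  have c2 : ContinuousAt (fun t : ℝ => (m.1, t)) m.2 := by fun_prop
  -- A positive maximum is interior, and both one-dimensional slices have a local maximum there,
  -- against the strict sign of the Laplacian.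
  have h1 : dx (dx f) m ≤ 0 :=
    deriv_deriv_nonpos_of_isLocalMax (g := fun t => f (t, m.2)) (c1.eventually hloc)
      (ContinuousAt.comp (f := fun t : ℝ => (t, m.2)) (x := m.1) hcf c1)
  have h2 : dy (dy f) m ≤ 0 :=
    deriv_deriv_nonpos_of_isLocalMax (g := fun t => f (m.1, t)) (c2.eventually hloc)
      (ContinuousAt.comp (f := fun t : ℝ => (m.1, t)) (x := m.2) hcf c2)
  have := hlap m hmU hfm
  unfold lap at this
  linarith

/-! ### The quadratic barrier -/

/-- The barrier for one-sided gradient estimates on the box `0 ≤ t ≤ d`, `|s| ≤ d`. -/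
noncomputable def boxBarrier (d M K : ℝ) (q : ℝ × ℝ) : ℝ :=
  M / d ^ 2 * (q.2 ^ 2 + q.1 * (2 * d - q.1)) + K / 2 * (q.1 * (d - q.1))

lemma contDiff_boxBarrier (d M K : ℝ) : ContDiff ℝ 2 (boxBarrier d M K) := by
  unfold boxBarrier; fun_prop

/-- The M-part s² + t(2d - t) is harmonic; the K-part, concave in t, accounts for -K. -/
lemma lap_boxBarrier (d M K : ℝ) (q : ℝ × ℝ) : lap (boxBarrier d M K) q = -K := by
  have h1 : dx (boxBarrier d M K) = fun p => M / d ^ 2 * (2 * d - 2 * p.1) + K / 2 * (d - 2 * p.1) := by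
    funext p
    have : HasDerivAt (fun t : ℝ => M / d ^ 2 * (p.2 ^ 2 + t * (2 * d - t)) + K / 2 * (t * (d - t)))
        (M / d ^ 2 * (0 + (1 * (2 * d - p.1) + p.1 * (0 - 1)))
          + K / 2 * (1 * (d - p.1) + p.1 * (0 - 1))) p.1 := by
      have hi := hasDerivAt_id' p.1
      exact (((hasDerivAt_const _ _).add (hi.mul ((hasDerivAt_const _ _).sub hi))).const_mul _).add
        ((hi.mul ((hasDerivAt_const _ _).sub hi)).const_mul _)
    refine this.deriv.trans ?_
    ring
  have h2 : dy (boxBarrier d M K) = fun p => M / d ^ 2 * (2 * p.2) := by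
    funext p
    have : HasDerivAt (fun t : ℝ => M / d ^ 2 * (t ^ 2 + p.1 * (2 * d - p.1))
        + K / 2 * (p.1 * (d - p.1))) (M / d ^ 2 * (2 * p.2 ^ 1 * 1)) p.2 := by
      have hi := (hasDerivAt_id' p.2).pow 2
      exact (((hi.add_const _).const_mul _).add_const _)
    refine this.deriv.trans ?_
    ring
  unfold lap
  rw [h1, h2]
  have h3 : dx (fun p : ℝ × ℝ => M / d ^ 2 * (2 * d - 2 * p.1) + K / 2 * (d - 2 * p.1)) q
      = M / d ^ 2 * (0 - 2 * 1) + K / 2 * (0 - 2 * 1) := by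
    have hi := (hasDerivAt_id' q.1).const_mul 2
    exact ((((hasDerivAt_const _ _).sub hi).const_mul _).add
      (((hasDerivAt_const _ _).sub hi).const_mul _)).deriv
  have h4 : dy (fun p : ℝ × ℝ => M / d ^ 2 * (2 * p.2)) q = M / d ^ 2 * (2 * 1) :=
    (((hasDerivAt_id' q.2).const_mul 2).const_mul _).deriv
  rw [h3, h4]; ring

/-- The half box `0 ≤ t ≤ d`, `|s| ≤ d`, cut off below at `s = -b`. -/
def halfBox (d b : ℝ) : Set (ℝ × ℝ) := {q | 0 ≤ q.1 ∧ q.1 ≤ d ∧ |q.2| ≤ d ∧ -b ≤ q.2}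

lemma isCompact_halfBox (d b : ℝ) : IsCompact (halfBox d b) := by
  refine IsCompact.of_isClosed_subset (isCompact_Icc (a := ((0 : ℝ), -d)) (b := (d, d))) ?_ ?_
  · exact (isClosed_le continuous_const continuous_fst).inter
      ((isClosed_le continuous_fst continuous_const).inter
      ((isClosed_le continuous_snd.abs continuous_const).inter
        (isClosed_le continuous_const continuous_snd)))
  · rintro q ⟨h1, h2, h3, h4⟩
    exact ⟨⟨h1, (abs_le.1 h3).1⟩, ⟨h2, (abs_le.1 h3).2⟩⟩

/-- Comparison on the half box. On t = d and |s| = d the M-part is at least M, on t = 0 and s = -b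
one has w ≤ 0 while the barrier is nonnegative, and the K-part absorbs the Laplacian. The maximum
principle needs a strict inequality, so K is replaced by K + ε and ε tends to 0 at the end. -/
theorem le_boxBarrier {d M K b : ℝ} (hd : 0 < d) (hM : 0 ≤ M) (hK : 0 ≤ K) {w : ℝ × ℝ → ℝ}
    (hc : ContinuousOn w (halfBox d b))
    (hC2 : ∀ q : ℝ × ℝ, 0 < q.1 → q.1 < d → |q.2| < d → -b < q.2 → ContDiffAt ℝ 2 w q)
    (h0 : ∀ s, |s| ≤ d → -b ≤ s → w (0, s) ≤ 0)
    (hwb : b ≤ d → ∀ t, 0 ≤ t → t ≤ d → w (t, -b) ≤ 0)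
    (hwM : ∀ q ∈ halfBox d b, w q ≤ M)
    (hlap : ∀ q : ℝ × ℝ, 0 < q.1 → q.1 < d → |q.2| < d → -b < q.2 → -K ≤ lap w q) :
    ∀ q ∈ halfBox d b, w q ≤ boxBarrier d M K q := by
  have main : ∀ ε > 0, ∀ q ∈ halfBox d b, w q ≤ boxBarrier d M (K + ε) q := by
    intro ε hε
    have hcomp := isCompact_halfBox d b
    let U : Set (ℝ × ℝ) := {q | 0 < q.1 ∧ q.1 < d ∧ |q.2| < d ∧ -b < q.2}
    have hU : IsOpen U := (isOpen_lt continuous_const continuous_fst).inter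
      ((isOpen_lt continuous_fst continuous_const).inter
      ((isOpen_lt continuous_snd.abs continuous_const).inter
        (isOpen_lt continuous_const continuous_snd)))
    have hUK : U ⊆ halfBox d b := fun q hq => ⟨hq.1.le, hq.2.1.le, hq.2.2.1.le, hq.2.2.2.le⟩
    have hpsi : ∀ q ∈ halfBox d b, 0 ≤ boxBarrier d M (K + ε) q := by
      rintro q ⟨h1, h2, h3, h4⟩
      unfold boxBarrier
      have : 0 ≤ q.1 * (2 * d - q.1) := mul_nonneg h1 (by linarith)
      have : 0 ≤ q.1 * (d - q.1) := mul_nonneg h1 (by linarith)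
      positivity
    have hpsiM : ∀ q ∈ halfBox d b, (q.1 = d ∨ |q.2| = d) → M ≤ boxBarrier d M (K + ε) q := by
      rintro q ⟨h1, h2, h3, h4⟩ hq
      unfold boxBarrier
      have e1 : 0 ≤ q.1 * (2 * d - q.1) := mul_nonneg h1 (by linarith)
      have e2 : 0 ≤ q.1 * (d - q.1) := mul_nonneg h1 (by linarith)
      have e3 : d ^ 2 ≤ q.2 ^ 2 + q.1 * (2 * d - q.1) := by
        rcases hq with hq | hq
        · rw [hq]; nlinarith [sq_nonneg q.2]
        · rw [← sq_abs q.2, hq]; linarith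
      have e4 : M ≤ M / d ^ 2 * (q.2 ^ 2 + q.1 * (2 * d - q.1)) := by
        calc M = M / d ^ 2 * d ^ 2 := by field_simp
          _ ≤ _ := by gcongr
      have : 0 ≤ (K + ε) / 2 * (q.1 * (d - q.1)) := by positivity
      linarith
    have := nonpos_of_lap_pos hcomp hU hUK (f := fun q => w q - boxBarrier d M (K + ε) q)
      (hc.sub (contDiff_boxBarrier d M (K + ε)).continuous.continuousOn) ?_ ?_
    · intro q hq; have := this q hq; linarith
    · rintro q hq hqU
      have hq' := hq
      obtain ⟨h1, h2, h3, h4⟩ := hq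
      rcases h1.eq_or_lt with e | h1'
      · have hw := h0 q.2 h3 h4
        have : q = (0, q.2) := Prod.ext e.symm rfl
        have := hpsi q hq'
        rw [← ‹q = (0, q.2)›] at hw
        linarith
      rcases h4.eq_or_lt with e | h4'
      · have hbd : b ≤ d := by rw [← e] at h3; exact (le_abs_self b).trans (by rwa [abs_neg] at h3)
        have hw := hwb hbd q.1 h1 h2
        have hqe : q = (q.1, -b) := Prod.ext rfl e.symm
        have := hpsi q hq'
        rw [← hqe] at hw
        linarith
      have hor : q.1 = d ∨ |q.2| = d := by
        by_contra! hcon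
        exact hqU ⟨h1', lt_of_le_of_ne h2 hcon.1, lt_of_le_of_ne h3 hcon.2, h4'⟩
      have := hpsiM q hq' hor
      have := hwM q hq'
      linarith
    · rintro q ⟨h1, h2, h3, h4⟩ -
      rw [lap_sub (hC2 q h1 h2 h3 h4) (contDiff_boxBarrier d M (K + ε)).contDiffAt, lap_boxBarrier]
      have := hlap q h1 h2 h3 h4
      linarith
  intro q hq
  have hlim : Tendsto (fun ε : ℝ => boxBarrier d M (K + ε) q) (𝓝[>] 0) (𝓝 (boxBarrier d M K q)) := by
    have : Continuous fun ε : ℝ => boxBarrier d M (K + ε) q := by unfold boxBarrier; fun_prop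
    have h := this.tendsto 0
    simp only [add_zero] at h
    exact h.mono_left nhdsWithin_le_nhds
  refine ge_of_tendsto hlim ?_
  filter_upwards [self_mem_nhdsWithin] with ε hε using main ε hε q hq

/-- On the segment s = 0 the barrier is at most linear in t; the slope becomes the gradient bound.
-/
lemma boxBarrier_axis_le {d M K t : ℝ} (hd : 0 < d) (hM : 0 ≤ M) (hK : 0 ≤ K) (ht : 0 ≤ t) :
    boxBarrier d M K (t, 0) ≤ t * (2 * M / d + K * d / 2) := by
  unfold boxBarrier
  have h1 : M / d ^ 2 * (t * (2 * d - t)) ≤ M / d ^ 2 * (t * (2 * d)) := by gcongr; linarith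
  have h2 : K / 2 * (t * (d - t)) ≤ K / 2 * (t * d) := by gcongr; linarith
  have h3 : M / d ^ 2 * (t * (2 * d)) = t * (2 * M / d) := by field_simp
  simp only
  nlinarith

/-! ### Gradient bounds from the quadratic barrier -/

lemma le_of_hasDerivAt_of_le_mul {g : ℝ → ℝ} {g' c d : ℝ} (hd : 0 < d) (hg : HasDerivAt g g' 0)
    (h0 : g 0 = 0) (hle : ∀ t, 0 ≤ t → t ≤ d → g t ≤ t * c) : g' ≤ c := by
  have h := (hasDerivAt_iff_tendsto_slope.1 hg).mono_left
    (nhdsWithin_mono (0 : ℝ) (fun x (hx : x ∈ Ioi 0) => ne_of_gt hx))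
  refine le_of_tendsto h ?_
  filter_upwards [Ioo_mem_nhdsGT hd] with t ht
  rw [slope_def_field, h0, sub_zero, sub_zero, div_le_iff₀ ht.1, mul_comm]
  exact hle t ht.1.le ht.2.le

/-- Composition with an affine substitution `(t, s) ↦ (x₀ + σ t, y₀ + s)`. -/
lemma lap_affine {u : ℝ × ℝ → ℝ} (x₀ y₀ σ : ℝ) (hσ : σ ^ 2 = 1) (q : ℝ × ℝ) :
    lap (fun p => u (x₀ + σ * p.1, y₀ + p.2)) q = lap u (x₀ + σ * q.1, y₀ + q.2) := by
  have key : ∀ (f : ℝ → ℝ) (t : ℝ), deriv (fun t => f (x₀ + σ * t)) t = σ * deriv f (x₀ + σ * t) := by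
    intro f t
    have h1 := deriv_comp_mul_left σ (fun s => f (x₀ + s)) t
    have h2 := deriv_comp_const_add f x₀ (σ * t)
    rw [h1, h2]; rfl
  have h1 : dx (fun p => u (x₀ + σ * p.1, y₀ + p.2))
      = fun p => σ * dx u (x₀ + σ * p.1, y₀ + p.2) := by
    funext p
    exact key (fun s => u (s, y₀ + p.2)) p.1
  have h2 : dy (fun p => u (x₀ + σ * p.1, y₀ + p.2)) = fun p => dy u (x₀ + σ * p.1, y₀ + p.2) := by
    funext p
    exact deriv_comp_const_add (fun s => u (x₀ + σ * p.1, s)) y₀ p.2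
  unfold lap
  rw [h1, h2, dx_const_mul]
  have h3 : dx (fun p => dx u (x₀ + σ * p.1, y₀ + p.2)) q = σ * dx (dx u) (x₀ + σ * q.1, y₀ + q.2) :=
    key (fun s => dx u (s, y₀ + q.2)) q.1
  have h4 : dy (fun p => dy u (x₀ + σ * p.1, y₀ + p.2)) q = dy (dy u) (x₀ + σ * q.1, y₀ + q.2) :=
    deriv_comp_const_add (fun s => dy u (x₀ + σ * q.1, s)) y₀ q.2
  rw [h3, h4, ← mul_assoc, ← sq, hσ, one_mul]

/-- One-sided gradient bound in the first variable, on a box which may be cut off from below by a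
line on which `u` vanishes. -/
theorem dx_le_of_box {u : ℝ × ℝ → ℝ} {x₀ y₀ d b M K : ℝ} (hd : 0 < d) (hb : 0 < b)
    (hc : ContinuousOn u {p | |p.1 - x₀| ≤ d ∧ |p.2 - y₀| ≤ d ∧ y₀ - b ≤ p.2})
    (hC2 : ∀ p : ℝ × ℝ, |p.1 - x₀| < d → |p.2 - y₀| < d → y₀ - b < p.2 → ContDiffAt ℝ 2 u p)
    (h0 : b ≤ d → ∀ x, |x - x₀| ≤ d → u (x, y₀ - b) = 0)
    (hM : ∀ p : ℝ × ℝ, |p.1 - x₀| ≤ d → |p.2 - y₀| ≤ d → y₀ - b ≤ p.2 → |u p| ≤ M)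
    (hK : ∀ p : ℝ × ℝ, |p.1 - x₀| < d → |p.2 - y₀| < d → y₀ - b < p.2 → |lap u p| ≤ K) :
    dx u (x₀, y₀) ≤ 2 * M / d + K * d / 2 := by
  have hM0 : 0 ≤ M := (abs_nonneg _).trans (hM (x₀, y₀) (by simp [hd.le]) (by simp [hd.le]) (by simp [hb.le]))
  have hK0 : 0 ≤ K := (abs_nonneg _).trans (hK (x₀, y₀) (by simpa) (by simpa) (by simpa))
  have aff : ∀ σ : ℝ, |σ| = 1 → ∀ q ∈ halfBox d b, |x₀ + σ * q.1 - x₀| ≤ d ∧ |y₀ + q.2 - y₀| ≤ d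
      ∧ y₀ - b ≤ y₀ + q.2 := by
    rintro σ hσ q ⟨h1, h2, h3, h4⟩
    refine ⟨?_, by simpa using h3, by linarith⟩
    rw [add_sub_cancel_left, abs_mul, hσ, one_mul, abs_of_nonneg h1]; exact h2
  have aff' : ∀ σ : ℝ, |σ| = 1 → ∀ q : ℝ × ℝ, 0 < q.1 → q.1 < d → |q.2| < d → -b < q.2 →
      |x₀ + σ * q.1 - x₀| < d ∧ |y₀ + q.2 - y₀| < d ∧ y₀ - b < y₀ + q.2 := by
    rintro σ hσ q h1 h2 h3 h4
    refine ⟨?_, by simpa using h3, by linarith⟩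
    rw [add_sub_cancel_left, abs_mul, hσ, one_mul, abs_of_pos h1]; exact h2
  have s1 : |(1 : ℝ)| = 1 := abs_one
  have s2 : |(-1 : ℝ)| = 1 := by simp
  have cd : ∀ σ : ℝ, |σ| = 1 → ∀ q : ℝ × ℝ, 0 < q.1 → q.1 < d → |q.2| < d → -b < q.2 →
      ContDiffAt ℝ 2 (fun p : ℝ × ℝ => u (x₀ + σ * p.1, y₀ + p.2)) q := by
    intro σ hσ q h1 h2 h3 h4
    obtain ⟨a1, a2, a3⟩ := aff' σ hσ q h1 h2 h3 h4
    exact ContDiffAt.comp q (hC2 (x₀ + σ * q.1, y₀ + q.2) a1 a2 a3) (by fun_prop)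
  have cc : ∀ σ : ℝ, |σ| = 1 →
      ContinuousOn (fun p : ℝ × ℝ => u (x₀ + σ * p.1, y₀ + p.2)) (halfBox d b) := by
    intro σ hσ
    exact hc.comp (f := fun p : ℝ × ℝ => (x₀ + σ * p.1, y₀ + p.2)) (by fun_prop) (aff σ hσ)
  -- The odd part of u about x₀. It vanishes at t = 0 and on the cut line, inherits the bounds M and
  -- K, and its t-derivative at the centre is `dx u (x₀, y₀)`, so the slope of the barrier bounds
  -- this derivative.
  set w : ℝ × ℝ → ℝ := fun p => (1 / 2) * (u (x₀ + 1 * p.1, y₀ + p.2) - u (x₀ + (-1) * p.1, y₀ + p.2))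
    with hw
  have hbar := le_boxBarrier hd hM0 hK0 (b := b) (w := w)
    (continuousOn_const.mul ((cc 1 s1).sub (cc (-1) s2))) ?_ ?_ ?_ ?_ ?_
  · have hdiff : DifferentiableAt ℝ u (x₀, y₀) :=
      (hC2 (x₀, y₀) (by simpa) (by simpa) (by simpa)).differentiableAt (by simp)
    have hder := hasDerivAt_dx hdiff
    simp only at hder
    have e1 : HasDerivAt (fun t : ℝ => u (x₀ + 1 * t, y₀ + 0)) (dx u (x₀, y₀) * 1) 0 := by
      have hin : HasDerivAt (fun t : ℝ => x₀ + 1 * t) 1 0 := by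
        simpa using ((hasDerivAt_id (0 : ℝ)).const_mul 1).const_add x₀
      have : HasDerivAt (fun t => u (t, y₀)) (dx u (x₀, y₀)) (x₀ + 1 * 0) := by simpa using hder
      simp only [add_zero]
      exact HasDerivAt.comp (0 : ℝ) this hin
    have e2 : HasDerivAt (fun t : ℝ => u (x₀ + (-1) * t, y₀ + 0)) (dx u (x₀, y₀) * (-1)) 0 := by
      have hin : HasDerivAt (fun t : ℝ => x₀ + (-1) * t) (-1) 0 := by
        simpa using ((hasDerivAt_id (0 : ℝ)).const_mul (-1)).const_add x₀
      have : HasDerivAt (fun t => u (t, y₀)) (dx u (x₀, y₀)) (x₀ + (-1) * 0) := by simpa using hder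
      simp only [add_zero]
      exact HasDerivAt.comp (0 : ℝ) this hin
    have e3 := (e1.sub e2).const_mul (1 / 2)
    have e4 := le_of_hasDerivAt_of_le_mul (c := 2 * M / d + K * d / 2) hd e3 (by simp) (by
      intro t ht0 htd
      have := hbar (t, 0) ⟨ht0, htd, by simpa using hd.le, by simpa using hb.le⟩
      exact this.trans (boxBarrier_axis_le hd hM0 hK0 ht0))
    linarith
  · intro q h1 h2 h3 h4
    exact contDiffAt_const.mul ((cd 1 s1 q h1 h2 h3 h4).sub (cd (-1) s2 q h1 h2 h3 h4))
  · intro s _ _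
    simp [hw]
  · intro hbd t ht0 htd
    have e1 := h0 hbd (x₀ + 1 * t) (by rw [add_sub_cancel_left, one_mul, abs_of_nonneg ht0]; exact htd)
    have e2 := h0 hbd (x₀ + (-1) * t)
      (by rw [add_sub_cancel_left, abs_mul, s2, one_mul, abs_of_nonneg ht0]; exact htd)
    simp only [hw]
    rw [← sub_eq_add_neg, e1, e2]; simp
  · intro q hq
    obtain ⟨a1, a2, a3⟩ := aff 1 s1 q hq
    obtain ⟨b1, b2, b3⟩ := aff (-1) s2 q hq
    have e1 := hM (x₀ + 1 * q.1, y₀ + q.2) a1 a2 a3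
    have e2 := hM (x₀ + (-1) * q.1, y₀ + q.2) b1 b2 b3
    have := (abs_le.1 e1).2
    have := (abs_le.1 e2).1
    simp only [hw]; linarith
  · intro q h1 h2 h3 h4
    obtain ⟨a1, a2, a3⟩ := aff' 1 s1 q h1 h2 h3 h4
    obtain ⟨b1, b2, b3⟩ := aff' (-1) s2 q h1 h2 h3 h4
    have e1 := hK (x₀ + 1 * q.1, y₀ + q.2) a1 a2 a3
    have e2 := hK (x₀ + (-1) * q.1, y₀ + q.2) b1 b2 b3
    rw [hw, lap_const_mul, lap_sub (cd 1 s1 q h1 h2 h3 h4) (cd (-1) s2 q h1 h2 h3 h4),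
      lap_affine x₀ y₀ 1 (by norm_num), lap_affine x₀ y₀ (-1) (by norm_num)]
    have := (abs_le.1 e1).1
    have := (abs_le.1 e2).2
    linarith

theorem abs_dx_le_of_box {u : ℝ × ℝ → ℝ} {x₀ y₀ d b M K : ℝ} (hd : 0 < d) (hb : 0 < b)
    (hc : ContinuousOn u {p | |p.1 - x₀| ≤ d ∧ |p.2 - y₀| ≤ d ∧ y₀ - b ≤ p.2})
    (hC2 : ∀ p : ℝ × ℝ, |p.1 - x₀| < d → |p.2 - y₀| < d → y₀ - b < p.2 → ContDiffAt ℝ 2 u p)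
    (h0 : b ≤ d → ∀ x, |x - x₀| ≤ d → u (x, y₀ - b) = 0)
    (hM : ∀ p : ℝ × ℝ, |p.1 - x₀| ≤ d → |p.2 - y₀| ≤ d → y₀ - b ≤ p.2 → |u p| ≤ M)
    (hK : ∀ p : ℝ × ℝ, |p.1 - x₀| < d → |p.2 - y₀| < d → y₀ - b < p.2 → |lap u p| ≤ K) :
    |dx u (x₀, y₀)| ≤ 2 * M / d + K * d / 2 := by
  rw [abs_le]
  refine ⟨?_, dx_le_of_box hd hb hc hC2 h0 hM hK⟩
  have := dx_le_of_box (u := fun q => -u q) hd hb hc.neg (fun p h1 h2 h3 => (hC2 p h1 h2 h3).neg)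
    (fun h x hx => by simpa using h0 h x hx) (fun p h1 h2 h3 => by simpa using hM p h1 h2 h3)
    (fun p h1 h2 h3 => by rw [lap_neg, abs_neg]; exact hK p h1 h2 h3)
  rw [dx_neg] at this
  linarith

lemma lap_swap (u : ℝ × ℝ → ℝ) (p : ℝ × ℝ) :
    lap (fun q => u (q.2, q.1)) p = lap u (p.2, p.1) := by
  unfold lap
  rw [add_comm]; rfl

/-- Interior gradient bound in the second variable. -/
theorem abs_dy_le_of_box {u : ℝ × ℝ → ℝ} {x₀ y₀ d M K : ℝ} (hd : 0 < d)
    (hc : ContinuousOn u {p | |p.1 - x₀| ≤ d ∧ |p.2 - y₀| ≤ d})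
    (hC2 : ∀ p : ℝ × ℝ, |p.1 - x₀| < d → |p.2 - y₀| < d → ContDiffAt ℝ 2 u p)
    (hM : ∀ p : ℝ × ℝ, |p.1 - x₀| ≤ d → |p.2 - y₀| ≤ d → |u p| ≤ M)
    (hK : ∀ p : ℝ × ℝ, |p.1 - x₀| < d → |p.2 - y₀| < d → |lap u p| ≤ K) :
    |dy u (x₀, y₀)| ≤ 2 * M / d + K * d / 2 := by
  -- After exchanging the coordinates, b = 2d puts the cut line outside the box, so the condition on
  -- it is void.
  have := abs_dx_le_of_box (u := fun q => u (q.2, q.1)) (x₀ := y₀) (y₀ := x₀) (b := 2 * d) (M := M)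
    (K := K) hd (by linarith)
    (hc.comp (f := fun q : ℝ × ℝ => (q.2, q.1)) (by fun_prop) (fun p hp => ⟨hp.2.1, hp.1⟩))
    (fun p h1 h2 _ => ContDiffAt.comp p (hC2 (p.2, p.1) h2 h1) (by fun_prop))
    (fun h => by linarith)
    (fun p h1 h2 _ => hM (p.2, p.1) h2 h1)
    (fun p h1 h2 _ => by rw [lap_swap]; exact hK (p.2, p.1) h2 h1)
  exact this

/-- The part of the box of size `d` around `p₀` in the closed upper half plane. -/
def upperBox (p₀ : ℝ × ℝ) (d : ℝ) : Set (ℝ × ℝ) :=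
  {p | |p.1 - p₀.1| ≤ d ∧ |p.2 - p₀.2| ≤ d ∧ 0 ≤ p.2}

/-- Linear growth away from the boundary. -/
theorem abs_le_mul_of_box {u : ℝ × ℝ → ℝ} {x₀ d M K : ℝ} (hd : 0 < d) (hM0 : 0 ≤ M) (hK0 : 0 ≤ K)
    (hc : ContinuousOn u {p | |p.1 - x₀| ≤ d ∧ 0 ≤ p.2 ∧ p.2 ≤ d})
    (hC2 : ∀ p : ℝ × ℝ, |p.1 - x₀| < d → 0 < p.2 → p.2 < d → ContDiffAt ℝ 2 u p)
    (h0 : ∀ x, |x - x₀| ≤ d → u (x, 0) = 0)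
    (hM : ∀ p : ℝ × ℝ, |p.1 - x₀| ≤ d → 0 ≤ p.2 → p.2 ≤ d → |u p| ≤ M)
    (hK : ∀ p : ℝ × ℝ, |p.1 - x₀| < d → 0 < p.2 → p.2 < d → |lap u p| ≤ K) :
    ∀ y, 0 ≤ y → y ≤ d → |u (x₀, y)| ≤ y * (2 * M / d + K * d / 2) := by
  have main : ∀ v : ℝ × ℝ → ℝ, ContinuousOn v {p | |p.1 - x₀| ≤ d ∧ 0 ≤ p.2 ∧ p.2 ≤ d} →
      (∀ p : ℝ × ℝ, |p.1 - x₀| < d → 0 < p.2 → p.2 < d → ContDiffAt ℝ 2 v p) →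
      (∀ x, |x - x₀| ≤ d → v (x, 0) ≤ 0) →
      (∀ p : ℝ × ℝ, |p.1 - x₀| ≤ d → 0 ≤ p.2 → p.2 ≤ d → v p ≤ M) →
      (∀ p : ℝ × ℝ, |p.1 - x₀| < d → 0 < p.2 → p.2 < d → -K ≤ lap v p) →
      ∀ y, 0 ≤ y → y ≤ d → v (x₀, y) ≤ y * (2 * M / d + K * d / 2) := by
    intro v hc hC2 h0 hM hK y hy0 hyd
    have mem : ∀ q ∈ halfBox d (2 * d), |x₀ + 1 * q.2 - x₀| ≤ d ∧ 0 ≤ 0 + q.1 ∧ 0 + q.1 ≤ d := by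
      rintro q ⟨h1, h2, h3, h4⟩
      exact ⟨by simpa using h3, by simpa using h1, by simpa using h2⟩
    -- Here the barrier variable t is the height above the wall, where v ≤ 0; again b = 2d removes
    -- the cut.
    have hbar := le_boxBarrier hd hM0 hK0 (b := 2 * d) (w := fun q => v (x₀ + 1 * q.2, 0 + q.1))
      (hc.comp (f := fun q : ℝ × ℝ => (x₀ + 1 * q.2, 0 + q.1)) (by fun_prop) mem)
      (fun q h1 h2 h3 _ => ContDiffAt.comp q (hC2 (x₀ + 1 * q.2, 0 + q.1) (by simpa using h3)
        (by simpa using h1) (by simpa using h2)) (by fun_prop))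
      (fun s hs _ => by simpa using h0 (x₀ + s) (by simpa using hs))
      (fun h => by linarith)
      (fun q hq => by obtain ⟨a1, a2, a3⟩ := mem q hq; exact hM _ a1 a2 a3)
      (fun q h1 h2 h3 _ => by
        rw [lap_swap (fun q => v (x₀ + 1 * q.1, 0 + q.2)) q, lap_affine x₀ 0 1 (by norm_num)]
        exact hK _ (by simpa using h3) (by simpa using h1) (by simpa using h2))
      (y, 0) ⟨hy0, hyd, by simpa using hd.le, by simpa using hd.le⟩
    have := hbar.trans (boxBarrier_axis_le hd hM0 hK0 hy0)
    simpa using this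
  intro y hy0 hyd
  rw [abs_le]
  constructor
  · have := main (fun q => -u q) hc.neg (fun p h1 h2 h3 => (hC2 p h1 h2 h3).neg)
      (fun x hx => by simp [h0 x hx]) (fun p h1 h2 h3 => by
        have := (abs_le.1 (hM p h1 h2 h3)).1; linarith)
      (fun p h1 h2 h3 => by
        rw [lap_neg]; have := (abs_le.1 (hK p h1 h2 h3)).2; linarith) y hy0 hyd
    linarith
  · exact main u hc hC2 (fun x hx => (h0 x hx).le) (fun p h1 h2 h3 => (abs_le.1 (hM p h1 h2 h3)).2)
      (fun p h1 h2 h3 => (abs_le.1 (hK p h1 h2 h3)).1) y hy0 hyd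

/-- The gradient estimate, up to the boundary. -/
theorem gradBound_of_box {u : ℝ × ℝ → ℝ} {p₀ : ℝ × ℝ} {d M K : ℝ} (hd : 0 < d) (hp₀ : 0 < p₀.2)
    (hc : ContinuousOn u (upperBox p₀ (2 * d)))
    (hC2 : ∀ p ∈ upperBox p₀ (2 * d), 0 < p.2 → ContDiffAt ℝ 2 u p)
    (h0 : ∀ p ∈ upperBox p₀ (2 * d), p.2 = 0 → u p = 0)
    (hM : ∀ p ∈ upperBox p₀ (2 * d), |u p| ≤ M)
    (hK : ∀ p ∈ upperBox p₀ (2 * d), 0 < p.2 → |lap u p| ≤ K) :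
    GradBound u p₀ M (8 * M / d + 3 * K * d) := by
  obtain ⟨x₀, y₀⟩ := p₀
  simp only at hp₀
  have hmem : (x₀, y₀) ∈ upperBox (x₀, y₀) (2 * d) := by
    refine ⟨?_, ?_, hp₀.le⟩ <;> simp <;> linarith
  have hM0 : 0 ≤ M := (abs_nonneg _).trans (hM _ hmem)
  have hK0 : 0 ≤ K := (abs_nonneg _).trans (hK _ hmem hp₀)
  have hMd : 0 ≤ M / d := by positivity
  have hKd : 0 ≤ K * d := by positivity
  refine ⟨(hC2 _ hmem hp₀).differentiableAt (by simp), hM _ hmem, ?_, ?_⟩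
  · have := abs_dx_le_of_box (u := u) (x₀ := x₀) (y₀ := y₀) (d := 2 * d) (b := y₀) (M := M) (K := K)
      (by linarith) hp₀ (by simpa [upperBox] using hc)
      (fun p h1 h2 h3 => hC2 p ⟨h1.le, h2.le, by linarith⟩ (by linarith))
      (fun h x hx => h0 _ ⟨hx, by simpa [abs_of_pos hp₀] using h, by simp⟩ (by simp))
      (fun p h1 h2 h3 => hM p ⟨h1, h2, by linarith⟩)
      (fun p h1 h2 h3 => hK p ⟨h1.le, h2.le, by linarith⟩ (by linarith))
    refine this.trans ?_
    have e : 2 * M / (2 * d) + K * (2 * d) / 2 = M / d + K * d := by field_simp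
    have e' : 8 * M / d = 8 * (M / d) := by ring
    rw [e, e']; linarith
  -- Far from the wall the interior estimate on a box of size d/2 suffices. Near the wall the box
  -- has the small size y₀, and the linear growth of u away from the wall makes its supremum there
  -- at most 2y₀L, which compensates the division by y₀.
  · rcases le_or_gt (d / 2) y₀ with hy | hy
    · have sub : ∀ p : ℝ × ℝ, |p.1 - x₀| ≤ d / 2 → |p.2 - y₀| ≤ d / 2 →
          p ∈ upperBox (x₀, y₀) (2 * d) := fun p h1 h2 =>
        ⟨by simp only; linarith, by simp only; linarith, by have := (abs_le.1 h2).1; linarith⟩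
      have := abs_dy_le_of_box (u := u) (x₀ := x₀) (y₀ := y₀) (d := d / 2) (M := M) (K := K)
        (by linarith) (hc.mono fun p hp => sub p hp.1 hp.2)
        (fun p h1 h2 => hC2 p (sub p h1.le h2.le) (by have := (abs_lt.1 h2).1; linarith))
        (fun p h1 h2 => hM p (sub p h1 h2))
        (fun p h1 h2 => hK p (sub p h1.le h2.le) (by have := (abs_lt.1 h2).1; linarith))
      refine this.trans ?_
      have e : 2 * M / (d / 2) + K * (d / 2) / 2 = 4 * (M / d) + K * d / 4 := by field_simp; ring
      have e' : 8 * M / d = 8 * (M / d) := by ring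
      rw [e, e']; linarith
    · have lin : ∀ p : ℝ × ℝ, |p.1 - x₀| ≤ d → 0 ≤ p.2 → p.2 ≤ d →
          |u p| ≤ p.2 * (2 * M / d + K * d / 2) := by
        intro p hp1 hp2 hp3
        have sub : ∀ q : ℝ × ℝ, |q.1 - p.1| ≤ d → 0 ≤ q.2 → q.2 ≤ d →
            q ∈ upperBox (x₀, y₀) (2 * d) := by
          intro q h1 h2 h3
          refine ⟨?_, ?_, h2⟩
          · have := abs_sub_le q.1 p.1 x₀; simp only; linarith
          · rw [abs_le]; simp only; constructor <;> linarith
        exact abs_le_mul_of_box hd hM0 hK0 (hc.mono fun q hq => sub q hq.1 hq.2.1 hq.2.2)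
          (fun q h1 h2 h3 => hC2 q (sub q h1.le h2.le h3.le) h2)
          (fun x hx => h0 _ (sub (x, 0) hx le_rfl hd.le) rfl)
          (fun q h1 h2 h3 => hM q (sub q h1 h2 h3))
          (fun q h1 h2 h3 => hK q (sub q h1.le h2.le h3.le) h2) p.2 hp2 hp3
      have sub : ∀ p : ℝ × ℝ, |p.1 - x₀| ≤ y₀ → |p.2 - y₀| ≤ y₀ → 0 ≤ p.2 ∧ p.2 ≤ 2 * y₀ ∧
          p ∈ upperBox (x₀, y₀) (2 * d) := by
        intro p h1 h2
        have := abs_le.1 h2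
        refine ⟨by linarith, by linarith, by simp only; linarith, by simp only; linarith, by linarith⟩
      set L := 2 * M / d + K * d / 2 with hL
      have hL0 : 0 ≤ L := by positivity
      have := abs_dy_le_of_box (u := u) (x₀ := x₀) (y₀ := y₀) (d := y₀) (M := 2 * y₀ * L) (K := K)
        hp₀ (hc.mono fun p hp => (sub p hp.1 hp.2).2.2)
        (fun p h1 h2 => hC2 p (sub p h1.le h2.le).2.2 (by have := (abs_lt.1 h2).1; linarith))
        (fun p h1 h2 => by
          obtain ⟨a1, a2, a3⟩ := sub p h1 h2
          refine (lin p (by linarith) a1 (by linarith)).trans ?_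
          gcongr)
        (fun p h1 h2 => hK p (sub p h1.le h2.le).2.2 (by have := (abs_lt.1 h2).1; linarith))
      refine this.trans ?_
      have e : 2 * (2 * y₀ * L) / y₀ = 4 * L := by field_simp; ring
      have e' : 8 * M / d = 8 * (M / d) := by ring
      have e2 : 2 * M / d = 2 * (M / d) := by ring
      rw [e, e', hL, e2]
      have : K * y₀ ≤ K * d := by gcongr; linarith
      linarith

/-! ### Mean value inequalities and second derivatives by tangential difference quotients -/

lemma abs_sub_le_of_dx_bound {u : ℝ × ℝ → ℝ} {x₁ x₂ y M : ℝ}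
    (hd : ∀ x ∈ Set.uIcc x₁ x₂, DifferentiableAt ℝ u (x, y))
    (hb : ∀ x ∈ Set.uIcc x₁ x₂, |dx u (x, y)| ≤ M) : |u (x₂, y) - u (x₁, y)| ≤ M * |x₂ - x₁| := by
  have := Convex.norm_image_sub_le_of_norm_hasDerivWithin_le (f := fun t => u (t, y))
    (f' := fun t => dx u (t, y)) (s := Set.uIcc x₁ x₂) (C := M)
    (fun x hx => (hasDerivAt_dx (hd x hx)).hasDerivWithinAt) hb (convex_uIcc _ _)
    Set.left_mem_uIcc Set.right_mem_uIcc
  simpa using this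

lemma abs_sub_le_of_dy_bound {u : ℝ × ℝ → ℝ} {x y₁ y₂ M : ℝ}
    (hd : ∀ y ∈ Set.uIcc y₁ y₂, DifferentiableAt ℝ u (x, y))
    (hb : ∀ y ∈ Set.uIcc y₁ y₂, |dy u (x, y)| ≤ M) : |u (x, y₂) - u (x, y₁)| ≤ M * |y₂ - y₁| := by
  have := Convex.norm_image_sub_le_of_norm_hasDerivWithin_le (f := fun t => u (x, t))
    (f' := fun t => dy u (x, t)) (s := Set.uIcc y₁ y₂) (C := M)
    (fun y hy => (hasDerivAt_dy (hd y hy)).hasDerivWithinAt) hb (convex_uIcc _ _)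
    Set.left_mem_uIcc Set.right_mem_uIcc
  simpa using this

lemma abs_hasDerivAt_le {g : ℝ → ℝ} {g' c x d : ℝ} (hd : 0 < d) (hg : HasDerivAt g g' x)
    (hle : ∀ h, 0 < h → h < d → |g (x + h) - g x| ≤ h * c) : |g'| ≤ c := by
  have h := (hasDerivAt_iff_tendsto_slope_zero.1 hg).mono_left
    (nhdsWithin_mono (0 : ℝ) (fun x (hx : x ∈ Ioi 0) => ne_of_gt hx))
  refine le_of_tendsto h.abs ?_
  filter_upwards [Ioo_mem_nhdsGT hd] with t ht
  rw [smul_eq_mul, abs_mul, abs_inv, abs_of_pos ht.1, inv_mul_le_iff₀ ht.1]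
  exact hle t ht.1 ht.2

/-- Second derivatives involving `x`, up to the boundary. -/
theorem abs_dx_dx_le_of_box {u : ℝ × ℝ → ℝ} {p₀ : ℝ × ℝ} {d M K : ℝ} (hd : 0 < d) (hp₀ : 0 < p₀.2)
    (hc : ContinuousOn u (upperBox p₀ (3 * d)))
    (hC2 : ∀ p ∈ upperBox p₀ (3 * d), 0 < p.2 → ContDiffAt ℝ 2 u p)
    (h0 : ∀ p ∈ upperBox p₀ (3 * d), p.2 = 0 → u p = 0)
    (hM : ∀ p ∈ upperBox p₀ (3 * d), 0 < p.2 → |dx u p| ≤ M)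
    (hK : ∀ p ∈ upperBox p₀ (3 * d), ∀ h, (p.1 + h, p.2) ∈ upperBox p₀ (3 * d) → 0 < p.2 → 0 < h →
      |lap u (p.1 + h, p.2) - lap u p| ≤ K * h) :
    |dx (dx u) p₀| ≤ 8 * M / d + 3 * K * d ∧ |dx (dy u) p₀| ≤ 8 * M / d + 3 * K * d := by
  have hmem : p₀ ∈ upperBox p₀ (3 * d) := ⟨by simp; linarith, by simp; linarith, hp₀.le⟩
  have hM0 : 0 ≤ M := (abs_nonneg _).trans (hM _ hmem hp₀)
  -- A horizontal translate of u still vanishes on the wall. The difference u(x+h, y) - u(x, y) has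
  -- size at most Mh and Laplacian at most Kh, so the two components of its gradient, divided by h,
  -- bound u_xx and u_xy.
  have step : ∀ h, 0 < h → h < d →
      GradBound (fun q => u (h + 1 * q.1, 0 + q.2) - u q) p₀ (M * h) (8 * (M * h) / d + 3 * (K * h) * d) := by
    intro h hh0 hhd
    have sub1 : ∀ p ∈ upperBox p₀ (2 * d), p ∈ upperBox p₀ (3 * d) := fun p hp =>
      ⟨hp.1.trans (by linarith), hp.2.1.trans (by linarith), hp.2.2⟩
    have sub2 : ∀ p ∈ upperBox p₀ (2 * d), (h + 1 * p.1, 0 + p.2) ∈ upperBox p₀ (3 * d) := by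
      intro p hp
      refine ⟨?_, by simpa using hp.2.1.trans (by linarith), by simpa using hp.2.2⟩
      have := abs_le.1 hp.1
      rw [abs_le]; simp only; constructor <;> linarith
    refine gradBound_of_box hd hp₀ ?_ ?_ ?_ ?_ ?_
    · exact (hc.comp (f := fun q : ℝ × ℝ => (h + 1 * q.1, 0 + q.2)) (by fun_prop) sub2).sub
        (hc.mono sub1)
    · intro p hp hp2
      exact (ContDiffAt.comp p (hC2 (h + 1 * p.1, 0 + p.2) (sub2 p hp) (by simpa using hp2))
        (by fun_prop)).sub (hC2 p (sub1 p hp) hp2)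
    · intro p hp hp2
      rw [h0 p (sub1 p hp) hp2, h0 _ (sub2 p hp) (by simpa using hp2)]; simp
    · intro p hp
      rcases hp.2.2.eq_or_lt with e | hp2
      · rw [h0 p (sub1 p hp) e.symm, h0 _ (sub2 p hp) (by simpa using e.symm)]; simp; positivity
      · have key : ∀ x ∈ Set.uIcc p.1 (h + 1 * p.1), (x, p.2) ∈ upperBox p₀ (3 * d) := by
          intro x hx
          rw [Set.uIcc_of_le (by linarith)] at hx
          refine ⟨?_, (sub1 p hp).2.1, (sub1 p hp).2.2⟩
          have := abs_le.1 hp.1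
          have := hx.1; have := hx.2
          rw [abs_le]; simp only; constructor <;> linarith
        have := abs_sub_le_of_dx_bound (u := u) (x₁ := p.1) (x₂ := h + 1 * p.1) (y := p.2) (M := M)
          (fun x hx => (hC2 _ (key x hx) hp2).differentiableAt (by simp))
          (fun x hx => hM _ (key x hx) hp2)
        rw [show h + 1 * p.1 - p.1 = h by ring, abs_of_pos hh0] at this
        simpa using this
    · intro p hp hp2
      have e := lap_affine (u := u) h 0 1 (by norm_num) p
      have hcd : ContDiffAt ℝ 2 (fun q : ℝ × ℝ => u (h + 1 * q.1, 0 + q.2)) p :=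
        ContDiffAt.comp p (hC2 (h + 1 * p.1, 0 + p.2) (sub2 p hp) (by simpa using hp2))
          (by fun_prop)
      rw [lap_sub hcd (hC2 p (sub1 p hp) hp2)]
      have hs := sub2 p hp
      have e2 : (h + 1 * p.1, 0 + p.2) = (p.1 + h, p.2) := by ext <;> simp [add_comm]
      rw [e2] at hs
      have := hK p (sub1 p hp) h hs hp2 hh0
      rw [e2] at e
      rwa [e]
  have hdiff := hC2 p₀ hmem hp₀
  have hpt : ∀ h, 0 < h → h < d → ContDiffAt ℝ 2 u (p₀.1 + h, p₀.2) := by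
    intro h hh0 hhd
    refine hC2 _ ⟨?_, by simp; linarith, hp₀.le⟩ hp₀
    simp [abs_of_pos hh0]; linarith
  have e1 : ∀ h, h + 1 * p₀.1 = p₀.1 + h := fun h => by ring
  have hfun : ∀ h, (fun q : ℝ × ℝ => u (h + 1 * q.1, 0 + q.2) - u q)
      = fun q => u (q.1 + h, q.2) - u q := by
    intro h; funext q; rw [one_mul, zero_add, add_comm h]
  have dsh : ∀ h, dx (fun q => u (q.1 + h, q.2)) p₀ = dx u (p₀.1 + h, p₀.2) := fun h =>
    deriv_comp_add_const (fun s => u (s, p₀.2)) h p₀.1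
  have dsh' : ∀ h, dy (fun q => u (q.1 + h, q.2)) p₀ = dy u (p₀.1 + h, p₀.2) := fun h => rfl
  have dd : ∀ h, 0 < h → h < d → DifferentiableAt ℝ (fun q : ℝ × ℝ => u (q.1 + h, q.2)) p₀ := by
    intro h a b
    exact DifferentiableAt.comp (g := u) (f := fun q : ℝ × ℝ => (q.1 + h, q.2)) p₀
      ((hpt h a b).differentiableAt (by simp)) (by fun_prop)
  have fin : ∀ h : ℝ, 8 * (M * h) / d + 3 * (K * h) * d = h * (8 * M / d + 3 * K * d) := by
    intro h; ring
  constructor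
  · refine abs_hasDerivAt_le hd (hasDerivAt_dx (differentiableAt_dx hdiff)) ?_
    intro h a b
    have := (step h a b).dx_le
    rw [hfun, dx_sub (dd h a b) (hdiff.differentiableAt (by simp)), dsh, fin] at this
    exact this
  · refine abs_hasDerivAt_le hd (hasDerivAt_dx (differentiableAt_dy hdiff)) ?_
    intro h a b
    have := (step h a b).dy_le
    rw [hfun, dy_sub (dd h a b) (hdiff.differentiableAt (by simp)), dsh', fin] at this
    exact this

/-! ### The reduced problem -/

/-- The potential `(3/4) C_l² / r²`. -/
noncomputable def pot (Cl : ℝ) (p : ℝ × ℝ) : ℝ := (3 / 4 : ℝ) * Cl ^ 2 / rad Cl p ^ 2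

/-- The closed cell. -/
def cell (Cl : ℝ) : Set (ℝ × ℝ) := {p | |p.1| ≤ 1 / Cl ∧ 0 ≤ p.2 ∧ p.2 ≤ 1 / Cl}

/-- The cell with its lower side but without the other sides. -/
def lowerCell (Cl : ℝ) : Set (ℝ × ℝ) := {p | |p.1| < 1 / Cl ∧ 0 ≤ p.2 ∧ p.2 < 1 / Cl}

/-- `u` solves `-Δu + (3/4) (C_l / r)² u = Ω` in the cell with zero boundary values. -/
structure IsReduced (Cl S : ℝ) (Ω u : ℝ × ℝ → ℝ) : Prop where
  Cl_pos : 0 < Cl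
  cont : ContinuousOn u (cell Cl)
  smooth : ContDiffOn ℝ 2 u (lowerCell Cl)
  odd : ∀ x y : ℝ, |x| ≤ 1 / Cl → 0 ≤ y → y ≤ 1 / Cl → u (-x, y) = -u (x, y)
  wall : ∀ x : ℝ, |x| ≤ 1 / Cl → u (x, 0) = 0
  side : ∀ x y : ℝ, |x| = 1 / Cl → 0 ≤ y → y ≤ 1 / Cl → u (x, y) = 0
  axis : ∀ x : ℝ, |x| ≤ 1 / Cl → u (x, 1 / Cl) = 0
  pde : ∀ p : ℝ × ℝ, |p.1| < 1 / Cl → 0 < p.2 → p.2 < 1 / Cl → lap u p = pot Cl p * u p - Ω p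
  supp : ∀ p ∈ halfPlane, S < len p → Ω p = 0
  odd_source : ∀ x y : ℝ, 0 < y → Ω (-x, y) = -Ω (x, y)

lemma rad_pos {Cl : ℝ} (hCl : 0 < Cl) {p : ℝ × ℝ} (hp : p.2 < 1 / Cl) : 0 < rad Cl p := by
  unfold rad
  have := (lt_div_iff₀ hCl).1 hp
  linarith

lemma isOpen_innerCell (Cl : ℝ) : IsOpen {p : ℝ × ℝ | |p.1| < 1 / Cl ∧ 0 < p.2 ∧ p.2 < 1 / Cl} :=
  (isOpen_lt continuous_fst.abs continuous_const).inter
    ((isOpen_lt continuous_const continuous_snd).inter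
      (isOpen_lt continuous_snd continuous_const))

lemma contDiffAt_of_lowerCell {Cl : ℝ} {u : ℝ × ℝ → ℝ} (h : ContDiffOn ℝ 2 u (lowerCell Cl))
    {p : ℝ × ℝ} (h1 : |p.1| < 1 / Cl) (h2 : 0 < p.2) (h3 : p.2 < 1 / Cl) : ContDiffAt ℝ 2 u p :=
  h.contDiffAt (Filter.mem_of_superset ((isOpen_innerCell Cl).mem_nhds ⟨h1, h2, h3⟩)
    fun _ hq => ⟨hq.1, hq.2.1.le, hq.2.2⟩)

lemma contDiff_rad (Cl : ℝ) {n : WithTop ℕ∞} : ContDiff ℝ n (rad Cl) := by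
  unfold rad; fun_prop

lemma hasDerivAt_rad_rpow {Cl : ℝ} {p : ℝ × ℝ} (hp : 0 < rad Cl p) (s : ℝ) :
    HasDerivAt (fun t => rad Cl (p.1, t) ^ s) (-Cl * s * rad Cl p ^ (s - 1)) p.2 := by
  have h1 : HasDerivAt (fun t => rad Cl (p.1, t)) (-Cl) p.2 := by
    unfold rad
    simpa using ((hasDerivAt_id p.2).const_mul Cl).const_sub 1
  exact h1.rpow_const (Or.inl hp.ne')

/-- The Liouville transform `u = r^{1/2} φ` of the stream function. -/
theorem isReduced_streamOne {Cl S : ℝ} {ω φ : ℝ × ℝ → ℝ} (hCl : 0 < Cl) (hω : IsSource S ω)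
    (hφ : IsStream Cl ω φ) : IsReduced Cl S (OmOne Cl ω) (streamOne Cl φ) where
  Cl_pos := hCl
  cont := by
    refine hφ.cont.mul (Continuous.continuousOn ?_)
    exact (contDiff_rad Cl (n := 1)).continuous.rpow_const (fun _ => Or.inr (by norm_num))
  smooth := hφ.smooth.mul ((contDiff_rad Cl).contDiffOn.rpow_const_of_ne
    fun p hp => (rad_pos hCl hp.2.2).ne')
  odd := fun x y hx hy hy' => by simp only [streamOne, hφ.odd x y hx hy hy', rad]; ring
  wall := fun x hx => by simp [streamOne, hφ.wall x hx]
  side := fun x y hx hy hy' => by simp [streamOne, hφ.side x y hx hy hy']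
  axis := fun x hx => by simp only [streamOne, hφ.axis x hx, zero_mul]
  supp := fun p hp h => by simp [OmOne, hω.supp p hp h]
  odd_source := fun x y hy => by simp only [OmOne, hω.odd x y hy, rad]; ring
  pde := by
    intro p h1 h2 h3
    have hr := rad_pos hCl h3
    have hφ2 := contDiffAt_of_lowerCell hφ.smooth h1 h2 h3
    have hm : ContDiffAt ℝ 2 (fun q => rad Cl q ^ (1 / 2 : ℝ)) p :=
      (contDiff_rad Cl).contDiffAt.rpow_const_of_ne hr.ne'
    have hev : ∀ᶠ q in 𝓝 p, 0 < rad Cl q :=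
      (contDiff_rad Cl (n := 1)).continuous.continuousAt.eventually (lt_mem_nhds hr)
    have hdx : dx (fun q => rad Cl q ^ (1 / 2 : ℝ)) = fun _ => 0 := by
      funext q; simp [dx, rad]
    have hdy : dy (fun q => rad Cl q ^ (1 / 2 : ℝ)) =ᶠ[𝓝 p]
        fun q => -Cl * (1 / 2) * rad Cl q ^ (1 / 2 - 1 : ℝ) := by
      filter_upwards [hev] with q hq
      exact (hasDerivAt_rad_rpow hq _).deriv
    have hlap : lap (fun q => rad Cl q ^ (1 / 2 : ℝ)) p
        = -Cl * (1 / 2) * (-Cl * (1 / 2 - 1) * rad Cl p ^ (1 / 2 - 1 - 1 : ℝ)) := by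
      unfold lap
      rw [hdx, dy_congr hdy, dy_const_mul]
      have := (hasDerivAt_rad_rpow hr (1 / 2 - 1)).deriv
      simp only [dx, deriv_const, zero_add]
      rw [← this]; rfl
    have hpde := hφ.pde p h1 h2 h3
    set s := rad Cl p ^ (1 / 2 : ℝ) with hs
    have hs0 : 0 < s := Real.rpow_pos_of_pos hr _
    have e1 : rad Cl p = s ^ 2 := by
      rw [hs, ← Real.rpow_natCast, ← Real.rpow_mul hr.le]; norm_num
    have e2 : rad Cl p ^ (3 / 2 : ℝ) = s ^ 3 := by
      rw [hs, ← Real.rpow_natCast, ← Real.rpow_mul hr.le]; norm_num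
    have e3 : rad Cl p ^ (1 / 2 - 1 : ℝ) = s⁻¹ := by
      rw [hs, ← Real.rpow_neg hr.le]; norm_num
    have e4 : rad Cl p ^ (1 / 2 - 1 - 1 : ℝ) = (s ^ 3)⁻¹ := by
      rw [← e2, ← Real.rpow_neg hr.le]; norm_num
    have hl : dx (dx φ) p + dy (dy φ) p = lap φ p := rfl
    rw [hl, e1] at hpde
    have hl2 : lap φ p = Cl / s ^ 2 * dy φ p + Cl ^ 2 / (s ^ 2) ^ 2 * φ p - s ^ 2 * ω p := by linarith
    -- The cross term 2φ_y ∂_y r^{1/2} = -C_l r^{-1/2} φ_y cancels the first order term of the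
    -- equation, and Δr^{1/2} = -(C_l²/4) r^{-3/2} turns the coefficient 1 of the potential into
    -- 3/4. With s = r^{1/2} all powers of r are integer powers of s.
    have hmul := lap_mul hφ2 hm
    rw [hlap, hdx, hdy.self_of_nhds] at hmul
    beta_reduce at hmul
    rw [e3, e4, hl2] at hmul
    change lap (fun q => φ q * rad Cl q ^ (1 / 2 : ℝ)) p = _
    rw [hmul]
    simp only [pot, OmOne, streamOne, e2, ← hs]
    rw [e1]
    field_simp
    ring

/-! ### The logarithmically concave barrier -/

/-- The profile `∫₀^P (1 + |t|^a)^{-b} dt`. -/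
noncomputable def prof (a b P : ℝ) : ℝ := ∫ t in (0 : ℝ)..P, (1 + |t| ^ a) ^ (-b)

section prof

variable {a b : ℝ}

lemma continuous_prof_integrand (ha : 0 < a) : Continuous fun t : ℝ => (1 + |t| ^ a) ^ (-b) := by
  have : Continuous fun t : ℝ => 1 + |t| ^ a :=
    continuous_const.add (continuous_abs.rpow_const fun _ => Or.inr ha.le)
  exact this.rpow_const fun t => Or.inl (by positivity)

lemma hasDerivAt_prof (ha : 0 < a) (P : ℝ) :
    HasDerivAt (prof a b) ((1 + |P| ^ a) ^ (-b)) P :=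
  (continuous_prof_integrand ha).integral_hasStrictDerivAt 0 P |>.hasDerivAt

lemma continuous_prof (ha : 0 < a) : Continuous (prof a b) :=
  continuous_iff_continuousAt.2 fun P => (hasDerivAt_prof ha P).continuousAt

lemma prof_nonneg {P : ℝ} (hP : 0 ≤ P) : 0 ≤ prof a b P :=
  intervalIntegral.integral_nonneg hP fun t _ => by positivity

lemma prof_le_self (ha : 0 < a) (hb : 0 ≤ b) {P : ℝ} (hP : 0 ≤ P) : prof a b P ≤ P := by
  have := intervalIntegral.integral_mono_on (μ := MeasureTheory.volume) hP
    ((continuous_prof_integrand (b := b) ha).intervalIntegrable 0 P)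
    (intervalIntegrable_const (c := (1 : ℝ))) (fun t _ =>
      Real.rpow_le_one_of_one_le_of_nonpos (by have : 0 ≤ |t| ^ a := by positivity
                                               linarith) (by linarith))
  simpa [prof] using this

/-- The integrand is at most t^{-ab}. With ab = β/2 and P = xy this is the growth |x|^{2-β}, whereas
`prof_le_self` is the growth |x|². -/
lemma prof_le_rpow (ha : 0 < a) (hb : 0 ≤ b) (hab : a * b < 1) {P : ℝ} (hP : 0 ≤ P) :
    prof a b P ≤ P ^ (1 - a * b) / (1 - a * b) := by
  have hint := intervalIntegral.intervalIntegrable_rpow' (a := 0) (b := P) (r := -(a * b)) (by linarith)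
  have hle : prof a b P ≤ ∫ t in (0 : ℝ)..P, t ^ (-(a * b)) := by
    refine intervalIntegral.integral_mono_on_of_le_Ioo hP
      ((continuous_prof_integrand (b := b) ha).intervalIntegrable 0 P) hint ?_
    intro t ht
    rw [abs_of_pos ht.1, show -(a * b) = a * (-b) by ring, Real.rpow_mul ht.1.le]
    exact Real.rpow_le_rpow_of_nonpos (Real.rpow_pos_of_pos ht.1 _) (by linarith) (by linarith)
  refine hle.trans (le_of_eq ?_)
  rw [integral_rpow (Or.inl (by linarith)), Real.zero_rpow (by linarith)]
  rw [show -(a * b) + 1 = 1 - a * b by ring, sub_zero]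

lemma hasDerivAt_prof_deriv {P : ℝ} (hP : 0 < P) :
    HasDerivAt (fun t : ℝ => (1 + |t| ^ a) ^ (-b))
      (-(a * b * P ^ (a - 1) * (1 + P ^ a) ^ (-b - 1))) P := by
  have h1 : HasDerivAt (fun t : ℝ => 1 + t ^ a) (a * P ^ (a - 1)) P :=
    (Real.hasDerivAt_rpow_const (Or.inl hP.ne')).const_add 1
  have h2 := h1.rpow_const (p := -b) (Or.inl (by positivity))
  have h3 : (fun t : ℝ => (1 + |t| ^ a) ^ (-b)) =ᶠ[𝓝 P] fun t => (1 + t ^ a) ^ (-b) := by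
    filter_upwards [lt_mem_nhds hP] with t ht
    rw [abs_of_pos ht]
  refine (h2.congr_of_eventuallyEq h3).congr_deriv ?_
  ring

lemma contDiffAt_prof (ha : 0 < a) {P : ℝ} (hP : 0 < P) : ContDiffAt ℝ 2 (prof a b) P := by
  have h : ContDiffOn ℝ 2 (prof a b) (Ioi 0) := by
    rw [show (2 : WithTop ℕ∞) = 1 + 1 by norm_num, contDiffOn_succ_iff_deriv_of_isOpen isOpen_Ioi]
    refine ⟨fun t _ => (hasDerivAt_prof ha t).differentiableAt.differentiableWithinAt, by simp, ?_⟩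
    have e : deriv (prof a b) = fun t => (1 + |t| ^ a) ^ (-b) :=
      funext fun t => (hasDerivAt_prof ha t).deriv
    rw [e]
    refine ContDiffOn.congr (f := fun t : ℝ => (1 + t ^ a) ^ (-b)) ?_
      (fun t ht => by rw [abs_of_pos (mem_Ioi.1 ht)])
    refine ContDiffOn.rpow_const_of_ne (contDiffOn_const.add
      (contDiffOn_id.rpow_const_of_ne fun t ht => (mem_Ioi.1 ht).ne')) ?_
    intro t ht
    have : 0 < t := ht
    positivity
  exact h.contDiffAt (Ioi_mem_nhds hP)

lemma contDiffAt_prof_mul (ha : 0 < a) {p : ℝ × ℝ} (h1 : 0 < p.1) (h2 : 0 < p.2) :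
    ContDiffAt ℝ 2 (fun q : ℝ × ℝ => prof a b (q.1 * q.2)) p :=
  ContDiffAt.comp p (contDiffAt_prof ha (mul_pos h1 h2)) (by fun_prop)

/-- ΔF(xy) = F''(xy)(x² + y²), and F'' < 0 for the concave profile. -/
lemma lap_prof_mul (ha : 0 < a) {p : ℝ × ℝ} (h1 : 0 < p.1) (h2 : 0 < p.2) :
    lap (fun q : ℝ × ℝ => prof a b (q.1 * q.2)) p
      = -(a * b * (p.1 * p.2) ^ (a - 1) * (1 + (p.1 * p.2) ^ a) ^ (-b - 1)) * len p ^ 2 := by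
  have e1 : dx (fun q : ℝ × ℝ => prof a b (q.1 * q.2))
      = fun q => (1 + |q.1 * q.2| ^ a) ^ (-b) * q.2 := by
    funext q
    exact (HasDerivAt.comp q.1 (hasDerivAt_prof (b := b) ha (q.1 * q.2))
      (by simpa using (hasDerivAt_id q.1).mul_const q.2)).deriv
  have e2 : dy (fun q : ℝ × ℝ => prof a b (q.1 * q.2))
      = fun q => (1 + |q.1 * q.2| ^ a) ^ (-b) * q.1 := by
    funext q
    exact (HasDerivAt.comp q.2 (hasDerivAt_prof (b := b) ha (q.1 * q.2))
      (by simpa using (hasDerivAt_id q.2).const_mul q.1)).deriv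
  have hd := hasDerivAt_prof_deriv (a := a) (b := b) (mul_pos h1 h2)
  have e3 : dx (fun q : ℝ × ℝ => (1 + |q.1 * q.2| ^ a) ^ (-b) * q.2) p
      = -(a * b * (p.1 * p.2) ^ (a - 1) * (1 + (p.1 * p.2) ^ a) ^ (-b - 1)) * p.2 * p.2 :=
    ((HasDerivAt.comp p.1 hd (h := fun t => t * p.2)
      (by simpa using (hasDerivAt_id p.1).mul_const p.2)).mul_const p.2).deriv
  have e4 : dy (fun q : ℝ × ℝ => (1 + |q.1 * q.2| ^ a) ^ (-b) * q.1) p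
      = -(a * b * (p.1 * p.2) ^ (a - 1) * (1 + (p.1 * p.2) ^ a) ^ (-b - 1)) * p.1 * p.1 :=
    ((HasDerivAt.comp p.2 hd (h := fun t => p.1 * t)
      (by simpa using (hasDerivAt_id p.2).const_mul p.1)).mul_const p.1).deriv
  unfold lap
  rw [e1, e2, e3, e4, len_sq]
  ring

end prof

lemma one_add_rpow_le {s m : ℝ} (hs : 0 ≤ s) (hm : 0 ≤ m) : (1 + s) ^ m ≤ 2 ^ m * (1 + s ^ m) := by
  have h1 : (0 : ℝ) ≤ s ^ m := by positivity
  rcases le_total s 1 with h | h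
  · calc (1 + s) ^ m ≤ 2 ^ m := Real.rpow_le_rpow (by positivity) (by linarith) hm
      _ ≤ _ := le_mul_of_one_le_right (by positivity) (by linarith)
  · calc (1 + s) ^ m ≤ (2 * s) ^ m := Real.rpow_le_rpow (by positivity) (by linarith) hm
      _ = 2 ^ m * s ^ m := Real.mul_rpow (by norm_num) hs
      _ ≤ _ := by gcongr; linarith

/-- The barrier is superharmonic enough to dominate the weighted source. -/
lemma le_neg_lap_prof {α β : ℝ} (hα : 0 < α) (hα1 : α ≤ 1) (hβ : 0 < β) {p : ℝ × ℝ} (h1 : 0 < p.1)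
    (h2 : 0 < p.2) :
    β / 2 * 2 ^ (-(β / α) - 1) ≤ -lap (fun q : ℝ × ℝ => prof (α / 2) (β / α) (q.1 * q.2)) p
      * (len p ^ (-α) + len p ^ β) := by
  set ρ := len p with hρ
  have hρ0 : 0 < ρ := len_pos_of_mem h2
  set P := p.1 * p.2 with hP
  have hP0 : 0 < P := mul_pos h1 h2
  have hPρ : P ≤ ρ ^ 2 := by
    rw [hρ, len_sq, hP]; nlinarith [sq_nonneg (p.1 - p.2)]
  rw [lap_prof_mul (by positivity) h1 h2, ← hρ, ← hP]
  have hab : α / 2 * (β / α) = β / 2 := by field_simp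
  -- Both factors of the Laplacian that depend on P = xy have negative exponents, so P ≤ ρ² gives
  -- lower bounds in terms of ρ alone.
  have e1 : ρ ^ (α - 2) ≤ P ^ (α / 2 - 1) := by
    calc ρ ^ (α - 2) = (ρ ^ 2) ^ (α / 2 - 1) := by
          rw [← Real.rpow_natCast, ← Real.rpow_mul hρ0.le]; congr 1; push_cast; ring
      _ ≤ _ := Real.rpow_le_rpow_of_nonpos hP0 hPρ (by linarith)
  have e2 : (1 + ρ ^ α) ^ (-(β / α) - 1) ≤ (1 + P ^ (α / 2)) ^ (-(β / α) - 1) := by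
    refine Real.rpow_le_rpow_of_nonpos (by positivity) ?_ (by have : 0 < β / α := by positivity
                                                              linarith)
    have : P ^ (α / 2) ≤ (ρ ^ 2) ^ (α / 2) := Real.rpow_le_rpow hP0.le hPρ (by positivity)
    rw [← Real.rpow_natCast, ← Real.rpow_mul hρ0.le] at this
    rw [show ((2 : ℕ) : ℝ) * (α / 2) = α by push_cast; ring] at this
    linarith
  have e3 : ρ ^ (α - 2) * ρ ^ 2 = ρ ^ α := by
    rw [← Real.rpow_natCast, ← Real.rpow_add hρ0]; congr 1; push_cast; ring
  -- The exponent β/α of the profile is chosen for this identity: the weight times ρ^α is 1 +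
  -- (ρ^α)^{β/α+1}, which compensates the factor (1 + ρ^α)^{-β/α-1} up to a power of 2.
  have e4 : ρ ^ α * (ρ ^ (-α) + ρ ^ β) = 1 + (ρ ^ α) ^ (β / α + 1) := by
    rw [mul_add, ← Real.rpow_add hρ0, ← Real.rpow_add hρ0, ← Real.rpow_mul hρ0.le]
    rw [show α + -α = 0 by ring, Real.rpow_zero, show α * (β / α + 1) = α + β by field_simp; ring]
  have e5 := one_add_rpow_le (s := ρ ^ α) (m := β / α + 1) (by positivity) (by positivity)
  have e6 : (2 : ℝ) ^ (-(β / α) - 1) ≤ (1 + ρ ^ α) ^ (-(β / α) - 1) * (1 + (ρ ^ α) ^ (β / α + 1)) := by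
    rw [show -(β / α) - 1 = -(β / α + 1) by ring, Real.rpow_neg (by positivity),
      Real.rpow_neg (by positivity), ← div_eq_inv_mul, inv_eq_one_div, div_le_div_iff₀ (by positivity)
      (by positivity)]
    linarith
  rw [hab]
  calc β / 2 * 2 ^ (-(β / α) - 1)
      ≤ β / 2 * ((1 + ρ ^ α) ^ (-(β / α) - 1) * (1 + (ρ ^ α) ^ (β / α + 1))) := by gcongr
    _ = β / 2 * ρ ^ (α - 2) * (1 + ρ ^ α) ^ (-(β / α) - 1) * ρ ^ 2 * (ρ ^ (-α) + ρ ^ β) := by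
        rw [← e4, ← e3]; ring
    _ ≤ β / 2 * P ^ (α / 2 - 1) * (1 + P ^ (α / 2)) ^ (-(β / α) - 1) * ρ ^ 2 * (ρ ^ (-α) + ρ ^ β) := by
        gcongr
    _ = _ := by ring

namespace IsReduced

variable {Cl S : ℝ} {Ω u : ℝ × ℝ → ℝ}

lemma neg (h : IsReduced Cl S Ω u) : IsReduced Cl S (fun p => -Ω p) (fun p => -u p) where
  Cl_pos := h.Cl_pos
  cont := h.cont.neg
  smooth := h.smooth.neg
  odd := fun x y a b c => by rw [h.odd x y a b c]
  wall := fun x a => by rw [h.wall x a, neg_zero]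
  side := fun x y a b c => by rw [h.side x y a b c, neg_zero]
  axis := fun x a => by rw [h.axis x a, neg_zero]
  pde := fun p a b c => by rw [lap_neg, h.pde p a b c]; ring
  supp := fun p a b => by rw [h.supp p a b, neg_zero]
  odd_source := fun x y a => by rw [h.odd_source x y a]

lemma pot_pos (h : IsReduced Cl S Ω u) {p : ℝ × ℝ} (hp : p.2 < 1 / Cl) : 0 < pot Cl p := by
  have := h.Cl_pos
  have := rad_pos h.Cl_pos hp
  unfold pot; positivity

/-- Comparison in the part of a quarter of the cell outside a disc. -/
theorem le_barrier (h : IsReduced Cl S Ω u) {W : ℝ × ℝ → ℝ} {s : ℝ}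
    (hc : ContinuousOn W {p | p ∈ cell Cl ∧ 0 ≤ p.1 ∧ s ≤ len p})
    (hC2 : ∀ p : ℝ × ℝ, 0 < p.1 → 0 < p.2 → s < len p → ContDiffAt ℝ 2 W p)
    (hW0 : ∀ p : ℝ × ℝ, 0 ≤ p.1 → 0 ≤ p.2 → s ≤ len p → 0 ≤ W p)
    (hs : ∀ p ∈ cell Cl, 0 ≤ p.1 → s = len p → u p ≤ W p)
    (hlap : ∀ p : ℝ × ℝ, 0 < p.1 → 0 < p.2 → s < len p → Ω p ≤ -lap W p) :
    ∀ p ∈ cell Cl, 0 ≤ p.1 → s ≤ len p → u p ≤ W p := by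
  set K : Set (ℝ × ℝ) := {p | p ∈ cell Cl ∧ 0 ≤ p.1 ∧ s ≤ len p} with hKdef
  have hK : IsCompact K := by
    refine IsCompact.of_isClosed_subset (isCompact_Icc (a := ((0 : ℝ), (0 : ℝ)))
      (b := (1 / Cl, 1 / Cl))) ?_ ?_
    · exact ((isClosed_le continuous_fst.abs continuous_const).inter
        ((isClosed_le continuous_const continuous_snd).inter
        (isClosed_le continuous_snd continuous_const))).inter
        ((isClosed_le continuous_const continuous_fst).inter
          (isClosed_le continuous_const continuous_len))
    · rintro p ⟨⟨h1, h2, h3⟩, h4, h5⟩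
      exact ⟨⟨h4, h2⟩, ⟨(le_abs_self _).trans h1, h3⟩⟩
  let U : Set (ℝ × ℝ) := {p | (|p.1| < 1 / Cl ∧ 0 < p.2 ∧ p.2 < 1 / Cl) ∧ 0 < p.1 ∧ s < len p}
  have hU : IsOpen U := (isOpen_innerCell Cl).inter
    ((isOpen_lt continuous_const continuous_fst).inter (isOpen_lt continuous_const continuous_len))
  have hUK : U ⊆ K := fun p hp =>
    ⟨⟨hp.1.1.le, hp.1.2.1.le, hp.1.2.2.le⟩, hp.2.1.le, hp.2.2.le⟩
  have := nonpos_of_lap_pos hK hU hUK (f := fun p => u p - W p)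
    ((h.cont.mono fun p hp => hp.1).sub hc) ?_ ?_
  · intro p hp h1 h2
    have := this p ⟨hp, h1, h2⟩
    linarith
  · rintro p ⟨hp, hp1, hps⟩ hpU
    -- Off the arc |p| = s, u vanishes on the whole boundary: on the sides of the cell by the
    -- boundary condition, on x₁ = 0 by oddness.
    have hu : s = len p ∨ u p = 0 := by
      by_contra! hcon
      refine hpU ⟨⟨?_, ?_, ?_⟩, ?_, lt_of_le_of_ne hps hcon.1⟩
      · refine lt_of_le_of_ne hp.1 fun e => hcon.2 ?_
        exact h.side p.1 p.2 e hp.2.1 hp.2.2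
      · refine lt_of_le_of_ne hp.2.1 fun e => hcon.2 ?_
        have := h.wall p.1 hp.1
        rwa [show (p.1, (0 : ℝ)) = p from Prod.ext rfl e] at this
      · refine lt_of_le_of_ne hp.2.2 fun e => hcon.2 ?_
        have := h.axis p.1 hp.1
        rwa [← e] at this
      · refine lt_of_le_of_ne hp1 fun e => hcon.2 ?_
        have := h.odd p.1 p.2 hp.1 hp.2.1 hp.2.2
        rw [← e, neg_zero] at this
        rw [show p = (0, p.2) from Prod.ext e.symm rfl]
        linarith
    rcases hu with e | e
    · have := hs p hp hp1 e; linarith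
    · have := hW0 p hp1 hp.2.1 hps
      rw [e]; linarith
  · rintro p ⟨⟨h1, h2, h3⟩, h4, h5⟩ hpos
    -- Where u > W ≥ 0 the term Vu is strictly positive, which provides the strict inequality in the
    -- maximum principle.
    rw [lap_sub (contDiffAt_of_lowerCell h.smooth h1 h2 h3) (hC2 p h4 h2 h5), h.pde p h1 h2 h3]
    have e1 := hlap p h4 h2 h5
    have e2 := hW0 p h4.le h2.le h5.le
    have e3 := mul_pos (h.pot_pos h3) (show 0 < u p by linarith)
    linarith

/-- A two-sided bound in half of the cell extends to the other half by oddness. -/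
lemma abs_le_of_symm (h : IsReduced Cl S Ω u) {W : ℝ × ℝ → ℝ} {s : ℝ}
    (h1 : ∀ p ∈ cell Cl, 0 ≤ p.1 → s ≤ len p → u p ≤ W p)
    (h2 : ∀ p ∈ cell Cl, 0 ≤ p.1 → s ≤ len p → -u p ≤ W p) :
    ∀ p ∈ cell Cl, s ≤ len p → |u p| ≤ W (|p.1|, p.2) := by
  intro p hp hs
  rcases le_total 0 p.1 with h0 | h0
  · rw [abs_of_nonneg h0, abs_le]
    have := h1 p hp h0 hs
    have := h2 p hp h0 hs
    constructor <;> linarith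
  · have hp' : (-p.1, p.2) ∈ cell Cl := ⟨by simpa using hp.1, hp.2⟩
    have hs' : s ≤ len (-p.1, p.2) := by rw [len_neg_fst]; exact hs
    have a1 := h1 _ hp' (by simpa using h0) hs'
    have a2 := h2 _ hp' (by simpa using h0) hs'
    rw [h.odd p.1 p.2 hp.1 hp.2.1 hp.2.2] at a1 a2
    rw [abs_of_nonpos h0, abs_le]
    constructor <;> linarith

end IsReduced

/-- `A` bounds the weighted source. -/
def SourceBound (α β A : ℝ) (Ω : ℝ × ℝ → ℝ) : Prop :=
  ∀ p ∈ halfPlane, |Ω p| * (len p ^ (-α) + len p ^ β) ≤ A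

lemma abs_mul_le_sq (p : ℝ × ℝ) : |p.1| * |p.2| ≤ len p ^ 2 := by
  rw [len_sq, ← sq_abs p.1, ← sq_abs p.2]; nlinarith [sq_nonneg (|p.1| - |p.2|), sq_nonneg |p.1|]

/-- Size of the stream function. -/
theorem exists_size_bound {α β : ℝ} (hα : 0 < α) (hα1 : α ≤ 1) (hβ : 0 < β) (hβ1 : β < 1) :
    ∃ C : ℝ, 0 < C ∧ ∀ (Cl S A : ℝ) (Ω u : ℝ × ℝ → ℝ), IsReduced Cl S Ω u → 0 ≤ A →
      SourceBound α β A Ω → ∀ p ∈ cell Cl,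
        |u p| ≤ C * A * len p ^ 2 ∧ |u p| ≤ C * A * len p ^ (2 - β) := by
  set c := β / 2 * 2 ^ (-(β / α) - 1) with hc
  have hc0 : 0 < c := by positivity
  refine ⟨2 / c, by positivity, ?_⟩
  intro Cl S A Ω u h hA hΩ p hp
  -- The constant c is the lower bound of `le_neg_lap_prof`, so that -ΔW dominates the source. The
  -- comparison is made with a disc of radius 0, that is, in the whole half cell.
  set W : ℝ × ℝ → ℝ := fun q => A / c * prof (α / 2) (β / α) (q.1 * q.2) with hW
  have hα2 : 0 < α / 2 := by positivity
  have one_side : ∀ v Ω', IsReduced Cl S Ω' v → SourceBound α β A Ω' →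
      ∀ p ∈ cell Cl, 0 ≤ p.1 → 0 ≤ len p → v p ≤ W p := by
    intro v Ω' hv hΩ'
    refine hv.le_barrier ?_ ?_ ?_ ?_ ?_
    · exact (continuous_const.mul ((continuous_prof hα2).comp
        (continuous_fst.mul continuous_snd))).continuousOn
    · intro p h1 h2 _
      exact contDiffAt_const.mul (contDiffAt_prof_mul hα2 h1 h2)
    · intro p h1 h2 _
      have := prof_nonneg (a := α / 2) (b := β / α) (mul_nonneg h1 h2)
      simp only [hW]; positivity
    · intro p hp h1 h2
      have e : p.2 = 0 := by
        have := abs_snd_le_len p; rw [← h2] at this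
        exact abs_eq_zero.1 (le_antisymm this (abs_nonneg _))
      have hv0 := hv.wall p.1 hp.1
      rw [show (p.1, (0 : ℝ)) = p from Prod.ext rfl e.symm] at hv0
      rw [hv0]
      have := prof_nonneg (a := α / 2) (b := β / α) (mul_nonneg h1 hp.2.1)
      simp only [hW]; positivity
    · intro p h1 h2 _
      rw [hW, lap_const_mul]
      have e1 := le_neg_lap_prof hα hα1 hβ h1 h2
      have hρ := len_pos_of_mem h2
      have hw : 0 < len p ^ (-α) + len p ^ β := by positivity
      have e2 := hΩ' p h2
      refine (le_abs_self _).trans ?_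
      refine le_of_mul_le_mul_right ?_ hw
      calc |Ω' p| * (len p ^ (-α) + len p ^ β) ≤ A := e2
        _ = A / c * c := by field_simp
        _ ≤ A / c * (-lap (fun q : ℝ × ℝ => prof (α / 2) (β / α) (q.1 * q.2)) p
              * (len p ^ (-α) + len p ^ β)) := by gcongr
        _ = _ := by ring
  have hneg : SourceBound α β A (fun p => -Ω p) := fun p hp => by rw [abs_neg]; exact hΩ p hp
  have hub := h.abs_le_of_symm (one_side u Ω h hΩ) (fun p hp h1 h2 => one_side _ _ h.neg hneg p hp h1 h2)
    p hp (len_nonneg p)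
  have hP : 0 ≤ |p.1| * p.2 := mul_nonneg (abs_nonneg _) hp.2.1
  have hPle : |p.1| * p.2 ≤ len p ^ 2 := by
    have := abs_mul_le_sq p; rwa [abs_of_nonneg hp.2.1] at this
  have hb : 0 ≤ β / α := by positivity
  have hab : α / 2 * (β / α) = β / 2 := by field_simp
  have hlen := len_nonneg p
  constructor
  · refine hub.trans ?_
    simp only [hW]
    have := (prof_le_self (b := β / α) hα2 hb hP).trans hPle
    calc A / c * prof (α / 2) (β / α) (|p.1| * p.2) ≤ A / c * len p ^ 2 := by gcongr
      _ ≤ 2 * (A / c * len p ^ 2) := by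
          have : 0 ≤ A / c * len p ^ 2 := by positivity
          linarith
      _ = _ := by ring
  · refine hub.trans ?_
    simp only [hW]
    have h1 := prof_le_rpow (b := β / α) hα2 hb (by rw [hab]; linarith) hP
    rw [hab] at h1
    have h2 : (|p.1| * p.2) ^ (1 - β / 2) ≤ len p ^ (2 - β) := by
      calc (|p.1| * p.2) ^ (1 - β / 2) ≤ (len p ^ 2) ^ (1 - β / 2) :=
            Real.rpow_le_rpow hP hPle (by linarith)
        _ = _ := by rw [← Real.rpow_natCast, ← Real.rpow_mul hlen]; congr 1; push_cast; ring
    -- The factor 2 bounds 1/(1 - β/2), by β < 1.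
    have h3 : prof (α / 2) (β / α) (|p.1| * p.2) ≤ 2 * len p ^ (2 - β) := by
      refine h1.trans ?_
      rw [div_le_iff₀ (by linarith)]
      have : 0 ≤ len p ^ (2 - β) := by positivity
      nlinarith
    calc A / c * prof (α / 2) (β / α) (|p.1| * p.2) ≤ A / c * (2 * len p ^ (2 - β)) := by gcongr
      _ = _ := by ring

/-! ### Decay away from the source -/

/-- The sum of the two harmonic dipoles x/|x|² and y/|x|². Both are needed: since x + y ≥ |x| in the
closed quadrant, the sum is at least 1/|x| up to the axes. -/
lemma dipole_aux {p : ℝ × ℝ} (hp : 0 < p.2) :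
    ContDiffAt ℝ 2 (fun q : ℝ × ℝ => (q.1 + q.2) * (q.1 ^ 2 + q.2 ^ 2)⁻¹) p ∧
      lap (fun q : ℝ × ℝ => (q.1 + q.2) * (q.1 ^ 2 + q.2 ^ 2)⁻¹) p = 0 := by
  have hD : 0 < p.1 ^ 2 + p.2 ^ 2 := by positivity
  have hg : ContDiffAt ℝ 2 (fun q : ℝ × ℝ => (q.1 ^ 2 + q.2 ^ 2)⁻¹) p :=
    ContDiffAt.inv (by fun_prop) hD.ne'
  have hf : ContDiffAt ℝ 2 (fun q : ℝ × ℝ => q.1 + q.2) p := by fun_prop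
  refine ⟨hf.mul hg, ?_⟩
  have f1 : dx (fun q : ℝ × ℝ => q.1 + q.2) = fun _ => 1 := by
    funext q; simp [dx]
  have f2 : dy (fun q : ℝ × ℝ => q.1 + q.2) = fun _ => 1 := by
    funext q; simp [dy]
  have hev : ∀ᶠ q in 𝓝 p, 0 < q.1 ^ 2 + q.2 ^ 2 :=
    (by fun_prop : ContinuousAt (fun q : ℝ × ℝ => q.1 ^ 2 + q.2 ^ 2) p).eventually (lt_mem_nhds hD)
  have g1 : ∀ q : ℝ × ℝ, 0 < q.1 ^ 2 + q.2 ^ 2 → HasDerivAt (fun t => (t ^ 2 + q.2 ^ 2)⁻¹)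
      (-(2 * q.1) / (q.1 ^ 2 + q.2 ^ 2) ^ 2) q.1 := by
    intro q hq
    have := ((hasDerivAt_pow 2 q.1).add_const (q.2 ^ 2)).inv hq.ne'
    exact HasDerivAt.congr_deriv this (by simp)
  have g2 : ∀ q : ℝ × ℝ, 0 < q.1 ^ 2 + q.2 ^ 2 → HasDerivAt (fun t => (q.1 ^ 2 + t ^ 2)⁻¹)
      (-(2 * q.2) / (q.1 ^ 2 + q.2 ^ 2) ^ 2) q.2 := by
    intro q hq
    have := ((hasDerivAt_pow 2 q.2).const_add (q.1 ^ 2)).inv hq.ne'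
    exact HasDerivAt.congr_deriv this (by simp)
  have e1 : dx (fun q : ℝ × ℝ => (q.1 ^ 2 + q.2 ^ 2)⁻¹) =ᶠ[𝓝 p]
      fun q => -(2 * q.1) / (q.1 ^ 2 + q.2 ^ 2) ^ 2 := hev.mono fun q hq => (g1 q hq).deriv
  have e2 : dy (fun q : ℝ × ℝ => (q.1 ^ 2 + q.2 ^ 2)⁻¹) =ᶠ[𝓝 p]
      fun q => -(2 * q.2) / (q.1 ^ 2 + q.2 ^ 2) ^ 2 := hev.mono fun q hq => (g2 q hq).deriv
  have k1 : HasDerivAt (fun t : ℝ => -(2 * t) / (t ^ 2 + p.2 ^ 2) ^ 2)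
      ((-2 * (p.1 ^ 2 + p.2 ^ 2) ^ 2 - -(2 * p.1) * (2 * (p.1 ^ 2 + p.2 ^ 2) * (2 * p.1)))
        / ((p.1 ^ 2 + p.2 ^ 2) ^ 2) ^ 2) p.1 := by
    have a := ((hasDerivAt_id' p.1).const_mul 2).neg
    have b := (((hasDerivAt_pow 2 p.1).add_const (p.2 ^ 2)).pow 2)
    exact HasDerivAt.congr_deriv (a.div b (pow_pos hD 2).ne') (by simp)
  have k2 : HasDerivAt (fun t : ℝ => -(2 * t) / (p.1 ^ 2 + t ^ 2) ^ 2)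
      ((-2 * (p.1 ^ 2 + p.2 ^ 2) ^ 2 - -(2 * p.2) * (2 * (p.1 ^ 2 + p.2 ^ 2) * (2 * p.2)))
        / ((p.1 ^ 2 + p.2 ^ 2) ^ 2) ^ 2) p.2 := by
    have a := ((hasDerivAt_id' p.2).const_mul 2).neg
    have b := (((hasDerivAt_pow 2 p.2).const_add (p.1 ^ 2)).pow 2)
    exact HasDerivAt.congr_deriv (a.div b (pow_pos hD 2).ne') (by simp)
  rw [lap_mul hf hg]
  have l1 : lap (fun q : ℝ × ℝ => q.1 + q.2) p = 0 := by
    unfold lap; rw [f1, f2]; simp [dx, dy]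
  have l2 : lap (fun q : ℝ × ℝ => (q.1 ^ 2 + q.2 ^ 2)⁻¹) p = 4 / (p.1 ^ 2 + p.2 ^ 2) ^ 2 := by
    unfold lap
    rw [dx_congr e1, dy_congr e2]
    rw [show dx (fun q : ℝ × ℝ => -(2 * q.1) / (q.1 ^ 2 + q.2 ^ 2) ^ 2) p = _ from k1.deriv,
      show dy (fun q : ℝ × ℝ => -(2 * q.2) / (q.1 ^ 2 + q.2 ^ 2) ^ 2) p = _ from k2.deriv]
    field_simp
    ring
  rw [l1, l2, f1, f2, e1.self_of_nhds, e2.self_of_nhds]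
  field_simp
  ring

/-- Beyond |x| = S there is no source, so the dipole is a barrier there. Its coefficient S^{3-β} is
fixed by matching the size bound S^{2-β} on the arc |x| = S. -/
theorem exists_far_bound {α β : ℝ} (hα : 0 < α) (hα1 : α ≤ 1) (hβ : 0 < β) (hβ1 : β < 1) :
    ∃ C : ℝ, 0 < C ∧ ∀ (Cl S A : ℝ) (Ω u : ℝ × ℝ → ℝ), IsReduced Cl S Ω u → 0 ≤ A → 0 < S →
      SourceBound α β A Ω → ∀ p ∈ cell Cl, S ≤ len p → |u p| ≤ C * A * S ^ (3 - β) / len p := by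
  obtain ⟨C, hC, hsize⟩ := exists_size_bound hα hα1 hβ hβ1
  refine ⟨2 * C, by positivity, ?_⟩
  intro Cl S A Ω u h hA hS hΩ p hp hpS
  set D := C * A * S ^ (3 - β) with hD
  have hD0 : 0 ≤ D := by positivity
  set W : ℝ × ℝ → ℝ := fun q => D * ((q.1 + q.2) * (q.1 ^ 2 + q.2 ^ 2)⁻¹) with hW
  have hW0 : ∀ p : ℝ × ℝ, 0 ≤ p.1 → 0 ≤ p.2 → 0 ≤ W p := by
    intro p h1 h2; simp only [hW]; positivity
  have one_side : ∀ v Ω', IsReduced Cl S Ω' v → SourceBound α β A Ω' →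
      ∀ p ∈ cell Cl, 0 ≤ p.1 → S ≤ len p → v p ≤ W p := by
    intro v Ω' hv hΩ'
    refine hv.le_barrier ?_ ?_ ?_ ?_ ?_
    · refine continuousOn_const.mul (ContinuousOn.mul (by fun_prop) (ContinuousOn.inv₀ (by fun_prop) ?_))
      rintro q ⟨-, -, hq⟩
      rw [← len_sq]
      have := hS.trans_le hq
      positivity
    · intro p h1 h2 _
      exact contDiffAt_const.mul (dipole_aux h2).1
    · intro p h1 h2 _
      exact hW0 p h1 h2
    · intro p hp h1 h2
      refine (le_abs_self _).trans (((hsize Cl S A Ω' v hv hA hΩ' p hp).2).trans ?_)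
      have hle := len_le_add p
      rw [abs_of_nonneg h1, abs_of_nonneg hp.2.1] at hle
      simp only [hW, hD]
      rw [← len_sq, ← h2] at *
      calc C * A * S ^ (2 - β) = C * A * S ^ (3 - β) * (S * (S ^ 2)⁻¹) := by
            rw [show 3 - β = (2 - β) + 1 by ring, Real.rpow_add_one hS.ne']; field_simp
        _ ≤ _ := by gcongr
    · intro p h1 h2 h3
      rw [hv.supp p h2 h3, hW, lap_const_mul, (dipole_aux h2).2]; simp
  have hneg : SourceBound α β A (fun p => -Ω p) := fun p hp => by rw [abs_neg]; exact hΩ p hp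
  have hub := h.abs_le_of_symm (one_side u Ω h hΩ) (fun p hp h1 h2 => one_side _ _ h.neg hneg p hp h1 h2)
    p hp hpS
  refine hub.trans ?_
  simp only [hW]
  have hl := hS.trans_le hpS
  have h1 := abs_fst_le_len p
  have h2 := (le_abs_self _).trans (abs_snd_le_len p)
  rw [sq_abs, ← len_sq]
  calc D * ((|p.1| + p.2) * (len p ^ 2)⁻¹) ≤ D * ((len p + len p) * (len p ^ 2)⁻¹) := by gcongr
    _ = 2 * C * A * S ^ (3 - β) / len p := by rw [hD]; field_simp; ring

/-! ### Gradient and Hessian bounds at the scale of the distance to the origin -/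

lemma len_of_mem_upperBox {p q : ℝ × ℝ} {t : ℝ} (h : q ∈ upperBox p t) :
    len p - 2 * t ≤ len q ∧ len q ≤ len p + 2 * t := by
  have h1 : len (q - p) ≤ 2 * t := (len_le_add _).trans (by
    have := h.1; have := h.2.1; simp only [Prod.fst_sub, Prod.snd_sub]; linarith)
  have h2 : len (p - q) ≤ 2 * t := (len_le_add _).trans (by
    have := h.1; have := h.2.1
    simp only [Prod.fst_sub, Prod.snd_sub]
    rw [abs_sub_comm p.1, abs_sub_comm p.2]; linarith)
  have e1 := len_triangle p (q - p)
  have e2 := len_triangle q (p - q)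
  rw [add_sub_cancel] at e1 e2
  constructor <;> linarith

lemma rpow_abs_le_max {a b ρ s : ℝ} (ha : 0 < a) (hab : a ≤ ρ) (hρb : ρ ≤ b) :
    ρ ^ s ≤ max (a ^ s) (b ^ s) := by
  rcases le_total 0 s with h | h
  · exact (Real.rpow_le_rpow (ha.le.trans hab) hρb h).trans (le_max_right _ _)
  · exact (Real.rpow_le_rpow_of_nonpos ha hab h).trans (le_max_left _ _)

/-- Powers with exponents in `[-2, 2]` at comparable points are comparable. -/
lemma rpow_le_four_mul {ρ ρ' s : ℝ} (hρ : 0 < ρ) (h1 : ρ / 2 ≤ ρ') (h2 : ρ' ≤ 2 * ρ) (hs : |s| ≤ 2) :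
    ρ' ^ s ≤ 4 * ρ ^ s := by
  have hs' := abs_le.1 hs
  have h4 : (2 : ℝ) ^ (2 : ℝ) = 4 := by norm_num
  refine (rpow_abs_le_max (by positivity) h1 h2).trans (max_le ?_ ?_)
  · rw [Real.div_rpow hρ.le (by norm_num), div_eq_mul_inv, ← Real.rpow_neg (by norm_num), mul_comm]
    have : (2 : ℝ) ^ (-s) ≤ 2 ^ (2 : ℝ) := Real.rpow_le_rpow_of_exponent_le (by norm_num) (by linarith)
    rw [h4] at this
    gcongr
  · rw [Real.mul_rpow (by norm_num) hρ.le]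
    have : (2 : ℝ) ^ s ≤ 2 ^ (2 : ℝ) := Real.rpow_le_rpow_of_exponent_le (by norm_num) (by linarith)
    rw [h4] at this
    gcongr

lemma pot_le {Cl : ℝ} (hCl : 0 < Cl) {p : ℝ × ℝ} (hp : p.2 ≤ 1 / (4 * Cl)) : pot Cl p ≤ 2 * Cl ^ 2 := by
  have h : 3 / 4 ≤ rad Cl p := by
    unfold rad
    rw [le_div_iff₀ (by positivity)] at hp
    linarith
  unfold pot
  rw [div_le_iff₀ (by positivity)]
  have : (3 / 4 : ℝ) ^ 2 ≤ rad Cl p ^ 2 := by gcongr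
  nlinarith [sq_nonneg Cl]

lemma abs_pot {Cl : ℝ} (p : ℝ × ℝ) : |pot Cl p| = pot Cl p := by
  apply abs_of_nonneg; unfold pot; positivity

namespace SourceBound

variable {α β A : ℝ} {Ω : ℝ × ℝ → ℝ}

lemma abs_le_rpow (h : SourceBound α β A Ω) {p : ℝ × ℝ} (hp : p ∈ halfPlane) :
    |Ω p| ≤ A * len p ^ (-β) := by
  have hρ := len_pos_of_mem hp
  have h1 := h p hp
  rw [Real.rpow_neg hρ.le β, ← div_eq_mul_inv, le_div_iff₀ (by positivity)]
  refine le_trans ?_ h1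
  have : 0 < len p ^ (-α) := by positivity
  gcongr; linarith

lemma abs_le_rpow' (h : SourceBound α β A Ω) {p : ℝ × ℝ} (hp : p ∈ halfPlane) :
    |Ω p| ≤ A * len p ^ α := by
  have hρ := len_pos_of_mem hp
  have h1 := h p hp
  rw [← neg_neg α, Real.rpow_neg hρ.le (-α), ← div_eq_mul_inv, le_div_iff₀ (by positivity)]
  refine le_trans ?_ h1
  have : 0 < len p ^ β := by positivity
  gcongr; linarith

lemma abs_le (h : SourceBound α β A Ω) (hα : 0 < α) (hβ : 0 < β) (hA : 0 ≤ A) {p : ℝ × ℝ}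
    (hp : p ∈ halfPlane) : |Ω p| ≤ A := by
  have hρ := len_pos_of_mem hp
  rcases le_total (len p) 1 with h1 | h1
  · exact (h.abs_le_rpow' hp).trans (mul_le_of_le_one_right hA (Real.rpow_le_one hρ.le h1 hα.le))
  · exact (h.abs_le_rpow hp).trans (mul_le_of_le_one_right hA
      (Real.rpow_le_one_of_one_le_of_nonpos h1 (by linarith)))

/-- For |x| ≤ 1 lowering the exponent α lowers the weight; for |x| ≥ 1 the negative powers are at
most 1 ≤ |x|^β, which costs the factor 2. This reduces arbitrary α > 0 to α ≤ 1, the range of the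
barrier. -/
lemma mono_exp (h : SourceBound α β A Ω) {α' : ℝ} (hβ : 0 < β) (h0 : 0 < α') (hα : α' ≤ α) :
    SourceBound α' β (2 * A) Ω := by
  intro p hp
  have hρ := len_pos_of_mem hp
  have h1 := h p hp
  rcases le_total (len p) 1 with h2 | h2
  · have : len p ^ (-α') ≤ len p ^ (-α) := Real.rpow_le_rpow_of_exponent_ge hρ h2 (by linarith)
    have : 0 ≤ |Ω p| * (len p ^ (-α) + len p ^ β) := by positivity
    calc |Ω p| * (len p ^ (-α') + len p ^ β) ≤ |Ω p| * (len p ^ (-α) + len p ^ β) := by gcongr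
      _ ≤ 2 * A := by linarith
  · have e1 : len p ^ (-α') ≤ 1 := Real.rpow_le_one_of_one_le_of_nonpos h2 (by linarith)
    have e2 : 1 ≤ len p ^ β := Real.one_le_rpow h2 hβ.le
    have e3 : 0 ≤ len p ^ (-α) := by positivity
    calc |Ω p| * (len p ^ (-α') + len p ^ β) ≤ |Ω p| * (2 * (len p ^ (-α) + len p ^ β)) := by
          gcongr; linarith
      _ ≤ 2 * A := by linarith

end SourceBound

namespace IsReduced

variable {Cl S : ℝ} {Ω u : ℝ × ℝ → ℝ}

lemma contDiffAt (h : IsReduced Cl S Ω u) {p : ℝ × ℝ} (hp : 0 < p.2) (hl : len p < 1 / Cl) :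
    ContDiffAt ℝ 2 u p :=
  contDiffAt_of_lowerCell h.smooth ((abs_fst_le_len p).trans_lt hl) hp
    ((le_abs_self _).trans_lt ((abs_snd_le_len p).trans_lt hl))

lemma lap_eq (h : IsReduced Cl S Ω u) {p : ℝ × ℝ} (hp : 0 < p.2) (hl : len p < 1 / Cl) :
    lap u p = pot Cl p * u p - Ω p :=
  h.pde p ((abs_fst_le_len p).trans_lt hl) hp
    ((le_abs_self _).trans_lt ((abs_snd_le_len p).trans_lt hl))

lemma mem_cell {p : ℝ × ℝ} (hp : 0 ≤ p.2) (hl : len p ≤ 1 / Cl) : p ∈ cell Cl :=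
  ⟨(abs_fst_le_len p).trans hl, hp, (le_abs_self _).trans ((abs_snd_le_len p).trans hl)⟩

lemma wall' (h : IsReduced Cl S Ω u) {p : ℝ × ℝ} (hp : p.2 = 0) (hl : len p ≤ 1 / Cl) : u p = 0 := by
  have := h.wall p.1 ((abs_fst_le_len p).trans hl)
  rwa [show (p.1, (0 : ℝ)) = p from Prod.ext rfl hp.symm] at this

lemma inv_four_lt (h : IsReduced Cl S Ω u) : 1 / (4 * Cl) < 1 / Cl := by
  have := h.Cl_pos
  rw [div_lt_div_iff₀ (by positivity) this]; linarith

/-- The gradient estimate on the scale of the distance to the origin. -/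
theorem gradBound_scale (h : IsReduced Cl S Ω u) {p : ℝ × ℝ} (hp : p ∈ halfPlane)
    (hl : len p ≤ 1 / (8 * Cl)) {M K : ℝ}
    (hM : ∀ q ∈ closedHalfPlane, len p / 2 ≤ len q → len q ≤ 2 * len p → |u q| ≤ M)
    (hK : ∀ q ∈ halfPlane, len p / 2 ≤ len q → len q ≤ 2 * len p → |Ω q| ≤ K) :
    GradBound u p M (65 * M / len p + K * len p) := by
  have hCl := h.Cl_pos
  have hρ : 0 < len p := len_pos_of_mem hp
  have hbox : ∀ q ∈ upperBox p (2 * (len p / 8)), len p / 2 ≤ len q ∧ len q ≤ 2 * len p := by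
    intro q hq
    obtain ⟨h1, h2⟩ := len_of_mem_upperBox hq
    constructor <;> linarith
  have hle4 : 2 * len p ≤ 1 / (4 * Cl) := by
    rw [le_div_iff₀ (by positivity)] at hl ⊢; linarith
  have hlt := h.inv_four_lt
  have hM0 : 0 ≤ M := (abs_nonneg _).trans (hM p (show 0 ≤ p.2 from le_of_lt hp) (by linarith) (by linarith))
  have hK0 : 0 ≤ K := (abs_nonneg _).trans (hK p hp (by linarith) (by linarith))
  -- A box of half side |p|/4 changes the length by at most |p|/2, so it stays in the shell |p|/2 ≤
  -- |q| ≤ 2|p|.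
  have := gradBound_of_box (u := u) (p₀ := p) (d := len p / 8) (M := M) (K := 2 * Cl ^ 2 * M + K)
    (by positivity) hp
    (h.cont.mono fun q hq => mem_cell hq.2.2 ((hbox q hq).2.trans (hle4.trans hlt.le)))
    (fun q hq hq2 => h.contDiffAt hq2 ((hbox q hq).2.trans_lt (hle4.trans_lt hlt)))
    (fun q hq hq2 => h.wall' hq2 ((hbox q hq).2.trans (hle4.trans hlt.le)))
    (fun q hq => hM q hq.2.2 (hbox q hq).1 (hbox q hq).2)
    (fun q hq hq2 => by
      rw [h.lap_eq hq2 ((hbox q hq).2.trans_lt (hle4.trans_lt hlt))]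
      refine (abs_sub _ _).trans (add_le_add ?_ (hK q hq2 (hbox q hq).1 (hbox q hq).2))
      rw [abs_mul, abs_pot]
      have hpot := pot_le hCl (p := q) ((le_abs_self _).trans ((abs_snd_le_len q).trans
        ((hbox q hq).2.trans hle4)))
      exact mul_le_mul hpot (hM q hq.2.2 (hbox q hq).1 (hbox q hq).2) (abs_nonneg _) (by positivity))
  refine this.mono le_rfl ?_
  have e1 : 8 * M / (len p / 8) = 64 * (M / len p) := by field_simp; ring
  have e2 : 65 * M / len p = 65 * (M / len p) := by ring
  -- The lower order term is absorbed because C_l|p| ≤ 1/8.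
  have e3 : 2 * Cl ^ 2 * M * len p ≤ M / len p := by
    rw [le_div_iff₀ hρ]
    rw [le_div_iff₀ (by positivity)] at hl
    have h1 : 0 ≤ len p * Cl := by positivity
    have h2 : (len p * Cl) ^ 2 ≤ 1 / 2 := by nlinarith
    nlinarith
  have e4 : 0 ≤ K * len p := by positivity
  have e5 : 0 ≤ M / len p := by positivity
  rw [e1, e2]
  linarith

end IsReduced

/-- Gradient bounds near the origin and at intermediate distances. -/
theorem exists_grad_bound {α β : ℝ} (hα : 0 < α) (hα1 : α ≤ 1) (hβ : 0 < β) (hβ1 : β < 1) :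
    ∃ C : ℝ, 0 < C ∧ ∀ (Cl S A : ℝ) (Ω u : ℝ × ℝ → ℝ), IsReduced Cl S Ω u → 0 ≤ A →
      SourceBound α β A Ω → ∀ p ∈ halfPlane, len p ≤ 1 / (8 * Cl) →
        GradBound u p (C * A * len p ^ 2) (C * A * len p) ∧
        GradBound u p (C * A * len p ^ (2 - β)) (C * A * len p ^ (1 - β)) := by
  obtain ⟨C, hC, hsize⟩ := exists_size_bound hα hα1 hβ hβ1
  refine ⟨260 * C + 4, by positivity, ?_⟩
  intro Cl S A Ω u h hA hΩ p hp hl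
  have hCl := h.Cl_pos
  have hρ : 0 < len p := len_pos_of_mem hp
  have hle1 : 2 * len p ≤ 1 / Cl := by
    have : 2 * len p ≤ 1 / (4 * Cl) := by
      rw [le_div_iff₀ (by positivity)] at hl ⊢; linarith
    exact this.trans h.inv_four_lt.le
  constructor
  · have := h.gradBound_scale hp hl (M := 4 * (C * A * len p ^ 2)) (K := A)
      (fun q hq h1 h2 => by
        refine ((hsize Cl S A Ω u h hA hΩ q (IsReduced.mem_cell hq (h2.trans hle1))).1).trans ?_
        calc C * A * len q ^ 2 ≤ C * A * (2 * len p) ^ 2 := by gcongr; exact len_nonneg q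
          _ = _ := by ring)
      (fun q hq _ _ => hΩ.abs_le hα hβ hA hq)
    refine this.mono ?_ ?_
    · have : 0 ≤ A * len p ^ 2 := by positivity
      nlinarith
    · have e : 65 * (4 * (C * A * len p ^ 2)) / len p = 260 * C * A * len p := by field_simp; ring
      rw [e]
      have : 0 ≤ A * len p := by positivity
      nlinarith
  · have := h.gradBound_scale hp hl (M := 4 * (C * A * len p ^ (2 - β))) (K := 4 * (A * len p ^ (-β)))
      (fun q hq h1 h2 => by
        refine ((hsize Cl S A Ω u h hA hΩ q (IsReduced.mem_cell hq (h2.trans hle1))).2).trans ?_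
        have := rpow_le_four_mul (s := 2 - β) hρ h1 h2 (by rw [abs_le]; constructor <;> linarith)
        calc C * A * len q ^ (2 - β) ≤ C * A * (4 * len p ^ (2 - β)) := by gcongr
          _ = _ := by ring)
      (fun q hq h1 h2 => by
        refine (hΩ.abs_le_rpow hq).trans ?_
        have := rpow_le_four_mul (s := -β) hρ h1 h2 (by rw [abs_le]; constructor <;> linarith)
        calc A * len q ^ (-β) ≤ A * (4 * len p ^ (-β)) := by gcongr
          _ = _ := by ring)
    refine this.mono ?_ ?_
    · have : 0 ≤ A * len p ^ (2 - β) := by positivity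
      nlinarith
    · have e0 : len p ^ (2 - β) = len p ^ (1 - β) * len p := by
        rw [← Real.rpow_add_one hρ.ne']; ring_nf
      have e1 : len p ^ (1 - β) = len p ^ (-β) * len p := by
        rw [← Real.rpow_add_one hρ.ne']; ring_nf
      have e : 65 * (4 * (C * A * len p ^ (2 - β))) / len p = 260 * C * A * len p ^ (1 - β) := by
        rw [e0]; field_simp; ring
      rw [e, mul_assoc 4, mul_assoc A, ← e1]
      nlinarith

/-- For |p| ≥ 8S the shell |q| ≥ |p|/2 lies beyond the source, so the box estimate has no source
contribution and inherits the dipole decay. -/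
theorem exists_far_grad_bound {α β : ℝ} (hα : 0 < α) (hα1 : α ≤ 1) (hβ : 0 < β) (hβ1 : β < 1) :
    ∃ C : ℝ, 0 < C ∧ ∀ (Cl S A : ℝ) (Ω u : ℝ × ℝ → ℝ), IsReduced Cl S Ω u → 0 ≤ A → 0 < S →
      SourceBound α β A Ω → ∀ p ∈ halfPlane, 8 * S ≤ len p → len p ≤ 1 / (8 * Cl) →
        GradBound u p (C * A * S ^ (3 - β) / len p) (C * A * S ^ (3 - β) / len p ^ 2) := by
  obtain ⟨C, hC, hfar⟩ := exists_far_bound hα hα1 hβ hβ1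
  refine ⟨130 * C, by positivity, ?_⟩
  intro Cl S A Ω u h hA hS hΩ p hp hpS hl
  have hCl := h.Cl_pos
  have hρ : 0 < len p := len_pos_of_mem hp
  have hle1 : 2 * len p ≤ 1 / Cl := by
    have : 2 * len p ≤ 1 / (4 * Cl) := by
      rw [le_div_iff₀ (by positivity)] at hl ⊢; linarith
    exact this.trans h.inv_four_lt.le
  have := h.gradBound_scale hp hl (M := 2 * (C * A * S ^ (3 - β) / len p)) (K := 0)
    (fun q hq h1 h2 => by
      refine (hfar Cl S A Ω u h hA hS hΩ q (IsReduced.mem_cell hq (h2.trans hle1)) (by linarith)).trans ?_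
      calc C * A * S ^ (3 - β) / len q ≤ C * A * S ^ (3 - β) / (len p / 2) := by gcongr
        _ = _ := by field_simp)
    (fun q hq h1 _ => by rw [h.supp q hq (by linarith)]; simp)
  refine this.mono ?_ (le_of_eq ?_)
  · have : 0 ≤ C * A * S ^ (3 - β) / len p := by positivity
    calc _ ≤ 130 * (C * A * S ^ (3 - β) / len p) := by linarith
      _ = _ := by ring
  · field_simp; ring

/-- All second derivatives of `f` at `p` are at most `b`. -/
structure HessBound (f : ℝ × ℝ → ℝ) (p : ℝ × ℝ) (b : ℝ) : Prop where
  xx : |dx (dx f) p| ≤ b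
  xy : |dx (dy f) p| ≤ b
  yx : |dy (dx f) p| ≤ b
  yy : |dy (dy f) p| ≤ b

lemma HessBound.mono {f : ℝ × ℝ → ℝ} {p : ℝ × ℝ} {b b' : ℝ} (h : HessBound f p b) (hb : b ≤ b') :
    HessBound f p b' := ⟨h.xx.trans hb, h.xy.trans hb, h.yx.trans hb, h.yy.trans hb⟩

lemma HessBound.norm_hess_le {f : ℝ × ℝ → ℝ} {p : ℝ × ℝ} {b : ℝ} (h : HessBound f p b) :
    ‖hess f p‖ ≤ 2 * b := ElliEst.norm_hess_le h.xx h.xy h.yx h.yy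

/-- On scales comparable with the cell, away from the source, all derivatives are controlled. -/
theorem exists_hess_bound {α β : ℝ} (hα : 0 < α) (hα1 : α ≤ 1) (hβ : 0 < β) (hβ1 : β < 1) :
    ∃ C : ℝ, 0 < C ∧ ∀ (Cl S A : ℝ) (Ω u : ℝ × ℝ → ℝ), IsReduced Cl S Ω u → 0 ≤ A →
      SourceBound α β A Ω → ∀ p ∈ halfPlane, 4 * S ≤ len p → len p ≤ 1 / (16 * Cl) →
        HessBound u p (C * A * len p ^ (-β)) := by
  obtain ⟨C, hC, hgrad⟩ := exists_grad_bound hα hα1 hβ hβ1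
  refine ⟨520 * C, by positivity, ?_⟩
  intro Cl S A Ω u h hA hΩ p hp hpS hl
  have hCl := h.Cl_pos
  have hρ : 0 < len p := len_pos_of_mem hp
  have hle8 : 2 * len p ≤ 1 / (8 * Cl) := by
    rw [le_div_iff₀ (by positivity)] at hl ⊢; linarith
  have hle4 : 2 * len p ≤ 1 / (4 * Cl) := by
    rw [le_div_iff₀ (by positivity)] at hl ⊢; linarith
  have hlt := h.inv_four_lt
  have hbox : ∀ q ∈ upperBox p (3 * (len p / 16)), len p / 2 ≤ len q ∧ len q ≤ 2 * len p := by
    intro q hq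
    obtain ⟨h1, h2⟩ := len_of_mem_upperBox hq
    constructor <;> linarith
  have e1 : len p ^ (1 - β) = len p ^ (-β) * len p := by
    rw [← Real.rpow_add_one hρ.ne']; ring_nf
  have e2 : len p ^ (2 - β) = len p ^ (-β) * len p ^ 2 := by
    rw [← Real.rpow_natCast, ← Real.rpow_add hρ]; congr 1; push_cast; ring
  set M := 4 * (C * A * len p ^ (1 - β)) with hMdef
  have hM0 : 0 ≤ M := by positivity
  have hg : ∀ q ∈ upperBox p (3 * (len p / 16)), 0 < q.2 → |dx u q| ≤ M := by
    intro q hq hq2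
    have hb := hbox q hq
    refine ((hgrad Cl S A Ω u h hA hΩ q hq2 (hb.2.trans hle8)).2.dx_le).trans ?_
    have := rpow_le_four_mul (s := 1 - β) hρ hb.1 hb.2 (by rw [abs_le]; constructor <;> linarith)
    calc C * A * len q ^ (1 - β) ≤ C * A * (4 * len p ^ (1 - β)) := by gcongr
      _ = _ := by rw [hMdef]; ring
  have hcd : ∀ q ∈ upperBox p (3 * (len p / 16)), 0 < q.2 → ContDiffAt ℝ 2 u q := fun q hq hq2 =>
    h.contDiffAt hq2 ((hbox q hq).2.trans_lt (hle4.trans_lt hlt))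
  have hlap : ∀ q ∈ upperBox p (3 * (len p / 16)), 0 < q.2 → lap u q = pot Cl q * u q := by
    intro q hq hq2
    have hb := hbox q hq
    rcases lt_or_ge 0 S with hS | hS
    · rw [h.lap_eq hq2 (hb.2.trans_lt (hle4.trans_lt hlt)), h.supp q hq2 (by linarith), sub_zero]
    · rw [h.lap_eq hq2 (hb.2.trans_lt (hle4.trans_lt hlt)),
        h.supp q hq2 (lt_of_le_of_lt hS (len_pos_of_mem hq2)), sub_zero]
  have hpot : ∀ q ∈ upperBox p (3 * (len p / 16)), pot Cl q ≤ 2 * Cl ^ 2 := fun q hq =>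
    pot_le hCl (p := q) ((le_abs_self _).trans ((abs_snd_le_len q).trans ((hbox q hq).2.trans hle4)))
  -- The box avoids the source, so Δu = Vu in it. As V depends on y only, horizontal differences of
  -- the right-hand side cost only sup V · sup|u_x| per unit length.
  have key := abs_dx_dx_le_of_box (u := u) (p₀ := p) (d := len p / 16) (M := M) (K := 2 * Cl ^ 2 * M)
    (by positivity) hp
    (h.cont.mono fun q hq => IsReduced.mem_cell hq.2.2 ((hbox q hq).2.trans (hle4.trans hlt.le)))
    hcd
    (fun q hq hq2 => h.wall' hq2 ((hbox q hq).2.trans (hle4.trans hlt.le)))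
    hg
    (fun q hq t hqt hq2 ht => by
      rw [hlap q hq hq2, hlap _ hqt hq2]
      have ep : pot Cl (q.1 + t, q.2) = pot Cl q := rfl
      rw [ep, ← mul_sub, abs_mul, abs_pot, mul_assoc]
      refine mul_le_mul (hpot q hq) ?_ (abs_nonneg _) (by positivity)
      have hseg : ∀ x ∈ Set.uIcc q.1 (q.1 + t), (x, q.2) ∈ upperBox p (3 * (len p / 16)) := by
        intro x hx
        rw [Set.uIcc_of_le (by linarith)] at hx
        refine ⟨?_, hq.2.1, hq.2.2⟩
        have a1 := abs_le.1 hq.1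
        have a2 := abs_le.1 hqt.1
        have := hx.1; have := hx.2
        simp only at a2 ⊢
        rw [abs_le]; constructor <;> linarith
      have := abs_sub_le_of_dx_bound (u := u) (x₁ := q.1) (x₂ := q.1 + t) (y := q.2) (M := M)
        (fun x hx => (hcd _ (hseg x hx) hq2).differentiableAt (by simp))
        (fun x hx => hg _ (hseg x hx) hq2)
      rwa [add_sub_cancel_left, abs_of_pos ht] at this)
  have hClρ : (len p * Cl) ^ 2 ≤ 1 / 2 := by
    rw [le_div_iff₀ (by positivity)] at hl
    have h1 : 0 ≤ len p * Cl := by positivity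
    nlinarith
  have hB : 0 ≤ C * A * len p ^ (-β) := by positivity
  have hfin : 8 * M / (len p / 16) + 3 * (2 * Cl ^ 2 * M) * (len p / 16) ≤ 516 * (C * A * len p ^ (-β)) := by
    rw [hMdef, e1]
    have : 8 * (4 * (C * A * (len p ^ (-β) * len p))) / (len p / 16) = 512 * (C * A * len p ^ (-β)) := by
      field_simp; ring
    rw [this]
    have : 3 * (2 * Cl ^ 2 * (4 * (C * A * (len p ^ (-β) * len p)))) * (len p / 16)
        = 3 / 2 * (C * A * len p ^ (-β)) * (len p * Cl) ^ 2 := by ring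
    rw [this]
    nlinarith
  have hmem : p ∈ upperBox p (3 * (len p / 16)) := ⟨by simp; positivity, by simp; positivity, le_of_lt hp⟩
  have hlapb : |lap u p| ≤ 2 * (C * A * len p ^ (-β)) := by
    rw [hlap p hmem hp, abs_mul, abs_pot]
    have h1 := (hgrad Cl S A Ω u h hA hΩ p hp (by linarith)).2.val
    rw [e2] at h1
    calc pot Cl p * |u p| ≤ 2 * Cl ^ 2 * (C * A * (len p ^ (-β) * len p ^ 2)) :=
          mul_le_mul (hpot p hmem) h1 (abs_nonneg _) (by positivity)
      _ = 2 * (C * A * len p ^ (-β)) * (len p * Cl) ^ 2 := by ring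
      _ ≤ _ := by nlinarith
  have hfe : 520 * C * A * len p ^ (-β) = 520 * (C * A * len p ^ (-β)) := by ring
  rw [hfe]
  have kxx := key.1.trans hfin
  have kxy := key.2.trans hfin
  refine ⟨by linarith, by linarith, ?_, ?_⟩
  · rw [← dx_dy_comm (hcd p hmem hp)]; linarith
  -- The one second derivative not seen by horizontal differences comes from the equation.
  · have e : dy (dy u) p = lap u p - dx (dx u) p := by unfold lap; ring
    rw [e]
    refine (abs_sub _ _).trans ?_
    linarith

/-! ### Integrability of the Newtonian kernels -/

lemma integrableOn_abs_rpow_neg_half (L : ℝ) (hL : 0 < L) (a : ℝ) :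
    IntegrableOn (fun t : ℝ => |a - t| ^ (-(1 / 2) : ℝ)) (Icc (a - L) (a + L)) ∧
      ∫ t in Icc (a - L) (a + L), |a - t| ^ (-(1 / 2) : ℝ) = 4 * Real.sqrt L := by
  have h0 : IntervalIntegrable (fun t : ℝ => |t| ^ (-(1 / 2) : ℝ)) volume 0 L :=
    (intervalIntegral.intervalIntegrable_rpow' (a := 0) (b := L) (r := -(1 / 2)) (by norm_num)).congr
      (by
        intro t ht
        rw [uIoc_of_le hL.le] at ht
        simp only
        rw [abs_of_pos ht.1])
  have h1 : IntervalIntegrable (fun t : ℝ => |t| ^ (-(1 / 2) : ℝ)) volume (-L) 0 := by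
    have := (IntervalIntegrable.iff_comp_neg (f := fun t : ℝ => |t| ^ (-(1 / 2) : ℝ)) (a := 0)
      (b := L)).1 h0
    simpa using this.symm
  have h2 := h1.trans h0
  have i0 : ∫ t in (0 : ℝ)..L, |t| ^ (-(1 / 2) : ℝ) = 2 * Real.sqrt L := by
    have : ∫ t in (0 : ℝ)..L, |t| ^ (-(1 / 2) : ℝ) = ∫ t in (0 : ℝ)..L, t ^ (-(1 / 2) : ℝ) := by
      refine intervalIntegral.integral_congr fun t ht => ?_
      rw [uIcc_of_le hL.le] at ht
      rw [abs_of_nonneg ht.1]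
    rw [this, integral_rpow (Or.inl (by norm_num)), Real.zero_rpow (by norm_num), Real.sqrt_eq_rpow]
    norm_num
    ring
  have i1 : ∫ t in (-L)..0, |t| ^ (-(1 / 2) : ℝ) = 2 * Real.sqrt L := by
    have : ∫ t in (0 : ℝ)..L, |(-t)| ^ (-(1 / 2) : ℝ) = ∫ t in (-L)..(-0), |t| ^ (-(1 / 2) : ℝ) :=
      intervalIntegral.integral_comp_neg (fun t : ℝ => |t| ^ (-(1 / 2) : ℝ))
    simp only [abs_neg, neg_zero] at this
    rw [← this, i0]
  have i2 := intervalIntegral.integral_add_adjacent_intervals h1 h0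
  rw [i0, i1] at i2
  have h3 := h2.comp_sub_left a
  have i3 := intervalIntegral.integral_comp_sub_left (fun t : ℝ => |t| ^ (-(1 / 2) : ℝ)) (a := a - L)
    (b := a + L) a
  rw [show a - (a + L) = -L by ring, show a - (a - L) = L by ring, ← i2] at i3
  constructor
  · have h4 : IntervalIntegrable (fun t : ℝ => |a - t| ^ (-(1 / 2) : ℝ)) volume (a - L) (a + L) := by
      have := h3.symm
      rwa [sub_neg_eq_add] at this
    rwa [intervalIntegrable_iff_integrableOn_Icc_of_le (by linarith)] at h4
  · rw [integral_Icc_eq_integral_Ioc, ← intervalIntegral.integral_of_le (by linarith), i3]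
    ring

/-- Uniform integrability of `|a - t|^{-1/2}` over intervals of length `2L`. -/
lemma integral_abs_rpow_neg_half_le (L : ℝ) (hL : 0 < L) (a c : ℝ) :
    IntegrableOn (fun t : ℝ => |a - t| ^ (-(1 / 2) : ℝ)) (Icc (c - L) (c + L)) ∧
      ∫ t in Icc (c - L) (c + L), |a - t| ^ (-(1 / 2) : ℝ) ≤ 6 * Real.sqrt L := by
  obtain ⟨hi, he⟩ := integrableOn_abs_rpow_neg_half L hL a
  set f : ℝ → ℝ := fun t => |a - t| ^ (-(1 / 2) : ℝ) with hf
  -- At distance more than L from the pole the integrand is at most L^{-1/2}. This contributes 2√L,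
  -- and the interval around the pole at most 4√L, wherever the pole lies.
  set g : ℝ → ℝ := fun t => L ^ (-(1 / 2) : ℝ) + (Icc (a - L) (a + L)).indicator f t with hg
  have hf0 : ∀ t, 0 ≤ f t := fun t => by positivity
  have hind : Integrable ((Icc (a - L) (a + L)).indicator f) volume :=
    (integrable_indicator_iff measurableSet_Icc).2 hi
  have hgi : IntegrableOn g (Icc (c - L) (c + L)) :=
    (integrableOn_const (by simp)).add hind.integrableOn
  have hle : ∀ t, f t ≤ g t := by
    intro t
    by_cases ht : t ∈ Icc (a - L) (a + L)
    · simp only [hg, indicator_of_mem ht]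
      have : 0 < L ^ (-(1 / 2) : ℝ) := by positivity
      linarith
    · simp only [hg, indicator_of_notMem ht, add_zero, hf]
      refine Real.rpow_le_rpow_of_nonpos hL ?_ (by norm_num)
      by_contra! h
      have := abs_lt.1 h
      exact ht ⟨by linarith, by linarith⟩
  have hfi : IntegrableOn f (Icc (c - L) (c + L)) := by
    refine hgi.mono' ?_ (Eventually.of_forall fun t => ?_)
    · exact (Measurable.pow_const (by fun_prop) _).aestronglyMeasurable
    · rw [Real.norm_of_nonneg (hf0 t)]; exact hle t
  refine ⟨hfi, ?_⟩
  have h1 : ∫ t in Icc (c - L) (c + L), f t ≤ ∫ t in Icc (c - L) (c + L), g t :=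
    setIntegral_mono hfi hgi hle
  have h2 : ∫ t in Icc (c - L) (c + L), g t = 2 * L * L ^ (-(1 / 2) : ℝ)
      + ∫ t in Icc (c - L) (c + L), (Icc (a - L) (a + L)).indicator f t := by
    have hconst : Integrable (fun _ : ℝ => L ^ (-(1 / 2) : ℝ))
        (volume.restrict (Icc (c - L) (c + L))) := integrableOn_const (by simp)
    rw [hg, integral_add hconst hind.integrableOn, setIntegral_const]
    have : volume.real (Icc (c - L) (c + L)) = 2 * L := by
      rw [Real.volume_real_Icc_of_le (by linarith)]; ring
    rw [this, smul_eq_mul]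
  have h3 : ∫ t in Icc (c - L) (c + L), (Icc (a - L) (a + L)).indicator f t ≤ 4 * Real.sqrt L := by
    rw [← he, ← integral_indicator measurableSet_Icc (f := f)]
    exact setIntegral_le_integral hind (Eventually.of_forall fun t =>
      indicator_nonneg (fun t _ => hf0 t) t)
  have h4 : L * L ^ (-(1 / 2) : ℝ) = Real.sqrt L := by
    rw [Real.sqrt_eq_rpow]
    nth_rewrite 1 [← Real.rpow_one L]
    rw [← Real.rpow_add hL]; norm_num
  calc _ ≤ _ := h1
    _ = 2 * (L * L ^ (-(1 / 2) : ℝ)) + _ := by rw [h2, mul_assoc]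
    _ ≤ 2 * Real.sqrt L + 4 * Real.sqrt L := by rw [h4]; linarith
    _ = _ := by ring

/-- The closed square with centre `c` and half side `L`. -/
def sqBox (c : ℝ × ℝ) (L : ℝ) : Set (ℝ × ℝ) := Icc (c.1 - L) (c.1 + L) ×ˢ Icc (c.2 - L) (c.2 + L)

lemma mem_sqBox {c q : ℝ × ℝ} {L : ℝ} : q ∈ sqBox c L ↔ |q.1 - c.1| ≤ L ∧ |q.2 - c.2| ≤ L := by
  simp only [sqBox, mem_prod, mem_Icc, abs_le]
  constructor <;> rintro ⟨⟨a, b⟩, c, d⟩ <;> refine ⟨⟨?_, ?_⟩, ?_, ?_⟩ <;> linarith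

lemma mem_sqBox_of_len {c q : ℝ × ℝ} {L : ℝ} (h : len (q - c) ≤ L) : q ∈ sqBox c L :=
  mem_sqBox.2 ⟨(abs_fst_le_len _).trans h, (abs_snd_le_len _).trans h⟩

lemma measurableSet_sqBox (c : ℝ × ℝ) (L : ℝ) : MeasurableSet (sqBox c L) :=
  measurableSet_Icc.prod measurableSet_Icc

lemma isCompact_sqBox (c : ℝ × ℝ) (L : ℝ) : IsCompact (sqBox c L) := isCompact_Icc.prod isCompact_Icc

lemma measurable_len : Measurable len := continuous_len.measurable

lemma ae_ne_fst (a : ℝ) : ∀ᵐ q : ℝ × ℝ, q.1 ≠ a := by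
  have := (Measure.quasiMeasurePreserving_fst (μ := (volume : Measure ℝ)) (ν := (volume : Measure ℝ))).ae
    (p := fun t => t ≠ a) (by simp [ae_iff])
  exact this

lemma ae_ne_snd (a : ℝ) : ∀ᵐ q : ℝ × ℝ, q.2 ≠ a := by
  have := (Measure.quasiMeasurePreserving_snd (μ := (volume : Measure ℝ)) (ν := (volume : Measure ℝ))).ae
    (p := fun t => t ≠ a) (by simp [ae_iff])
  exact this

/-- |z₁||z₂| ≤ |z|² dominates the planar kernel by a product of integrable one-dimensional kernels,
so Fubini gives its integrability. Both coordinates must be nonzero because a negative power of 0 is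
0 here. -/
lemma inv_len_le {z : ℝ × ℝ} (h1 : z.1 ≠ 0) (h2 : z.2 ≠ 0) :
    (len z)⁻¹ ≤ |z.1| ^ (-(1 / 2) : ℝ) * |z.2| ^ (-(1 / 2) : ℝ) := by
  have a1 : 0 < |z.1| := abs_pos.2 h1
  have a2 : 0 < |z.2| := abs_pos.2 h2
  have hl : 0 < len z := a1.trans_le (abs_fst_le_len z)
  rw [← Real.mul_rpow a1.le a2.le, ← Real.rpow_neg_one]
  have e : len z ^ (-1 : ℝ) = (len z ^ 2) ^ (-(1 / 2) : ℝ) := by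
    rw [← Real.rpow_natCast, ← Real.rpow_mul hl.le]; norm_num
  rw [e]
  exact Real.rpow_le_rpow_of_nonpos (by positivity) (abs_mul_le_sq z) (by norm_num)

/-- The kernel `1 / |p - q|` is integrable over squares, uniformly in the pole. -/
theorem integral_inv_len_le (p c : ℝ × ℝ) {L : ℝ} (hL : 0 < L) :
    IntegrableOn (fun q : ℝ × ℝ => (len (p - q))⁻¹) (sqBox c L) ∧
      ∫ q in sqBox c L, (len (p - q))⁻¹ ≤ 36 * L := by
  obtain ⟨i1, e1⟩ := integral_abs_rpow_neg_half_le L hL p.1 c.1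
  obtain ⟨i2, e2⟩ := integral_abs_rpow_neg_half_le L hL p.2 c.2
  have hprod := Integrable.mul_prod i1 i2
  rw [Measure.prod_restrict] at hprod
  have hprod' : IntegrableOn (fun q : ℝ × ℝ => |p.1 - q.1| ^ (-(1 / 2) : ℝ)
      * |p.2 - q.2| ^ (-(1 / 2) : ℝ)) (sqBox c L) := hprod
  have hle : ∀ᵐ q : ℝ × ℝ, (len (p - q))⁻¹ ≤ |p.1 - q.1| ^ (-(1 / 2) : ℝ)
      * |p.2 - q.2| ^ (-(1 / 2) : ℝ) := by
    filter_upwards [ae_ne_fst p.1, ae_ne_snd p.2] with q h1 h2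
    exact inv_len_le (z := p - q) (sub_ne_zero.2 h1.symm) (sub_ne_zero.2 h2.symm)
  have hint : IntegrableOn (fun q : ℝ × ℝ => (len (p - q))⁻¹) (sqBox c L) := by
    refine hprod'.mono' ?_ (ae_restrict_of_ae (hle.mono fun q hq => ?_))
    · exact ((measurable_len.comp (measurable_const.sub measurable_id)).inv).aestronglyMeasurable
    · rwa [Real.norm_of_nonneg (inv_nonneg.2 (len_nonneg _))]
  refine ⟨hint, (setIntegral_mono_ae hint hprod' hle).trans ?_⟩
  have : ∫ q in sqBox c L, |p.1 - q.1| ^ (-(1 / 2) : ℝ) * |p.2 - q.2| ^ (-(1 / 2) : ℝ)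
      = (∫ t in Icc (c.1 - L) (c.1 + L), |p.1 - t| ^ (-(1 / 2) : ℝ))
        * ∫ t in Icc (c.2 - L) (c.2 + L), |p.2 - t| ^ (-(1 / 2) : ℝ) := by
    rw [← setIntegral_prod_mul]; rfl
  rw [this]
  have n2 : 0 ≤ ∫ t in Icc (c.2 - L) (c.2 + L), |p.2 - t| ^ (-(1 / 2) : ℝ) :=
    integral_nonneg fun t => by positivity
  calc _ ≤ (6 * Real.sqrt L) * (6 * Real.sqrt L) := mul_le_mul e1 e2 n2 (by positivity)
    _ = 36 * (Real.sqrt L * Real.sqrt L) := by ring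
    _ = 36 * L := by rw [Real.mul_self_sqrt hL.le]

lemma abs_log_le {t : ℝ} (ht : 0 ≤ t) : |Real.log t| ≤ t + t⁻¹ := by
  rcases ht.eq_or_lt with rfl | h
  · simp
  rw [abs_le]
  have h1 := Real.log_le_sub_one_of_pos h
  have h2 := Real.log_le_sub_one_of_pos (inv_pos.2 h)
  rw [Real.log_inv] at h2
  have : 0 < t⁻¹ := by positivity
  constructor <;> linarith

/-- Functions dominated by `a + b / |p - q|` on a square, and vanishing outside. -/
lemma integrable_of_le_inv_len {f : ℝ × ℝ → ℝ} {p c : ℝ × ℝ} {L a b : ℝ} (hL : 0 < L)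
    (hm : AEStronglyMeasurable f volume) (hz : ∀ q, q ∉ sqBox c L → f q = 0)
    (hb : ∀ q ∈ sqBox c L, |f q| ≤ a + b * (len (p - q))⁻¹) : Integrable f := by
  have h1 : IntegrableOn (fun q : ℝ × ℝ => a + b * (len (p - q))⁻¹) (sqBox c L) :=
    (integrableOn_const ((isCompact_sqBox c L).measure_lt_top.ne)).add
      ((integral_inv_len_le p c hL).1.const_mul b)
  have h2 : IntegrableOn f (sqBox c L) := by
    refine h1.mono' hm.restrict ?_
    filter_upwards [ae_restrict_mem (measurableSet_sqBox c L)] with q hq using hb q hq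
  have : (sqBox c L).indicator f = f := by
    funext q
    by_cases hq : q ∈ sqBox c L
    · rw [indicator_of_mem hq]
    · rw [indicator_of_notMem hq, hz q hq]
  rw [← this]
  exact (integrable_indicator_iff (measurableSet_sqBox c L)).2 h2

/-! ### Green's identity in the half plane -/

lemma halfPlane_eq : halfPlane = univ ×ˢ Ioi (0 : ℝ) := by
  ext p; simp [halfPlane]

lemma measurableSet_halfPlane : MeasurableSet halfPlane := isOpen_halfPlane.measurableSet

lemma volume_restrict_halfPlane :
    (volume : Measure (ℝ × ℝ)).restrict halfPlane
      = (volume : Measure ℝ).prod ((volume : Measure ℝ).restrict (Ioi 0)) := by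
  rw [halfPlane_eq, Measure.volume_eq_prod, ← Measure.prod_restrict, Measure.restrict_univ]

lemma mem_sqBox_zero {q : ℝ × ℝ} {L : ℝ} (h : len q ≤ L) : q ∈ sqBox 0 L :=
  mem_sqBox_of_len (by simpa using h)

/-- Continuous functions with bounded support in the half plane, bounded there, are integrable. -/
lemma integrableOn_halfPlane {f : ℝ × ℝ → ℝ} {L B : ℝ} (hc : ContinuousOn f halfPlane)
    (hb : ∀ p ∈ halfPlane, len p ≤ L → |f p| ≤ B) (hz : ∀ p ∈ halfPlane, L < len p → f p = 0) :
    IntegrableOn f halfPlane := by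
  have hm : AEStronglyMeasurable f (volume.restrict halfPlane) :=
    hc.aestronglyMeasurable measurableSet_halfPlane
  have hi : IntegrableOn ((sqBox 0 L).indicator fun _ => B) halfPlane :=
    ((integrable_indicator_iff (measurableSet_sqBox 0 L)).2
      (integrableOn_const ((isCompact_sqBox 0 L).measure_lt_top.ne))).integrableOn
  refine hi.mono' hm ?_
  filter_upwards [ae_restrict_mem measurableSet_halfPlane] with p hp
  rcases le_or_gt (len p) L with h | h
  · rw [indicator_of_mem (mem_sqBox_zero h)]; exact hb p hp h
  · rw [hz p hp h, norm_zero]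
    by_cases hs : p ∈ sqBox 0 L
    · rw [indicator_of_mem hs]
      -- At points of the square outside the disc f vanishes, and 0 ≤ B is what is needed; the bound
      -- at (0, L) provides it.
      by_contra! hB
      have hL : 0 ≤ L := by
        have := mem_sqBox.1 hs
        exact (abs_nonneg _).trans this.1
      rcases hL.eq_or_lt with e | hL
      · subst e
        have := mem_sqBox.1 hs
        have hp2 : p.2 = 0 := by simpa using this.2
        have : 0 < p.2 := hp
        linarith
      · have := hb (0, L) hL (by simp [len, Real.sqrt_sq hL.le])
        have := abs_nonneg (f (0, L))
        linarith
    · rw [indicator_of_notMem hs]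

/-- Twice differentiable functions on the half plane with bounded derivatives and bounded support,
vanishing linearly at the boundary. -/
structure IsTest (L B : ℝ) (v : ℝ × ℝ → ℝ) : Prop where
  smooth : ∀ p ∈ halfPlane, ContDiffAt ℝ 2 v p
  zero : ∀ p ∈ halfPlane, L < len p → v p = 0
  trace : ∀ p ∈ halfPlane, |v p| ≤ B * p.2
  dx_le : ∀ p ∈ halfPlane, |dx v p| ≤ B
  dy_le : ∀ p ∈ halfPlane, |dy v p| ≤ B
  dxx_le : ∀ p ∈ halfPlane, |dx (dx v) p| ≤ B
  dyy_le : ∀ p ∈ halfPlane, |dy (dy v) p| ≤ B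

namespace IsTest

variable {L B : ℝ} {v : ℝ × ℝ → ℝ}

lemma eventually_zero (h : IsTest L B v) {p : ℝ × ℝ} (hp : p ∈ halfPlane) (hl : L < len p) :
    v =ᶠ[𝓝 p] fun _ => 0 := by
  filter_upwards [isOpen_halfPlane.mem_nhds hp,
    continuous_len.continuousAt.eventually (lt_mem_nhds hl)] with q h1 h2 using h.zero q h1 h2

lemma dx_zero (h : IsTest L B v) {p : ℝ × ℝ} (hp : p ∈ halfPlane) (hl : L < len p) : dx v p = 0 := by
  rw [dx_congr (h.eventually_zero hp hl)]; simp [dx]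

lemma dy_zero (h : IsTest L B v) {p : ℝ × ℝ} (hp : p ∈ halfPlane) (hl : L < len p) : dy v p = 0 := by
  rw [dy_congr (h.eventually_zero hp hl)]; simp [dy]

lemma dxx_zero (h : IsTest L B v) {p : ℝ × ℝ} (hp : p ∈ halfPlane) (hl : L < len p) :
    dx (dx v) p = 0 := by
  rw [dx_congr (dx_eventuallyEq (h.eventually_zero hp hl))]; simp [dx]

lemma dyy_zero (h : IsTest L B v) {p : ℝ × ℝ} (hp : p ∈ halfPlane) (hl : L < len p) :
    dy (dy v) p = 0 := by
  rw [dy_congr (dy_eventuallyEq (h.eventually_zero hp hl))]; simp [dy]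

lemma cont (h : IsTest L B v) : ContinuousOn v halfPlane := fun p hp =>
  (h.smooth p hp).continuousAt.continuousWithinAt

lemma cont_dxx (h : IsTest L B v) : ContinuousOn (dx (dx v)) halfPlane := fun p hp =>
  (contDiffAt_dx (n := 0) (by simpa using contDiffAt_dx_one (h.smooth p hp))).continuousAt.continuousWithinAt

lemma cont_dyy (h : IsTest L B v) : ContinuousOn (dy (dy v)) halfPlane := fun p hp =>
  (contDiffAt_dy (n := 0) (by simpa using contDiffAt_dy_one (h.smooth p hp))).continuousAt.continuousWithinAt

end IsTest

lemma exists_bound_on_ball {K : ℝ × ℝ → ℝ} (hK : Continuous K) (L : ℝ) :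
    ∃ B : ℝ, 0 ≤ B ∧ ∀ p, len p ≤ L → |K p| ≤ B := by
  obtain ⟨B, hB⟩ := (isCompact_sqBox 0 L).exists_bound_of_continuousOn hK.continuousOn
  exact ⟨max B 0, le_max_right _ _, fun p hp => (hB p (mem_sqBox_zero hp)).trans (le_max_left _ _)⟩

lemma continuous_dx_of_contDiff {K : ℝ × ℝ → ℝ} (hK : ContDiff ℝ 2 K) : Continuous (dx K) :=
  continuous_iff_continuousAt.2 fun _ => (contDiffAt_dx_one hK.contDiffAt).continuousAt

lemma continuous_dy_of_contDiff {K : ℝ × ℝ → ℝ} (hK : ContDiff ℝ 2 K) : Continuous (dy K) :=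
  continuous_iff_continuousAt.2 fun _ => (contDiffAt_dy_one hK.contDiffAt).continuousAt

lemma continuous_dxx_of_contDiff {K : ℝ × ℝ → ℝ} (hK : ContDiff ℝ 2 K) : Continuous (dx (dx K)) :=
  continuous_iff_continuousAt.2 fun _ =>
    (contDiffAt_dx (n := 0) (by simpa using contDiffAt_dx_one hK.contDiffAt)).continuousAt

lemma continuous_dyy_of_contDiff {K : ℝ × ℝ → ℝ} (hK : ContDiff ℝ 2 K) : Continuous (dy (dy K)) :=
  continuous_iff_continuousAt.2 fun _ =>
    (contDiffAt_dy (n := 0) (by simpa using contDiffAt_dy_one hK.contDiffAt)).continuousAt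

lemma abs_mul_sub_mul_le {a b c d A B C D : ℝ} (ha : |a| ≤ A) (hb : |b| ≤ B) (hc : |c| ≤ C)
    (hd : |d| ≤ D) : |a * b - c * d| ≤ A * B + C * D := by
  refine (abs_sub _ _).trans (add_le_add ?_ ?_)
  · rw [abs_mul]; exact mul_le_mul ha hb (abs_nonneg _) ((abs_nonneg _).trans ha)
  · rw [abs_mul]; exact mul_le_mul hc hd (abs_nonneg _) ((abs_nonneg _).trans hc)

lemma IsTest.val_le {L B : ℝ} {v : ℝ × ℝ → ℝ} (hv : IsTest L B v) {p : ℝ × ℝ} (hp : p ∈ halfPlane)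
    (hl : len p ≤ L) : |v p| ≤ B * L := by
  have hB : 0 ≤ B := (abs_nonneg _).trans (hv.dx_le p hp)
  refine (hv.trace p hp).trans ?_
  gcongr
  exact (le_abs_self _).trans ((abs_snd_le_len p).trans hl)

lemma IsTest.integrableOn_xx {L B : ℝ} {v K : ℝ × ℝ → ℝ} (hv : IsTest L B v) (hK : ContDiff ℝ 2 K) :
    IntegrableOn (fun p => K p * dx (dx v) p - v p * dx (dx K) p) halfPlane := by
  obtain ⟨B1, -, h1⟩ := exists_bound_on_ball hK.continuous L
  obtain ⟨B2, -, h2⟩ := exists_bound_on_ball (continuous_dxx_of_contDiff hK) L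
  refine integrableOn_halfPlane (L := L) (B := B1 * B + B * L * B2)
    ((hK.continuous.continuousOn.mul hv.cont_dxx).sub
      (hv.cont.mul (continuous_dxx_of_contDiff hK).continuousOn)) ?_ ?_
  · intro p hp hl
    exact abs_mul_sub_mul_le (h1 p hl) (hv.dxx_le p hp) (hv.val_le hp hl) (h2 p hl)
  · intro p hp hl
    rw [hv.dxx_zero hp hl, hv.zero p hp hl]; ring

lemma IsTest.integrableOn_yy {L B : ℝ} {v K : ℝ × ℝ → ℝ} (hv : IsTest L B v) (hK : ContDiff ℝ 2 K) :
    IntegrableOn (fun p => K p * dy (dy v) p - v p * dy (dy K) p) halfPlane := by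
  obtain ⟨B1, -, h1⟩ := exists_bound_on_ball hK.continuous L
  obtain ⟨B2, -, h2⟩ := exists_bound_on_ball (continuous_dyy_of_contDiff hK) L
  refine integrableOn_halfPlane (L := L) (B := B1 * B + B * L * B2)
    ((hK.continuous.continuousOn.mul hv.cont_dyy).sub
      (hv.cont.mul (continuous_dyy_of_contDiff hK).continuousOn)) ?_ ?_
  · intro p hp hl
    exact abs_mul_sub_mul_le (h1 p hl) (hv.dyy_le p hp) (hv.val_le hp hl) (h2 p hl)
  · intro p hp hl
    rw [hv.dyy_zero hp hl, hv.zero p hp hl]; ring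

/-- On each horizontal line the integrand is the derivative of K v_x - v K_x, which has compact
support. -/
lemma IsTest.integral_xx {L B : ℝ} {v K : ℝ × ℝ → ℝ} (hv : IsTest L B v) (hK : ContDiff ℝ 2 K) :
    ∫ p in halfPlane, (K p * dx (dx v) p - v p * dx (dx K) p) = 0 := by
  have hint := hv.integrableOn_xx hK
  rw [IntegrableOn, volume_restrict_halfPlane] at hint
  rw [volume_restrict_halfPlane, integral_prod_symm _ hint]
  refine (integral_congr_ae (g := fun _ => 0) ?_).trans (by simp)
  filter_upwards [ae_restrict_mem measurableSet_Ioi] with y hy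
  have hy' : ∀ x, (x, y) ∈ halfPlane := fun x => hy
  have hbig : ∀ x, x ∉ Icc (-L) L → L < len (x, y) := by
    intro x hx
    have : L < |x| := by
      by_contra! h; exact hx (abs_le.1 h)
    exact this.trans_le (abs_fst_le_len (x, y))
  have hslice : Continuous fun x : ℝ => (x, y) := by fun_prop
  have hon : ∀ g : ℝ × ℝ → ℝ, ContinuousOn g halfPlane → Continuous fun x => g (x, y) := fun g hg =>
    continuous_iff_continuousAt.2 fun x => ContinuousAt.comp (f := fun x : ℝ => (x, y)) (x := x)
      (hg.continuousAt (isOpen_halfPlane.mem_nhds (hy' x))) hslice.continuousAt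
  have hdxv : ContinuousOn (dx v) halfPlane := fun p hp =>
    (contDiffAt_dx_one (hv.smooth p hp)).continuousAt.continuousWithinAt
  have cK := hK.continuous.comp hslice
  have cK1 := (continuous_dx_of_contDiff hK).comp hslice
  have cK2 := (continuous_dxx_of_contDiff hK).comp hslice
  have hderiv : ∀ x, HasDerivAt (fun x => K (x, y) * dx v (x, y) - v (x, y) * dx K (x, y))
      (K (x, y) * dx (dx v) (x, y) - v (x, y) * dx (dx K) (x, y)) x := by
    intro x
    have a1 := hasDerivAt_dx ((hv.smooth _ (hy' x)).differentiableAt (by simp))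
    have a2 := hasDerivAt_dx (differentiableAt_dx (hv.smooth _ (hy' x)))
    have b1 := hasDerivAt_dx (p := (x, y)) (hK.contDiffAt.differentiableAt (by simp))
    have b2 := hasDerivAt_dx (p := (x, y)) (differentiableAt_dx hK.contDiffAt)
    refine ((b1.mul a2).sub (a1.mul b2)).congr_deriv ?_
    simp only
    ring
  refine integral_eq_zero_of_hasDerivAt_of_integrable hderiv ?_ ?_
  · refine Continuous.integrable_of_hasCompactSupport
      ((cK.mul (hon _ hv.cont_dxx)).sub ((hon _ hv.cont).mul cK2))
      (HasCompactSupport.intro (isCompact_Icc (a := -L) (b := L)) fun x hx => ?_)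
    rw [hv.dxx_zero (hy' x) (hbig x hx), hv.zero _ (hy' x) (hbig x hx)]; ring
  · refine Continuous.integrable_of_hasCompactSupport
      ((cK.mul (hon _ hdxv)).sub ((hon _ hv.cont).mul cK1))
      (HasCompactSupport.intro (isCompact_Icc (a := -L) (b := L)) fun x hx => ?_)
    rw [hv.dx_zero (hy' x) (hbig x hx), hv.zero _ (hy' x) (hbig x hx)]; ring

/-- On each vertical half line the integrand is the derivative of K v_y - v K_y. At the wall K tends
to 0 while v_y stays bounded, and v vanishes linearly, so there is no boundary term. -/
lemma IsTest.integral_yy {L B : ℝ} {v K : ℝ × ℝ → ℝ} (hv : IsTest L B v) (hK : ContDiff ℝ 2 K)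
    (hK0 : ∀ x, K (x, 0) = 0) :
    ∫ p in halfPlane, (K p * dy (dy v) p - v p * dy (dy K) p) = 0 := by
  have hint := hv.integrableOn_yy hK
  rw [IntegrableOn, volume_restrict_halfPlane] at hint
  rw [volume_restrict_halfPlane, integral_prod _ hint]
  have hslices := hint.prod_right_ae
  refine (integral_congr_ae (g := fun _ => 0) ?_).trans (by simp)
  filter_upwards [hslices] with x hx
  have hbig : ∀ y, L < y → L < len (x, y) := fun y hy =>
    hy.trans_le ((le_abs_self _).trans (abs_snd_le_len (x, y)))
  set F : ℝ → ℝ := fun y => K (x, y) * dy v (x, y) - v (x, y) * dy K (x, y) with hF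
  -- The indicator fixes the value 0 at y = 0, so the vanishing of the boundary term becomes right
  -- continuity of G at 0, without any assumption on v at the wall.
  set G : ℝ → ℝ := (Ioi 0).indicator F with hG
  have hderivF : ∀ y ∈ Ioi (0 : ℝ), HasDerivAt F
      (K (x, y) * dy (dy v) (x, y) - v (x, y) * dy (dy K) (x, y)) y := by
    intro y hy
    have hy' : (x, y) ∈ halfPlane := hy
    have a1 := hasDerivAt_dy ((hv.smooth _ hy').differentiableAt (by simp))
    have a2 := hasDerivAt_dy (differentiableAt_dy (hv.smooth _ hy'))
    have b1 := hasDerivAt_dy (p := (x, y)) (hK.contDiffAt.differentiableAt (by simp))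
    have b2 := hasDerivAt_dy (p := (x, y)) (differentiableAt_dy hK.contDiffAt)
    refine ((b1.mul a2).sub (a1.mul b2)).congr_deriv ?_
    simp only
    ring
  have hderiv : ∀ y ∈ Ioi (0 : ℝ), HasDerivAt G
      (K (x, y) * dy (dy v) (x, y) - v (x, y) * dy (dy K) (x, y)) y := by
    intro y hy
    refine (hderivF y hy).congr_of_eventuallyEq ?_
    filter_upwards [Ioi_mem_nhds (mem_Ioi.1 hy)] with t ht
    rw [hG, indicator_of_mem ht]
  have hG0 : G 0 = 0 := by rw [hG, indicator_of_notMem (by simp)]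
  have hcont : ContinuousWithinAt G (Ici 0) 0 := by
    have cK : Continuous fun y : ℝ => |K (x, y)| * B + B * |y| * |dy K (x, y)| := by
      have := hK.continuous
      have := continuous_dy_of_contDiff hK
      fun_prop
    have hlim : Tendsto (fun y : ℝ => |K (x, y)| * B + B * |y| * |dy K (x, y)|) (𝓝 0) (𝓝 0) := by
      have := cK.tendsto 0
      simpa [hK0] using this
    rw [ContinuousWithinAt, hG0]
    refine squeeze_zero_norm' ?_ (hlim.mono_left nhdsWithin_le_nhds)
    filter_upwards [self_mem_nhdsWithin] with y hy
    have hB : 0 ≤ B := (abs_nonneg _).trans (hv.dx_le (0, 1) (by simp [halfPlane]))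
    rcases (mem_Ici.1 hy).eq_or_lt with e | h
    · rw [← e, hG0, norm_zero]; positivity
    · rw [hG, indicator_of_mem (mem_Ioi.2 h)]
      have hy' : (x, y) ∈ halfPlane := h
      refine abs_mul_sub_mul_le le_rfl (hv.dy_le _ hy') ?_ le_rfl
      rw [abs_of_pos h]; exact hv.trace _ hy'
  have htop : Tendsto G atTop (𝓝 0) := by
    refine tendsto_const_nhds.congr' ?_
    filter_upwards [eventually_gt_atTop L, eventually_gt_atTop 0] with y h1 h2
    have hy' : (x, y) ∈ halfPlane := h2
    rw [hG, indicator_of_mem (mem_Ioi.2 h2)]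
    simp only [hF]
    rw [hv.zero _ hy' (hbig y h1), hv.dy_zero hy' (hbig y h1)]; ring
  rw [integral_Ioi_of_hasDerivAt_of_tendsto hcont hderiv hx htop, hG0, sub_zero]

/-- Green's identity. -/
theorem IsTest.integral_green {L B : ℝ} {v K : ℝ × ℝ → ℝ} (hv : IsTest L B v) (hK : ContDiff ℝ 2 K)
    (hK0 : ∀ x, K (x, 0) = 0) :
    ∫ p in halfPlane, K p * lap v p = ∫ p in halfPlane, v p * lap K p := by
  have h1 := hv.integral_xx hK
  have h2 := hv.integral_yy hK hK0
  have h3 := integral_add (hv.integrableOn_xx hK) (hv.integrableOn_yy hK)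
  rw [h1, h2, add_zero] at h3
  have i1 : IntegrableOn (fun p => K p * lap v p) halfPlane := by
    obtain ⟨B1, -, hb⟩ := exists_bound_on_ball hK.continuous L
    refine integrableOn_halfPlane (L := L) (B := B1 * (B + B))
      (hK.continuous.continuousOn.mul (hv.cont_dxx.add hv.cont_dyy)) ?_ ?_
    · intro p hp hl
      rw [abs_mul]
      exact mul_le_mul (hb p hl) ((abs_add_le _ _).trans (add_le_add (hv.dxx_le p hp) (hv.dyy_le p hp)))
        (abs_nonneg _) ((abs_nonneg _).trans (hb p hl))
    · intro p hp hl
      rw [lap, hv.dxx_zero hp hl, hv.dyy_zero hp hl]; ring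
  have i2 : IntegrableOn (fun p => v p * lap K p) halfPlane := by
    obtain ⟨B1, -, hb⟩ := exists_bound_on_ball
      ((continuous_dxx_of_contDiff hK).add (continuous_dyy_of_contDiff hK)) L
    refine integrableOn_halfPlane (L := L) (B := B * L * B1)
      (hv.cont.mul ((continuous_dxx_of_contDiff hK).add (continuous_dyy_of_contDiff hK)).continuousOn) ?_ ?_
    · intro p hp hl
      rw [abs_mul]
      exact mul_le_mul (hv.val_le hp hl) (hb p hl) (abs_nonneg _)
        ((abs_nonneg _).trans (hv.val_le hp hl))
    · intro p hp hl
      rw [hv.zero p hp hl]; ring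
  rw [← sub_eq_zero, ← integral_sub i1 i2, ← h3]
  congr 1
  funext p
  unfold lap
  ring

/-! ### Regularized logarithm and the representation formula -/

/-- The regularized logarithm with pole `a`. -/
noncomputable def regLog (ε : ℝ) (a q : ℝ × ℝ) : ℝ :=
  1 / 2 * Real.log ((q.1 - a.1) ^ 2 + (q.2 - a.2) ^ 2 + ε ^ 2)

lemma regLog_pos_arg {ε : ℝ} (hε : ε ≠ 0) (a q : ℝ × ℝ) :
    0 < (q.1 - a.1) ^ 2 + (q.2 - a.2) ^ 2 + ε ^ 2 := by positivity

lemma contDiff_regLog {ε : ℝ} (hε : ε ≠ 0) (a : ℝ × ℝ) : ContDiff ℝ 2 (regLog ε a) := by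
  unfold regLog
  exact contDiff_const.mul (ContDiff.log (by fun_prop) fun q => (regLog_pos_arg hε a q).ne')

/-- The Laplacian is 2π times an approximate identity of width ε, which makes regularized logarithms
usable in Green's identity in place of the singular kernel. -/
lemma lap_regLog {ε : ℝ} (hε : ε ≠ 0) (a q : ℝ × ℝ) :
    lap (regLog ε a) q = 2 * ε ^ 2 / ((q.1 - a.1) ^ 2 + (q.2 - a.2) ^ 2 + ε ^ 2) ^ 2 := by
  have h1 : dx (regLog ε a) = fun q => (q.1 - a.1) / ((q.1 - a.1) ^ 2 + (q.2 - a.2) ^ 2 + ε ^ 2) := by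
    funext q
    have hD := (regLog_pos_arg hε a q).ne'
    have h := ((((((hasDerivAt_id' q.1).sub_const a.1).pow 2).add_const ((q.2 - a.2) ^ 2)).add_const
      (ε ^ 2)).log hD).const_mul (1 / 2)
    refine h.deriv.trans ?_
    simp; field_simp
  have h2 : dy (regLog ε a) = fun q => (q.2 - a.2) / ((q.1 - a.1) ^ 2 + (q.2 - a.2) ^ 2 + ε ^ 2) := by
    funext q
    have hD := (regLog_pos_arg hε a q).ne'
    have h := ((((((hasDerivAt_id' q.2).sub_const a.2).pow 2).const_add ((q.1 - a.1) ^ 2)).add_const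
      (ε ^ 2)).log hD).const_mul (1 / 2)
    refine h.deriv.trans ?_
    simp; field_simp
  have hD := (regLog_pos_arg hε a q).ne'
  have h3 := ((hasDerivAt_id' q.1).sub_const a.1).div (((((hasDerivAt_id' q.1).sub_const a.1).pow
    2).add_const ((q.2 - a.2) ^ 2)).add_const (ε ^ 2)) hD
  have h4 := ((hasDerivAt_id' q.2).sub_const a.2).div (((((hasDerivAt_id' q.2).sub_const a.2).pow
    2).const_add ((q.1 - a.1) ^ 2)).add_const (ε ^ 2)) hD
  unfold lap
  rw [h1, h2]
  have e3 := h3.deriv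
  have e4 := h4.deriv
  unfold dx dy
  refine (congrArg₂ (· + ·) e3 e4).trans ?_
  simp
  field_simp
  ring

/-- The normalized peak `π⁻¹ (1 + |z|²)⁻²`. -/
noncomputable def peak (z : ℝ × ℝ) : ℝ := Real.pi⁻¹ * ((1 + (z.1 ^ 2 + z.2 ^ 2)) ^ 2)⁻¹

lemma integral_peak : ∫ z, peak z = 1 := by
  have h1 : ∀ p : ℝ × ℝ, p.1 • ((1 + ((polarCoord.symm p).1 ^ 2 + (polarCoord.symm p).2 ^ 2)) ^ 2)⁻¹
      = (p.1 * ((1 + p.1 ^ 2) ^ 2)⁻¹) * (1 : ℝ) := by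
    intro p
    simp only [polarCoord_symm_apply, smul_eq_mul, mul_one]
    rw [show (p.1 * Real.cos p.2) ^ 2 + (p.1 * Real.sin p.2) ^ 2 = p.1 ^ 2 by
      rw [mul_pow, mul_pow, ← mul_add, Real.cos_sq_add_sin_sq, mul_one]]
  have h2 : ∫ r in Ioi (0 : ℝ), r * ((1 + r ^ 2) ^ 2)⁻¹ = 1 / 2 := by
    have hd : ∀ r ∈ Ici (0 : ℝ), HasDerivAt (fun r : ℝ => -(1 / 2) * (1 + r ^ 2)⁻¹)
        (r * ((1 + r ^ 2) ^ 2)⁻¹) r := by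
      intro r _
      have hp : (1 + r ^ 2) ≠ 0 := by positivity
      have h := (((hasDerivAt_pow 2 r).const_add 1).inv hp).const_mul (-(1 / 2) : ℝ)
      refine h.congr_deriv ?_
      simp; field_simp
    have hlim : Tendsto (fun r : ℝ => -(1 / 2) * (1 + r ^ 2)⁻¹) atTop (𝓝 (-(1 / 2) * 0)) := by
      refine Tendsto.const_mul _ (tendsto_inv_atTop_zero.comp ?_)
      exact tendsto_atTop_add_const_left _ _ (tendsto_pow_atTop two_ne_zero)
    rw [integral_Ioi_of_hasDerivAt_of_nonneg' hd (fun r hr => by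
      have : 0 < r := hr
      positivity) hlim]
    norm_num
  unfold peak
  rw [integral_const_mul, ← integral_comp_polarCoord_symm]
  simp_rw [h1]
  rw [polarCoord_target, Measure.volume_eq_prod, setIntegral_prod_mul (fun r : ℝ => r * ((1 + r ^ 2) ^ 2)⁻¹)
    (fun _ : ℝ => (1 : ℝ)), h2, setIntegral_const]
  rw [Real.volume_real_Ioo_of_le (by linarith [Real.pi_pos])]
  have := Real.pi_pos
  simp
  field_simp
  norm_num

lemma norm_sq_le_len_sq (z : ℝ × ℝ) : ‖z‖ ^ 2 ≤ z.1 ^ 2 + z.2 ^ 2 := by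
  rw [Prod.norm_def]
  rcases max_cases ‖z.1‖ ‖z.2‖ with h | h <;> rw [h.1, Real.norm_eq_abs, sq_abs] <;>
    nlinarith [sq_nonneg z.1, sq_nonneg z.2]

/-- The functions c² `peak` (c·) form an approximate identity: the mass is 1, and |x|² `peak` x
tends to 0 at infinity, where |x| may be taken as the sup norm. -/
lemma tendsto_peak {g : ℝ × ℝ → ℝ} (hg : Integrable g) {a : ℝ × ℝ} (hc : ContinuousAt g a) :
    Tendsto (fun c : ℝ => ∫ x, c ^ 2 * peak (c • (a - x)) * g x) atTop (𝓝 (g a)) := by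
  have hfin : Module.finrank ℝ (ℝ × ℝ) = 2 := by simp
  have := tendsto_integral_comp_smul_smul_of_integrable' (μ := (volume : Measure (ℝ × ℝ))) (φ := peak)
    (fun x => by unfold peak; have := Real.pi_pos; positivity) integral_peak ?_ hg hc
  · simpa only [hfin, smul_eq_mul] using this
  · rw [hfin]
    have hlim : Tendsto (fun x : ℝ × ℝ => Real.pi⁻¹ * (‖x‖ ^ 2)⁻¹) (Bornology.cobounded (ℝ × ℝ)) (𝓝 (Real.pi⁻¹ * 0)) :=
      (tendsto_inv_atTop_zero.comp ((tendsto_pow_atTop two_ne_zero).comp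
        tendsto_norm_cobounded_atTop)).const_mul _
    rw [mul_zero] at hlim
    have hpi := Real.pi_pos
    refine squeeze_zero (fun x => by unfold peak; positivity) (fun x => ?_) hlim
    unfold peak
    rw [mul_left_comm]
    gcongr
    have h1 := norm_sq_le_len_sq x
    rcases eq_or_ne x 0 with rfl | hx
    · simp
    have hn : 0 < ‖x‖ ^ 2 := by positivity
    rw [← div_eq_mul_inv, inv_eq_one_div, div_le_div_iff₀ (by positivity) hn]
    nlinarith

lemma peak_eq {c : ℝ} (hc : 0 < c) (a q : ℝ × ℝ) :
    lap (regLog c⁻¹ a) q = 2 * Real.pi * (c ^ 2 * peak (c • (a - q))) := by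
  have hpi := Real.pi_pos
  rw [lap_regLog (by positivity)]
  unfold peak
  have hD : 0 < (q.1 - a.1) ^ 2 + (q.2 - a.2) ^ 2 + c⁻¹ ^ 2 := regLog_pos_arg (by positivity) a q
  have e : (1 + ((c • (a - q)).1 ^ 2 + (c • (a - q)).2 ^ 2))
      = c ^ 2 * ((q.1 - a.1) ^ 2 + (q.2 - a.2) ^ 2 + c⁻¹ ^ 2) := by
    simp only [Prod.smul_fst, Prod.smul_snd, Prod.fst_sub, Prod.snd_sub, smul_eq_mul]
    field_simp
    ring
  rw [e]
  set D := (q.1 - a.1) ^ 2 + (q.2 - a.2) ^ 2 + c⁻¹ ^ 2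
  field_simp

lemma len_sub_sq (a q : ℝ × ℝ) : len (a - q) ^ 2 = (q.1 - a.1) ^ 2 + (q.2 - a.2) ^ 2 := by
  rw [len_sq]; simp only [Prod.fst_sub, Prod.snd_sub]; ring

/-- A bound uniform in ε ≤ 1 and integrable on bounded sets, for dominated convergence as ε → 0. -/
lemma abs_regLog_le {ε : ℝ} (hε : 0 < ε) (hε1 : ε ≤ 1) {a q : ℝ × ℝ} (h : 0 < len (a - q)) :
    |regLog ε a q| ≤ len (a - q) ^ 2 + len (a - q) + (len (a - q))⁻¹ := by
  unfold regLog
  rw [← len_sub_sq]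
  set t := len (a - q)
  have h1 : Real.log (t ^ 2 + ε ^ 2) ≤ t ^ 2 + ε ^ 2 - 1 := Real.log_le_sub_one_of_pos (by positivity)
  have h2 : Real.log (t ^ 2) ≤ Real.log (t ^ 2 + ε ^ 2) :=
    Real.log_le_log (by positivity) (by nlinarith)
  rw [Real.log_pow] at h2
  have h3 := (abs_le.1 (abs_log_le h.le)).1
  have h4 : ε ^ 2 ≤ 1 := by nlinarith
  have h5 : 0 < t⁻¹ := by positivity
  push_cast at h2
  rw [abs_le]
  constructor <;> nlinarith

lemma tendsto_regLog {a q : ℝ × ℝ} (h : 0 < len (a - q)) :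
    Tendsto (fun c : ℝ => regLog c⁻¹ a q) atTop (𝓝 (Real.log (len (a - q)))) := by
  have e : Real.log (len (a - q)) = 1 / 2 * Real.log (len (a - q) ^ 2 + 0 ^ 2) := by
    rw [zero_pow two_ne_zero, add_zero, Real.log_pow]; push_cast; ring
  rw [e]
  unfold regLog
  simp_rw [← len_sub_sq]
  refine Tendsto.const_mul _ ((Real.continuousAt_log (by positivity)).tendsto.comp ?_)
  exact tendsto_const_nhds.add (tendsto_inv_atTop_zero.pow 2)

lemma len_sub_pos {a q : ℝ × ℝ} (h : q.1 ≠ a.1) : 0 < len (a - q) :=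
  (abs_pos.2 (sub_ne_zero.2 h.symm)).trans_le (abs_fst_le_len (a - q))

lemma invLap_kernel_eq (p q : ℝ × ℝ) : len (p.1 - q.1, p.2 + q.2) = len ((p.1, -p.2) - q) := by
  unfold len; congr 1; simp only [Prod.fst_sub, Prod.snd_sub]; ring

/-- A majorant for the regularized logarithms on a square. -/
noncomputable def logDom (L : ℝ) (a : ℝ × ℝ) : ℝ × ℝ → ℝ :=
  (sqBox 0 L).indicator fun q => len (a - q) ^ 2 + len (a - q) + (len (a - q))⁻¹

lemma integrable_logDom {L : ℝ} (hL : 0 < L) (a : ℝ × ℝ) : Integrable (logDom L a) := by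
  have hc : Continuous fun q : ℝ × ℝ => len (a - q) ^ 2 + len (a - q) := by
    have := continuous_len
    fun_prop
  obtain ⟨B, hB⟩ := (isCompact_sqBox 0 L).exists_bound_of_continuousOn hc.continuousOn
  have hm : Measurable fun q : ℝ × ℝ => len (a - q) ^ 2 + len (a - q) + (len (a - q))⁻¹ :=
    hc.measurable.add (measurable_len.comp (measurable_const.sub measurable_id)).inv
  refine integrable_of_le_inv_len (p := a) (c := 0) (L := L) (a := B) (b := 1) hL
    (hm.indicator (measurableSet_sqBox 0 L)).aestronglyMeasurable
    (fun q hq => indicator_of_notMem hq _) (fun q hq => ?_)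
  rw [logDom, indicator_of_mem hq]
  have h0 := len_nonneg (a - q)
  have h1 : 0 ≤ (len (a - q))⁻¹ := by positivity
  have := (le_abs_self _).trans (hB q hq)
  rw [abs_of_nonneg (by positivity)]
  linarith

lemma abs_regLog_le_logDom {L : ℝ} {a q : ℝ × ℝ} (hq : q ∈ sqBox 0 L) {ε : ℝ} (hε : 0 < ε)
    (hε1 : ε ≤ 1) (h : 0 < len (a - q)) : |regLog ε a q| ≤ logDom L a q := by
  rw [logDom, indicator_of_mem hq]; exact abs_regLog_le hε hε1 h

namespace IsTest

variable {L B : ℝ} {v : ℝ × ℝ → ℝ}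

lemma integrable_indicator (hv : IsTest L B v) : Integrable (halfPlane.indicator v) :=
  (integrable_indicator_iff measurableSet_halfPlane).2
    (integrableOn_halfPlane (L := L) (B := B * L) hv.cont (fun _ hp hl => hv.val_le hp hl)
      (fun p hp hl => hv.zero p hp hl))

lemma tendsto_source (hv : IsTest L B v) {a : ℝ × ℝ} (hc : ContinuousAt (halfPlane.indicator v) a) :
    Tendsto (fun c : ℝ => ∫ q in halfPlane, v q * lap (regLog c⁻¹ a) q) atTop
      (𝓝 (2 * Real.pi * halfPlane.indicator v a)) := by
  have h := (tendsto_peak hv.integrable_indicator hc).const_mul (2 * Real.pi)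
  refine h.congr' ?_
  filter_upwards [eventually_gt_atTop 0] with c hc
  rw [← integral_const_mul, ← integral_indicator measurableSet_halfPlane]
  congr 1
  funext q
  by_cases hq : q ∈ halfPlane
  · rw [indicator_of_mem hq, indicator_of_mem hq, peak_eq hc]; ring
  · rw [indicator_of_notMem hq, indicator_of_notMem hq]; ring

/-- The representation formula. -/
theorem invLap_eq (hv : IsTest L B v) {p : ℝ × ℝ} (hp : p ∈ halfPlane) :
    invLap (fun q => -lap v q) p = v p := by
  have hpi := Real.pi_pos
  have hp2 : 0 < p.2 := hp
  -- The image pole. The extension of v by zero is continuous at p with value v(p) and vanishes near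
  -- p', so in the limit the approximate identities produce 2π v(p) and 0.
  set p' : ℝ × ℝ := (p.1, -p.2) with hp'
  have hB : 0 ≤ B := (abs_nonneg _).trans (hv.dx_le p hp)
  set L' := max L 1 with hL'
  have hL0 : 0 < L' := lt_max_of_lt_right one_pos
  -- the right-hand side
  have ev1 : halfPlane.indicator v =ᶠ[𝓝 p] v := by
    filter_upwards [isOpen_halfPlane.mem_nhds hp] with q hq using indicator_of_mem hq _
  have c1 : ContinuousAt (halfPlane.indicator v) p := (hv.smooth p hp).continuousAt.congr ev1.symm
  have ev2 : halfPlane.indicator v =ᶠ[𝓝 p'] fun _ => 0 := by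
    have ho : IsOpen {q : ℝ × ℝ | q.2 < 0} := isOpen_lt continuous_snd continuous_const
    filter_upwards [ho.mem_nhds (show (p'.2 : ℝ) < 0 by simp only [hp']; linarith)] with q hq
    exact indicator_of_notMem (by simp only [halfPlane, mem_ofPred_eq, not_lt]; exact le_of_lt hq) _
  have c2 : ContinuousAt (halfPlane.indicator v) p' := continuousAt_const.congr ev2.symm
  have t1 := (hv.tendsto_source c1).sub (hv.tendsto_source c2)
  rw [ev1.self_of_nhds, ev2.self_of_nhds, mul_zero, sub_zero] at t1
  -- the left-hand side
  set J : ℝ × ℝ → ℝ := fun q => Real.log (len (p - q)) - Real.log (len (p' - q)) with hJ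
  have hlapc : ContinuousOn (lap v) halfPlane := hv.cont_dxx.add hv.cont_dyy
  have t2 : Tendsto (fun c : ℝ => ∫ q in halfPlane, (regLog c⁻¹ p q - regLog c⁻¹ p' q) * lap v q) atTop
      (𝓝 (∫ q in halfPlane, J q * lap v q)) := by
    refine tendsto_integral_filter_of_dominated_convergence
      (fun q => (logDom L' p q + logDom L' p' q) * (2 * B)) ?_ ?_ ?_ ?_
    · filter_upwards [eventually_gt_atTop 0] with c hc
      refine AEStronglyMeasurable.mul ?_ (hlapc.aestronglyMeasurable measurableSet_halfPlane)
      exact ((contDiff_regLog (by positivity) p).continuous.sub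
        (contDiff_regLog (by positivity) p').continuous).aestronglyMeasurable
    · filter_upwards [eventually_ge_atTop 1] with c hc
      have hε : 0 < c⁻¹ := by positivity
      have hε1 : c⁻¹ ≤ 1 := inv_le_one_of_one_le₀ hc
      filter_upwards [ae_restrict_mem measurableSet_halfPlane, ae_restrict_of_ae (ae_ne_fst p.1)]
        with q hq hq1
      have d1 : 0 < len (p - q) := len_sub_pos hq1
      have d2 : 0 < len (p' - q) := len_sub_pos hq1
      have n1 : 0 ≤ logDom L' p q := by
        unfold logDom; exact indicator_nonneg (fun q _ => by have := len_nonneg (p - q); positivity) q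
      have n2 : 0 ≤ logDom L' p' q := by
        unfold logDom; exact indicator_nonneg (fun q _ => by have := len_nonneg (p' - q); positivity) q
      rcases le_or_gt (len q) L with hl | hl
      · have hbox : q ∈ sqBox 0 L' := mem_sqBox_zero (hl.trans (le_max_left _ _))
        rw [norm_mul]
        refine mul_le_mul ((norm_sub_le _ _).trans (add_le_add
          (abs_regLog_le_logDom hbox hε hε1 d1) (abs_regLog_le_logDom hbox hε hε1 d2))) ?_
          (norm_nonneg _) (by positivity)
        refine (abs_add_le _ _).trans ?_
        have := hv.dxx_le q hq
        have := hv.dyy_le q hq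
        linarith
      · rw [lap, hv.dxx_zero hq hl, hv.dyy_zero hq hl]
        simp only [add_zero, mul_zero, norm_zero]
        positivity
    · exact (((integrable_logDom hL0 p).add (integrable_logDom hL0 p')).mul_const (2 * B)).integrableOn
    · filter_upwards [ae_restrict_of_ae (ae_ne_fst p.1)] with q hq1
      exact ((tendsto_regLog (len_sub_pos hq1)).sub
        (tendsto_regLog (a := p') (len_sub_pos hq1))).mul_const _
  have hgreen : ∀ᶠ c : ℝ in atTop, ∫ q in halfPlane, (regLog c⁻¹ p q - regLog c⁻¹ p' q) * lap v q
      = (∫ q in halfPlane, v q * lap (regLog c⁻¹ p) q) - ∫ q in halfPlane, v q * lap (regLog c⁻¹ p') q := by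
    filter_upwards [eventually_gt_atTop 0] with c hc
    have hε : c⁻¹ ≠ 0 := by positivity
    have s1 := contDiff_regLog hε p
    have s2 := contDiff_regLog hε p'
    -- The two regularized logarithms agree on the wall, so their difference is admissible in
    -- Green's identity.
    have := hv.integral_green (K := fun q => regLog c⁻¹ p q - regLog c⁻¹ p' q) (s1.sub s2)
      (fun x => by simp only [regLog, hp']; ring_nf)
    rw [this]
    have int : ∀ a, IntegrableOn (fun q => v q * lap (regLog c⁻¹ a) q) halfPlane := by
      intro a
      have hs := contDiff_regLog hε a
      have hcont : Continuous (lap (regLog c⁻¹ a)) :=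
        (continuous_dxx_of_contDiff hs).add (continuous_dyy_of_contDiff hs)
      obtain ⟨B1, -, hb⟩ := exists_bound_on_ball hcont L
      refine integrableOn_halfPlane (L := L) (B := B * L * B1) (hv.cont.mul hcont.continuousOn) ?_ ?_
      · intro q hq hl
        rw [abs_mul]
        exact mul_le_mul (hv.val_le hq hl) (hb q hl) (abs_nonneg _)
          ((abs_nonneg _).trans (hv.val_le hq hl))
      · intro q hq hl
        rw [hv.zero q hq hl, zero_mul]
    rw [← integral_sub (int p) (int p')]
    congr 1
    funext q
    rw [lap_sub s1.contDiffAt s2.contDiffAt]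
    ring
  have hlim := tendsto_nhds_unique (t2.congr' hgreen) t1
  unfold invLap
  have e : ∫ q in halfPlane, (Real.log (len (p.1 - q.1, p.2 - q.2))
      - Real.log (len (p.1 - q.1, p.2 + q.2))) * -lap v q = -∫ q in halfPlane, J q * lap v q := by
    rw [← integral_neg]
    congr 1
    funext q
    rw [invLap_kernel_eq]
    simp only [hJ, hp']
    rw [show (p.1 - q.1, p.2 - q.2) = p - q from rfl]
    ring
  rw [e, hlim]
  field_simp

end IsTest

/-! ### Logarithmic potentials of continuously differentiable densities -/

/-- The convolution of a kernel with a density. -/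
noncomputable def kerConv (K g : ℝ × ℝ → ℝ) : ℝ × ℝ → ℝ :=
  convolution K g (ContinuousLinearMap.mul ℝ ℝ) volume

lemma kerConv_apply (K g : ℝ × ℝ → ℝ) (p : ℝ × ℝ) : kerConv K g p = ∫ t, K t * g (p - t) := rfl

lemma kerConv_swap (K g : ℝ × ℝ → ℝ) (p : ℝ × ℝ) : kerConv K g p = ∫ q, K (p - q) * g q := by
  rw [kerConv, convolution_eq_swap]; rfl

/-- Continuously differentiable functions supported in a square. -/
structure IsDensity (L : ℝ) (g : ℝ × ℝ → ℝ) : Prop where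
  smooth : ContDiff ℝ 1 g
  zero : ∀ q, q ∉ sqBox 0 L → g q = 0

lemma fderiv_eq_dx_dy {f : ℝ × ℝ → ℝ} {p : ℝ × ℝ} (h : DifferentiableAt ℝ f p) (y : ℝ × ℝ) :
    fderiv ℝ f p y = y.1 * dx f p + y.2 * dy f p := by
  rw [dx_eq_fderiv h, dy_eq_fderiv h, ← smul_eq_mul, ← smul_eq_mul, ← map_smul, ← map_smul, ← map_add]
  congr 1
  ext <;> simp

namespace IsDensity

variable {L : ℝ} {g : ℝ × ℝ → ℝ}

lemma hasCompactSupport (h : IsDensity L g) : HasCompactSupport g :=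
  HasCompactSupport.intro (isCompact_sqBox 0 L) h.zero

lemma dx_zero (h : IsDensity L g) {q : ℝ × ℝ} (hq : q ∉ sqBox 0 L) : dx g q = 0 := by
  have : g =ᶠ[𝓝 q] fun _ => 0 := by
    filter_upwards [(isCompact_sqBox 0 L).isClosed.isOpen_compl.mem_nhds hq] with z hz using h.zero z hz
  rw [dx_congr this]; simp [dx]

lemma dy_zero (h : IsDensity L g) {q : ℝ × ℝ} (hq : q ∉ sqBox 0 L) : dy g q = 0 := by
  have : g =ᶠ[𝓝 q] fun _ => 0 := by
    filter_upwards [(isCompact_sqBox 0 L).isClosed.isOpen_compl.mem_nhds hq] with z hz using h.zero z hz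
  rw [dy_congr this]; simp [dy]

lemma differentiableAt (h : IsDensity L g) (q : ℝ × ℝ) : DifferentiableAt ℝ g q :=
  (h.smooth.differentiable one_ne_zero) q

lemma continuous_dx (h : IsDensity L g) : Continuous (dx g) := by
  have : dx g = fun q => fderiv ℝ g q (1, 0) := funext fun q => dx_eq_fderiv (h.differentiableAt q)
  rw [this]
  exact (h.smooth.continuous_fderiv one_ne_zero).clm_apply continuous_const

lemma continuous_dy (h : IsDensity L g) : Continuous (dy g) := by
  have : dy g = fun q => fderiv ℝ g q (0, 1) := funext fun q => dy_eq_fderiv (h.differentiableAt q)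
  rw [this]
  exact (h.smooth.continuous_fderiv one_ne_zero).clm_apply continuous_const

lemma hasCompactSupport_dx (h : IsDensity L g) : HasCompactSupport (dx g) :=
  HasCompactSupport.intro (isCompact_sqBox 0 L) fun _ => h.dx_zero

lemma hasCompactSupport_dy (h : IsDensity L g) : HasCompactSupport (dy g) :=
  HasCompactSupport.intro (isCompact_sqBox 0 L) fun _ => h.dy_zero

variable {K : ℝ × ℝ → ℝ}

lemma hasFDerivAt_kerConv (h : IsDensity L g) (hK : LocallyIntegrable K) (p : ℝ × ℝ) :
    HasFDerivAt (kerConv K g)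
      (convolution K (fderiv ℝ g) ((ContinuousLinearMap.mul ℝ ℝ).precompR (ℝ × ℝ)) volume p) p :=
  h.hasCompactSupport.hasFDerivAt_convolution_right _ hK h.smooth p

lemma differentiableAt_kerConv (h : IsDensity L g) (hK : LocallyIntegrable K) (p : ℝ × ℝ) :
    DifferentiableAt ℝ (kerConv K g) p := (h.hasFDerivAt_kerConv hK p).differentiableAt

lemma fderiv_kerConv (h : IsDensity L g) (hK : LocallyIntegrable K) (p y : ℝ × ℝ) :
    fderiv ℝ (kerConv K g) p y = kerConv K (fun q => fderiv ℝ g q y) p := by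
  rw [(h.hasFDerivAt_kerConv hK p).fderiv, convolution_precompR_apply _ hK
    (h.hasCompactSupport.fderiv ℝ) (h.smooth.continuous_fderiv one_ne_zero)]
  rfl

lemma contDiff_kerConv (h : IsDensity L g) (hK : LocallyIntegrable K) :
    ContDiff ℝ 1 (kerConv K g) :=
  h.hasCompactSupport.contDiff_convolution_right _ hK h.smooth

lemma dx_kerConv (h : IsDensity L g) (hK : LocallyIntegrable K) :
    dx (kerConv K g) = kerConv K (dx g) := by
  funext p
  rw [dx_eq_fderiv (h.differentiableAt_kerConv hK p), h.fderiv_kerConv hK]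
  congr 1
  exact funext fun q => (dx_eq_fderiv (h.differentiableAt q)).symm

lemma dy_kerConv (h : IsDensity L g) (hK : LocallyIntegrable K) :
    dy (kerConv K g) = kerConv K (dy g) := by
  funext p
  rw [dy_eq_fderiv (h.differentiableAt_kerConv hK p), h.fderiv_kerConv hK]
  congr 1
  exact funext fun q => (dy_eq_fderiv (h.differentiableAt q)).symm

end IsDensity

/-! ### The logarithmic kernel and its derivatives -/

/-- The logarithmic kernel. -/
noncomputable def logKer (z : ℝ × ℝ) : ℝ := Real.log (len z)

/-- The first derivative of the logarithmic kernel. -/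
noncomputable def logKerX (z : ℝ × ℝ) : ℝ := z.1 / len z ^ 2

/-- The second derivative of the logarithmic kernel. -/
noncomputable def logKerY (z : ℝ × ℝ) : ℝ := z.2 / len z ^ 2

lemma abs_logKerX_le (z : ℝ × ℝ) : |logKerX z| ≤ (len z)⁻¹ := by
  rcases (len_nonneg z).eq_or_lt with h | h
  · simp [logKerX, ← h]
  · rw [logKerX, abs_div, abs_of_pos (by positivity : 0 < len z ^ 2), div_le_iff₀ (by positivity)]
    calc |z.1| ≤ len z := abs_fst_le_len z
      _ = (len z)⁻¹ * len z ^ 2 := by field_simp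

lemma abs_logKerY_le (z : ℝ × ℝ) : |logKerY z| ≤ (len z)⁻¹ := by
  rcases (len_nonneg z).eq_or_lt with h | h
  · simp [logKerY, ← h]
  · rw [logKerY, abs_div, abs_of_pos (by positivity : 0 < len z ^ 2), div_le_iff₀ (by positivity)]
    calc |z.2| ≤ len z := abs_snd_le_len z
      _ = (len z)⁻¹ * len z ^ 2 := by field_simp

lemma measurable_logKer : Measurable logKer := Real.measurable_log.comp measurable_len

lemma measurable_logKerX : Measurable logKerX := measurable_fst.div (measurable_len.pow_const 2)

lemma measurable_logKerY : Measurable logKerY := measurable_snd.div (measurable_len.pow_const 2)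

lemma locallyIntegrable_of_le_inv_len {K : ℝ × ℝ → ℝ} (hm : Measurable K)
    (h : ∀ z, |K z| ≤ len z + (len z)⁻¹) : LocallyIntegrable K := by
  rw [locallyIntegrable_iff]
  intro k hk
  obtain ⟨B, hB⟩ := hk.exists_bound_of_continuousOn continuous_len.continuousOn
  set L := max B 1
  have hL : 0 < L := lt_max_of_lt_right one_pos
  have hsub : k ⊆ sqBox 0 L := fun z hz => mem_sqBox_zero
    (((le_abs_self _).trans (hB z hz)).trans (le_max_left _ _))
  refine IntegrableOn.mono_set ?_ hsub
  rw [← integrable_indicator_iff (measurableSet_sqBox 0 L)]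
  refine integrable_of_le_inv_len (p := 0) (c := 0) (L := L) (a := 2 * L) (b := 1) hL
    (hm.indicator (measurableSet_sqBox 0 L)).aestronglyMeasurable
    (fun q hq => indicator_of_notMem hq _) fun q hq => ?_
  rw [indicator_of_mem hq]
  refine (h q).trans ?_
  have e : len (0 - q) = len q := by unfold len; congr 1; simp
  rw [e, one_mul]
  gcongr
  obtain ⟨h1, h2⟩ := mem_sqBox.1 hq
  simp only [Prod.fst_zero, Prod.snd_zero, sub_zero] at h1 h2
  exact (len_le_add q).trans (by linarith)

lemma locallyIntegrable_logKer : LocallyIntegrable logKer :=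
  locallyIntegrable_of_le_inv_len measurable_logKer fun z => abs_log_le (len_nonneg z)

lemma locallyIntegrable_logKerX : LocallyIntegrable logKerX :=
  locallyIntegrable_of_le_inv_len measurable_logKerX fun z =>
    (abs_logKerX_le z).trans (le_add_of_nonneg_left (len_nonneg z))

lemma locallyIntegrable_logKerY : LocallyIntegrable logKerY :=
  locallyIntegrable_of_le_inv_len measurable_logKerY fun z =>
    (abs_logKerY_le z).trans (le_add_of_nonneg_left (len_nonneg z))

lemma logKer_eq (z : ℝ × ℝ) : logKer z = Real.log (z.1 ^ 2 + z.2 ^ 2) / 2 := by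
  rw [logKer, len, Real.log_sqrt (by positivity)]

lemma hasDerivAt_logKer_fst {s t : ℝ} (h : t ≠ 0) :
    HasDerivAt (fun s => logKer (s, t)) (logKerX (s, t)) s := by
  have hp : s ^ 2 + t ^ 2 ≠ 0 := by positivity
  have h1 : HasDerivAt (fun s : ℝ => Real.log (s ^ 2 + t ^ 2) / 2) _ s :=
    ((((hasDerivAt_id s).pow 2).add_const (t ^ 2)).log hp).div_const 2
  have e : (fun s => logKer (s, t)) = fun s : ℝ => Real.log (s ^ 2 + t ^ 2) / 2 :=
    funext fun s => logKer_eq (s, t)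
  rw [e]
  refine h1.congr_deriv ?_
  rw [logKerX, len_sq]
  have hq : (id ^ 2) s + t ^ 2 = s ^ 2 + t ^ 2 := rfl
  rw [hq]
  simp only [id]
  field_simp
  simp [mul_comm]

lemma hasDerivAt_logKer_snd {s t : ℝ} (h : s ≠ 0) :
    HasDerivAt (fun t => logKer (s, t)) (logKerY (s, t)) t := by
  have hp : t ^ 2 + s ^ 2 ≠ 0 := by positivity
  have h1 := hasDerivAt_logKer_fst (s := t) (t := s) h
  have e : (fun t => logKer (s, t)) = fun t => logKer (t, s) := by
    funext t; rw [logKer_eq, logKer_eq, add_comm]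
  rw [e]
  refine h1.congr_deriv ?_
  rw [logKerX, logKerY, len_sq, len_sq]
  simp only
  rw [add_comm]

namespace IsDensity

variable {L : ℝ} {g : ℝ × ℝ → ℝ}

lemma integrable_ker (hc : HasCompactSupport g) (hg : Continuous g) {K : ℝ × ℝ → ℝ}
    (hK : LocallyIntegrable K) (p : ℝ × ℝ) : Integrable fun t => K t * g (p - t) :=
  hc.convolutionExists_right (ContinuousLinearMap.mul ℝ ℝ) hK hg p

/-- Integration by parts along the lines t ≠ 0, which avoid the pole: the difference of the
integrands is the derivative of log|(s,t)| g(p - (s,t)) in s, with compact support. The pole is met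
by a null set of lines only. -/
lemma kerConv_log_dx (h : IsDensity L g) : kerConv logKer (dx g) = kerConv logKerX g := by
  funext p
  rw [kerConv_apply, kerConv_apply, eq_comm, ← sub_eq_zero,
    ← integral_sub (integrable_ker h.hasCompactSupport h.smooth.continuous locallyIntegrable_logKerX p)
    (integrable_ker h.hasCompactSupport_dx h.continuous_dx locallyIntegrable_logKer p)]
  have hi : Integrable fun t => logKerX t * g (p - t) - logKer t * dx g (p - t) :=
    (integrable_ker h.hasCompactSupport h.smooth.continuous locallyIntegrable_logKerX p).sub
    (integrable_ker h.hasCompactSupport_dx h.continuous_dx locallyIntegrable_logKer p)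
  rw [Measure.volume_eq_prod] at hi ⊢
  rw [integral_prod_symm _ hi]
  refine integral_eq_zero_of_ae ?_
  have : ∀ᵐ t : ℝ, t ≠ 0 := by simp [ae_iff]
  filter_upwards [this] with t ht
  have hd : ∀ s : ℝ, HasDerivAt (fun s => logKer (s, t) * g (p - (s, t)))
      (logKerX (s, t) * g (p - (s, t)) - logKer (s, t) * dx g (p - (s, t))) s := by
    intro s
    have h1 : HasDerivAt (fun s => g (p - (s, t))) (-dx g (p - (s, t))) s := by
      have := HasDerivAt.scomp s (g₁ := fun r => g (r, p.2 - t)) (h := fun s => p.1 - s)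
        (hasDerivAt_dx (h.differentiableAt (p - (s, t)))) ((hasDerivAt_id s).const_sub p.1)
      refine HasDerivAt.congr_deriv (this : HasDerivAt (fun s => g (p - (s, t))) _ s) ?_
      simp
    exact ((hasDerivAt_logKer_fst ht).mul h1).congr_deriv (by ring)
  have hcl : Continuous fun s => logKer (s, t) := continuous_iff_continuousAt.2 fun s =>
    (hasDerivAt_logKer_fst ht).continuousAt
  have hcx : Continuous fun s => logKerX (s, t) := by
    unfold logKerX
    refine Continuous.div (by fun_prop) ((continuous_len.comp (by fun_prop)).pow 2) fun s => ?_
    rw [len_sq]; positivity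
  have hz : ∀ s, s ∉ Icc (p.1 - L) (p.1 + L) → p - (s, t) ∉ sqBox 0 L := by
    intro s hs hm
    have := abs_le.1 (mem_sqBox.1 hm).1
    simp only [Prod.fst_sub, Prod.fst_zero, sub_zero] at this
    exact hs ⟨by linarith, by linarith⟩
  have hgc : Continuous fun s : ℝ => g (p - (s, t)) := h.smooth.continuous.comp (by fun_prop)
  have hgx : Continuous fun s : ℝ => dx g (p - (s, t)) := h.continuous_dx.comp (by fun_prop)
  refine integral_eq_zero_of_hasDerivAt_of_integrable hd ?_ ?_
  · refine Continuous.integrable_of_hasCompactSupport ((hcx.mul hgc).sub (hcl.mul hgx))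
      (HasCompactSupport.intro (isCompact_Icc (a := p.1 - L) (b := p.1 + L)) fun s hs => ?_)
    rw [h.zero _ (hz s hs), h.dx_zero (hz s hs)]; simp
  · refine Continuous.integrable_of_hasCompactSupport (hcl.mul hgc)
      (HasCompactSupport.intro (isCompact_Icc (a := p.1 - L) (b := p.1 + L)) fun s hs => ?_)
    rw [h.zero _ (hz s hs)]; simp

lemma kerConv_log_dy (h : IsDensity L g) : kerConv logKer (dy g) = kerConv logKerY g := by
  funext p
  rw [kerConv_apply, kerConv_apply, eq_comm, ← sub_eq_zero,
    ← integral_sub (integrable_ker h.hasCompactSupport h.smooth.continuous locallyIntegrable_logKerY p)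
    (integrable_ker h.hasCompactSupport_dy h.continuous_dy locallyIntegrable_logKer p)]
  have hi : Integrable fun t => logKerY t * g (p - t) - logKer t * dy g (p - t) :=
    (integrable_ker h.hasCompactSupport h.smooth.continuous locallyIntegrable_logKerY p).sub
    (integrable_ker h.hasCompactSupport_dy h.continuous_dy locallyIntegrable_logKer p)
  rw [Measure.volume_eq_prod] at hi ⊢
  rw [integral_prod _ hi]
  refine integral_eq_zero_of_ae ?_
  have : ∀ᵐ t : ℝ, t ≠ 0 := by simp [ae_iff]
  filter_upwards [this] with t ht
  have hd : ∀ s : ℝ, HasDerivAt (fun s => logKer (t, s) * g (p - (t, s)))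
      (logKerY (t, s) * g (p - (t, s)) - logKer (t, s) * dy g (p - (t, s))) s := by
    intro s
    have h1 : HasDerivAt (fun s => g (p - (t, s))) (-dy g (p - (t, s))) s := by
      have := HasDerivAt.scomp s (g₁ := fun r => g (p.1 - t, r)) (h := fun s => p.2 - s)
        (hasDerivAt_dy (h.differentiableAt (p - (t, s)))) ((hasDerivAt_id s).const_sub p.2)
      refine HasDerivAt.congr_deriv (this : HasDerivAt (fun s => g (p - (t, s))) _ s) ?_
      simp
    exact ((hasDerivAt_logKer_snd ht).mul h1).congr_deriv (by ring)
  have hcl : Continuous fun s => logKer (t, s) := continuous_iff_continuousAt.2 fun s =>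
    (hasDerivAt_logKer_snd ht).continuousAt
  have hcx : Continuous fun s => logKerY (t, s) := by
    unfold logKerY
    refine Continuous.div (by fun_prop) ((continuous_len.comp (by fun_prop)).pow 2) fun s => ?_
    rw [len_sq]; positivity
  have hz : ∀ s, s ∉ Icc (p.2 - L) (p.2 + L) → p - (t, s) ∉ sqBox 0 L := by
    intro s hs hm
    have := abs_le.1 (mem_sqBox.1 hm).2
    simp only [Prod.snd_sub, Prod.snd_zero, sub_zero] at this
    exact hs ⟨by linarith, by linarith⟩
  have hgc : Continuous fun s : ℝ => g (p - (t, s)) := h.smooth.continuous.comp (by fun_prop)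
  have hgx : Continuous fun s : ℝ => dy g (p - (t, s)) := h.continuous_dy.comp (by fun_prop)
  refine integral_eq_zero_of_hasDerivAt_of_integrable hd ?_ ?_
  · refine Continuous.integrable_of_hasCompactSupport ((hcx.mul hgc).sub (hcl.mul hgx))
      (HasCompactSupport.intro (isCompact_Icc (a := p.2 - L) (b := p.2 + L)) fun s hs => ?_)
    rw [h.zero _ (hz s hs), h.dy_zero (hz s hs)]; simp
  · refine Continuous.integrable_of_hasCompactSupport (hcl.mul hgc)
      (HasCompactSupport.intro (isCompact_Icc (a := p.2 - L) (b := p.2 + L)) fun s hs => ?_)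
    rw [h.zero _ (hz s hs)]; simp

lemma dx_log (h : IsDensity L g) : dx (kerConv logKer g) = kerConv logKerX g := by
  rw [h.dx_kerConv locallyIntegrable_logKer, h.kerConv_log_dx]

lemma dy_log (h : IsDensity L g) : dy (kerConv logKer g) = kerConv logKerY g := by
  rw [h.dy_kerConv locallyIntegrable_logKer, h.kerConv_log_dy]

/-- The logarithmic potential of a `C¹` density is `C²`. -/
theorem contDiff_log (h : IsDensity L g) : ContDiff ℝ 2 (kerConv logKer g) := by
  have h2 : (2 : WithTop ℕ∞) = 1 + 1 := by norm_num
  rw [h2, contDiff_succ_iff_fderiv_apply]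
  refine ⟨fun p => h.differentiableAt_kerConv locallyIntegrable_logKer p, by simp, fun y => ?_⟩
  -- The differential of the potential is a combination of convolutions of the C¹ density with
  -- locally integrable kernels, and these are C¹ again.
  have : (fun p => fderiv ℝ (kerConv logKer g) p y)
      = fun p => y.1 * kerConv logKerX g p + y.2 * kerConv logKerY g p := by
    funext p
    rw [fderiv_eq_dx_dy (h.differentiableAt_kerConv locallyIntegrable_logKer p), h.dx_log, h.dy_log]
  rw [this]
  exact ((h.contDiff_kerConv locallyIntegrable_logKerX).const_smul y.1).add
    ((h.contDiff_kerConv locallyIntegrable_logKerY).const_smul y.2)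

end IsDensity

/-- The bound on f is required only off the null line q₂ = 0, as derivatives of an odd extension are
estimated only there. -/
lemma abs_kerConv_le {K f : ℝ × ℝ → ℝ} {L B : ℝ} (hL : 0 < L) (hB : 0 ≤ B)
    (hK : ∀ z, |K z| ≤ (len z)⁻¹) (hz : ∀ q, q ∉ sqBox 0 L → f q = 0)
    (hf : ∀ q : ℝ × ℝ, q.2 ≠ 0 → |f q| ≤ B) (p : ℝ × ℝ) : |kerConv K f p| ≤ 36 * L * B := by
  obtain ⟨h1, h2⟩ := integral_inv_len_le p 0 hL
  rw [kerConv_swap]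
  have h3 : ∫ q, (sqBox 0 L).indicator (fun q => (len (p - q))⁻¹ * B) q ≤ 36 * L * B := by
    rw [integral_indicator (measurableSet_sqBox 0 L), integral_mul_const]
    gcongr
  refine le_trans ?_ h3
  rw [← Real.norm_eq_abs]
  refine norm_integral_le_of_norm_le
    ((integrable_indicator_iff (measurableSet_sqBox 0 L)).2 (h1.mul_const B)) ?_
  filter_upwards [ae_ne_snd 0] with q hq
  by_cases hm : q ∈ sqBox 0 L
  · rw [indicator_of_mem hm, Real.norm_eq_abs, abs_mul]
    exact mul_le_mul (hK _) (hf q hq) (abs_nonneg _) (inv_nonneg.2 (len_nonneg _))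
  · rw [indicator_of_notMem hm, hz q hm]; simp

namespace IsDensity

variable {L : ℝ} {g : ℝ × ℝ → ℝ}

/-- Second derivatives of logarithmic potentials in terms of first derivatives of the density. -/
theorem hessBound_log (h : IsDensity L g) {B : ℝ} (hL : 0 < L)
    (hx : ∀ q : ℝ × ℝ, q.2 ≠ 0 → |dx g q| ≤ B) (hy : ∀ q : ℝ × ℝ, q.2 ≠ 0 → |dy g q| ≤ B)
    (p : ℝ × ℝ) : HessBound (kerConv logKer g) p (36 * L * B) := by
  have hB : 0 ≤ B := (abs_nonneg _).trans (hx (0, 1) one_ne_zero)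
  refine ⟨?_, ?_, ?_, ?_⟩
  · rw [h.dx_log, h.dx_kerConv locallyIntegrable_logKerX]
    exact abs_kerConv_le hL hB abs_logKerX_le (fun q => h.dx_zero) hx p
  · rw [h.dy_log, h.dx_kerConv locallyIntegrable_logKerY]
    exact abs_kerConv_le hL hB abs_logKerY_le (fun q => h.dx_zero) hx p
  · rw [h.dx_log, h.dy_kerConv locallyIntegrable_logKerX]
    exact abs_kerConv_le hL hB abs_logKerX_le (fun q => h.dy_zero) hy p
  · rw [h.dy_log, h.dy_kerConv locallyIntegrable_logKerY]
    exact abs_kerConv_le hL hB abs_logKerY_le (fun q => h.dy_zero) hy p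

end IsDensity

/-! ### Reflection across the wall -/

lemma measurePreserving_reflect :
    MeasurePreserving (fun q : ℝ × ℝ => (q.1, -q.2)) volume volume := by
  have := (MeasurePreserving.id (volume : Measure ℝ)).prod (Measure.measurePreserving_neg (volume : Measure ℝ))
  exact this

/-- The reflection maps the lower half plane onto the upper one up to the null line q₂ = 0. -/
lemma integral_eq_halfPlane {F : ℝ × ℝ → ℝ} (hF : Integrable F) :
    ∫ q, F q = ∫ q in halfPlane, (F q + F (q.1, -q.2)) := by
  have hr : MeasurableEmbedding (fun q : ℝ × ℝ => (q.1, -q.2)) :=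
    ((MeasurableEquiv.refl ℝ).prodCongr (MeasurableEquiv.neg ℝ)).measurableEmbedding
  have hF' : Integrable fun q : ℝ × ℝ => F (q.1, -q.2) :=
    measurePreserving_reflect.integrable_comp_emb hr |>.2 hF
  rw [integral_add hF.integrableOn hF'.integrableOn, ← integral_add_compl measurableSet_halfPlane hF]
  congr 1
  have h1 := measurePreserving_reflect.setIntegral_preimage_emb hr F halfPlaneᶜ
  rw [← h1]
  refine setIntegral_congr_set ?_
  filter_upwards [ae_ne_snd 0] with q hq
  apply propext
  show ¬ (0 < -q.2) ↔ 0 < q.2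
  constructor
  · intro h
    exact lt_of_le_of_ne (by linarith) (Ne.symm hq)
  · intro h; linarith

/-- For densities that are odd across the wall, the Green potential is a logarithmic potential. -/
theorem invLap_eq_kerConv {L : ℝ} {g : ℝ × ℝ → ℝ} (h : IsDensity L g)
    (hodd : ∀ q : ℝ × ℝ, g (q.1, -q.2) = -g q) (p : ℝ × ℝ) :
    invLap g p = -(1 / (2 * Real.pi)) * kerConv logKer g p := by
  have hi : Integrable fun q => logKer (p - q) * g q := by
    have := (h.hasCompactSupport.convolutionExists_right (ContinuousLinearMap.mul ℝ ℝ)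
      locallyIntegrable_logKer h.smooth.continuous p).integrable_swap
    exact this
  rw [invLap, kerConv_swap, integral_eq_halfPlane hi]
  congr 2
  funext q
  rw [hodd]
  have : p - (q.1, -q.2) = (p.1 - q.1, p.2 + q.2) := by ext <;> simp
  rw [this, logKer, logKer]
  have : p - q = (p.1 - q.1, p.2 - q.2) := rfl
  rw [this]
  ring

lemma invLap_congr {f g : ℝ × ℝ → ℝ} (h : ∀ q ∈ halfPlane, f q = g q) : invLap f = invLap g := by
  funext p
  unfold invLap
  congr 1
  exact setIntegral_congr_fun measurableSet_halfPlane fun q hq => by simp only [h q hq]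

lemma two_pi_inv_abs_le : |-(1 / (2 * Real.pi))| ≤ 1 := by
  rw [abs_neg, abs_of_pos (by positivity), div_le_one (by positivity)]
  linarith [Real.pi_gt_three]

lemma HessBound.const_mul {f : ℝ × ℝ → ℝ} {p : ℝ × ℝ} {b : ℝ} (h : HessBound f p b) {c : ℝ} (hc : |c| ≤ 1) :
    HessBound (fun q => c * f q) p b := by
  have e1 : dx (fun q => c * f q) = fun q => c * dx f q := funext fun q => dx_const_mul ..
  have e2 : dy (fun q => c * f q) = fun q => c * dy f q := funext fun q => dy_const_mul ..
  have key : ∀ t, |t| ≤ b → |c * t| ≤ b := fun t ht => by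
    rw [abs_mul]; nlinarith [abs_nonneg t, abs_nonneg c]
  refine ⟨?_, ?_, ?_, ?_⟩
  · rw [e1, dx_const_mul]; exact key _ h.xx
  · rw [e2, dx_const_mul]; exact key _ h.xy
  · rw [e1, dy_const_mul]; exact key _ h.yx
  · rw [e2, dy_const_mul]; exact key _ h.yy

/-- Green potentials of odd `C¹` densities are `C²`, with a bound on the second derivatives. -/
theorem contDiff_invLap_of_odd {L B : ℝ} {g : ℝ × ℝ → ℝ} (h : IsDensity L g) (hL : 0 < L)
    (hodd : ∀ q : ℝ × ℝ, g (q.1, -q.2) = -g q)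
    (hx : ∀ q : ℝ × ℝ, q.2 ≠ 0 → |dx g q| ≤ B) (hy : ∀ q : ℝ × ℝ, q.2 ≠ 0 → |dy g q| ≤ B) :
    ContDiff ℝ 2 (invLap g) ∧ ∀ p, HessBound (invLap g) p (36 * L * B) := by
  have e : invLap g = fun p => -(1 / (2 * Real.pi)) * kerConv logKer g p :=
    funext fun p => invLap_eq_kerConv h hodd p
  rw [e]
  exact ⟨contDiff_const.mul h.contDiff_log, fun p => (h.hessBound_log hL hx hy p).const_mul two_pi_inv_abs_le⟩

/-! ### Odd extension across the wall -/

/-- The odd extension of a function on the closed half plane. -/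
noncomputable def oddExt (g : ℝ × ℝ → ℝ) (q : ℝ × ℝ) : ℝ := if 0 ≤ q.2 then g q else -g (q.1, -q.2)

lemma oddExt_of_nonneg (g : ℝ × ℝ → ℝ) {q : ℝ × ℝ} (h : 0 ≤ q.2) : oddExt g q = g q := if_pos h

lemma oddExt_of_neg (g : ℝ × ℝ → ℝ) {q : ℝ × ℝ} (h : q.2 < 0) : oddExt g q = -g (q.1, -q.2) :=
  if_neg (not_le.2 h)

lemma oddExt_of_nonpos {g : ℝ × ℝ → ℝ} (h0 : ∀ x, g (x, 0) = 0) {q : ℝ × ℝ} (h : q.2 ≤ 0) :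
    oddExt g q = -g (q.1, -q.2) := by
  rcases h.eq_or_lt with e | h
  · obtain ⟨x, y⟩ := q
    simp only at e
    subst e
    rw [oddExt_of_nonneg g le_rfl]
    simp [h0]
  · exact oddExt_of_neg g h

lemma oddExt_reflect {g : ℝ × ℝ → ℝ} (h0 : ∀ x, g (x, 0) = 0) (q : ℝ × ℝ) :
    oddExt g (q.1, -q.2) = -oddExt g q := by
  rcases le_total 0 q.2 with h | h
  · rw [oddExt_of_nonpos h0 (q := (q.1, -q.2)) (by simpa using h), oddExt_of_nonneg g h]
    simp
  · rw [oddExt_of_nonpos h0 h, oddExt_of_nonneg g (q := (q.1, -q.2)) (by simpa using h)]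
    simp

lemma uniqueDiffOn_closedHalfPlane : UniqueDiffOn ℝ closedHalfPlane := by
  have : closedHalfPlane = univ ×ˢ Ici (0 : ℝ) := by ext p; simp [closedHalfPlane]
  rw [this]
  exact uniqueDiffOn_univ.prod (uniqueDiffOn_Ici 0)

/-- The reflection across the wall. -/
noncomputable def reflectL : (ℝ × ℝ) →L[ℝ] ℝ × ℝ :=
  (ContinuousLinearMap.fst ℝ ℝ ℝ).prod (-ContinuousLinearMap.snd ℝ ℝ ℝ)

lemma reflectL_apply (q : ℝ × ℝ) : reflectL q = (q.1, -q.2) := rfl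

lemma fderivWithin_wall_fst {g : ℝ × ℝ → ℝ} (hg : DifferentiableOn ℝ g closedHalfPlane)
    (h0 : ∀ x, g (x, 0) = 0) (x : ℝ) : fderivWithin ℝ g closedHalfPlane (x, 0) (1, 0) = 0 := by
  have h1 : HasFDerivWithinAt g (fderivWithin ℝ g closedHalfPlane (x, 0)) closedHalfPlane (x, 0) :=
    (hg (x, 0) (show (0 : ℝ) ≤ 0 from le_rfl)).hasFDerivWithinAt
  have h2 : HasDerivAt (fun t : ℝ => (t, (0 : ℝ))) ((1 : ℝ), (0 : ℝ)) x :=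
    (hasDerivAt_id x).prodMk (hasDerivAt_const x 0)
  have h3 := h1.comp_hasDerivAt (f := fun t : ℝ => (t, (0 : ℝ))) x h2
    (Eventually.of_forall fun t => show (0 : ℝ) ≤ 0 from le_rfl)
  have h4 : HasDerivAt (fun _ : ℝ => (0 : ℝ)) _ x :=
    h3.congr_of_eventuallyEq (Eventually.of_forall fun t => (h0 t).symm)
  exact h4.unique (hasDerivAt_const x 0)

/-- The odd extension of a `C¹` function vanishing on the wall is `C¹`. -/
theorem contDiff_oddExt {g : ℝ × ℝ → ℝ} (hg : ContDiffOn ℝ 1 g closedHalfPlane)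
    (h0 : ∀ x, g (x, 0) = 0) : ContDiff ℝ 1 (oddExt g) := by
  set D := fderivWithin ℝ g closedHalfPlane with hD
  have hd : DifferentiableOn ℝ g closedHalfPlane := hg.differentiableOn one_ne_zero
  have hDc : ContinuousOn D closedHalfPlane :=
    hg.continuousOn_fderivWithin uniqueDiffOn_closedHalfPlane le_rfl
  set low : Set (ℝ × ℝ) := {q | q.2 ≤ 0} with hlow
  have hlc : IsClosed low := isClosed_le continuous_snd continuous_const
  set E : ℝ × ℝ → (ℝ × ℝ →L[ℝ] ℝ) := fun q => -(D (reflectL q)).comp reflectL with hE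
  have hmaps : MapsTo reflectL low closedHalfPlane := fun q (hq : q.2 ≤ 0) =>
    show 0 ≤ -q.2 by linarith
  have hEc : ContinuousOn E low := by
    have h1 : ContinuousOn (fun q => D (reflectL q)) low := hDc.comp reflectL.continuous.continuousOn hmaps
    exact (h1.clm_comp continuousOn_const).neg
  -- The one-sided differentials match on the wall: the tangential derivative is zero as g vanishes
  -- there, and the normal derivative changes sign twice under odd reflection.
  have hwall : ∀ q : ℝ × ℝ, q.2 = 0 → D q = E q := by
    rintro ⟨x, y⟩ (hy : y = 0)
    subst hy
    have hx0 := fderivWithin_wall_fst hd h0 x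
    have hr : reflectL (x, 0) = (x, 0) := by simp [reflectL_apply]
    ext
    · simp only [hE, hr, hD]
      simp [reflectL_apply, hx0]
    · simp only [hE, hr]
      simp only [ContinuousLinearMap.comp_apply, neg_apply,
        ContinuousLinearMap.inr_apply, reflectL_apply]
      rw [← map_neg]
      congr 1
      simp
  -- The glued differential. It is continuous on each of the two closed half planes, hence
  -- everywhere, and it is the derivative within each of them.
  set T : ℝ × ℝ → (ℝ × ℝ →L[ℝ] ℝ) := fun q => if 0 ≤ q.2 then D q else E q with hT
  have hT1 : EqOn T D closedHalfPlane := fun q (hq : 0 ≤ q.2) => if_pos hq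
  have hT2 : EqOn T E low := by
    intro q (hq : q.2 ≤ 0)
    rcases hq.eq_or_lt with e | h
    · simp only [hT, e, le_refl, if_true, hwall q e]
    · exact if_neg (not_le.2 h)
  have hun : closedHalfPlane ∪ low = univ := by
    ext q; simp only [mem_union, mem_univ, iff_true]
    exact le_total 0 q.2
  have hTc : Continuous T := by
    rw [← continuousOn_univ, ← hun]
    exact (hDc.congr hT1).union_of_isClosed (hEc.congr hT2) isClosed_closedHalfPlane hlc
  have hfd : ∀ q, HasFDerivAt (oddExt g) (T q) q := by
    intro q
    have h1 : HasFDerivWithinAt (oddExt g) (T q) closedHalfPlane q := by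
      by_cases hq : q ∈ closedHalfPlane
      · rw [hT1 hq]
        exact (hd q hq).hasFDerivWithinAt.congr (fun z hz => oddExt_of_nonneg g hz) (oddExt_of_nonneg g hq)
      · exact HasFDerivWithinAt.of_notMem_closure (by rwa [isClosed_closedHalfPlane.closure_eq])
    have h2 : HasFDerivWithinAt (oddExt g) (T q) low q := by
      by_cases hq : q ∈ low
      · rw [hT2 hq]
        have h3 := ((hd _ (hmaps hq)).hasFDerivWithinAt.comp q
          reflectL.hasFDerivAt.hasFDerivWithinAt hmaps).neg
        exact h3.congr (fun z hz => oddExt_of_nonpos h0 hz) (oddExt_of_nonpos h0 hq)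
      · exact HasFDerivWithinAt.of_notMem_closure (by rwa [hlc.closure_eq])
    have := h1.union h2
    rwa [hun, hasFDerivWithinAt_univ] at this
  rw [contDiff_one_iff_fderiv]
  refine ⟨fun q => (hfd q).differentiableAt, ?_⟩
  have : fderiv ℝ (oddExt g) = T := funext fun q => (hfd q).fderiv
  rwa [this]

lemma oddExt_eventuallyEq (g : ℝ × ℝ → ℝ) {q : ℝ × ℝ} (h : 0 < q.2) : oddExt g =ᶠ[𝓝 q] g := by
  filter_upwards [isOpen_halfPlane.mem_nhds (show q ∈ halfPlane from h)] with z hz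
  exact oddExt_of_nonneg g (le_of_lt (show 0 < z.2 from hz))

lemma abs_dx_oddExt_le {g : ℝ × ℝ → ℝ} {B : ℝ} (h : ∀ q ∈ halfPlane, |dx g q| ≤ B) {q : ℝ × ℝ}
    (hq : q.2 ≠ 0) : |dx (oddExt g) q| ≤ B := by
  rcases lt_or_gt_of_ne hq with h1 | h1
  · have : dx (oddExt g) q = -dx g (q.1, -q.2) := by
      unfold dx
      rw [← deriv.fun_neg]
      congr 1
      funext t
      exact oddExt_of_neg g (q := (t, q.2)) h1
    rw [this, abs_neg]
    exact h _ (show 0 < -q.2 by linarith)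
  · rw [dx_congr (oddExt_eventuallyEq g h1)]; exact h q h1

lemma abs_dy_oddExt_le {g : ℝ × ℝ → ℝ} {B : ℝ} (h : ∀ q ∈ halfPlane, |dy g q| ≤ B) {q : ℝ × ℝ}
    (hq : q.2 ≠ 0) : |dy (oddExt g) q| ≤ B := by
  rcases lt_or_gt_of_ne hq with h1 | h1
  · have : dy (oddExt g) q = dy g (q.1, -q.2) := by
      unfold dy
      have e : (fun t => oddExt g (q.1, t)) =ᶠ[𝓝 q.2] fun t => -(fun s => g (q.1, s)) (-t) := by
        filter_upwards [Iio_mem_nhds h1] with t ht using oddExt_of_neg g (q := (q.1, t)) ht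
      rw [e.deriv_eq, deriv.fun_neg, deriv_comp_neg (f := fun s => g (q.1, s))]
      simp
    rw [this]
    exact h _ (show 0 < -q.2 by linarith)
  · rw [dy_congr (oddExt_eventuallyEq g h1)]; exact h q h1

/-- Green potentials of `C¹` densities vanishing on the wall are `C²`, with a bound on the second
derivatives. -/
theorem contDiff_invLap {L B : ℝ} {g : ℝ × ℝ → ℝ} (hg : ContDiffOn ℝ 1 g closedHalfPlane)
    (h0 : ∀ x, g (x, 0) = 0) (hL : 0 < L) (hz : ∀ q ∈ closedHalfPlane, L < len q → g q = 0)
    (hx : ∀ q ∈ halfPlane, |dx g q| ≤ B) (hy : ∀ q ∈ halfPlane, |dy g q| ≤ B) :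
    ContDiff ℝ 2 (invLap g) ∧ ∀ p, HessBound (invLap g) p (36 * L * B) := by
  have e : invLap g = invLap (oddExt g) := invLap_congr fun q hq =>
    (oddExt_of_nonneg g (le_of_lt (show 0 < q.2 from hq))).symm
  rw [e]
  have hzero : ∀ q, L < len q → oddExt g q = 0 := by
    intro q hq
    rcases le_or_gt 0 q.2 with h | h
    · rw [oddExt_of_nonneg g h]; exact hz q h hq
    · rw [oddExt_of_neg g h, hz (q.1, -q.2) (show 0 ≤ -q.2 by linarith) (by simpa [len] using hq), neg_zero]
  refine contDiff_invLap_of_odd (L := L) ⟨contDiff_oddExt hg h0, fun q hq => hzero q ?_⟩ hL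
    (oddExt_reflect h0) (fun q => abs_dx_oddExt_le hx) (fun q => abs_dy_oddExt_le hy)
  by_contra! h
  exact hq (mem_sqBox_zero h)

lemma invLap_wall (g : ℝ × ℝ → ℝ) (x : ℝ) : invLap g (x, 0) = 0 := by
  simp [invLap, len]

/-! ### Expansion of Green potentials at the origin -/

/-- Half of the kernel of the Green potential, antisymmetrized in `x₁`. -/
noncomputable def oddKer (p q : ℝ × ℝ) : ℝ :=
  (Real.log (len (p - q)) - Real.log (len ((p.1, -p.2) - q))
    - Real.log (len ((-p.1, p.2) - q)) + Real.log (len ((-p.1, -p.2) - q))) / 2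

lemma two_log_len (z : ℝ × ℝ) : Real.log (len z) = Real.log (z.1 ^ 2 + z.2 ^ 2) / 2 := logKer_eq z

/-- With z = a + ic and w = b + id of moduli r² and s², the quotient |z - w|²/|z - w̄|² equals 1 -
t, where t = 4cd/D and D = |z - w̄|². Then log(1-t) = -t + O(t²) contributes 32, and D = s⁴ +
O(r²s²) allows cd/D to be replaced by cd/s⁴ at the cost of 6. -/
lemma far_kernel_scalar {a b c d r s : ℝ} (hr : 0 < r) (hs : 4 * r ≤ s) (h1 : a ^ 2 + c ^ 2 = r ^ 4)
    (h2 : b ^ 2 + d ^ 2 = s ^ 4) :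
    |Real.log (((a - b) ^ 2 + (c - d) ^ 2) / ((a - b) ^ 2 + (c + d) ^ 2)) / 4 + c * d / s ^ 4|
      ≤ 38 * (r ^ 4 / s ^ 4) := by
  have hs0 : 0 < s := by linarith
  set D := (a - b) ^ 2 + (c + d) ^ 2 with hD
  have hc : |c| ≤ r ^ 2 := abs_le_of_sq_le_sq (by nlinarith [sq_nonneg a]) (by positivity)
  have hd : |d| ≤ s ^ 2 := abs_le_of_sq_le_sq (by nlinarith [sq_nonneg b]) (by positivity)
  have hcd : |c * d| ≤ r ^ 2 * s ^ 2 := by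
    rw [abs_mul]; exact mul_le_mul hc hd (abs_nonneg _) (by positivity)
  have hcs : |c * d - a * b| ≤ r ^ 2 * s ^ 2 := by
    refine abs_le_of_sq_le_sq ?_ (by positivity)
    have : (r ^ 2 * s ^ 2) ^ 2 = (a ^ 2 + c ^ 2) * (b ^ 2 + d ^ 2) := by rw [h1, h2]; ring
    rw [this]; nlinarith [sq_nonneg (a * d + b * c)]
  have hrs : 16 * r ^ 2 ≤ s ^ 2 := by nlinarith
  have hDs : |D - s ^ 4| ≤ 3 * (r ^ 2 * s ^ 2) := by
    have e : D - s ^ 4 = r ^ 4 + 2 * (c * d - a * b) := by rw [hD, ← h1, ← h2]; ring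
    rw [e]
    have h4 : r ^ 4 ≤ r ^ 2 * s ^ 2 := by nlinarith [sq_nonneg r]
    have := abs_add_le (r ^ 4) (2 * (c * d - a * b))
    rw [abs_mul, abs_of_pos (by positivity : 0 < r ^ 4), abs_two] at this
    linarith
  have hDl : s ^ 4 / 2 ≤ D := by
    have h3 : 16 * (r ^ 2 * s ^ 2) ≤ s ^ 4 := by nlinarith [sq_nonneg s]
    have := (abs_le.1 hDs).1
    have : 0 < s ^ 4 := by positivity
    linarith
  have hD0 : 0 < D := lt_of_lt_of_le (by positivity) hDl
  set t := 4 * (c * d) / D with ht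
  have e1 : ((a - b) ^ 2 + (c - d) ^ 2) / D = 1 - t := by
    rw [ht, eq_sub_iff_add_eq, ← add_div, div_eq_one_iff_eq hD0.ne', hD]; ring
  have hta : |t| ≤ 8 * (r ^ 2 / s ^ 2) := by
    rw [ht, abs_div, abs_of_pos hD0, abs_mul, abs_of_pos (by norm_num : (0 : ℝ) < 4), div_le_iff₀ hD0]
    have : 8 * (r ^ 2 / s ^ 2) * (s ^ 4 / 2) = 4 * (r ^ 2 * s ^ 2) := by field_simp; norm_num
    have h5 : 8 * (r ^ 2 / s ^ 2) * (s ^ 4 / 2) ≤ 8 * (r ^ 2 / s ^ 2) * D := by gcongr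
    linarith
  have hth : |t| ≤ 1 / 2 := by
    have : r ^ 2 / s ^ 2 ≤ 1 / 16 := by rw [div_le_iff₀ (by positivity)]; linarith
    linarith
  have hlog : |Real.log (1 - t) + t| ≤ 2 * t ^ 2 := by
    have := Real.abs_log_sub_add_sum_range_le (x := t) (by linarith) 1
    simp only [Finset.range_one, Finset.sum_singleton, Nat.cast_zero, zero_add, pow_one, div_one] at this
    rw [add_comm]
    refine this.trans ?_
    rw [div_le_iff₀ (by linarith), show (1 + 1) = 2 from rfl, sq_abs]
    nlinarith [sq_nonneg t]
  have htt : t ^ 2 ≤ 64 * (r ^ 4 / s ^ 4) := by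
    rw [← sq_abs]
    calc |t| ^ 2 ≤ (8 * (r ^ 2 / s ^ 2)) ^ 2 := by gcongr
      _ = _ := by field_simp; norm_num
  have e2 : |c * d / s ^ 4 - t / 4| ≤ 6 * (r ^ 4 / s ^ 4) := by
    have : c * d / s ^ 4 - t / 4 = c * d * (D - s ^ 4) / (s ^ 4 * D) := by
      rw [ht]; field_simp
    rw [this, abs_div, abs_mul, abs_of_pos (by positivity : 0 < s ^ 4 * D), div_le_iff₀ (by positivity)]
    calc |c * d| * |D - s ^ 4| ≤ (r ^ 2 * s ^ 2) * (3 * (r ^ 2 * s ^ 2)) := by gcongr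
      _ = 6 * (r ^ 4 / s ^ 4) * (s ^ 4 * (s ^ 4 / 2)) := by field_simp; norm_num
      _ ≤ _ := by gcongr
  rw [e1]
  have : Real.log (1 - t) / 4 + c * d / s ^ 4 = (Real.log (1 - t) + t) / 4 + (c * d / s ^ 4 - t / 4) := by
    ring
  rw [this]
  refine (abs_add_le _ _).trans ?_
  rw [abs_div, abs_of_pos (by norm_num : (0 : ℝ) < 4)]
  linarith

/-- In complex notation the product of p - q and -p - q is q² - p², so squaring merges the four
image poles into two and reduces the claim to the scalar estimate, with z = p² and w = q². -/
lemma oddKer_far {p q : ℝ × ℝ} (hp : 0 < len p) (hq : 4 * len p ≤ len q) :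
    |oddKer p q + 4 * (p.1 * p.2) * (q.1 * q.2 / len q ^ 4)| ≤ 38 * (len p ^ 4 / len q ^ 4) := by
  have e4 (z : ℝ × ℝ) : (z.1 ^ 2 - z.2 ^ 2) ^ 2 + (2 * z.1 * z.2) ^ 2 = len z ^ 4 := by
    have : len z ^ 4 = (len z ^ 2) ^ 2 := by ring
    rw [this, len_sq]; ring
  have hlen (z : ℝ × ℝ) (hz : len z = len p) : (z.1 - q.1) ^ 2 + (z.2 - q.2) ^ 2 ≠ 0 := by
    intro h
    have h1 : z.1 = q.1 := by nlinarith [sq_nonneg (z.1 - q.1), sq_nonneg (z.2 - q.2)]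
    have h2 : z.2 = q.2 := by nlinarith [sq_nonneg (z.1 - q.1), sq_nonneg (z.2 - q.2)]
    have : z = q := Prod.ext h1 h2
    subst this
    linarith
  have n1 := hlen p rfl
  have n2 := hlen (p.1, -p.2) (by simp [len])
  have n3 := hlen (-p.1, p.2) (by simp [len])
  have n4 := hlen (-p.1, -p.2) (by simp [len])
  have key := far_kernel_scalar hp hq (e4 p) (e4 q)
  have : oddKer p q = Real.log (((p.1 ^ 2 - p.2 ^ 2 - (q.1 ^ 2 - q.2 ^ 2)) ^ 2
      + (2 * p.1 * p.2 - 2 * q.1 * q.2) ^ 2) / ((p.1 ^ 2 - p.2 ^ 2 - (q.1 ^ 2 - q.2 ^ 2)) ^ 2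
      + (2 * p.1 * p.2 + 2 * q.1 * q.2) ^ 2)) / 4 := by
    have f1 : (p.1 ^ 2 - p.2 ^ 2 - (q.1 ^ 2 - q.2 ^ 2)) ^ 2 + (2 * p.1 * p.2 - 2 * q.1 * q.2) ^ 2
        = ((p.1 - q.1) ^ 2 + (p.2 - q.2) ^ 2) * ((-p.1 - q.1) ^ 2 + (-p.2 - q.2) ^ 2) := by ring
    have f2 : (p.1 ^ 2 - p.2 ^ 2 - (q.1 ^ 2 - q.2 ^ 2)) ^ 2 + (2 * p.1 * p.2 + 2 * q.1 * q.2) ^ 2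
        = ((p.1 - q.1) ^ 2 + (-p.2 - q.2) ^ 2) * ((-p.1 - q.1) ^ 2 + (p.2 - q.2) ^ 2) := by ring
    rw [f1, f2, Real.log_div (mul_ne_zero n1 n4) (mul_ne_zero n2 n3), Real.log_mul n1 n4,
      Real.log_mul n2 n3, oddKer, two_log_len, two_log_len, two_log_len, two_log_len]
    simp only [Prod.fst_sub, Prod.snd_sub]
    ring
  rw [this]
  convert key using 2
  ring

lemma abs_log_len_sub {r : ℝ} (hr : 0 < r) (a q : ℝ × ℝ) (ha : len a = r) (hq : len q ≤ 4 * r)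
    (h : 0 < len (a - q)) : |Real.log (len (a - q)) - Real.log r| ≤ 5 + r * (len (a - q))⁻¹ := by
  rw [← Real.log_div h.ne' hr.ne']
  refine (abs_log_le (by positivity)).trans ?_
  rw [inv_div, div_eq_mul_inv r]
  gcongr
  rw [div_le_iff₀ hr]
  have := len_triangle a (-q)
  rw [← sub_eq_add_neg] at this
  have e : len (-q) = len q := by unfold len; simp
  linarith

/-- The four signs add up to zero, so log|p| may be subtracted from each logarithm; this makes the
bound scale invariant. -/
lemma oddKer_near {p q : ℝ × ℝ} (hp : 0 < len p) (hq : len q ≤ 4 * len p) (h1 : q.1 ≠ p.1)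
    (h2 : q.1 ≠ -p.1) :
    |oddKer p q| ≤ 10 + len p * ((len (p - q))⁻¹ + (len ((p.1, -p.2) - q))⁻¹
      + (len ((-p.1, p.2) - q))⁻¹ + (len ((-p.1, -p.2) - q))⁻¹) := by
  have a1 := abs_log_len_sub hp p q rfl hq (len_sub_pos h1)
  have a2 := abs_log_len_sub hp (p.1, -p.2) q (by simp [len]) hq (len_sub_pos h1)
  have a3 := abs_log_len_sub hp (-p.1, p.2) q (by simp [len]) hq (len_sub_pos h2)
  have a4 := abs_log_len_sub hp (-p.1, -p.2) q (by simp [len]) hq (len_sub_pos h2)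
  have b1 := inv_nonneg.2 (len_nonneg (p - q))
  have b2 := inv_nonneg.2 (len_nonneg ((p.1, -p.2) - q))
  have b3 := inv_nonneg.2 (len_nonneg ((-p.1, p.2) - q))
  have b4 := inv_nonneg.2 (len_nonneg ((-p.1, -p.2) - q))
  have c1 := mul_nonneg hp.le b1
  have c2 := mul_nonneg hp.le b2
  have c3 := mul_nonneg hp.le b3
  have c4 := mul_nonneg hp.le b4
  rw [oddKer, abs_le]
  rw [abs_le] at a1 a2 a3 a4
  constructor <;> linarith [a1.1, a1.2, a2.1, a2.2, a3.1, a3.2, a4.1, a4.2]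

/-- A majorant for the remainder in the expansion of the kernel. -/
noncomputable def kerDom (p q : ℝ × ℝ) : ℝ :=
  (sqBox 0 (4 * len p)).indicator (fun q => 40 * len p + 4 * len p ^ 2 * ((len (p - q))⁻¹
    + (len ((p.1, -p.2) - q))⁻¹ + (len ((-p.1, p.2) - q))⁻¹ + (len ((-p.1, -p.2) - q))⁻¹
    + (len (0 - q))⁻¹)) q
  + 304 * len p * (1 + ‖(len p)⁻¹ • q‖) ^ (-3 : ℝ)

lemma norm_le_len (z : ℝ × ℝ) : ‖z‖ ≤ len z := by
  rw [Prod.norm_def]; exact max_le (abs_fst_le_len z) (abs_snd_le_len z)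

/-- The factor |q| is the growth of the density. With it the subtracted term is O(|p|²/|q|) near the
origin, and the far remainder O(|p|⁴/|q|³) is integrable at infinity. -/
lemma abs_oddKer_le_kerDom {p q : ℝ × ℝ} (hp : 0 < len p) (h1 : q.1 ≠ p.1) (h2 : q.1 ≠ -p.1)
    (h3 : q.1 ≠ 0) :
    |oddKer p q + 4 * (p.1 * p.2) * (q.1 * q.2 / len q ^ 4)| * len q ≤ kerDom p q := by
  have hq : 0 < len q := (abs_pos.2 h3).trans_le (abs_fst_le_len q)
  have b1 := inv_nonneg.2 (len_nonneg (p - q))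
  have b2 := inv_nonneg.2 (len_nonneg ((p.1, -p.2) - q))
  have b3 := inv_nonneg.2 (len_nonneg ((-p.1, p.2) - q))
  have b4 := inv_nonneg.2 (len_nonneg ((-p.1, -p.2) - q))
  have b5 := inv_nonneg.2 (len_nonneg (0 - q))
  rcases le_total (len q) (4 * len p) with h | h
  · have hn := oddKer_near hp h h1 h2
    have e0 : len (0 - q) = len q := by unfold len; congr 1; simp
    have hm : |4 * (p.1 * p.2) * (q.1 * q.2 / len q ^ 4)| * len q ≤ 4 * len p ^ 2 * (len (0 - q))⁻¹ := by
      rw [e0, abs_mul, abs_mul, abs_div, abs_mul, abs_mul, abs_of_pos (by norm_num : (0 : ℝ) < 4),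
        abs_of_pos (by positivity : 0 < len q ^ 4)]
      calc 4 * (|p.1| * |p.2|) * (|q.1| * |q.2| / len q ^ 4) * len q
          ≤ 4 * len p ^ 2 * (len q ^ 2 / len q ^ 4) * len q := by
            gcongr
            · exact abs_mul_le_sq p
            · exact abs_mul_le_sq q
        _ = _ := by field_simp
    have hk : |oddKer p q| * len q ≤ (10 + len p * ((len (p - q))⁻¹ + (len ((p.1, -p.2) - q))⁻¹
      + (len ((-p.1, p.2) - q))⁻¹ + (len ((-p.1, -p.2) - q))⁻¹)) * (4 * len p) := by
      gcongr
    have hpos : 0 ≤ 304 * len p * (1 + ‖(len p)⁻¹ • q‖) ^ (-3 : ℝ) := by positivity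
    rw [kerDom, indicator_of_mem (mem_sqBox_zero h)]
    calc _ ≤ (|oddKer p q| + |4 * (p.1 * p.2) * (q.1 * q.2 / len q ^ 4)|) * len q := by
          gcongr; exact abs_add_le _ _
      _ ≤ _ := by
          rw [add_mul]
          refine (add_le_add hk hm).trans ?_
          refine le_trans (le_of_eq ?_) (le_add_of_nonneg_right hpos)
          ring
  · have hf := oddKer_far hp h
    have hind : 0 ≤ (sqBox 0 (4 * len p)).indicator (fun q => 40 * len p + 4 * len p ^ 2
        * ((len (p - q))⁻¹ + (len ((p.1, -p.2) - q))⁻¹ + (len ((-p.1, p.2) - q))⁻¹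
        + (len ((-p.1, -p.2) - q))⁻¹ + (len (0 - q))⁻¹)) q := by
      refine indicator_nonneg (fun z _ => ?_) q
      have := len_nonneg
      have h0 : ∀ w : ℝ × ℝ, 0 ≤ (len w)⁻¹ := fun w => inv_nonneg.2 (len_nonneg w)
      have := h0 (p - z)
      have := h0 ((p.1, -p.2) - z)
      have := h0 ((-p.1, p.2) - z)
      have := h0 ((-p.1, -p.2) - z)
      have := h0 (0 - z)
      positivity
    rw [kerDom]
    refine le_trans ?_ (le_add_of_nonneg_left hind)
    have e3 : (1 + ‖(len p)⁻¹ • q‖) ^ (-3 : ℝ) = ((1 + ‖(len p)⁻¹ • q‖) ^ 3)⁻¹ := by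
      rw [Real.rpow_neg (by positivity)]; norm_cast
    -- The constant 304 in `kerDom` is 38 · 2³, the 2³ being lost in this comparison.
    have e4 : 1 + ‖(len p)⁻¹ • q‖ ≤ 2 * (len q / len p) := by
      rw [norm_smul, norm_inv, Real.norm_of_nonneg hp.le]
      have h6 : (len p)⁻¹ * ‖q‖ ≤ len q / len p := by
        rw [div_eq_inv_mul]; gcongr; exact norm_le_len q
      have h7 : 1 ≤ len q / len p := by rw [le_div_iff₀ hp]; linarith
      linarith
    calc _ ≤ 38 * (len p ^ 4 / len q ^ 4) * len q := by gcongr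
      _ = 304 * len p * ((2 * (len q / len p)) ^ 3)⁻¹ := by field_simp; norm_num
      _ ≤ _ := by rw [e3]; gcongr

lemma setIntegral_add_le {f g : ℝ × ℝ → ℝ} {s : Set (ℝ × ℝ)} {a b : ℝ}
    (hf : IntegrableOn f s ∧ ∫ q in s, f q ≤ a) (hg : IntegrableOn g s ∧ ∫ q in s, g q ≤ b) :
    IntegrableOn (fun q => f q + g q) s ∧ ∫ q in s, (f q + g q) ≤ a + b :=
  ⟨hf.1.add hg.1, by rw [integral_add hf.1 hg.1]; exact add_le_add hf.2 hg.2⟩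

/-- The integral of `(1 + |z|)^{-3}` over the plane. -/
noncomputable def tailConst : ℝ := ∫ z : ℝ × ℝ, (1 + ‖z‖) ^ (-3 : ℝ)

/-- Both parts of the majorant scale like |p|³. On the square, 5440 = 64·40 + 4·5·144, from the
volume term and five kernels of integral at most 144|p| each. -/
lemma integral_kerDom_le {p : ℝ × ℝ} (hp : 0 < len p) :
    Integrable (kerDom p) ∧ ∫ q, kerDom p q ≤ (5440 + 304 * tailConst) * len p ^ 3 := by
  have hL : 0 < 4 * len p := by positivity
  have I (a : ℝ × ℝ) := integral_inv_len_le a 0 hL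
  have hsum := setIntegral_add_le (setIntegral_add_le (setIntegral_add_le (setIntegral_add_le (I p)
    (I (p.1, -p.2))) (I (-p.1, p.2))) (I (-p.1, -p.2))) (I 0)
  have hconst : IntegrableOn (fun _ : ℝ × ℝ => 40 * len p) (sqBox 0 (4 * len p)) :=
    integrableOn_const ((isCompact_sqBox 0 _).measure_lt_top.ne)
  have i1 : IntegrableOn (fun q => 40 * len p + 4 * len p ^ 2 * ((len (p - q))⁻¹
    + (len ((p.1, -p.2) - q))⁻¹ + (len ((-p.1, p.2) - q))⁻¹ + (len ((-p.1, -p.2) - q))⁻¹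
    + (len (0 - q))⁻¹)) (sqBox 0 (4 * len p)) := hconst.add (hsum.1.const_mul _)
  have i2 : Integrable fun q : ℝ × ℝ => (1 + ‖(len p)⁻¹ • q‖) ^ (-3 : ℝ) := by
    have h := integrable_one_add_norm (E := ℝ × ℝ) (μ := volume) (r := 3) (by simp; norm_num)
    exact (integrable_comp_smul_iff volume (fun z : ℝ × ℝ => (1 + ‖z‖) ^ (-3 : ℝ))
      (inv_ne_zero hp.ne')).2 h
  have i3 := (integrable_indicator_iff (measurableSet_sqBox 0 (4 * len p))).2 i1
  refine ⟨i3.add (i2.const_mul _), ?_⟩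
  have e2 : ∫ q : ℝ × ℝ, (1 + ‖(len p)⁻¹ • q‖) ^ (-3 : ℝ) = len p ^ 2 * tailConst := by
    rw [Measure.integral_comp_smul volume (fun z : ℝ × ℝ => (1 + ‖z‖) ^ (-3 : ℝ)), tailConst]
    simp only [Module.finrank_prod, Module.finrank_self, smul_eq_mul]
    rw [abs_of_pos (by positivity)]
    congr 1
    rw [inv_pow, inv_inv]
  have vol : volume.real (sqBox 0 (4 * len p)) = 64 * len p ^ 2 := by
    rw [sqBox, Measure.volume_eq_prod, measureReal_prod_prod, Real.volume_real_Icc_of_le (by simp; positivity),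
      Real.volume_real_Icc_of_le (by simp; positivity)]
    simp; ring
  have e1 : ∫ q in sqBox 0 (4 * len p), (40 * len p + 4 * len p ^ 2 * ((len (p - q))⁻¹
    + (len ((p.1, -p.2) - q))⁻¹ + (len ((-p.1, p.2) - q))⁻¹ + (len ((-p.1, -p.2) - q))⁻¹
    + (len (0 - q))⁻¹)) ≤ 5440 * len p ^ 3 := by
    rw [integral_add hconst (hsum.1.const_mul _), setIntegral_const, vol, smul_eq_mul, integral_const_mul]
    calc _ ≤ 64 * len p ^ 2 * (40 * len p) + 4 * len p ^ 2 * (36 * (4 * len p) + 36 * (4 * len p)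
          + 36 * (4 * len p) + 36 * (4 * len p) + 36 * (4 * len p)) :=
          add_le_add le_rfl (mul_le_mul_of_nonneg_left hsum.2 (by positivity))
      _ = 5440 * len p ^ 3 := by ring
  have : ∫ q, kerDom p q = (∫ q, (sqBox 0 (4 * len p)).indicator (fun q => 40 * len p
    + 4 * len p ^ 2 * ((len (p - q))⁻¹
    + (len ((p.1, -p.2) - q))⁻¹ + (len ((-p.1, p.2) - q))⁻¹ + (len ((-p.1, -p.2) - q))⁻¹
    + (len (0 - q))⁻¹)) q) + ∫ q : ℝ × ℝ, 304 * len p * (1 + ‖(len p)⁻¹ • q‖) ^ (-3 : ℝ) :=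
    integral_add i3 (i2.const_mul _)
  rw [this, integral_indicator (measurableSet_sqBox 0 _), integral_const_mul, e2]
  nlinarith [e1]

lemma measurePreserving_reflect_fst :
    MeasurePreserving (fun q : ℝ × ℝ => (-q.1, q.2)) volume volume :=
  (Measure.measurePreserving_neg (volume : Measure ℝ)).prod (MeasurePreserving.id (volume : Measure ℝ))

lemma integral_reflect_fst (F : ℝ × ℝ → ℝ) : ∫ q : ℝ × ℝ, F (-q.1, q.2) = ∫ q, F q := by
  have hr : MeasurableEmbedding (fun q : ℝ × ℝ => (-q.1, q.2)) :=
    ((MeasurableEquiv.neg ℝ).prodCongr (MeasurableEquiv.refl ℝ)).measurableEmbedding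
  exact measurePreserving_reflect_fst.integral_comp hr F

/-- Second order expansion at the origin of the Green potential of a density that is odd in `x₁`. -/
theorem exists_expansion : ∃ C : ℝ, 0 < C ∧ ∀ (A L : ℝ) (F : ℝ × ℝ → ℝ), 0 ≤ A →
    ContinuousOn F halfPlane → (∀ q ∈ halfPlane, F (-q.1, q.2) = -F q) →
    (∀ q ∈ halfPlane, |F q| ≤ A * len q) → (∀ q ∈ halfPlane, L < len q → F q = 0) →
    ∃ c : ℝ, ∀ p ∈ halfPlane, |invLap F p - c * (p.1 * p.2)| ≤ C * A * len p ^ 3 := by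
  have ht : 0 ≤ tailConst := integral_nonneg fun z => by positivity
  refine ⟨5440 + 304 * tailConst, by positivity, fun A L F hA hFc hodd hF hz => ?_⟩
  set f := halfPlane.indicator F with hf
  set M := max L 1 with hM
  have hM0 : 0 < M := lt_max_of_lt_right one_pos
  have hfm : AEStronglyMeasurable f volume :=
    (aestronglyMeasurable_indicator_iff measurableSet_halfPlane).2
      (hFc.aestronglyMeasurable measurableSet_halfPlane)
  have hfo : ∀ q : ℝ × ℝ, f (-q.1, q.2) = -f q := by
    intro q
    by_cases hq : q ∈ halfPlane
    · have : ((-q.1, q.2) : ℝ × ℝ) ∈ halfPlane := hq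
      rw [hf, indicator_of_mem hq, indicator_of_mem this, hodd q hq]
    · have : ((-q.1, q.2) : ℝ × ℝ) ∉ halfPlane := hq
      rw [hf, indicator_of_notMem hq, indicator_of_notMem this, neg_zero]
  have hfb : ∀ q, |f q| ≤ A * len q := by
    intro q
    by_cases hq : q ∈ halfPlane
    · rw [hf, indicator_of_mem hq]; exact hF q hq
    · rw [hf, indicator_of_notMem hq, abs_zero]; exact mul_nonneg hA (len_nonneg q)
  have hfz : ∀ q, q ∉ sqBox 0 M → f q = 0 := by
    intro q hb
    by_cases hq : q ∈ halfPlane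
    · rw [hf, indicator_of_mem hq]
      refine hz q hq ?_
      by_contra! h
      exact hb (mem_sqBox_zero (h.trans (le_max_left _ _)))
    · rw [hf, indicator_of_notMem hq]
  have hlen : ∀ q ∈ sqBox 0 M, len q ≤ 2 * M := by
    intro q hq
    obtain ⟨h1, h2⟩ := mem_sqBox.1 hq
    simp only [Prod.fst_zero, Prod.snd_zero, sub_zero] at h1 h2
    exact (len_le_add q).trans (by linarith)
  have hlog : ∀ a : ℝ × ℝ, Integrable fun q => Real.log (len (a - q)) * f q := by
    intro a
    refine integrable_of_le_inv_len (p := a) (c := 0) (L := M) (a := (len a + 2 * M) * (A * (2 * M)))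
      (b := A * (2 * M)) hM0 ?_ (fun q hq => by rw [hfz q hq, mul_zero]) fun q hq => ?_
    · exact (Real.measurable_log.comp (measurable_len.comp
        (measurable_const.sub measurable_id))).aestronglyMeasurable.mul hfm
    · rw [abs_mul]
      have h1 := abs_log_le (len_nonneg (a - q))
      have h2 : |f q| ≤ A * (2 * M) := (hfb q).trans (by gcongr; exact hlen q hq)
      have h3 : len (a - q) ≤ len a + 2 * M := by
        have := len_triangle a (-q)
        rw [← sub_eq_add_neg] at this
        have e : len (-q) = len q := by unfold len; simp
        linarith [hlen q hq]
      have h4 := inv_nonneg.2 (len_nonneg (a - q))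
      have h5 := len_nonneg a
      have h6 := len_nonneg (a - q)
      calc _ ≤ (len (a - q) + (len (a - q))⁻¹) * (A * (2 * M)) := by gcongr
        _ ≤ (len a + 2 * M + (len (a - q))⁻¹) * (A * (2 * M)) := by gcongr
        _ = _ := by ring
  -- The linear growth of f at the origin reduces the singularity |q|^{-2} to |q|^{-1}.
  have hc : Integrable fun q : ℝ × ℝ => q.1 * q.2 / len q ^ 4 * f q := by
    refine integrable_of_le_inv_len (p := 0) (c := 0) (L := M) (a := 0) (b := A) hM0 ?_
      (fun q hq => by rw [hfz q hq, mul_zero]) fun q hq => ?_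
    · exact ((measurable_fst.mul measurable_snd).div (measurable_len.pow_const 4)).aestronglyMeasurable.mul hfm
    · have e0 : len (0 - q) = len q := by unfold len; congr 1; simp
      rw [e0, zero_add, abs_mul]
      rcases (len_nonneg q).eq_or_lt with h | h
      · rw [← h]; simp
      · rw [abs_div, abs_mul, abs_of_pos (by positivity : 0 < len q ^ 4)]
        calc _ ≤ len q ^ 2 / len q ^ 4 * (A * len q) := by
              gcongr
              · exact abs_mul_le_sq q
              · exact hfb q
          _ = _ := by field_simp
  -- The second order coefficient of the potential is (2/π) I, from the leading term of the
  -- antisymmetrized kernel.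
  set I := ∫ q : ℝ × ℝ, q.1 * q.2 / len q ^ 4 * f q with hI
  refine ⟨1 / (2 * Real.pi) * (4 * I), fun p hp => ?_⟩
  have hp0 : 0 < len p := len_pos_of_mem hp
  have e1 : invLap F p = -(1 / (2 * Real.pi)) *
      ((∫ q, Real.log (len (p - q)) * f q) - ∫ q, Real.log (len ((p.1, -p.2) - q)) * f q) := by
    rw [invLap, ← integral_sub (hlog _) (hlog _), ← integral_indicator measurableSet_halfPlane]
    congr 2
    funext q
    by_cases hq : q ∈ halfPlane
    · rw [indicator_of_mem hq, hf, indicator_of_mem hq, invLap_kernel_eq]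
      have : (p.1 - q.1, p.2 - q.2) = p - q := rfl
      rw [this]; ring
    · rw [indicator_of_notMem hq, hf, indicator_of_notMem hq]; ring
  -- Oddness of the density in q₁ moves the pole to its mirror image with a change of sign.
  -- Averaging both forms replaces the Green kernel by `oddKer`.
  have er : ∀ a : ℝ × ℝ, ∫ q, Real.log (len (a - q)) * f q
      = -∫ q, Real.log (len ((-a.1, a.2) - q)) * f q := by
    intro a
    rw [← integral_reflect_fst, ← integral_neg]
    congr 1
    funext q
    rw [hfo]
    have : len (a - (-q.1, q.2)) = len ((-a.1, a.2) - q) := by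
      unfold len; congr 1; simp only [Prod.fst_sub, Prod.snd_sub]; ring
    rw [this]; ring
  have e2 : invLap F p - 1 / (2 * Real.pi) * (4 * I) * (p.1 * p.2)
      = -(1 / (2 * Real.pi)) * ∫ q, (oddKer p q + 4 * (p.1 * p.2) * (q.1 * q.2 / len q ^ 4)) * f q := by
    have h1 : (∫ q, Real.log (len (p - q)) * f q) - ∫ q, Real.log (len ((p.1, -p.2) - q)) * f q
        = ∫ q, oddKer p q * f q := by
      have hs1 := er p
      have hs2 := er (p.1, -p.2)
      have : ∫ q, oddKer p q * f q = ((∫ q, Real.log (len (p - q)) * f q)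
          - (∫ q, Real.log (len ((p.1, -p.2) - q)) * f q)
          - (∫ q, Real.log (len ((-p.1, p.2) - q)) * f q)
          + ∫ q, Real.log (len ((-p.1, -p.2) - q)) * f q) / 2 := by
        have i2 : Integrable fun q => Real.log (len (p - q)) * f q
            - Real.log (len ((p.1, -p.2) - q)) * f q := (hlog _).sub (hlog _)
        have i3 : Integrable fun q => Real.log (len (p - q)) * f q
            - Real.log (len ((p.1, -p.2) - q)) * f q
            - Real.log (len ((-p.1, p.2) - q)) * f q := i2.sub (hlog _)
        rw [← integral_sub (hlog _) (hlog _), ← integral_sub i2 (hlog _),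
          ← integral_add i3 (hlog _), ← integral_div]
        congr 1
        funext q
        simp only [oddKer]
        ring
      rw [this]
      simp only at hs2
      linarith
    have hint : Integrable fun q => oddKer p q * f q := by
      have := ((((hlog p).sub (hlog (p.1, -p.2))).sub (hlog (-p.1, p.2))).add (hlog (-p.1, -p.2))).div_const 2
      refine this.congr (Eventually.of_forall fun q => ?_)
      simp only [oddKer, Pi.sub_apply, Pi.add_apply]
      ring
    have h2 : ∫ q, (oddKer p q + 4 * (p.1 * p.2) * (q.1 * q.2 / len q ^ 4)) * f q
        = (∫ q, oddKer p q * f q) + 4 * (p.1 * p.2) * I := by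
      rw [hI, ← integral_const_mul, ← integral_add hint (hc.const_mul _)]
      congr 1
      funext q
      ring
    rw [e1, h1, h2]; ring
  rw [e2, abs_mul]
  obtain ⟨hi, hb⟩ := integral_kerDom_le hp0
  have hfin : |∫ q, (oddKer p q + 4 * (p.1 * p.2) * (q.1 * q.2 / len q ^ 4)) * f q|
      ≤ A * ∫ q, kerDom p q := by
    rw [← Real.norm_eq_abs, ← integral_const_mul]
    refine norm_integral_le_of_norm_le (hi.const_mul A) ?_
    filter_upwards [ae_ne_fst p.1, ae_ne_fst (-p.1), ae_ne_fst 0] with q h1 h2 h3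
    rw [Real.norm_eq_abs, abs_mul]
    calc _ ≤ |oddKer p q + 4 * (p.1 * p.2) * (q.1 * q.2 / len q ^ 4)| * (A * len q) := by
          gcongr; exact hfb q
      _ = A * (|oddKer p q + 4 * (p.1 * p.2) * (q.1 * q.2 / len q ^ 4)| * len q) := by ring
      _ ≤ _ := by gcongr; exact abs_oddKer_le_kerDom hp0 h1 h2 h3
  calc _ ≤ 1 * (A * ((5440 + 304 * tailConst) * len p ^ 3)) := by
        refine mul_le_mul two_pi_inv_abs_le (hfin.trans ?_) (abs_nonneg _) zero_le_one
        gcongr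
    _ = _ := by ring

/-! ### Calculus up to the wall -/

/-- First partial derivative up to the wall. -/
noncomputable def pdx (f : ℝ × ℝ → ℝ) (p : ℝ × ℝ) : ℝ := fderivWithin ℝ f closedHalfPlane p (1, 0)

/-- Second partial derivative up to the wall. -/
noncomputable def pdy (f : ℝ × ℝ → ℝ) (p : ℝ × ℝ) : ℝ := fderivWithin ℝ f closedHalfPlane p (0, 1)

lemma closedHalfPlane_mem_nhds {p : ℝ × ℝ} (hp : p ∈ halfPlane) : closedHalfPlane ∈ 𝓝 p :=
  mem_of_superset (isOpen_halfPlane.mem_nhds hp) fun q hq => le_of_lt (show 0 < q.2 from hq)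

lemma halfPlane_subset {p : ℝ × ℝ} (hp : p ∈ halfPlane) : p ∈ closedHalfPlane :=
  le_of_lt (show 0 < p.2 from hp)

lemma pdx_eq_dx {f : ℝ × ℝ → ℝ} {p : ℝ × ℝ} (hp : p ∈ halfPlane) (h : DifferentiableAt ℝ f p) :
    pdx f p = dx f p := by
  rw [pdx, fderivWithin_of_mem_nhds (closedHalfPlane_mem_nhds hp), dx_eq_fderiv h]

lemma pdy_eq_dy {f : ℝ × ℝ → ℝ} {p : ℝ × ℝ} (hp : p ∈ halfPlane) (h : DifferentiableAt ℝ f p) :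
    pdy f p = dy f p := by
  rw [pdy, fderivWithin_of_mem_nhds (closedHalfPlane_mem_nhds hp), dy_eq_fderiv h]

lemma contDiffWithinAt_pdx {f : ℝ × ℝ → ℝ} {p : ℝ × ℝ} {n : ℕ} (hp : p ∈ closedHalfPlane)
    (h : ContDiffWithinAt ℝ (n + 1 : ℕ) f closedHalfPlane p) :
    ContDiffWithinAt ℝ n (pdx f) closedHalfPlane p :=
  (h.fderivWithin_right uniqueDiffOn_closedHalfPlane (by exact_mod_cast le_rfl) hp).clm_apply
    contDiffWithinAt_const

lemma contDiffWithinAt_pdy {f : ℝ × ℝ → ℝ} {p : ℝ × ℝ} {n : ℕ} (hp : p ∈ closedHalfPlane)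
    (h : ContDiffWithinAt ℝ (n + 1 : ℕ) f closedHalfPlane p) :
    ContDiffWithinAt ℝ n (pdy f) closedHalfPlane p :=
  (h.fderivWithin_right uniqueDiffOn_closedHalfPlane (by exact_mod_cast le_rfl) hp).clm_apply
    contDiffWithinAt_const

/-- Functions of class `Cⁿ` up to the wall with bounded support. -/
structure IsTame (n : ℕ) (L : ℝ) (f : ℝ × ℝ → ℝ) : Prop where
  smooth : ContDiffOn ℝ n f closedHalfPlane
  zero : ∀ p ∈ closedHalfPlane, L < len p → f p = 0

namespace IsTame

variable {n : ℕ} {L : ℝ} {f : ℝ × ℝ → ℝ}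

lemma mono_order {m : ℕ} (h : IsTame n L f) (hm : m ≤ n) : IsTame m L f :=
  ⟨h.smooth.of_le (by exact_mod_cast hm), h.zero⟩

lemma fderivWithin_zero (h : IsTame n L f) {p : ℝ × ℝ} (hp : p ∈ closedHalfPlane) (hl : L < len p) :
    fderivWithin ℝ f closedHalfPlane p = 0 := by
  have e : f =ᶠ[𝓝[closedHalfPlane] p] fun _ => 0 := by
    filter_upwards [self_mem_nhdsWithin, nhdsWithin_le_nhds
      (continuous_len.continuousAt.eventually (lt_mem_nhds hl))] with q h1 h2 using h.zero q h1 h2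
  rw [e.fderivWithin_eq (h.zero p hp hl)]
  simp

lemma pdx (h : IsTame (n + 1) L f) : IsTame n L (pdx f) :=
  ⟨fun p hp => contDiffWithinAt_pdx hp (h.smooth p hp),
    fun p hp hl => by rw [ElliEst.pdx, h.fderivWithin_zero hp hl]; rfl⟩

lemma pdy (h : IsTame (n + 1) L f) : IsTame n L (pdy f) :=
  ⟨fun p hp => contDiffWithinAt_pdy hp (h.smooth p hp),
    fun p hp hl => by rw [ElliEst.pdy, h.fderivWithin_zero hp hl]; rfl⟩

lemma exists_bound (h : IsTame n L f) : ∃ B : ℝ, 0 ≤ B ∧ ∀ p ∈ closedHalfPlane, |f p| ≤ B := by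
  obtain ⟨B, hB⟩ := ((isCompact_sqBox 0 L).inter_right isClosed_closedHalfPlane).exists_bound_of_continuousOn
    (h.smooth.continuousOn.mono inter_subset_right)
  refine ⟨max B 0, le_max_right _ _, fun p hp => ?_⟩
  rcases le_or_gt (len p) L with hl | hl
  · exact (hB p ⟨mem_sqBox_zero hl, hp⟩).trans (le_max_left _ _)
  · rw [h.zero p hp hl, abs_zero]; exact le_max_right _ _

lemma contDiffAt (h : IsTame n L f) {p : ℝ × ℝ} (hp : p ∈ halfPlane) : ContDiffAt ℝ n f p :=
  h.smooth.contDiffAt (closedHalfPlane_mem_nhds hp)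

lemma differentiableAt (h : IsTame (n + 1) L f) {p : ℝ × ℝ} (hp : p ∈ halfPlane) :
    DifferentiableAt ℝ f p :=
  (h.contDiffAt hp).differentiableAt (by norm_cast)

lemma pdx_eq (h : IsTame (n + 1) L f) {p : ℝ × ℝ} (hp : p ∈ halfPlane) : ElliEst.pdx f p = dx f p :=
  pdx_eq_dx hp (h.differentiableAt hp)

lemma pdy_eq (h : IsTame (n + 1) L f) {p : ℝ × ℝ} (hp : p ∈ halfPlane) : ElliEst.pdy f p = dy f p :=
  pdy_eq_dy hp (h.differentiableAt hp)

lemma pdx_ev (h : IsTame (n + 1) L f) {p : ℝ × ℝ} (hp : p ∈ halfPlane) :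
    dx f =ᶠ[𝓝 p] ElliEst.pdx f := by
  filter_upwards [isOpen_halfPlane.mem_nhds hp] with q hq using (h.pdx_eq hq).symm

lemma pdy_ev (h : IsTame (n + 1) L f) {p : ℝ × ℝ} (hp : p ∈ halfPlane) :
    dy f =ᶠ[𝓝 p] ElliEst.pdy f := by
  filter_upwards [isOpen_halfPlane.mem_nhds hp] with q hq using (h.pdy_eq hq).symm

lemma exists_gradBound (h : IsTame (n + 1) L f) :
    ∃ B : ℝ, 0 ≤ B ∧ ∀ p ∈ halfPlane, GradBound f p B B := by
  obtain ⟨B0, h0, hb0⟩ := h.exists_bound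
  obtain ⟨B1, h1, hb1⟩ := h.pdx.exists_bound
  obtain ⟨B2, h2, hb2⟩ := h.pdy.exists_bound
  refine ⟨B0 + B1 + B2, by positivity, fun p hp => ⟨h.differentiableAt hp, ?_, ?_, ?_⟩⟩
  · exact (hb0 p (halfPlane_subset hp)).trans (by linarith)
  · rw [← h.pdx_eq hp]; exact (hb1 p (halfPlane_subset hp)).trans (by linarith)
  · rw [← h.pdy_eq hp]; exact (hb2 p (halfPlane_subset hp)).trans (by linarith)

lemma add {g : ℝ × ℝ → ℝ} (h : IsTame n L f) (h' : IsTame n L g) : IsTame n L fun p => f p + g p :=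
  ⟨h.smooth.add h'.smooth, fun p hp hl => by rw [h.zero p hp hl, h'.zero p hp hl, add_zero]⟩

lemma lap_eq (h : IsTame 2 L f) {p : ℝ × ℝ} (hp : p ∈ halfPlane) :
    lap f p = ElliEst.pdx (ElliEst.pdx f) p + ElliEst.pdy (ElliEst.pdy f) p := by
  rw [lap, dx_congr (h.pdx_ev hp), dy_congr (h.pdy_ev hp), h.pdx.pdx_eq hp, h.pdy.pdy_eq hp]

end IsTame

/-- Bounds on a function on the half plane and on its derivatives up to third order, adapted to the
length scale `r`. -/
structure CutBound (r B : ℝ) (f : ℝ × ℝ → ℝ) : Prop where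
  smooth : ∀ p ∈ halfPlane, ContDiffAt ℝ 3 f p
  g0 : ∀ p ∈ halfPlane, GradBound f p B (B / r)
  gx : ∀ p ∈ halfPlane, GradBound (dx f) p (B / r) (B / r ^ 2)
  gy : ∀ p ∈ halfPlane, GradBound (dy f) p (B / r) (B / r ^ 2)
  gl : ∀ p ∈ halfPlane, GradBound (lap f) p (B / r ^ 2) (B / r ^ 3)

lemma IsTame.exists_cutBound {L : ℝ} {f : ℝ × ℝ → ℝ} (h : IsTame 3 L f) :
    ∃ B : ℝ, 0 ≤ B ∧ CutBound 1 B f := by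
  obtain ⟨B0, p0, h0⟩ := h.exists_gradBound
  obtain ⟨B1, p1, h1⟩ := (IsTame.pdx (n := 2) h).exists_gradBound
  obtain ⟨B2, p2, h2⟩ := (IsTame.pdy (n := 2) h).exists_gradBound
  have h3 : IsTame 2 L f := h.mono_order (by norm_num)
  have hxx : IsTame 1 L (ElliEst.pdx (ElliEst.pdx f)) := (IsTame.pdx (n := 2) h).pdx
  have hyy : IsTame 1 L (ElliEst.pdy (ElliEst.pdy f)) := (IsTame.pdy (n := 2) h).pdy
  obtain ⟨B3, p3, h3'⟩ := (hxx.add hyy).exists_gradBound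
  refine ⟨B0 + B1 + B2 + B3, by positivity, ⟨fun p hp => h.contDiffAt hp, fun p hp => ?_, fun p hp => ?_,
    fun p hp => ?_, fun p hp => ?_⟩⟩
  · exact (h0 p hp).mono (by linarith) (by linarith)
  · exact ((h1 p hp).congr (IsTame.pdx_ev (n := 2) h hp)).mono (by linarith) (by linarith)
  · exact ((h2 p hp).congr (IsTame.pdy_ev (n := 2) h hp)).mono (by linarith) (by linarith)
  · refine ((h3' p hp).congr ?_).mono (by linarith) (by linarith)
    filter_upwards [isOpen_halfPlane.mem_nhds hp] with q hq using h3.lap_eq hq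

/-! ### Scaling -/

/-- The rescaled function `x ↦ f(x / r)`. -/
noncomputable def scl (f : ℝ × ℝ → ℝ) (r : ℝ) (p : ℝ × ℝ) : ℝ := f (p.1 / r, p.2 / r)

lemma cut_eq_scl (χ : ℝ × ℝ → ℝ) (Cl : ℝ) (i : ℕ) : cut χ Cl i = scl χ (R Cl i) := rfl

lemma dx_scl (f : ℝ × ℝ → ℝ) (r : ℝ) : dx (scl f r) = fun p => r⁻¹ * scl (dx f) r p := dx_scale f r

lemma dy_scl (f : ℝ × ℝ → ℝ) (r : ℝ) : dy (scl f r) = fun p => r⁻¹ * scl (dy f) r p := dy_scale f r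

lemma lap_scl (f : ℝ × ℝ → ℝ) (r : ℝ) : lap (scl f r) = fun p => (r ^ 2)⁻¹ * scl (lap f) r p := by
  funext p
  rw [lap, dx_scl, dy_scl, dx_const_mul, dy_const_mul, dx_scl, dy_scl]
  simp only [scl, lap]
  ring

lemma contDiff_sclMap (r : ℝ) {n : WithTop ℕ∞} : ContDiff ℝ n fun p : ℝ × ℝ => (p.1 / r, p.2 / r) :=
  (contDiff_fst.div_const r).prodMk (contDiff_snd.div_const r)

lemma scl_mem_halfPlane {r : ℝ} (hr : 0 < r) {p : ℝ × ℝ} (hp : p ∈ halfPlane) :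
    ((p.1 / r, p.2 / r) : ℝ × ℝ) ∈ halfPlane := div_pos hp hr

lemma scl_mem_closedHalfPlane {r : ℝ} (hr : 0 < r) {p : ℝ × ℝ} (hp : p ∈ closedHalfPlane) :
    ((p.1 / r, p.2 / r) : ℝ × ℝ) ∈ closedHalfPlane := div_nonneg hp hr.le

lemma GradBound.scl {f : ℝ × ℝ → ℝ} {r a b : ℝ} (hr : 0 < r) {p : ℝ × ℝ}
    (h : GradBound f (p.1 / r, p.2 / r) a b) : GradBound (scl f r) p a (b / r) := by
  refine ⟨?_, h.val, ?_, ?_⟩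
  · exact DifferentiableAt.comp p (g := f) (f := fun p : ℝ × ℝ => (p.1 / r, p.2 / r)) h.diff
      ((contDiff_sclMap r (n := 1)).differentiable one_ne_zero p)
  · rw [dx_scl, abs_mul, abs_of_pos (inv_pos.2 hr), div_eq_inv_mul]
    exact mul_le_mul_of_nonneg_left h.dx_le (inv_nonneg.2 hr.le)
  · rw [dy_scl, abs_mul, abs_of_pos (inv_pos.2 hr), div_eq_inv_mul]
    exact mul_le_mul_of_nonneg_left h.dy_le (inv_nonneg.2 hr.le)

lemma CutBound.scl {f : ℝ × ℝ → ℝ} {B r : ℝ} (h : CutBound 1 B f) (hr : 0 < r) :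
    CutBound r B (scl f r) := by
  have hm {p : ℝ × ℝ} (hp : p ∈ halfPlane) := scl_mem_halfPlane hr hp
  have hri : |r⁻¹| = r⁻¹ := abs_of_pos (inv_pos.2 hr)
  refine ⟨fun p hp => ?_, fun p hp => ?_, fun p hp => ?_, fun p hp => ?_, fun p hp => ?_⟩
  · exact ContDiffAt.comp p (g := f) (f := fun p : ℝ × ℝ => (p.1 / r, p.2 / r)) (h.smooth _ (hm hp))
      (contDiff_sclMap r).contDiffAt
  · exact ((h.g0 _ (hm hp)).scl hr).mono le_rfl (by simp)
  · rw [dx_scl]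
    refine (((h.gx _ (hm hp)).scl hr).const_mul r⁻¹).mono (le_of_eq ?_) (le_of_eq ?_) <;>
    · rw [hri]; field_simp
  · rw [dy_scl]
    refine (((h.gy _ (hm hp)).scl hr).const_mul r⁻¹).mono (le_of_eq ?_) (le_of_eq ?_) <;>
    · rw [hri]; field_simp
  · rw [lap_scl]
    refine (((h.gl _ (hm hp)).scl hr).const_mul (r ^ 2)⁻¹).mono (le_of_eq ?_) (le_of_eq ?_) <;>
    · rw [abs_of_pos (by positivity)]; field_simp

lemma len_scl {r : ℝ} (hr : 0 < r) (p : ℝ × ℝ) : len (p.1 / r, p.2 / r) = len p / r := by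
  unfold len
  rw [show (p.1 / r) ^ 2 + (p.2 / r) ^ 2 = (p.1 ^ 2 + p.2 ^ 2) / r ^ 2 by field_simp,
    Real.sqrt_div (by positivity), Real.sqrt_sq hr.le]

namespace IsCutoff

variable {χ : ℝ × ℝ → ℝ}

lemma isTame (h : IsCutoff χ) (n : ℕ) : IsTame n 2 χ :=
  ⟨h.smooth.of_le (by exact_mod_cast (le_top : (n : ℕ∞) ≤ ⊤)), fun p hp hl => h.zero p hp hl.le⟩

lemma scl_one (h : IsCutoff χ) {r : ℝ} (hr : 0 < r) {p : ℝ × ℝ} (hp : p ∈ closedHalfPlane)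
    (hl : len p ≤ r) : scl χ r p = 1 :=
  h.one _ (scl_mem_closedHalfPlane hr hp) (by rw [len_scl hr, div_le_one hr]; exact hl)

lemma scl_zero (h : IsCutoff χ) {r : ℝ} (hr : 0 < r) {p : ℝ × ℝ} (hp : p ∈ closedHalfPlane)
    (hl : 2 * r ≤ len p) : scl χ r p = 0 :=
  h.zero _ (scl_mem_closedHalfPlane hr hp) (by rw [len_scl hr, le_div_iff₀ hr]; exact hl)

lemma scl_one_ev (h : IsCutoff χ) {r : ℝ} (hr : 0 < r) {p : ℝ × ℝ} (hp : p ∈ halfPlane)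
    (hl : len p < r) : scl χ r =ᶠ[𝓝 p] fun _ => 1 := by
  filter_upwards [isOpen_halfPlane.mem_nhds hp,
    continuous_len.continuousAt.eventually (gt_mem_nhds hl)] with q h1 h2
  exact h.scl_one hr (halfPlane_subset h1) h2.le

lemma scl_zero_ev (h : IsCutoff χ) {r : ℝ} (hr : 0 < r) {p : ℝ × ℝ} (hp : p ∈ halfPlane)
    (hl : 2 * r < len p) : scl χ r =ᶠ[𝓝 p] fun _ => 0 := by
  filter_upwards [isOpen_halfPlane.mem_nhds hp,
    continuous_len.continuousAt.eventually (lt_mem_nhds hl)] with q h1 h2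
  exact h.scl_zero hr (halfPlane_subset h1) h2.le

lemma scl_even (h : IsCutoff χ) {r : ℝ} (hr : 0 < r) {p : ℝ × ℝ} (hp : p ∈ closedHalfPlane) :
    scl χ r (-p.1, p.2) = scl χ r p := by
  have := h.even (p.1 / r) (p.2 / r) (scl_mem_closedHalfPlane hr hp)
  simpa [scl, neg_div] using this

end IsCutoff

/-! ### A radial cutoff -/

/-- A smooth radial cutoff function on the plane. -/
noncomputable def radCut (p : ℝ × ℝ) : ℝ := Real.smoothTransition (2 - (p.1 ^ 2 + p.2 ^ 2))

lemma contDiff_radCut {n : ℕ∞} : ContDiff ℝ n radCut :=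
  Real.smoothTransition.contDiff.comp (contDiff_const.sub ((contDiff_fst.pow 2).add (contDiff_snd.pow 2)))

lemma isCutoff_radCut : IsCutoff radCut where
  smooth := contDiff_radCut.contDiffOn
  mem_Icc p _ := ⟨Real.smoothTransition.nonneg _, Real.smoothTransition.le_one _⟩
  even x y _ := by simp [radCut]
  one p _ hl := by
    refine Real.smoothTransition.one_of_one_le ?_
    rw [← len_sq]; nlinarith [len_nonneg p]
  zero p _ hl := by
    refine Real.smoothTransition.zero_of_nonpos ?_
    rw [← len_sq]; nlinarith [len_nonneg p]

lemma contDiff_scl_radCut (r : ℝ) {n : ℕ∞} : ContDiff ℝ n (scl radCut r) :=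
  contDiff_radCut.comp (contDiff_sclMap r)

/-- A radial cutoff is even in y, so its normal derivative vanishes at the wall. This is why the
localization uses `radCut`: the source that it creates must vanish on the wall. -/
lemma dy_scl_radCut_wall (r x : ℝ) : dy (scl radCut r) (x, 0) = 0 := by
  have hd : DifferentiableAt ℝ (fun t => scl radCut r (x, t)) 0 :=
    ((contDiff_scl_radCut r (n := 1)).differentiable one_ne_zero _).comp (0 : ℝ)
      ((differentiableAt_const x).prodMk differentiableAt_id)
  have e : (fun t => scl radCut r (x, t)) = fun t => scl radCut r (x, -t) := by
    funext t; simp [scl, radCut, neg_div]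
  have h1 := deriv_comp_neg (f := fun t => scl radCut r (x, t)) (0 : ℝ)
  have h2 : deriv (fun t => scl radCut r (x, t)) 0 = deriv (fun t => scl radCut r (x, -t)) 0 := by
    conv_lhs => rw [e]
  unfold dy
  simp only [neg_zero] at h1 h2 ⊢
  linarith

/-! ### Localization of functions defined near the origin -/

lemma contDiffOn_of_local {n : WithTop ℕ∞} {f : ℝ × ℝ → ℝ} {L L' : ℝ} (hL : L < L')
    (h : ∀ p ∈ closedHalfPlane, len p < L' → ContDiffWithinAt ℝ n f closedHalfPlane p)
    (hz : ∀ p ∈ closedHalfPlane, L < len p → f p = 0) : ContDiffOn ℝ n f closedHalfPlane := by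
  intro p hp
  rcases lt_or_ge (len p) L' with hl | hl
  · exact h p hp hl
  · have e : f =ᶠ[𝓝[closedHalfPlane] p] fun _ => 0 := by
      filter_upwards [self_mem_nhdsWithin, nhdsWithin_le_nhds
        (continuous_len.continuousAt.eventually (lt_mem_nhds (hL.trans_le hl)))] with q h1 h2
          using hz q h1 h2
    exact contDiffWithinAt_const.congr_of_eventuallyEq e (hz p hp (hL.trans_le hl))

lemma IsTame.dxx_eq {L : ℝ} {f : ℝ × ℝ → ℝ} (h : IsTame 2 L f) {p : ℝ × ℝ} (hp : p ∈ halfPlane) :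
    dx (dx f) p = ElliEst.pdx (ElliEst.pdx f) p := by rw [dx_congr (h.pdx_ev hp), h.pdx.pdx_eq hp]

lemma IsTame.dyy_eq {L : ℝ} {f : ℝ × ℝ → ℝ} (h : IsTame 2 L f) {p : ℝ × ℝ} (hp : p ∈ halfPlane) :
    dy (dy f) p = ElliEst.pdy (ElliEst.pdy f) p := by rw [dy_congr (h.pdy_ev hp), h.pdy.pdy_eq hp]

/-- Functions of class `C²` up to the wall, vanishing on the wall, with bounded support, are
admissible in the representation formula. -/
lemma IsTame.exists_isTest {L : ℝ} {f : ℝ × ℝ → ℝ} (h : IsTame 2 L f) (h0 : ∀ x, f (x, 0) = 0) :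
    ∃ B, IsTest L B f := by
  obtain ⟨B1, p1, h1⟩ := (IsTame.pdx (n := 1) h).exists_bound
  obtain ⟨B2, p2, h2⟩ := (IsTame.pdy (n := 1) h).exists_bound
  obtain ⟨B3, p3, h3⟩ := (IsTame.pdx (n := 0) (IsTame.pdx (n := 1) h)).exists_bound
  obtain ⟨B4, p4, h4⟩ := (IsTame.pdy (n := 0) (IsTame.pdy (n := 1) h)).exists_bound
  have hy : ∀ p ∈ halfPlane, |dy f p| ≤ B2 := fun p hp => by
    rw [← IsTame.pdy_eq (n := 1) h hp]; exact h2 p (halfPlane_subset hp)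
  refine ⟨B1 + B2 + B3 + B4, ⟨fun p hp => h.contDiffAt hp, fun p hp => h.zero p (halfPlane_subset hp),
    fun p hp => ?_, fun p hp => ?_, fun p hp => (hy p hp).trans (by linarith), fun p hp => ?_,
    fun p hp => ?_⟩⟩
  · have hp' : 0 < p.2 := hp
    have hc : ContinuousOn (fun t => f (p.1, t)) (Icc 0 p.2) :=
      h.smooth.continuousOn.comp (by fun_prop) fun t ht => ht.1
    have hd : ∀ t ∈ Ioo 0 p.2, HasDerivAt (fun t => f (p.1, t)) (dy f (p.1, t)) t := fun t ht =>
      hasDerivAt_dy (p := (p.1, t)) (IsTame.differentiableAt (n := 1) h (show 0 < t from ht.1))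
    -- The mean value theorem on the vertical segment from the wall gives linear vanishing at the
    -- wall.
    obtain ⟨t, ht, e⟩ := exists_hasDerivAt_eq_slope _ _ hp' hc hd
    rw [eq_div_iff (by linarith), h0] at e
    have : |f p| = |dy f (p.1, t)| * p.2 := by
      have e2 : f p = dy f (p.1, t) * p.2 := by
        have : f p = f (p.1, p.2) := rfl
        rw [this]; linarith
      rw [e2, abs_mul, abs_of_pos hp']
    rw [this]
    have := hy (p.1, t) (show 0 < t from ht.1)
    gcongr
    linarith
  · rw [← IsTame.pdx_eq (n := 1) h hp]; exact (h1 p (halfPlane_subset hp)).trans (by linarith)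
  · rw [h.dxx_eq hp]; exact (h3 p (halfPlane_subset hp)).trans (by linarith)
  · rw [h.dyy_eq hp]; exact (h4 p (halfPlane_subset hp)).trans (by linarith)

/-! ### The localized stream function -/

/-- The localization radius. -/
noncomputable def locRad (Cl : ℝ) : ℝ := 1 / (32 * Cl)

/-- The localizing cutoff. -/
noncomputable def locCut (Cl : ℝ) : ℝ × ℝ → ℝ := scl radCut (locRad Cl)

/-- The localized stream function. -/
noncomputable def locFun (Cl : ℝ) (u : ℝ × ℝ → ℝ) (p : ℝ × ℝ) : ℝ := u p * locCut Cl p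

/-- The part of the source of the localized stream function that is due to the lower order term and
to the localization. -/
noncomputable def locSource (Cl : ℝ) (u : ℝ × ℝ → ℝ) (p : ℝ × ℝ) : ℝ :=
  -(pot Cl p * locFun Cl u p) - 2 * (pdx u p * dx (locCut Cl) p + pdy u p * dy (locCut Cl) p)
    - u p * lap (locCut Cl) p

lemma contDiff_locCut (Cl : ℝ) {n : ℕ∞} : ContDiff ℝ n (locCut Cl) := contDiff_scl_radCut _

lemma contDiff_dx {f : ℝ × ℝ → ℝ} {n : ℕ} (h : ContDiff ℝ (n + 1 : ℕ) f) : ContDiff ℝ n (dx f) :=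
  contDiff_iff_contDiffAt.2 fun _ => contDiffAt_dx h.contDiffAt

lemma contDiff_dy {f : ℝ × ℝ → ℝ} {n : ℕ} (h : ContDiff ℝ (n + 1 : ℕ) f) : ContDiff ℝ n (dy f) :=
  contDiff_iff_contDiffAt.2 fun _ => contDiffAt_dy h.contDiffAt

lemma contDiff_lap {f : ℝ × ℝ → ℝ} {n : ℕ} (h : ContDiff ℝ (n + 1 + 1 : ℕ) f) : ContDiff ℝ n (lap f) :=
  (contDiff_dx (contDiff_dx h)).add (contDiff_dy (contDiff_dy h))

lemma snd_lt_of_len {p : ℝ × ℝ} {a : ℝ} (h : len p < a) : p.2 < a :=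
  (le_abs_self _).trans_lt ((abs_snd_le_len p).trans_lt h)

lemma contDiffAt_pot {Cl : ℝ} (hCl : 0 < Cl) {p : ℝ × ℝ} (hp : p.2 < 1 / Cl) {n : WithTop ℕ∞} :
    ContDiffAt ℝ n (pot Cl) p := by
  unfold pot
  refine contDiffAt_const.div ?_ (by have := rad_pos hCl hp; positivity)
  refine ContDiffAt.pow ?_ 2
  unfold rad
  exact contDiffAt_const.sub (contDiffAt_const.mul contDiffAt_snd)

namespace IsReduced

variable {Cl S : ℝ} {Ω u : ℝ × ℝ → ℝ}

lemma locRad_pos (h : IsReduced Cl S Ω u) : 0 < locRad Cl := by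
  have := h.Cl_pos
  unfold locRad; positivity

lemma two_locRad (h : IsReduced Cl S Ω u) : 2 * locRad Cl = 1 / (16 * Cl) := by
  have := h.Cl_pos
  unfold locRad; field_simp; norm_num

lemma two_locRad_lt (h : IsReduced Cl S Ω u) : 2 * locRad Cl < 1 / Cl := by
  have := h.Cl_pos
  rw [h.two_locRad]
  exact one_div_lt_one_div_of_lt this (by linarith)

lemma contDiffWithinAt (h : IsReduced Cl S Ω u) {p : ℝ × ℝ} (hp : p ∈ closedHalfPlane)
    (hl : len p < 1 / Cl) : ContDiffWithinAt ℝ 2 u closedHalfPlane p := by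
  have hm : ∀ q ∈ closedHalfPlane, len q < 1 / Cl → q ∈ lowerCell Cl := fun q hq hl =>
    ⟨(abs_fst_le_len q).trans_lt hl, hq, snd_lt_of_len hl⟩
  refine (h.smooth p (hm p hp hl)).mono_of_mem_nhdsWithin ?_
  filter_upwards [self_mem_nhdsWithin, nhdsWithin_le_nhds
    (continuous_len.continuousAt.eventually (gt_mem_nhds hl))] with q h1 h2 using hm q h1 h2

lemma locCut_zero (h : IsReduced Cl S Ω u) {p : ℝ × ℝ} (hp : p ∈ closedHalfPlane)
    (hl : 2 * locRad Cl ≤ len p) : locCut Cl p = 0 := isCutoff_radCut.scl_zero h.locRad_pos hp hl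

lemma isTame_locFun (h : IsReduced Cl S Ω u) : IsTame 2 (2 * locRad Cl) (locFun Cl u) := by
  have hz : ∀ p ∈ closedHalfPlane, 2 * locRad Cl < len p → locFun Cl u p = 0 := fun p hp hl => by
    rw [locFun, h.locCut_zero hp hl.le, mul_zero]
  exact ⟨contDiffOn_of_local h.two_locRad_lt (fun p hp hl => (h.contDiffWithinAt hp hl).mul
    (contDiff_locCut Cl (n := 2)).contDiffAt.contDiffWithinAt) hz, hz⟩

lemma locFun_wall (h : IsReduced Cl S Ω u) (x : ℝ) : locFun Cl u (x, 0) = 0 := by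
  rcases le_or_gt |x| (1 / Cl) with hx | hx
  · rw [locFun, h.wall x hx, zero_mul]
  · rw [locFun, h.locCut_zero (show (0 : ℝ) ≤ 0 from le_rfl), mul_zero]
    exact h.two_locRad_lt.le.trans (hx.le.trans (abs_fst_le_len (x, 0)))

lemma dx_locCut_zero (h : IsReduced Cl S Ω u) {p : ℝ × ℝ} (hl : 2 * locRad Cl < len p) :
    dx (locCut Cl) p = 0 ∧ dy (locCut Cl) p = 0 ∧ lap (locCut Cl) p = 0 := by
  have e : locCut Cl =ᶠ[𝓝 p] fun _ => 0 := by
    filter_upwards [continuous_len.continuousAt.eventually (lt_mem_nhds hl)] with q hq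
    refine Real.smoothTransition.zero_of_nonpos ?_
    have h1 := len_scl h.locRad_pos q
    have h2 : 2 ≤ len q / locRad Cl := by rw [le_div_iff₀ h.locRad_pos]; exact hq.le
    rw [← h1] at h2
    rw [← len_sq]; nlinarith [len_nonneg (q.1 / locRad Cl, q.2 / locRad Cl)]
  refine ⟨?_, ?_, ?_⟩
  · rw [dx_congr e]; simp [dx]
  · rw [dy_congr e]; simp [dy]
  · rw [lap_congr e]; simp [lap, dx, dy]

/-- Only first derivatives of u occur, so u of class C² suffices; they are taken within the closed
half plane to make sense on the wall. -/
lemma isTame_locSource (h : IsReduced Cl S Ω u) : IsTame 1 (2 * locRad Cl) (locSource Cl u) := by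
  have hz : ∀ p ∈ closedHalfPlane, 2 * locRad Cl < len p → locSource Cl u p = 0 := fun p hp hl => by
    obtain ⟨h1, h2, h3⟩ := h.dx_locCut_zero hl
    rw [locSource, h1, h2, h3, h.isTame_locFun.zero p hp hl]; simp
  refine ⟨contDiffOn_of_local h.two_locRad_lt (fun p hp hl => ?_) hz, hz⟩
  have hu := h.contDiffWithinAt hp hl
  have hu1 : ContDiffWithinAt ℝ 1 u closedHalfPlane p := hu.of_le one_le_two
  have hx : ContDiffWithinAt ℝ 1 (pdx u) closedHalfPlane p := contDiffWithinAt_pdx (n := 1) hp hu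
  have hy : ContDiffWithinAt ℝ 1 (pdy u) closedHalfPlane p := contDiffWithinAt_pdy (n := 1) hp hu
  have cx : ContDiff ℝ 1 (dx (locCut Cl)) := contDiff_dx (n := 1) (contDiff_locCut Cl (n := 2))
  have cy : ContDiff ℝ 1 (dy (locCut Cl)) := contDiff_dy (n := 1) (contDiff_locCut Cl (n := 2))
  have cl : ContDiff ℝ 1 (lap (locCut Cl)) := contDiff_lap (n := 1) (contDiff_locCut Cl (n := 3))
  have hv : ContDiffWithinAt ℝ 1 (locFun Cl u) closedHalfPlane p :=
    (h.isTame_locFun.smooth p hp).of_le one_le_two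
  have hpot : ContDiffWithinAt ℝ 1 (pot Cl) closedHalfPlane p :=
    (contDiffAt_pot h.Cl_pos (snd_lt_of_len hl)).contDiffWithinAt
  exact ((hpot.mul hv).neg.sub (contDiffWithinAt_const.mul ((hx.mul cx.contDiffAt.contDiffWithinAt).add
    (hy.mul cy.contDiffAt.contDiffWithinAt)))).sub (hu1.mul cl.contDiffAt.contDiffWithinAt)

lemma pdx_wall (h : IsReduced Cl S Ω u) {x : ℝ} (hx : |x| < 1 / Cl) : pdx u (x, 0) = 0 := by
  have h1 : HasFDerivWithinAt u (fderivWithin ℝ u closedHalfPlane (x, 0)) closedHalfPlane (x, 0) :=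
    ((h.contDiffWithinAt (show (0 : ℝ) ≤ 0 from le_rfl)
      (by rw [len]; simpa [Real.sqrt_sq_eq_abs] using hx)).differentiableWithinAt two_ne_zero).hasFDerivWithinAt
  have h2 : HasDerivAt (fun t : ℝ => (t, (0 : ℝ))) ((1 : ℝ), (0 : ℝ)) x :=
    (hasDerivAt_id x).prodMk (hasDerivAt_const x 0)
  have h3 := h1.comp_hasDerivAt (f := fun t : ℝ => (t, (0 : ℝ))) x h2
    (Eventually.of_forall fun t => show (0 : ℝ) ≤ 0 from le_rfl)
  have h4 : HasDerivAt (fun _ : ℝ => (0 : ℝ)) (pdx u (x, 0)) x := by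
    refine h3.congr_of_eventuallyEq ?_
    filter_upwards [continuous_abs.continuousAt.eventually (gt_mem_nhds hx)] with t ht
    exact (h.wall t ht.le).symm
  exact h4.unique (hasDerivAt_const x 0)

/-- On the wall u and u_x vanish, and u_y meets the normal derivative of the radial cutoff, which is
zero. This is what the odd C¹ extension needs. -/
lemma locSource_wall (h : IsReduced Cl S Ω u) (x : ℝ) : locSource Cl u (x, 0) = 0 := by
  rcases lt_or_ge |x| (1 / Cl) with hx | hx
  · rw [locSource, h.locFun_wall, h.pdx_wall hx, h.wall x hx.le, locCut, dy_scl_radCut_wall]; simp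
  · exact h.isTame_locSource.zero _ (show (0 : ℝ) ≤ 0 from le_rfl)
      (h.two_locRad_lt.trans_le (hx.trans (abs_fst_le_len (x, 0))))

/-- The product rule, together with ζΩ = Ω: the cutoff equals 1 on the support of Ω because S is
less than the localization radius. -/
lemma neg_lap_locFun (h : IsReduced Cl S Ω u) (hS : S < locRad Cl) {p : ℝ × ℝ} (hp : p ∈ halfPlane) :
    -lap (locFun Cl u) p = Ω p + locSource Cl u p := by
  rcases le_or_gt (len p) (2 * locRad Cl) with hl | hl
  · have hl' := hl.trans_lt h.two_locRad_lt
    have hu := h.contDiffAt hp hl'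
    have hud : DifferentiableAt ℝ u p := hu.differentiableAt two_ne_zero
    have e : lap (locFun Cl u) p = u p * lap (locCut Cl) p + locCut Cl p * lap u p
        + 2 * (dx u p * dx (locCut Cl) p + dy u p * dy (locCut Cl) p) :=
      lap_mul hu (contDiff_locCut Cl (n := 2)).contDiffAt
    have hΩ : locCut Cl p * Ω p = Ω p := by
      rcases le_or_gt (len p) (locRad Cl) with h1 | h1
      · rw [locCut, isCutoff_radCut.scl_one h.locRad_pos (halfPlane_subset hp) h1, one_mul]
      · rw [h.supp p hp (hS.trans h1), mul_zero]
    rw [e, h.lap_eq hp hl', locSource, pdx_eq_dx hp hud, pdy_eq_dy hp hud, locFun]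
    have : locCut Cl p * (pot Cl p * u p - Ω p) = locCut Cl p * (pot Cl p * u p) - Ω p := by
      rw [mul_sub, hΩ]
    rw [this]; ring
  · have e : locFun Cl u =ᶠ[𝓝 p] fun _ => 0 := by
      filter_upwards [isOpen_halfPlane.mem_nhds hp,
        continuous_len.continuousAt.eventually (lt_mem_nhds hl)] with q h1 h2
      exact h.isTame_locFun.zero q (halfPlane_subset h1) h2
    rw [lap_congr e, h.isTame_locSource.zero p (halfPlane_subset hp) hl,
      h.supp p hp (by have := h.locRad_pos; linarith)]
    simp [lap, dx, dy]

lemma invLap_locFun (h : IsReduced Cl S Ω u) {p : ℝ × ℝ} (hp : p ∈ halfPlane) :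
    invLap (fun q => -lap (locFun Cl u) q) p = locFun Cl u p := by
  obtain ⟨B, hB⟩ := h.isTame_locFun.exists_isTest h.locFun_wall
  exact hB.invLap_eq hp

end IsReduced

/-! ### Linearity of the Green potential -/

lemma integrable_invLap {f : ℝ × ℝ → ℝ} {L B : ℝ} (hc : ContinuousOn f halfPlane)
    (hb : ∀ q ∈ halfPlane, |f q| ≤ B) (hz : ∀ q ∈ halfPlane, L < len q → f q = 0) (p : ℝ × ℝ) :
    IntegrableOn (fun q : ℝ × ℝ => (Real.log (len (p.1 - q.1, p.2 - q.2))
      - Real.log (len (p.1 - q.1, p.2 + q.2))) * f q) halfPlane := by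
  set M := max L 1
  have hM0 : 0 < M := lt_max_of_lt_right one_pos
  set g := halfPlane.indicator f with hg
  have hfm : AEStronglyMeasurable g volume :=
    (aestronglyMeasurable_indicator_iff measurableSet_halfPlane).2
      (hc.aestronglyMeasurable measurableSet_halfPlane)
  have hB : 0 ≤ B := (abs_nonneg _).trans (hb (0, 1) (show (0 : ℝ) < 1 from one_pos))
  have hgb : ∀ q, |g q| ≤ B := by
    intro q
    by_cases hq : q ∈ halfPlane
    · rw [hg, indicator_of_mem hq]; exact hb q hq
    · rw [hg, indicator_of_notMem hq, abs_zero]; exact hB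
  have hgz : ∀ q, q ∉ sqBox 0 M → g q = 0 := by
    intro q hs
    by_cases hq : q ∈ halfPlane
    · rw [hg, indicator_of_mem hq]
      refine hz q hq ?_
      by_contra! h
      exact hs (mem_sqBox_zero (h.trans (le_max_left _ _)))
    · rw [hg, indicator_of_notMem hq]
  have hlog : ∀ a : ℝ × ℝ, Integrable fun q => Real.log (len (a - q)) * g q := by
    intro a
    refine integrable_of_le_inv_len (p := a) (c := 0) (L := M) (a := (len a + 2 * M) * B)
      (b := B) hM0 ?_ (fun q hq => by rw [hgz q hq, mul_zero]) fun q hq => ?_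
    · exact (Real.measurable_log.comp (measurable_len.comp
        (measurable_const.sub measurable_id))).aestronglyMeasurable.mul hfm
    · rw [abs_mul]
      have h1 := abs_log_le (len_nonneg (a - q))
      have h3 : len (a - q) ≤ len a + 2 * M := by
        have := len_triangle a (-q)
        rw [← sub_eq_add_neg] at this
        have e : len (-q) = len q := by unfold len; simp
        obtain ⟨h1, h2⟩ := mem_sqBox.1 hq
        simp only [Prod.fst_zero, Prod.snd_zero, sub_zero] at h1 h2
        have := len_le_add q
        linarith
      have h4 := inv_nonneg.2 (len_nonneg (a - q))
      have h5 := len_nonneg a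
      have h6 := len_nonneg (a - q)
      calc _ ≤ (len (a - q) + (len (a - q))⁻¹) * B := by gcongr; exact hgb q
        _ ≤ (len a + 2 * M + (len (a - q))⁻¹) * B := by gcongr
        _ = _ := by ring
  have := ((hlog p).sub (hlog (p.1, -p.2))).integrableOn (s := halfPlane)
  refine this.congr_fun (fun q hq => ?_) measurableSet_halfPlane
  simp only [Pi.sub_apply, hg, indicator_of_mem hq, invLap_kernel_eq]
  have : (p.1 - q.1, p.2 - q.2) = p - q := rfl
  rw [this]; ring

lemma invLap_sub {f g : ℝ × ℝ → ℝ} {L B B' : ℝ} (hf : ContinuousOn f halfPlane)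
    (hfb : ∀ q ∈ halfPlane, |f q| ≤ B) (hfz : ∀ q ∈ halfPlane, L < len q → f q = 0)
    (hg : ContinuousOn g halfPlane) (hgb : ∀ q ∈ halfPlane, |g q| ≤ B')
    (hgz : ∀ q ∈ halfPlane, L < len q → g q = 0) (p : ℝ × ℝ) :
    invLap (fun q => f q - g q) p = invLap f p - invLap g p := by
  unfold invLap
  rw [← mul_sub, ← integral_sub (integrable_invLap hf hfb hfz p) (integrable_invLap hg hgb hgz p)]
  congr 2
  funext q
  ring

/-- Representation formula for the localized function plus linearity. It transfers questions on the
potential of Ω to u and to the potential of a C¹ density. -/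
lemma IsReduced.invLap_source {Cl S : ℝ} {Ω u : ℝ × ℝ → ℝ} (h : IsReduced Cl S Ω u)
    (hS : S < locRad Cl) {p : ℝ × ℝ} (hp : p ∈ halfPlane) :
    invLap Ω p = locFun Cl u p - invLap (locSource Cl u) p := by
  obtain ⟨B, hB⟩ := h.isTame_locFun.exists_isTest h.locFun_wall
  obtain ⟨B', -, hB'⟩ := h.isTame_locSource.exists_bound
  rw [← h.invLap_locFun hp, ← invLap_sub (L := 2 * locRad Cl) (B := B + B) (B' := B')
    (f := fun q => -lap (locFun Cl u) q) (hB.cont_dxx.add hB.cont_dyy).neg ?_ ?_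
    (h.isTame_locSource.smooth.continuousOn.mono fun q => halfPlane_subset)
    (fun q hq => hB' q (halfPlane_subset hq))
    (fun q hq => h.isTame_locSource.zero q (halfPlane_subset hq)) p]
  · refine congrFun (invLap_congr fun q hq => ?_) p
    have := h.neg_lap_locFun hS hq
    show Ω q = -lap (locFun Cl u) q - locSource Cl u q
    linarith
  · intro q hq
    show |-(dx (dx (locFun Cl u)) q + dy (dy (locFun Cl u)) q)| ≤ B + B
    rw [abs_neg]
    exact (abs_add_le _ _).trans (add_le_add (hB.dxx_le q hq) (hB.dyy_le q hq))
  · intro q hq hl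
    show -(dx (dx (locFun Cl u)) q + dy (dy (locFun Cl u)) q) = 0
    rw [hB.dxx_zero hq hl, hB.dyy_zero hq hl]; simp

/-! ### Bounds for the source of the localized problem -/

lemma rpow_two_sub {ρ : ℝ} (h : 0 < ρ) (β : ℝ) : ρ ^ (2 - β) = ρ ^ 2 * ρ ^ (-β) := by
  rw [sub_eq_add_neg, Real.rpow_add h]; norm_cast

lemma rpow_one_sub {ρ : ℝ} (h : 0 < ρ) (β : ℝ) : ρ ^ (1 - β) = ρ * ρ ^ (-β) := by
  rw [sub_eq_add_neg, Real.rpow_add h, Real.rpow_one]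

/-- On scales comparable with the cell, |x|^{-β} is of order C_l^β; the constant uses 64^β ≤ 64. -/
lemma rpow_neg_le_of_ge {ρ Cl β : ℝ} (hCl : 0 < Cl) (hβ : 0 < β) (hβ1 : β < 1)
    (h : 1 / (64 * Cl) ≤ ρ) : ρ ^ (-β) ≤ 64 * Cl ^ β := by
  have h0 : 0 < 1 / (64 * Cl) := by positivity
  calc ρ ^ (-β) ≤ (1 / (64 * Cl)) ^ (-β) := Real.rpow_le_rpow_of_nonpos h0 h (by linarith)
    _ = 64 ^ β * Cl ^ β := by
      rw [one_div, Real.inv_rpow (by positivity), ← Real.rpow_neg (by positivity), neg_neg,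
        Real.mul_rpow (by norm_num) hCl.le]
    _ ≤ 64 ^ (1 : ℝ) * Cl ^ β := by
      gcongr
      norm_num
    _ = _ := by rw [Real.rpow_one]

lemma mul_rpow_neg_le {ρ Cl β : ℝ} (hCl : 0 < Cl) (hβ1 : β < 1) (hρ : 0 < ρ)
    (h : ρ ≤ 1 / Cl) : Cl * (ρ * ρ ^ (-β)) ≤ Cl ^ β := by
  rw [← rpow_one_sub hρ]
  calc Cl * ρ ^ (1 - β) ≤ Cl * (1 / Cl) ^ (1 - β) := by
        gcongr
    _ = Cl ^ β := by
      rw [one_div, Real.inv_rpow hCl.le, ← Real.rpow_neg hCl.le]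
      nth_rewrite 1 [← Real.rpow_one Cl]
      rw [← Real.rpow_add hCl]
      congr 1; ring

lemma GradBound.of_contDiffAt_dx {f : ℝ × ℝ → ℝ} {p : ℝ × ℝ} {a b c : ℝ} (h : ContDiffAt ℝ 2 f p)
    (h1 : GradBound f p a b) (h2 : HessBound f p c) : GradBound (dx f) p b c :=
  ⟨differentiableAt_dx h, h1.dx_le, h2.xx, h2.yx⟩

lemma GradBound.of_contDiffAt_dy {f : ℝ × ℝ → ℝ} {p : ℝ × ℝ} {a b c : ℝ} (h : ContDiffAt ℝ 2 f p)
    (h1 : GradBound f p a b) (h2 : HessBound f p c) : GradBound (dy f) p b c :=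
  ⟨differentiableAt_dy h, h1.dy_le, h2.xy, h2.yy⟩

lemma HessBound.mul {f g : ℝ × ℝ → ℝ} {p : ℝ × ℝ} {a b c a' b' c' : ℝ} (hf : ContDiffAt ℝ 2 f p)
    (hg : ContDiffAt ℝ 2 g p) (h1 : GradBound f p a b) (h2 : HessBound f p c)
    (h1' : GradBound g p a' b') (h2' : HessBound g p c') :
    HessBound (fun q => f q * g q) p (c * a' + 2 * (b * b') + a * c') := by
  have hx := (((h1.of_contDiffAt_dx hf h2).mul h1').add (h1.mul (h1'.of_contDiffAt_dx hg h2'))).congr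
    (dx_mul_ev hf hg)
  have hy := (((h1.of_contDiffAt_dy hf h2).mul h1').add (h1.mul (h1'.of_contDiffAt_dy hg h2'))).congr
    (dy_mul_ev hf hg)
  have e : c * a' + b * b' + (b * b' + a * c') = c * a' + 2 * (b * b') + a * c' := by ring
  rw [e] at hx hy
  exact ⟨hx.dx_le, hy.dx_le, hx.dy_le, hy.dy_le⟩

lemma HessBound.congr {f g : ℝ × ℝ → ℝ} {p : ℝ × ℝ} {c : ℝ} (h : HessBound f p c) (e : g =ᶠ[𝓝 p] f) :
    HessBound g p c :=
  ⟨by rw [dx_congr (dx_eventuallyEq e)]; exact h.xx, by rw [dx_congr (dy_eventuallyEq e)]; exact h.xy,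
    by rw [dy_congr (dx_eventuallyEq e)]; exact h.yx, by rw [dy_congr (dy_eventuallyEq e)]; exact h.yy⟩

lemma HessBound.zero {p : ℝ × ℝ} {c : ℝ} (hc : 0 ≤ c) : HessBound (fun _ => 0) p c := by
  constructor <;> simp [dx, dy, hc]

lemma gradBound_pot {Cl : ℝ} (hCl : 0 < Cl) {p : ℝ × ℝ} (hp : p.2 ≤ 1 / (4 * Cl)) :
    GradBound (pot Cl) p (2 * Cl ^ 2) (4 * Cl ^ 3) := by
  have hr : 3 / 4 ≤ rad Cl p := by
    unfold rad
    rw [le_div_iff₀ (by positivity)] at hp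
    linarith
  have hlt : p.2 < 1 / Cl := hp.trans_lt (by
    rw [div_lt_div_iff₀ (by positivity) hCl]; linarith)
  refine ⟨(contDiffAt_pot hCl hlt (n := 1)).differentiableAt one_ne_zero, ?_, ?_, ?_⟩
  · rw [abs_pot]; exact pot_le hCl hp
  · have : dx (pot Cl) p = 0 := by simp [dx, pot, rad]
    rw [this, abs_zero]; positivity
  · have hd : HasDerivAt (fun t => pot Cl (p.1, t)) (3 / 2 * Cl ^ 3 / rad Cl p ^ 3) p.2 := by
      have h1 : HasDerivAt (fun t => rad Cl (p.1, t)) (-Cl) p.2 := by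
        have := ((hasDerivAt_id p.2).const_mul Cl).const_sub 1
        exact this.congr_deriv (by ring)
      have hne : rad Cl (p.1, p.2) ≠ 0 := by
        show rad Cl p ≠ 0
        linarith
      have h2 := (hasDerivAt_const p.2 ((3 / 4 : ℝ) * Cl ^ 2)).div (h1.pow 2) (pow_ne_zero 2 hne)
      refine HasDerivAt.congr_deriv (f := fun t => pot Cl (p.1, t)) h2 ?_
      simp only [Pi.pow_apply]
      have : rad Cl (p.1, p.2) = rad Cl p := rfl
      rw [this] at hne ⊢
      field_simp
      norm_num
      ring
    have : dy (pot Cl) p = 3 / 2 * Cl ^ 3 / rad Cl p ^ 3 := hd.deriv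
    have h3 : (3 / 4 : ℝ) ^ 3 ≤ rad Cl p ^ 3 := by gcongr
    rw [this, abs_of_nonneg (by positivity), div_le_iff₀ (by positivity)]
    have : 0 < Cl ^ 3 := by positivity
    nlinarith

lemma CutBound.contDiffAt_two {r B : ℝ} {f : ℝ × ℝ → ℝ} (h : CutBound r B f) {p : ℝ × ℝ}
    (hp : p ∈ halfPlane) : ContDiffAt ℝ 2 f p := (h.smooth p hp).of_le (by norm_num)

/-- Two different bounds for u enter: h1 makes the value O(C_l|x|), hence zero at the origin, as the
expansion requires, and h2 makes the gradient O(C_l^{1+β}). Each derivative of ζ costs a factor C_l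
and lives on |x| ≥ `locRad`, where the Hessian bound h3 holds and |x|^{-β} ≲ C_l^β. -/
lemma gradBound_locSource_near {Cl β a B : ℝ} {u : ℝ × ℝ → ℝ} {p : ℝ × ℝ} (hCl : 0 < Cl) (ha : 0 ≤ a)
    (hβ : 0 < β) (hβ1 : β < 1)
    (hp : p ∈ halfPlane) (hl : len p ≤ 1 / (16 * Cl)) (hB : 0 ≤ B)
    (hζ : CutBound (locRad Cl) B (locCut Cl)) (hu : ContDiffAt ℝ 2 u p)
    (h1 : GradBound u p (a * len p ^ 2) (a * len p))
    (h2 : GradBound u p (a * len p ^ (2 - β)) (a * len p ^ (1 - β)))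
    (h3 : locRad Cl ≤ len p → HessBound u p (a * len p ^ (-β))) :
    GradBound (locSource Cl u) p (600 * B * a * (Cl * len p)) (100000 * B * a * (Cl * Cl ^ β)) := by
  have hρ : 0 < len p := len_pos_of_mem hp
  set ρ := len p with hρdef
  set z := ρ ^ (-β) with hz
  set y := Cl ^ β with hy
  have hy0 : 0 < y := by positivity
  have hz0 : 0 < z := by positivity
  have hClρ : Cl * ρ ≤ 1 / 16 := by
    rw [le_div_iff₀ (by positivity)] at hl; linarith
  have hρ1 : ρ ≤ 1 / Cl := by
    rw [le_div_iff₀ hCl]; linarith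
  have hzy : Cl * (ρ * z) ≤ y := mul_rpow_neg_le hCl hβ1 hρ hρ1
  have hBr : B / locRad Cl = 32 * B * Cl := by unfold locRad; field_simp
  have hBr2 : B / locRad Cl ^ 2 = 1024 * B * Cl ^ 2 := by unfold locRad; field_simp; norm_num
  have hBr3 : B / locRad Cl ^ 3 = 32768 * B * Cl ^ 3 := by unfold locRad; field_simp; norm_num
  have g0 := hζ.g0 p hp
  have gx := hζ.gx p hp
  have gy := hζ.gy p hp
  have gl := hζ.gl p hp
  rw [hBr] at g0
  rw [hBr, hBr2] at gx gy
  rw [hBr2, hBr3] at gl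
  rw [rpow_two_sub hρ, rpow_one_sub hρ, ← hz] at h2
  have gp := gradBound_pot hCl (p := p) (by
    have := (le_abs_self _).trans ((abs_snd_le_len p).trans hl)
    refine this.trans ?_
    rw [div_le_div_iff₀ (by positivity) (by positivity)]; linarith)
  -- the lower order term
  have T1 : GradBound (fun q => pot Cl q * locFun Cl u q) p (B * a * (Cl * ρ)) (100 * B * a * (Cl * y)) := by
    -- t1 serves for the value and t2 for the derivatives.
    have t1 := gp.mul (h1.mul g0)
    have t2 := gp.mul (h2.mul g0)
    have hBa : 0 ≤ B * a := mul_nonneg hB ha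
    have v1 : 2 * Cl ^ 2 * (a * ρ ^ 2 * B) ≤ B * a * (Cl * ρ) := by
      have e : 2 * Cl ^ 2 * (a * ρ ^ 2 * B) = B * a * (Cl * ρ) * (2 * (Cl * ρ)) := by ring
      rw [e]
      exact mul_le_of_le_one_right (by positivity) (by linarith)
    have v2 : 4 * Cl ^ 3 * (a * (ρ ^ 2 * z) * B)
        + 2 * Cl ^ 2 * (a * (ρ * z) * B + a * (ρ ^ 2 * z) * (32 * B * Cl)) ≤ 100 * B * a * (Cl * y) := by
      have e : 4 * Cl ^ 3 * (a * (ρ ^ 2 * z) * B)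
        + 2 * Cl ^ 2 * (a * (ρ * z) * B + a * (ρ ^ 2 * z) * (32 * B * Cl))
        = B * a * Cl * (Cl * (ρ * z)) * (68 * (Cl * ρ) + 2) := by ring
      rw [e]
      calc _ ≤ B * a * Cl * y * (68 * (1 / 16) + 2) := by gcongr
        _ ≤ B * a * Cl * y * 100 := by gcongr; norm_num
        _ = _ := by ring
    exact ⟨t1.diff, t1.val.trans v1, t2.dx_le.trans v2, t2.dy_le.trans v2⟩
  have T23 : GradBound (fun q => 2 * (dx u q * dx (locCut Cl) q + dy u q * dy (locCut Cl) q)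
      + u q * lap (locCut Cl) q) p (400 * B * a * (Cl * ρ)) (60000 * B * a * (Cl * y)) := by
    rcases lt_or_ge ρ (locRad Cl) with hlt | hge
    · have e : locCut Cl =ᶠ[𝓝 p] fun _ => 1 :=
        isCutoff_radCut.scl_one_ev (by unfold locRad; positivity) hp hlt
      have ex : dx (locCut Cl) =ᶠ[𝓝 p] fun _ => 0 :=
        (dx_eventuallyEq e).trans (Eventually.of_forall fun q => by simp [dx])
      have ey : dy (locCut Cl) =ᶠ[𝓝 p] fun _ => 0 :=
        (dy_eventuallyEq e).trans (Eventually.of_forall fun q => by simp [dy])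
      have el : lap (locCut Cl) =ᶠ[𝓝 p] fun _ => 0 :=
        (lap_eventuallyEq e).trans (Eventually.of_forall fun q => by simp [lap, dx, dy])
      refine (GradBound.of_eventually_zero ?_).mono (by positivity) (by positivity)
      filter_upwards [ex, ey, el] with q h1 h2 h3
      rw [h1, h2, h3]; simp
    · have hh := h3 hge
      have hz64 : z ≤ 64 * y := rpow_neg_le_of_ge hCl hβ hβ1 (by
        refine le_trans ?_ hge
        unfold locRad
        rw [div_le_div_iff₀ (by positivity) (by positivity)]; linarith)
      have t1 := ((((h1.of_contDiffAt_dx hu hh).mul gx).add ((h1.of_contDiffAt_dy hu hh).mul gy)).const_mul 2).add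
        (h1.mul gl)
      have t2 := ((((h2.of_contDiffAt_dx hu hh).mul gx).add ((h2.of_contDiffAt_dy hu hh).mul gy)).const_mul 2).add
        (h2.mul gl)
      rw [abs_two] at t1 t2
      have v1 : 2 * (a * ρ * (32 * B * Cl) + a * ρ * (32 * B * Cl)) + a * ρ ^ 2 * (1024 * B * Cl ^ 2)
          ≤ 400 * B * a * (Cl * ρ) := by
        have e : 2 * (a * ρ * (32 * B * Cl) + a * ρ * (32 * B * Cl)) + a * ρ ^ 2 * (1024 * B * Cl ^ 2)
          = B * a * (Cl * ρ) * (128 + 1024 * (Cl * ρ)) := by ring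
        rw [e]
        calc _ ≤ B * a * (Cl * ρ) * (128 + 1024 * (1 / 16)) := by gcongr
          _ ≤ B * a * (Cl * ρ) * 400 := by gcongr; norm_num
          _ = _ := by ring
      have v2 : 2 * (a * z * (32 * B * Cl) + a * (ρ * z) * (1024 * B * Cl ^ 2)
          + (a * z * (32 * B * Cl) + a * (ρ * z) * (1024 * B * Cl ^ 2)))
          + (a * (ρ * z) * (1024 * B * Cl ^ 2) + a * (ρ ^ 2 * z) * (32768 * B * Cl ^ 3))
          ≤ 60000 * B * a * (Cl * y) := by
        have e : 2 * (a * z * (32 * B * Cl) + a * (ρ * z) * (1024 * B * Cl ^ 2)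
          + (a * z * (32 * B * Cl) + a * (ρ * z) * (1024 * B * Cl ^ 2)))
          + (a * (ρ * z) * (1024 * B * Cl ^ 2) + a * (ρ ^ 2 * z) * (32768 * B * Cl ^ 3))
          = B * a * Cl * z * (128 + 5120 * (Cl * ρ) + 32768 * (Cl * ρ) ^ 2) := by ring
        rw [e]
        calc _ ≤ B * a * Cl * (64 * y) * (128 + 5120 * (1 / 16) + 32768 * (1 / 16) ^ 2) := by gcongr
          _ ≤ B * a * Cl * (64 * y) * 900 := by gcongr; norm_num
          _ = 57600 * B * a * (Cl * y) := by ring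
          _ ≤ _ := by gcongr; norm_num
      exact ⟨t1.diff, t1.val.trans v1, t2.dx_le.trans v2, t2.dy_le.trans v2⟩
  refine ((T1.add T23).neg.congr ?_).mono ?_ ?_
  · filter_upwards [isOpen_halfPlane.mem_nhds hp, contDiffAt_two_eventually hu] with q h4 h5
    rw [locSource, pdx_eq_dx h4 h5, pdy_eq_dy h4 h5]; ring
  · have : 0 ≤ B * a * (Cl * ρ) := by positivity
    linarith
  · have : 0 ≤ B * a * (Cl * y) := by positivity
    linarith

/-- The size, gradient and Hessian bounds are inserted into the preceding estimate. The condition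
256S ≤ 1/C_l makes 4S at most `locRad`, so the Hessian bound is available wherever ζ varies; beyond
1/(16C_l) the source vanishes. -/
theorem exists_locSource_bound {α β : ℝ} (hα : 0 < α) (hα1 : α ≤ 1) (hβ : 0 < β) (hβ1 : β < 1) :
    ∃ C : ℝ, 0 < C ∧ ∀ (Cl S A : ℝ) (Ω u : ℝ × ℝ → ℝ), IsReduced Cl S Ω u → 0 ≤ A →
      SourceBound α β A Ω → 256 * S ≤ 1 / Cl → ∀ p ∈ halfPlane,
        GradBound (locSource Cl u) p (C * A * (Cl * len p)) (C * A * (Cl * Cl ^ β)) := by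
  obtain ⟨C1, hC1, hg⟩ := exists_grad_bound hα hα1 hβ hβ1
  obtain ⟨C2, hC2, hh⟩ := exists_hess_bound hα hα1 hβ hβ1
  obtain ⟨B, hB, hcut⟩ := (isCutoff_radCut.isTame 3).exists_cutBound
  refine ⟨100000 * B * (C1 + C2) + 1, by positivity, fun Cl S A Ω u h hA hΩ hS p hp => ?_⟩
  have hCl := h.Cl_pos
  have hρ : 0 < len p := len_pos_of_mem hp
  rcases le_or_gt (len p) (1 / (16 * Cl)) with hl | hl
  · have hl8 : len p ≤ 1 / (8 * Cl) := hl.trans (by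
      rw [div_le_div_iff₀ (by positivity) (by positivity)]; linarith)
    have hu := h.contDiffAt hp (hl.trans_lt (by rw [div_lt_div_iff₀ (by positivity) hCl]; linarith))
    obtain ⟨g1, g2⟩ := hg Cl S A Ω u h hA hΩ p hp hl8
    have hc : C1 * A ≤ (C1 + C2) * A := by gcongr; linarith
    have hc2 : C2 * A ≤ (C1 + C2) * A := by gcongr; linarith
    have := gradBound_locSource_near (β := β) (a := (C1 + C2) * A) hCl (by positivity) hβ hβ1 hp hl hB
      (hcut.scl h.locRad_pos) hu (g1.mono (by gcongr) (by gcongr)) (g2.mono (by gcongr) (by gcongr))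
      (fun hge => (hh Cl S A Ω u h hA hΩ p hp (by
        have h1 : 8 * (32 * S) ≤ 1 / Cl := by linarith
        have h2 : 4 * S ≤ locRad Cl := by
          unfold locRad
          rw [le_div_iff₀ (by positivity)] at h1 ⊢
          nlinarith
        linarith) hl).mono (by gcongr))
    refine this.mono ?_ ?_
    · calc 600 * B * ((C1 + C2) * A) * (Cl * len p) = (600 * B * (C1 + C2)) * A * (Cl * len p) := by ring
        _ ≤ _ := by
          gcongr
          have : 0 ≤ B * (C1 + C2) := by positivity
          nlinarith
    · calc 100000 * B * ((C1 + C2) * A) * (Cl * Cl ^ β)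
            = (100000 * B * (C1 + C2)) * A * (Cl * Cl ^ β) := by ring
        _ ≤ _ := by gcongr; linarith
  · have e : locSource Cl u =ᶠ[𝓝 p] fun _ => 0 := by
      filter_upwards [isOpen_halfPlane.mem_nhds hp,
        continuous_len.continuousAt.eventually (lt_mem_nhds hl)] with q h1 h2
      exact h.isTame_locSource.zero q (halfPlane_subset h1) (by rw [h.two_locRad]; exact h2)
    exact (GradBound.of_eventually_zero e).mono (by positivity) (by positivity)

/-- The Green potential of the localization source. -/
theorem exists_hessBound_invLap_locSource {α β : ℝ} (hα : 0 < α) (hα1 : α ≤ 1) (hβ : 0 < β) (hβ1 : β < 1) :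
    ∃ C : ℝ, 0 < C ∧ ∀ (Cl S A : ℝ) (Ω u : ℝ × ℝ → ℝ), IsReduced Cl S Ω u → 0 ≤ A →
      SourceBound α β A Ω → 256 * S ≤ 1 / Cl →
        ContDiff ℝ 2 (invLap (locSource Cl u)) ∧
          ∀ p, HessBound (invLap (locSource Cl u)) p (C * A * Cl ^ β) := by
  obtain ⟨C, hC, hb⟩ := exists_locSource_bound hα hα1 hβ hβ1
  refine ⟨3 * C, by positivity, fun Cl S A Ω u h hA hΩ hS => ?_⟩
  have hCl := h.Cl_pos
  have hG := hb Cl S A Ω u h hA hΩ hS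
  -- The support radius 1/(16C_l) times the gradient bound C_l^{1+β} leaves C_l^β.
  obtain ⟨h1, h2⟩ := contDiff_invLap (L := 2 * locRad Cl) (B := C * A * (Cl * Cl ^ β))
    h.isTame_locSource.smooth h.locSource_wall (by have := h.locRad_pos; positivity)
    h.isTame_locSource.zero (fun q hq => (hG q hq).dx_le) (fun q hq => (hG q hq).dy_le)
  refine ⟨h1, fun p => (h2 p).mono ?_⟩
  rw [h.two_locRad]
  have : 36 * (1 / (16 * Cl)) * (C * A * (Cl * Cl ^ β)) = 36 / 16 * (C * A * Cl ^ β) := by field_simp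
  rw [this]
  have : 0 ≤ C * A * Cl ^ β := by positivity
  linarith

/-! ### Mixed derivatives at the origin -/

/-- Functions of class `C²` up to the wall near the origin. -/
def IsC2AtZero (f : ℝ × ℝ → ℝ) : Prop :=
  ∃ δ > 0, ∀ p ∈ closedHalfPlane, len p < δ → ContDiffWithinAt ℝ 2 f closedHalfPlane p

lemma derivWithin_eq_pdy {f : ℝ × ℝ → ℝ} {s : ℝ} (h : DifferentiableWithinAt ℝ f closedHalfPlane (s, 0)) :
    HasDerivWithinAt (fun t => f (s, t)) (pdy f (s, 0)) (Ici 0) 0 := by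
  have h2 : HasDerivWithinAt (fun t : ℝ => (s, t)) ((0 : ℝ), (1 : ℝ)) (Ici 0) 0 :=
    (hasDerivWithinAt_const 0 _ s).prodMk (hasDerivWithinAt_id 0 _)
  exact h.hasFDerivWithinAt.comp_hasDerivWithinAt (f := fun t : ℝ => (s, t)) 0 h2 fun t ht => ht

lemma len_axis (s : ℝ) : len (s, 0) = |s| := by simp [len, Real.sqrt_sq_eq_abs]

lemma IsC2AtZero.eventually {f : ℝ × ℝ → ℝ} (h : IsC2AtZero f) :
    ∀ᶠ s in 𝓝 (0 : ℝ), ContDiffWithinAt ℝ 2 f closedHalfPlane (s, 0) := by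
  obtain ⟨δ, hδ, h⟩ := h
  have : ∀ᶠ s : ℝ in 𝓝 0, |s| < δ := continuous_abs.continuousAt.eventually (gt_mem_nhds (by simpa using hδ))
  filter_upwards [this] with s hs
  exact h (s, 0) (show (0 : ℝ) ≤ 0 from le_rfl) (by rwa [len_axis])

lemma IsC2AtZero.ev_derivWithin {f : ℝ × ℝ → ℝ} (h : IsC2AtZero f) :
    (fun s => derivWithin (fun t => f (s, t)) (Ici 0) 0) =ᶠ[𝓝 0] fun s => pdy f (s, 0) := by
  filter_upwards [h.eventually] with s hs
  exact (derivWithin_eq_pdy (hs.differentiableWithinAt two_ne_zero)).derivWithin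
    (uniqueDiffOn_Ici (0 : ℝ) 0 (by simp))

lemma IsC2AtZero.differentiableAt {f : ℝ × ℝ → ℝ} (h : IsC2AtZero f) :
    DifferentiableAt ℝ (fun s => pdy f (s, 0)) 0 := by
  have h1 : DifferentiableWithinAt ℝ (pdy f) closedHalfPlane (0, 0) :=
    (contDiffWithinAt_pdy (n := 1) (show (0 : ℝ) ≤ 0 from le_rfl) h.eventually.self_of_nhds).differentiableWithinAt
      (by simp)
  have h2 : DifferentiableWithinAt ℝ (fun s : ℝ => (s, (0 : ℝ))) univ 0 :=
    (differentiableAt_id.prodMk (differentiableAt_const 0)).differentiableWithinAt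
  have := DifferentiableWithinAt.comp (g := pdy f) (f := fun s : ℝ => (s, (0 : ℝ))) (0 : ℝ) h1 h2
    (fun s _ => show (0 : ℝ) ≤ 0 from le_rfl)
  exact differentiableWithinAt_univ.1 this

lemma IsC2AtZero.dxyZero_eq {f : ℝ × ℝ → ℝ} (h : IsC2AtZero f) :
    dxyZero f = deriv (fun s => pdy f (s, 0)) 0 := h.ev_derivWithin.deriv_eq

lemma IsC2AtZero.dxyZero_sub {f g : ℝ × ℝ → ℝ} (hf : IsC2AtZero f) (hg : IsC2AtZero g) :
    dxyZero (fun p => f p - g p) = dxyZero f - dxyZero g := by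
  rw [hf.dxyZero_eq, hg.dxyZero_eq, ← deriv_fun_sub hf.differentiableAt hg.differentiableAt]
  refine Filter.EventuallyEq.deriv_eq ?_
  filter_upwards [hf.eventually, hg.eventually] with s h1 h2
  exact ((derivWithin_eq_pdy (h1.differentiableWithinAt two_ne_zero)).sub
    (derivWithin_eq_pdy (h2.differentiableWithinAt two_ne_zero))).derivWithin
    (uniqueDiffOn_Ici (0 : ℝ) 0 (by simp))

lemma dxyZero_congr {f g : ℝ × ℝ → ℝ} {δ : ℝ} (hδ : 0 < δ)
    (h : ∀ p ∈ closedHalfPlane, len p < δ → f p = g p) : dxyZero f = dxyZero g := by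
  refine Filter.EventuallyEq.deriv_eq ?_
  have : ∀ᶠ s : ℝ in 𝓝 0, |s| < δ := continuous_abs.continuousAt.eventually (gt_mem_nhds (by simpa using hδ))
  filter_upwards [this] with s hs
  have hl : len (s, 0) < δ := by rwa [len_axis]
  have hc : Continuous fun t : ℝ => len (s, t) := continuous_len.comp (by fun_prop)
  refine Filter.EventuallyEq.derivWithin_eq ?_ (h (s, 0) (show (0 : ℝ) ≤ 0 from le_rfl) hl)
  filter_upwards [self_mem_nhdsWithin, nhdsWithin_le_nhds (hc.continuousAt.eventually (gt_mem_nhds hl))]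
    with t h1 h2 using h (s, t) h1 h2

lemma dxyZero_of_contDiff {f : ℝ × ℝ → ℝ} (h : ContDiff ℝ 2 f) :
    IsC2AtZero f ∧ dxyZero f = dx (dy f) (0, 0) := by
  have h1 : IsC2AtZero f := ⟨1, one_pos, fun p _ _ => h.contDiffAt.contDiffWithinAt⟩
  refine ⟨h1, Filter.EventuallyEq.deriv_eq (Eventually.of_forall fun s => ?_)⟩
  exact (hasDerivAt_dy (p := (s, 0)) (h.differentiable two_ne_zero _)).hasDerivWithinAt.derivWithin
    (uniqueDiffOn_Ici (0 : ℝ) 0 (by simp))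

lemma IsReduced.isC2AtZero {Cl S : ℝ} {Ω u : ℝ × ℝ → ℝ} (h : IsReduced Cl S Ω u) : IsC2AtZero u :=
  ⟨1 / Cl, by have := h.Cl_pos; positivity, fun _ hp hl => h.contDiffWithinAt hp hl⟩

/-! ### The Hessian estimate -/

/-- The difference of Hessians splits into ∇²(u(χ₃ - ζ)) and the Hessian of the potential of the
localization source. The first is supported in 1/(64C_l) ≤ |x| ≤ 1/(16C_l), beyond the source, where
u, its gradient and its Hessian are controlled by |x|^{-β} ≲ C_l^β with the proper powers of |x|. -/
theorem exists_hess_estimate {χ : ℝ × ℝ → ℝ} (hχ : IsCutoff χ) {α β : ℝ} (hα : 0 < α) (hα1 : α ≤ 1)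
    (hβ : 0 < β) (hβ1 : β < 1) :
    ∃ C : ℝ, 0 < C ∧ ∀ (Cl S A : ℝ) (Ω u : ℝ × ℝ → ℝ), IsReduced Cl S Ω u → 0 ≤ A →
      SourceBound α β A Ω → 256 * S ≤ 1 / Cl → 0 ≤ S →
        (∀ p ∈ halfPlane, ‖hess (fun q => u q * cut χ Cl 3 q) p - hess (invLap Ω) p‖ ≤ C * Cl ^ β * A) ∧
        |dxyZero u - dxyZero (invLap Ω)| ≤ C * Cl ^ β * A := by
  obtain ⟨C1, hC1, hg⟩ := exists_grad_bound hα hα1 hβ hβ1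
  obtain ⟨C2, hC2, hh⟩ := exists_hess_bound hα hα1 hβ hβ1
  obtain ⟨C3, hC3, hi⟩ := exists_hessBound_invLap_locSource hα hα1 hβ hβ1
  obtain ⟨B, hB, hcut⟩ := (isCutoff_radCut.isTame 3).exists_cutBound
  obtain ⟨B', hB', hcut'⟩ := (hχ.isTame 3).exists_cutBound
  set D := 4096 * B' + 1024 * B with hD
  have hD0 : 0 ≤ D := by positivity
  refine ⟨512 * D * (C1 + C2) + 2 * C3, by positivity, fun Cl S A Ω u h hA hΩ hS hS0 => ?_⟩
  have hCl := h.Cl_pos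
  obtain ⟨hI, hIb⟩ := hi Cl S A Ω u h hA hΩ hS
  have hSr : S < locRad Cl := by
    unfold locRad
    rw [le_div_iff₀ hCl] at hS
    rw [lt_div_iff₀ (by positivity)]
    nlinarith
  have hR3 : R Cl 3 = 1 / (64 * Cl) := by unfold R; field_simp; norm_num
  have hR3p : 0 < R Cl 3 := by rw [hR3]; positivity
  have hc3 := hcut'.scl hR3p
  have hcl := hcut.scl h.locRad_pos
  have key : ∀ p ∈ halfPlane, ‖hess (fun q => u q * cut χ Cl 3 q) p - hess (locFun Cl u) p‖
      ≤ 2 * (256 * D * ((C1 + C2) * A) * Cl ^ β) := by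
    intro p hp
    have hρ := len_pos_of_mem hp
    have hpos : 0 ≤ 256 * D * ((C1 + C2) * A) * Cl ^ β := by positivity
    rcases lt_or_ge (1 / (16 * Cl)) (len p) with hl | hl
    · have e1 : (fun q => u q * cut χ Cl 3 q) =ᶠ[𝓝 p] fun _ => 0 := by
        filter_upwards [hχ.scl_zero_ev hR3p hp (lt_of_le_of_lt (by
          rw [hR3, ← mul_div_assoc, div_le_div_iff₀ (by positivity) (by positivity)]; linarith) hl)] with q hq
        rw [cut_eq_scl, hq, mul_zero]
      have e2 : locFun Cl u =ᶠ[𝓝 p] fun _ => 0 := by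
        filter_upwards [isCutoff_radCut.scl_zero_ev h.locRad_pos hp (by rwa [h.two_locRad])] with q hq
        rw [locFun, locCut, hq, mul_zero]
      rw [hess_congr e1, hess_congr e2, sub_self, norm_zero]
      positivity
    · have hl1 : len p < 1 / Cl := hl.trans_lt (by rw [div_lt_div_iff₀ (by positivity) hCl]; linarith)
      have hl8 : len p ≤ 1 / (8 * Cl) := hl.trans (by
        rw [div_le_div_iff₀ (by positivity) (by positivity)]; linarith)
      have hu := h.contDiffAt hp hl1
      have hk : ContDiffAt ℝ 2 (fun q => cut χ Cl 3 q - locCut Cl q) p :=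
        (hc3.contDiffAt_two hp).sub (hcl.contDiffAt_two hp)
      have e0 := hess_sub (hu.mul (hc3.contDiffAt_two hp)) (hu.mul (hcl.contDiffAt_two hp))
      have e : (fun q => u q * scl χ (R Cl 3) q - u q * scl radCut (locRad Cl) q)
          = fun q => u q * (cut χ Cl 3 q - locCut Cl q) := by
        funext q; rw [cut_eq_scl, locCut]; ring
      show ‖hess (fun q => u q * scl χ (R Cl 3) q) p - hess (fun q => u q * scl radCut (locRad Cl) q) p‖ ≤ _
      rw [← e0]
      show ‖hess (fun q => u q * scl χ (R Cl 3) q - u q * scl radCut (locRad Cl) q) p‖ ≤ _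
      rw [e]
      refine HessBound.norm_hess_le ?_
      rcases lt_or_ge (len p) (R Cl 3) with hl3 | hl3
      -- Below R₃ = 1/(64C_l) both cutoffs are 1, so nothing is needed near the source.
      · have e3 : (fun q => u q * (cut χ Cl 3 q - locCut Cl q)) =ᶠ[𝓝 p] fun _ => 0 := by
          filter_upwards [hχ.scl_one_ev hR3p hp hl3, isCutoff_radCut.scl_one_ev h.locRad_pos hp
            (hl3.trans_le (by rw [hR3]; unfold locRad; rw [div_le_div_iff₀ (by positivity) (by positivity)]; linarith))]
            with q h1 h2
          rw [cut_eq_scl, h1, locCut, h2]; simp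
        exact (HessBound.zero hpos).congr e3
      · have hz64 : len p ^ (-β) ≤ 64 * Cl ^ β := rpow_neg_le_of_ge hCl hβ hβ1 (by rwa [hR3] at hl3)
        have gu := (hg Cl S A Ω u h hA hΩ p hp hl8).2
        have hu2 := hh Cl S A Ω u h hA hΩ p hp (by
          refine le_trans ?_ hl3
          rw [hR3, le_div_iff₀ (by positivity)]
          rw [le_div_iff₀ hCl] at hS
          linarith) hl
        rw [rpow_two_sub hρ, rpow_one_sub hρ] at gu
        have hk1 : GradBound (fun q => cut χ Cl 3 q - locCut Cl q) p D (D * Cl) := by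
          refine ((hc3.g0 p hp).sub (hcl.g0 p hp)).mono (by rw [hD]; linarith) ?_
          have e1 : B' / R Cl 3 = 64 * B' * Cl := by rw [hR3]; field_simp
          have e2 : B / locRad Cl = 32 * B * Cl := by unfold locRad; field_simp
          rw [e1, e2, hD]
          have : 0 ≤ B' * Cl := by positivity
          have : 0 ≤ B * Cl := by positivity
          nlinarith
        have hk2 : HessBound (fun q => cut χ Cl 3 q - locCut Cl q) p (D * Cl ^ 2) := by
          have h1 : GradBound (dx (fun q => cut χ Cl 3 q - locCut Cl q)) p _ _ :=
            ((hc3.gx p hp).sub (hcl.gx p hp)).congr (dx_sub_ev (hc3.contDiffAt_two hp) (hcl.contDiffAt_two hp))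
          have h2 : GradBound (dy (fun q => cut χ Cl 3 q - locCut Cl q)) p _ _ :=
            ((hc3.gy p hp).sub (hcl.gy p hp)).congr (dy_sub_ev (hc3.contDiffAt_two hp) (hcl.contDiffAt_two hp))
          have e1 : B' / R Cl 3 ^ 2 + B / locRad Cl ^ 2 = D * Cl ^ 2 := by
            rw [hR3, hD]; unfold locRad; field_simp; norm_num
          rw [e1] at h1 h2
          exact ⟨h1.dx_le, h2.dx_le, h1.dy_le, h2.dy_le⟩
        refine (HessBound.mul hu hk gu hu2 hk1 hk2).mono ?_
        have hClρ : Cl * len p ≤ 1 / 16 := by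
          rw [le_div_iff₀ (by positivity)] at hl; linarith
        have hz0 : 0 < len p ^ (-β) := by positivity
        have e4 : C2 * A * len p ^ (-β) * D + 2 * (C1 * A * (len p * len p ^ (-β)) * (D * Cl))
            + C1 * A * (len p ^ 2 * len p ^ (-β)) * (D * Cl ^ 2)
            = D * A * len p ^ (-β) * (C2 + C1 * (2 * (Cl * len p) + (Cl * len p) ^ 2)) := by ring
        rw [e4]
        calc _ ≤ D * A * (64 * Cl ^ β) * (C2 + C1 * (2 * (1 / 16) + (1 / 16) ^ 2)) := by gcongr
          _ ≤ D * A * (64 * Cl ^ β) * (4 * (C1 + C2)) := by gcongr; linarith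
          _ = _ := by ring
  constructor
  · intro p hp
    have hev : invLap Ω =ᶠ[𝓝 p] fun q => locFun Cl u q - invLap (locSource Cl u) q := by
      filter_upwards [isOpen_halfPlane.mem_nhds hp] with q hq using h.invLap_source hSr hq
    rw [hess_congr hev, hess_sub (h.isTame_locFun.contDiffAt hp) hI.contDiffAt]
    have e : hess (fun q => u q * cut χ Cl 3 q) p - (hess (locFun Cl u) p - hess (invLap (locSource Cl u)) p)
        = (hess (fun q => u q * cut χ Cl 3 q) p - hess (locFun Cl u) p) + hess (invLap (locSource Cl u)) p := by
      abel
    rw [e]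
    refine (norm_add_le _ _).trans ((add_le_add (key p hp) (hIb p).norm_hess_le).trans (le_of_eq ?_))
    ring
  -- Near 0, wall included, the potential of Ω is u minus the potential of the localization source.
  -- The latter is C² on the whole plane, so the difference of the mixed derivatives is an ordinary
  -- derivative already bounded.
  · have e1 : dxyZero (invLap Ω) = dxyZero fun p => u p - invLap (locSource Cl u) p := by
      refine dxyZero_congr h.locRad_pos fun p hp hl => ?_
      rcases (show 0 ≤ p.2 from hp).eq_or_lt with h0 | h0
      · obtain ⟨x, y⟩ := p
        simp only at h0
        subst h0
        rw [invLap_wall, invLap_wall, h.wall x, sub_zero]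
        rw [len_axis] at hl
        have := h.two_locRad_lt
        have := h.locRad_pos
        linarith
      · rw [h.invLap_source hSr h0, locFun, locCut, isCutoff_radCut.scl_one h.locRad_pos hp hl.le, mul_one]
    obtain ⟨hz, he⟩ := dxyZero_of_contDiff hI
    rw [e1, h.isC2AtZero.dxyZero_sub hz, he, sub_sub_cancel]
    refine ((hIb (0, 0)).xy).trans ?_
    have h1 : 0 ≤ 512 * D * (C1 + C2) * (Cl ^ β * A) := by positivity
    have h2 : 0 ≤ C3 * (Cl ^ β * A) := by positivity
    nlinarith

/-! ### Passing to extended norms -/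

lemma supNorm_le {D : Set (ℝ × ℝ)} {f : ℝ × ℝ → ℝ} {K : ℝ≥0∞}
    (h : ∀ p ∈ D, ENNReal.ofReal |f p| ≤ K) : supNorm D f ≤ K := iSup₂_le h

lemma le_supNorm {D : Set (ℝ × ℝ)} {f : ℝ × ℝ → ℝ} {p : ℝ × ℝ} (hp : p ∈ D) :
    ENNReal.ofReal |f p| ≤ supNorm D f := le_iSup₂ (f := fun p _ => ENNReal.ofReal |f p|) p hp

lemma sourceBound_of_wNorm {α β : ℝ} {Ω : ℝ × ℝ → ℝ} (h : wNorm α β Ω ≠ ∞) :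
    SourceBound α β (wNorm α β Ω).toReal Ω := by
  intro p hp
  have h1 : ENNReal.ofReal |Ω p * (len p ^ (-α) + len p ^ β)| ≤ wNorm α β Ω := le_supNorm hp
  have h2 := (ENNReal.ofReal_le_iff_le_toReal h).1 h1
  have h3 : 0 ≤ len p ^ (-α) + len p ^ β :=
    add_nonneg (Real.rpow_nonneg (len_nonneg p) _) (Real.rpow_nonneg (len_nonneg p) _)
  rwa [abs_mul, abs_of_nonneg h3] at h2

/-- If the weighted norm is infinite then so is the right-hand side, as C > 0; otherwise the real
estimate applies with A equal to the norm. -/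
lemma ofReal_le_mul_wNorm {α β X C : ℝ} {Ω : ℝ × ℝ → ℝ} (hC : 0 < C)
    (h : ∀ A, 0 ≤ A → SourceBound α β A Ω → X ≤ C * A) :
    ENNReal.ofReal X ≤ ENNReal.ofReal C * wNorm α β Ω := by
  by_cases hw : wNorm α β Ω = ∞
  · rw [hw, ENNReal.mul_top (by simpa using hC)]
    exact le_top
  · rw [← ENNReal.ofReal_toReal hw, ← ENNReal.ofReal_mul hC.le]
    exact ENNReal.ofReal_le_ofReal (h _ ENNReal.toReal_nonneg (sourceBound_of_wNorm hw))

/-! ### The gradient estimates -/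

/-- The exponent α is replaced by min(α, 1), which doubles A. The two weights of the first estimate
correspond to the two growth rates of the gradient; the second estimate is the dipole decay. -/
theorem gradient_estimates {α β : ℝ} (hα : 0 < α) (hβ : 0 < β) (hβ1 : β < 1) :
    ∃ C : ℝ, 0 < C ∧ ∀ (Cl S : ℝ) (Ω u : ℝ × ℝ → ℝ), IsReduced Cl S Ω u → 0 < S →
      (∀ p ∈ halfPlane, len p ≤ 2 * R Cl 2 →
        ENNReal.ofReal (‖grad u p‖ * (len p ^ (-1 : ℝ) + len p ^ (-1 + β)))
          ≤ ENNReal.ofReal C * wNorm α β Ω) ∧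
      (∀ p ∈ halfPlane, 8 * S ≤ len p → len p ≤ R Cl 1 / 2 →
        ENNReal.ofReal ‖grad u p‖ ≤ ENNReal.ofReal
          (C * (S ^ (3 - β) / len p ^ 2 + len p ^ (1 - β) * (Cl * S) ^ (2 - β))) * wNorm α β Ω) := by
  have hα' : 0 < min α 1 := lt_min hα one_pos
  obtain ⟨C1, hC1, hg⟩ := exists_grad_bound hα' (min_le_right α 1) hβ hβ1
  obtain ⟨C2, hC2, hf⟩ := exists_far_grad_bound hα' (min_le_right α 1) hβ hβ1
  refine ⟨8 * C1 + 4 * C2, by positivity, fun Cl S Ω u h hS => ⟨fun p hp hl => ?_, fun p hp hpS hl => ?_⟩⟩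
  · have hCl := h.Cl_pos
    have hρ := len_pos_of_mem hp
    refine ofReal_le_mul_wNorm (by positivity) fun A hA hΩ => ?_
    -- 2R₂ = 1/(8C_l), the limit of validity of the gradient bound; below, R₁/2 is the same radius.
    have hl8 : len p ≤ 1 / (8 * Cl) := by
      refine hl.trans (le_of_eq ?_)
      unfold R; field_simp; norm_num
    obtain ⟨g1, g2⟩ := hg Cl S (2 * A) Ω u h (by positivity) (hΩ.mono_exp hβ hα' (min_le_left _ _)) p hp hl8
    have n1 := g1.norm_grad_le
    have n2 := g2.norm_grad_le
    rw [mul_add]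
    have e1 : ‖grad u p‖ * len p ^ (-1 : ℝ) ≤ 4 * C1 * A := by
      calc _ ≤ 2 * (C1 * (2 * A) * len p) * len p ^ (-1 : ℝ) := by gcongr
        _ = 4 * C1 * A * (len p * len p ^ (-1 : ℝ)) := by ring
        _ = _ := by rw [Real.rpow_neg_one, mul_inv_cancel₀ hρ.ne', mul_one]
    have e2 : ‖grad u p‖ * len p ^ (-1 + β) ≤ 4 * C1 * A := by
      calc _ ≤ 2 * (C1 * (2 * A) * len p ^ (1 - β)) * len p ^ (-1 + β) := by gcongr
        _ = 4 * C1 * A * (len p ^ (1 - β) * len p ^ (-1 + β)) := by ring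
        _ = _ := by
          rw [← Real.rpow_add hρ, show 1 - β + (-1 + β) = 0 by ring, Real.rpow_zero, mul_one]
    have : 0 ≤ C2 * A := by positivity
    linarith
  · have hCl := h.Cl_pos
    have hρ := len_pos_of_mem hp
    refine ofReal_le_mul_wNorm (by positivity) fun A hA hΩ => ?_
    have hl8 : len p ≤ 1 / (8 * Cl) := by
      refine hl.trans (le_of_eq ?_)
      unfold R; field_simp; norm_num
    have n1 := (hf Cl S (2 * A) Ω u h (by positivity) hS
      (hΩ.mono_exp hβ hα' (min_le_left _ _)) p hp hpS hl8).norm_grad_le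
    refine n1.trans ?_
    have h1 : 0 ≤ len p ^ (1 - β) * (Cl * S) ^ (2 - β) := by positivity
    -- The first summand already suffices; the second is only used to be nonnegative.
    calc 2 * (C2 * (2 * A) * S ^ (3 - β) / len p ^ 2) = 4 * C2 * (S ^ (3 - β) / len p ^ 2 + 0) * A := by ring
      _ ≤ (8 * C1 + 4 * C2) * (S ^ (3 - β) / len p ^ 2 + len p ^ (1 - β) * (Cl * S) ^ (2 - β)) * A := by
        gcongr
        linarith

/-! ### The Hessian estimates -/

/-- On the wall φ = 0 and r = 1, so the normal derivatives of r^{1/2}φ and φ agree there. -/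
lemma dxyZero_streamOne {Cl : ℝ} {ω φ : ℝ × ℝ → ℝ} (hCl : 0 < Cl) (hφ : IsStream Cl ω φ) :
    dxyZero (streamOne Cl φ) = dxyZero φ := by
  have hsm : ∀ p ∈ closedHalfPlane, len p < 1 / Cl → ContDiffWithinAt ℝ 2 φ closedHalfPlane p := by
    intro p hp hl
    have hm : ∀ q ∈ closedHalfPlane, len q < 1 / Cl → q ∈ lowerCell Cl := fun q hq hl =>
      ⟨(abs_fst_le_len q).trans_lt hl, hq, snd_lt_of_len hl⟩
    refine (hφ.smooth p (hm p hp hl)).mono_of_mem_nhdsWithin ?_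
    filter_upwards [self_mem_nhdsWithin, nhdsWithin_le_nhds
      (continuous_len.continuousAt.eventually (gt_mem_nhds hl))] with q h1 h2 using hm q h1 h2
  refine Filter.EventuallyEq.deriv_eq ?_
  have hpos : 0 < 1 / Cl := by positivity
  have : ∀ᶠ s : ℝ in 𝓝 0, |s| < 1 / Cl :=
    continuous_abs.continuousAt.eventually (gt_mem_nhds (by simpa using hCl))
  filter_upwards [this] with s hs
  have hd := derivWithin_eq_pdy ((hsm (s, 0) (show (0 : ℝ) ≤ 0 from le_rfl)
    (by rwa [len_axis])).differentiableWithinAt two_ne_zero)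
  have hr : HasDerivAt (fun t => rad Cl (s, t) ^ (1 / 2 : ℝ)) (-Cl * (1 / 2) * rad Cl (s, 0) ^ (1 / 2 - 1 : ℝ)) 0 := by
    have h1 : HasDerivAt (fun t => rad Cl (s, t)) (-Cl) 0 := by
      have := ((hasDerivAt_id (0 : ℝ)).const_mul Cl).const_sub 1
      exact this.congr_deriv (by ring)
    exact h1.rpow_const (Or.inl (by simp [rad]))
  have h2 := hd.mul hr.hasDerivWithinAt
  have hu := uniqueDiffOn_Ici (0 : ℝ) 0 (by simp)
  rw [hd.derivWithin hu]
  refine (HasDerivWithinAt.derivWithin (f := fun t => streamOne Cl φ (s, t)) h2 hu).trans ?_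
  rw [hφ.wall s hs.le]
  simp [rad]

theorem hessian_estimates {χ : ℝ × ℝ → ℝ} (hχ : IsCutoff χ) {α β : ℝ} (hα : 0 < α) (hα1 : α ≤ 1)
    (hβ : 0 < β) (hβ1 : β < 1) :
    ∃ C : ℝ, 0 < C ∧ ∀ (Cl S : ℝ) (Ω u : ℝ × ℝ → ℝ), IsReduced Cl S Ω u → 0 ≤ S → 256 * S ≤ 1 / Cl →
      (∀ p ∈ halfPlane, ENNReal.ofReal ‖hess (fun q => u q * cut χ Cl 3 q) p - hess (invLap Ω) p‖
        ≤ ENNReal.ofReal (C * Cl ^ β) * wNorm α β Ω) ∧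
      ENNReal.ofReal |dxyZero u - dxyZero (invLap Ω)| ≤ ENNReal.ofReal (C * Cl ^ β) * wNorm α β Ω := by
  obtain ⟨C, hC, hb⟩ := exists_hess_estimate hχ hα hα1 hβ hβ1
  refine ⟨C, hC, fun Cl S Ω u h hS0 hS => ?_⟩
  have hCl := h.Cl_pos
  exact ⟨fun p hp => ofReal_le_mul_wNorm (by positivity) fun A hA hΩ => (hb Cl S A Ω u h hA hΩ hS hS0).1 p hp,
    ofReal_le_mul_wNorm (by positivity) fun A hA hΩ => (hb Cl S A Ω u h hA hΩ hS hS0).2⟩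

/-! ### The norm of the space `X` for functions with controlled gradient -/

/-- Functions on the half plane vanishing on the axis `x₁ = 0`, with a gradient that is `O(|x|²)` at
the origin and bounded elsewhere, and with decay `|x|^{-1/16}`. -/
structure ErrBound (N : ℝ) (Z : ℝ × ℝ → ℝ) : Prop where
  diff : ∀ p ∈ halfPlane, DifferentiableAt ℝ Z p
  axis : ∀ y : ℝ, 0 < y → Z (0, y) = 0
  near_dx : ∀ p ∈ halfPlane, len p < 1 → |dx Z p| ≤ N * len p ^ 2
  near_dy : ∀ p ∈ halfPlane, len p < 1 → |dy Z p| ≤ N * len p ^ 2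
  far_val : ∀ p ∈ halfPlane, 1 ≤ len p → |Z p| ≤ N * len p ^ (-(1 / 16) : ℝ)
  far_dx : ∀ p ∈ halfPlane, 1 ≤ len p → |dx Z p| ≤ N
  far_dy : ∀ p ∈ halfPlane, 1 ≤ len p → |dy Z p| ≤ N

/-! ### Derivatives of powers of the length and of the weight ψ₁ -/

lemma hasDerivAt_len_fst {p : ℝ × ℝ} (h : 0 < len p) (s : ℝ) :
    HasDerivAt (fun t => len (t, p.2) ^ s) (s * p.1 * len p ^ (s - 2)) p.1 := by
  have e : (fun t => len (t, p.2) ^ s) = fun t : ℝ => (t ^ 2 + p.2 ^ 2) ^ (s / 2) := by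
    funext t
    rw [len, Real.sqrt_eq_rpow, ← Real.rpow_mul (by positivity)]
    congr 1; ring
  have hpos : 0 < p.1 ^ 2 + p.2 ^ 2 := by rw [← len_sq]; positivity
  have h1 : HasDerivAt (fun t : ℝ => t ^ 2 + p.2 ^ 2) (2 * p.1) p.1 := by
    have := ((hasDerivAt_id p.1).pow 2).add_const (p.2 ^ 2)
    exact this.congr_deriv (by simp)
  have h2 := h1.rpow_const (p := s / 2) (Or.inl hpos.ne')
  rw [e]
  refine h2.congr_deriv ?_
  have e2 : len p ^ (s - 2) = (p.1 ^ 2 + p.2 ^ 2) ^ (s / 2 - 1) := by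
    rw [len, Real.sqrt_eq_rpow, ← Real.rpow_mul (by positivity)]
    congr 1; ring
  rw [e2]; ring

lemma gradBound_len_rpow {p : ℝ × ℝ} (h : 0 < len p) (s : ℝ) :
    GradBound (fun q => len q ^ s) p (len p ^ s) (|s| * len p ^ (s - 1)) := by
  have e1 : len p * len p ^ (s - 2) = len p ^ (s - 1) := by
    nth_rewrite 1 [← Real.rpow_one (len p)]
    rw [← Real.rpow_add h]; congr 1; ring
  have key : ∀ x, |x| ≤ len p → |s * x * len p ^ (s - 2)| ≤ |s| * len p ^ (s - 1) := by
    intro x hx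
    rw [abs_mul, abs_mul, abs_of_pos (Real.rpow_pos_of_pos h (s - 2)), mul_assoc, ← e1]
    gcongr
  refine ⟨?_, ?_, ?_, ?_⟩
  · have hpos : p.1 ^ 2 + p.2 ^ 2 ≠ 0 := by rw [← len_sq]; positivity
    have h1 : DifferentiableAt ℝ len p :=
      ((differentiableAt_fst.pow 2).add (differentiableAt_snd.pow 2)).sqrt hpos
    exact h1.rpow_const (Or.inl h.ne')
  · rw [abs_of_pos (Real.rpow_pos_of_pos h s)]
  · have : dx (fun q => len q ^ s) p = _ := (hasDerivAt_len_fst h s).deriv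
    rw [this]; exact key _ (abs_fst_le_len p)
  · have hs : len (p.2, p.1) = len p := by unfold len; rw [add_comm]
    have h2 := (hasDerivAt_len_fst (p := (p.2, p.1)) (by rwa [hs]) s).deriv
    have e3 : (fun t => len (t, p.1) ^ s) = fun t => len (p.1, t) ^ s := by
      funext t; unfold len; rw [add_comm]
    have : dy (fun q => len q ^ s) p = s * p.2 * len p ^ (s - 2) := by
      unfold dy
      simp only [hs] at h2
      rw [← e3]; exact h2
    rw [this]; exact key _ (abs_snd_le_len p)

lemma gradBound_psiOne {p : ℝ × ℝ} (h : 0 < len p) :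
    GradBound psiOne p (len p ^ (-2 : ℝ) + 0.5 * len p ^ (-1 : ℝ) + 0.2 * len p ^ (-(1 / 6) : ℝ))
      (2 * len p ^ (-3 : ℝ) + 0.5 * len p ^ (-2 : ℝ) + 0.2 * len p ^ (-(7 / 6) : ℝ)) := by
  have h1 := gradBound_len_rpow h (-2)
  have h2 := (gradBound_len_rpow h (-1)).const_mul 0.5
  have h3 := (gradBound_len_rpow h (-(1 / 6))).const_mul 0.2
  have hp : 0 < len p ^ (-(7 / 6) : ℝ) := by positivity
  refine ((h1.add h2).add h3).mono (le_of_eq ?_) ?_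
  · norm_num
  · norm_num
    norm_num at hp
    linarith

namespace ErrBound

variable {N : ℝ} {Z : ℝ × ℝ → ℝ}

lemma nonneg (h : ErrBound N Z) : 0 ≤ N :=
  (abs_nonneg _).trans (h.far_dx (0, 1) (show (0 : ℝ) < 1 from one_pos) (by simp [len]))

lemma dx_le (h : ErrBound N Z) {p : ℝ × ℝ} (hp : p ∈ halfPlane) : |dx Z p| ≤ N := by
  rcases lt_or_ge (len p) 1 with hl | hl
  · refine (h.near_dx p hp hl).trans (mul_le_of_le_one_right h.nonneg ?_)
    exact pow_le_one₀ (len_nonneg p) hl.le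
  · exact h.far_dx p hp hl

lemma val_le (h : ErrBound N Z) {p : ℝ × ℝ} (hp : p ∈ halfPlane) : |Z p| ≤ N * |p.1| := by
  have := abs_sub_le_of_dx_bound (u := Z) (y := p.2) (x₁ := 0) (x₂ := p.1) (M := N)
    (fun x _ => h.diff (x, p.2) hp) (fun x _ => h.dx_le hp)
  rwa [h.axis p.2 hp, sub_zero, sub_zero] at this

/-- Integration in x₁ from the axis, where Z = 0. The length does not exceed |p| along the segment,
so the gradient bound at p applies throughout. -/
lemma near_val (h : ErrBound N Z) {p : ℝ × ℝ} (hp : p ∈ halfPlane) (hl : len p < 1) :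
    |Z p| ≤ N * len p ^ 2 * |p.1| := by
  have hle : ∀ x ∈ uIcc 0 p.1, len (x, p.2) ≤ len p := by
    intro x hx
    refine Real.sqrt_le_sqrt ?_
    have : |x| ≤ |p.1| := by
      have := abs_sub_left_of_mem_uIcc hx
      simpa using this
    have := sq_le_sq' (by linarith [neg_abs_le x, abs_nonneg x] : -|p.1| ≤ x) ((le_abs_self x).trans this)
    simp only
    nlinarith [sq_abs p.1]
  have := abs_sub_le_of_dx_bound (u := Z) (y := p.2) (x₁ := 0) (x₂ := p.1) (M := N * len p ^ 2)
    (fun x _ => h.diff (x, p.2) hp) (fun x hx => (h.near_dx (x, p.2) hp ((hle x hx).trans_lt hl)).trans (by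
      have := h.nonneg
      have h2 := len_nonneg (x, p.2)
      gcongr
      exact hle x hx))
  rwa [h.axis p.2 hp, sub_zero, sub_zero] at this

lemma near_val' (h : ErrBound N Z) {p : ℝ × ℝ} (hp : p ∈ halfPlane) (hl : len p < 1) :
    |Z p| ≤ N * len p ^ 3 := by
  refine (h.near_val hp hl).trans ?_
  have := h.nonneg
  calc _ ≤ N * len p ^ 2 * len p := by gcongr; exact abs_fst_le_len p
    _ = _ := by ring

/-- Near 0, |Z| ≤ N|x|²|x₁| has order 3, against at most 2.9 lost to |x₁|^{-1/2}|x|^{-2.4}; the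
margin is |x|^{0.1}. Far away |Z| ≤ N|x₁| absorbs |x₁|^{-1/2} near the axis, and the decay
|x|^{-1/16} balances the growing weight. The coefficients add up to 2.9 ≤ 3. -/
lemma abs_mul_phiGOne_le (h : ErrBound N Z) {p : ℝ × ℝ} (hp : p ∈ quadrant) :
    |Z p| * phiGOne p ≤ 3 * N := by
  have hN := h.nonneg
  have hx : 0 < |p.1| := abs_pos.2 hp.1.ne'
  have hh : p ∈ halfPlane := hp.2
  have hρ := len_pos_of_mem hh
  set ρ := len p with hρd
  have hx1 : |p.1| * |p.1| ^ (-(1 / 2) : ℝ) = |p.1| ^ (1 / 2 : ℝ) := by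
    nth_rewrite 1 [← Real.rpow_one |p.1|]
    rw [← Real.rpow_add hx]; norm_num
  have hxle : |p.1| ^ (1 / 2 : ℝ) ≤ ρ ^ (1 / 2 : ℝ) := by gcongr; exact abs_fst_le_len p
  rcases lt_or_ge ρ 1 with hl | hl
  · have le1 : ∀ s : ℝ, 0 ≤ s → ρ ^ s ≤ 1 := fun s hs => Real.rpow_le_one hρ.le hl.le hs
    have hX : |Z p| * |p.1| ^ (-(1 / 2) : ℝ) ≤ N * ρ ^ (5 / 2 : ℝ) := by
      calc |Z p| * |p.1| ^ (-(1 / 2) : ℝ) ≤ N * ρ ^ 2 * |p.1| * |p.1| ^ (-(1 / 2) : ℝ) := by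
            gcongr; exact h.near_val hh hl
        _ = N * ρ ^ 2 * |p.1| ^ (1 / 2 : ℝ) := by rw [mul_assoc, hx1]
        _ ≤ N * ρ ^ 2 * ρ ^ (1 / 2 : ℝ) := by gcongr
        _ = _ := by
          rw [mul_assoc, ← Real.rpow_natCast ρ 2, ← Real.rpow_add hρ]; norm_num
    have a1 : |Z p| * |p.1| ^ (-(1 / 2) : ℝ) * ρ ^ (-2.4 : ℝ) ≤ N := by
      calc _ ≤ N * ρ ^ (5 / 2 : ℝ) * ρ ^ (-2.4 : ℝ) := by gcongr
        _ = N * ρ ^ (0.1 : ℝ) := by rw [mul_assoc, ← Real.rpow_add hρ]; norm_num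
        _ ≤ _ := mul_le_of_le_one_right hN (le1 _ (by norm_num))
    have a2 : |Z p| * |p.1| ^ (-(1 / 2) : ℝ) * ρ ^ (-(1 / 2) : ℝ) ≤ N := by
      calc _ ≤ N * ρ ^ (5 / 2 : ℝ) * ρ ^ (-(1 / 2) : ℝ) := by gcongr
        _ = N * ρ ^ (2 : ℝ) := by rw [mul_assoc, ← Real.rpow_add hρ]; norm_num
        _ ≤ _ := mul_le_of_le_one_right hN (le1 _ (by norm_num))
    have hv : |Z p| ≤ N * ρ ^ (3 : ℝ) := by
      have := h.near_val' hh hl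
      exact_mod_cast this
    have a3 : |Z p| * ρ ^ (-(1 / 6) : ℝ) ≤ N := by
      calc _ ≤ N * ρ ^ (3 : ℝ) * ρ ^ (-(1 / 6) : ℝ) := by gcongr
        _ = N * ρ ^ (17 / 6 : ℝ) := by rw [mul_assoc, ← Real.rpow_add hρ]; norm_num
        _ ≤ _ := mul_le_of_le_one_right hN (le1 _ (by norm_num))
    have a4 : |Z p| * ρ ^ (1 / 16 : ℝ) ≤ N := by
      calc _ ≤ N * ρ ^ (3 : ℝ) * ρ ^ (1 / 16 : ℝ) := by gcongr
        _ = N * ρ ^ (49 / 16 : ℝ) := by rw [mul_assoc, ← Real.rpow_add hρ]; norm_num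
        _ ≤ _ := mul_le_of_le_one_right hN (le1 _ (by norm_num))
    rw [phiGOne, phiOne, ← hρd]
    norm_num at a1 a2 a3 a4 ⊢
    linarith
  · have le1 : ∀ s : ℝ, s ≤ 0 → ρ ^ s ≤ 1 := fun s hs => Real.rpow_le_one_of_one_le_of_nonpos hl hs
    have hv := h.far_val p hh hl
    have hv1 : |Z p| ≤ N := hv.trans (mul_le_of_le_one_right hN (le1 _ (by norm_num)))
    have hX : |Z p| * |p.1| ^ (-(1 / 2) : ℝ) ≤ N := by
      rcases le_total |p.1| 1 with h1 | h1
      · calc _ ≤ N * |p.1| * |p.1| ^ (-(1 / 2) : ℝ) := by gcongr; exact h.val_le hh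
          _ = N * |p.1| ^ (1 / 2 : ℝ) := by rw [mul_assoc, hx1]
          _ ≤ _ := mul_le_of_le_one_right hN (Real.rpow_le_one hx.le h1 (by norm_num))
      · calc _ ≤ N * 1 := by
              gcongr
              exact Real.rpow_le_one_of_one_le_of_nonpos h1 (by norm_num)
          _ = N := mul_one N
    have hX0 : 0 ≤ |Z p| * |p.1| ^ (-(1 / 2) : ℝ) := by positivity
    have a1 : |Z p| * |p.1| ^ (-(1 / 2) : ℝ) * ρ ^ (-2.4 : ℝ) ≤ N :=
      (mul_le_of_le_one_right hX0 (le1 _ (by norm_num))).trans hX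
    have a2 : |Z p| * |p.1| ^ (-(1 / 2) : ℝ) * ρ ^ (-(1 / 2) : ℝ) ≤ N :=
      (mul_le_of_le_one_right hX0 (le1 _ (by norm_num))).trans hX
    have a3 : |Z p| * ρ ^ (-(1 / 6) : ℝ) ≤ N :=
      (mul_le_of_le_one_right (abs_nonneg _) (le1 _ (by norm_num))).trans hv1
    have a4 : |Z p| * ρ ^ (1 / 16 : ℝ) ≤ N := by
      calc _ ≤ N * ρ ^ (-(1 / 16) : ℝ) * ρ ^ (1 / 16 : ℝ) := by gcongr
        _ = N := by rw [mul_assoc, ← Real.rpow_add hρ]; norm_num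
    rw [phiGOne, phiOne, ← hρd]
    norm_num at a1 a2 a3 a4 ⊢
    linarith

/-- Near 0, Z = O(|x|³) and ∇Z = O(|x|²) compensate ψ₁ of order -2 and ∇ψ₁ of order -3; far away all
four factors are bounded. -/
lemma gradBound_mul_psiOne (h : ErrBound N Z) {p : ℝ × ℝ} (hp : p ∈ halfPlane) :
    GradBound (fun q => Z q * psiOne q) p (2 * N) (5 * N) := by
  have hN := h.nonneg
  have hρ := len_pos_of_mem hp
  have hψ := gradBound_psiOne hρ
  set ρ := len p with hρd
  rcases lt_or_ge ρ 1 with hl | hl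
  · have hZ : GradBound Z p (N * ρ ^ 3) (N * ρ ^ 2) :=
      ⟨h.diff p hp, h.near_val' hp hl, h.near_dx p hp hl, h.near_dy p hp hl⟩
    have le1 : ∀ s : ℝ, 0 ≤ s → ρ ^ s ≤ 1 := fun s hs => Real.rpow_le_one hρ.le hl.le hs
    have b2 : ρ ^ 2 * (ρ ^ (-2 : ℝ) + 0.5 * ρ ^ (-1 : ℝ) + 0.2 * ρ ^ (-(1 / 6) : ℝ)) ≤ 1.7 := by
      rw [mul_add, mul_add, mul_left_comm _ 0.5, mul_left_comm _ 0.2, ← Real.rpow_natCast ρ 2,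
        ← Real.rpow_add hρ, ← Real.rpow_add hρ, ← Real.rpow_add hρ]
      push_cast
      exact (add_le_add (add_le_add (le1 (2 + -2) (by norm_num))
        (mul_le_mul_of_nonneg_left (le1 (2 + -1) (by norm_num)) (by norm_num)))
        (mul_le_mul_of_nonneg_left (le1 (2 + -(1 / 6)) (by norm_num)) (by norm_num))).trans (by norm_num)
    have b3 : ρ ^ 3 * (2 * ρ ^ (-3 : ℝ) + 0.5 * ρ ^ (-2 : ℝ) + 0.2 * ρ ^ (-(7 / 6) : ℝ)) ≤ 2.7 := by
      rw [mul_add, mul_add, mul_left_comm _ 2, mul_left_comm _ 0.5, mul_left_comm _ 0.2,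
        ← Real.rpow_natCast ρ 3,
        ← Real.rpow_add hρ, ← Real.rpow_add hρ, ← Real.rpow_add hρ]
      push_cast
      exact (add_le_add (add_le_add (mul_le_mul_of_nonneg_left (le1 (3 + -3) (by norm_num)) (by norm_num))
        (mul_le_mul_of_nonneg_left (le1 (3 + -2) (by norm_num)) (by norm_num)))
        (mul_le_mul_of_nonneg_left (le1 (3 + -(7 / 6)) (by norm_num)) (by norm_num))).trans (by norm_num)
    refine (hZ.mul hψ).mono ?_ ?_
    · calc _ = N * (ρ * (ρ ^ 2 * (ρ ^ (-2 : ℝ) + 0.5 * ρ ^ (-1 : ℝ) + 0.2 * ρ ^ (-(1 / 6) : ℝ)))) := by ring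
        _ ≤ N * (1 * 1.7) := by gcongr
        _ ≤ _ := by linarith
    · calc _ = N * (ρ ^ 2 * (ρ ^ (-2 : ℝ) + 0.5 * ρ ^ (-1 : ℝ) + 0.2 * ρ ^ (-(1 / 6) : ℝ)))
          + N * (ρ ^ 3 * (2 * ρ ^ (-3 : ℝ) + 0.5 * ρ ^ (-2 : ℝ) + 0.2 * ρ ^ (-(7 / 6) : ℝ))) := by ring
        _ ≤ N * 1.7 + N * 2.7 := by gcongr
        _ ≤ _ := by linarith
  · have le1 : ∀ s : ℝ, s ≤ 0 → ρ ^ s ≤ 1 := fun s hs => Real.rpow_le_one_of_one_le_of_nonpos hl hs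
    have hZ : GradBound Z p N N :=
      ⟨h.diff p hp, (h.far_val p hp hl).trans (mul_le_of_le_one_right hN (le1 _ (by norm_num))),
        h.far_dx p hp hl, h.far_dy p hp hl⟩
    have := le1 (-2) (by norm_num)
    have := le1 (-1) (by norm_num)
    have := le1 (-(1 / 6)) (by norm_num)
    have := le1 (-3) (by norm_num)
    have := le1 (-(7 / 6)) (by norm_num)
    refine (hZ.mul hψ).mono ?_ ?_
    · calc _ ≤ N * 2 := by gcongr; linarith
        _ = _ := by ring
    · rw [← mul_add]
      calc _ ≤ N * 5 := by gcongr; linarith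
        _ = _ := by ring

end ErrBound

/-! ### The Hölder weight and the norm of X -/

lemma gOne_le {d : ℝ} {z : ℝ × ℝ} (hd : 0 < d) (h : d ≤ |z.1| ∨ d ≤ |z.2|) :
    0 ≤ gOne z ∧ gOne z ≤ 4 * (Real.sqrt d)⁻¹ := by
  have hs : 0 < Real.sqrt d := Real.sqrt_pos.2 hd
  -- The third comes from 0.12 ≥ 1/9, the worst case being a vertical difference.
  have h1 : Real.sqrt d / 3 ≤ Real.sqrt (|z.1| + 0.12 * |z.2|) := by
    rw [show Real.sqrt d / 3 = Real.sqrt (d / 9) by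
      rw [Real.sqrt_div hd.le, show (9 : ℝ) = 3 ^ 2 by norm_num, Real.sqrt_sq (by norm_num)]]
    refine Real.sqrt_le_sqrt ?_
    have := abs_nonneg z.1
    have := abs_nonneg z.2
    rcases h with h | h <;> linarith
  have h2 : (gOneZero (1, 0))⁻¹ ≤ 1.1 := by
    rw [gOneZero, inv_inv]
    have e1 : Real.sqrt (|(1 : ℝ)| + 0.12 * |(0 : ℝ)|) = 1 := by simp
    have e2 : Real.sqrt (|(0 : ℝ)| + 0.01 * |(1 : ℝ)|) ≤ 0.2 := by
      rw [Real.sqrt_le_left (by norm_num)]; norm_num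
    simp only [e1]
    linarith
  have h3 : 0 ≤ (gOneZero (1, 0))⁻¹ := by rw [gOneZero, inv_inv]; positivity
  have h4 : 0 ≤ gOneZero z := by unfold gOneZero; positivity
  have h5 : gOneZero z ≤ 3 * (Real.sqrt d)⁻¹ := by
    rw [gOneZero]
    have : Real.sqrt d / 3 ≤ Real.sqrt (|z.1| + 0.12 * |z.2|) + 0.25 * Real.sqrt (|z.2| + 0.01 * |z.1|) :=
      h1.trans (le_add_of_nonneg_right (by positivity))
    calc _ ≤ (Real.sqrt d / 3)⁻¹ := by gcongr
      _ = _ := by rw [inv_div]; ring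
  refine ⟨mul_nonneg h4 h3, ?_⟩
  calc gOne z ≤ 3 * (Real.sqrt d)⁻¹ * 1.1 := by unfold gOne; gcongr
    _ ≤ _ := by
      have : 0 < (Real.sqrt d)⁻¹ := by positivity
      linarith

/-- Bounded Lipschitz functions on the quadrant are of class `C^{1/2}`. -/
lemma abs_sub_mul_gOne_le {F : ℝ × ℝ → ℝ} {N : ℝ} (hF : ∀ p ∈ halfPlane, GradBound F p (2 * N) (5 * N))
    {p q : ℝ × ℝ} (hp : p ∈ quadrant) (hq : q ∈ quadrant) : |(F p - F q) * gOne (p - q)| ≤ 80 * N := by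
  have hN : 0 ≤ N := by linarith [(hF p hp.2).nonneg_val]
  set d := max |p.1 - q.1| |p.2 - q.2| with hd
  rcases (le_max_of_le_left (abs_nonneg (p.1 - q.1)) : 0 ≤ d).eq_or_lt with h0 | h0
  · have h1 : |p.1 - q.1| ≤ 0 := by rw [h0]; exact le_max_left _ _
    have h2 : |p.2 - q.2| ≤ 0 := by rw [h0]; exact le_max_right _ _
    have : p = q := Prod.ext (by linarith [abs_nonpos_iff.1 h1]) (by linarith [abs_nonpos_iff.1 h2])
    rw [this]; simp; positivity
  · obtain ⟨g0, g1⟩ := gOne_le (z := p - q) h0 (le_max_iff.1 (le_refl d))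
    have hv : |F p - F q| ≤ 4 * N := (abs_sub _ _).trans (by linarith [(hF p hp.2).val, (hF q hq.2).val])
    have hpos : ∀ {a b t : ℝ}, 0 < a → 0 < b → t ∈ uIcc a b → 0 < t := fun ha hb ht =>
      (lt_min ha hb).trans_le ht.1
    -- The path from q to p through (q₁, p₂), vertical then horizontal, stays in the quadrant.
    have l1 := abs_sub_le_of_dx_bound (u := F) (y := p.2) (x₁ := q.1) (x₂ := p.1) (M := 5 * N)
      (fun x _ => (hF (x, p.2) hp.2).diff) (fun x _ => (hF (x, p.2) hp.2).dx_le)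
    have l2 := abs_sub_le_of_dy_bound (u := F) (x := q.1) (y₁ := q.2) (y₂ := p.2) (M := 5 * N)
      (fun y hy => (hF (q.1, y) (hpos hq.2 hp.2 hy)).diff)
      (fun y hy => (hF (q.1, y) (hpos hq.2 hp.2 hy)).dy_le)
    have hl : |F p - F q| ≤ 10 * N * d := by
      have e : F p - F q = (F (p.1, p.2) - F (q.1, p.2)) + (F (q.1, p.2) - F (q.1, q.2)) := by ring
      rw [e]
      refine (abs_add_le _ _).trans ((add_le_add l1 l2).trans ?_)
      have h1 : |p.1 - q.1| ≤ d := le_max_left _ _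
      have h2 : |p.2 - q.2| ≤ d := le_max_right _ _
      nlinarith
    have hs : 0 < Real.sqrt d := Real.sqrt_pos.2 h0
    have hsq : Real.sqrt d * Real.sqrt d = d := Real.mul_self_sqrt h0.le
    -- Lipschitz for d ≤ 1, boundedness for d ≥ 1.
    have hfin : |F p - F q| ≤ 20 * N * Real.sqrt d := by
      rcases le_total (Real.sqrt d) 1 with h1 | h1
      · have : d ≤ Real.sqrt d := by nlinarith
        nlinarith
      · nlinarith
    rw [abs_mul, abs_of_nonneg g0]
    calc _ ≤ 20 * N * Real.sqrt d * (4 * (Real.sqrt d)⁻¹) := by gcongr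
      _ = _ := by field_simp; ring

/-- The `X` norm of functions with controlled gradient. -/
theorem ErrBound.xNorm_le {N : ℝ} {Z : ℝ × ℝ → ℝ} (h : ErrBound N Z) :
    xNorm Z ≤ ENNReal.ofReal (80 * N) := by
  have hN := h.nonneg
  have hφ : ∀ p, 0 ≤ phiOne p := fun p => by
    have := len_nonneg p
    unfold phiOne; positivity
  have hφg : ∀ p, phiOne p ≤ phiGOne p := fun p =>
    le_add_of_nonneg_right (Real.rpow_nonneg (len_nonneg p) _)
  refine max_le (supNorm_le fun p hp => ENNReal.ofReal_le_ofReal ?_)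
    (max_le (supNorm_le fun p hp => ENNReal.ofReal_le_ofReal ?_)
      (iSup₂_le fun p hp => iSup₂_le fun q hq => ENNReal.ofReal_le_ofReal
        (abs_sub_mul_gOne_le (F := fun p => Z p * psiOne p) (fun _ => h.gradBound_mul_psiOne) hp hq)))
  · rw [abs_mul, abs_of_nonneg (hφ p)]
    calc _ ≤ |Z p| * phiGOne p := by gcongr; exact hφg p
      _ ≤ 3 * N := h.abs_mul_phiGOne_le hp
      _ ≤ _ := by linarith
  · rw [abs_mul, abs_of_nonneg ((hφ p).trans (hφg p))]
    exact (h.abs_mul_phiGOne_le hp).trans (by linarith)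

/-! ### Expansion of the stream function at the origin -/

lemma dx_reflect (f : ℝ × ℝ → ℝ) (p : ℝ × ℝ) :
    dx (fun q => f (-q.1, q.2)) p = -dx f (-p.1, p.2) := deriv_comp_neg (f := fun t => f (t, p.2)) p.1

lemma dy_reflect (f : ℝ × ℝ → ℝ) (p : ℝ × ℝ) : dy (fun q => f (-q.1, q.2)) p = dy f (-p.1, p.2) := rfl

lemma lap_reflect (f : ℝ × ℝ → ℝ) (p : ℝ × ℝ) : lap (fun q => f (-q.1, q.2)) p = lap f (-p.1, p.2) := by
  have e1 : dx (fun q => f (-q.1, q.2)) = fun q => -dx f (-q.1, q.2) := funext (dx_reflect f)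
  have e2 : dy (fun q => f (-q.1, q.2)) = fun q => dy f (-q.1, q.2) := funext (dy_reflect f)
  rw [lap, e1, e2, dx_neg, dx_reflect, dy_reflect, neg_neg]; rfl

lemma lap_odd {f : ℝ × ℝ → ℝ} (hf : ∀ q ∈ halfPlane, f (-q.1, q.2) = -f q) {p : ℝ × ℝ}
    (hp : p ∈ halfPlane) : lap f (-p.1, p.2) = -lap f p := by
  rw [← lap_reflect, ← lap_neg]
  exact lap_congr (by filter_upwards [isOpen_halfPlane.mem_nhds hp] with q hq using hf q hq)

namespace IsReduced

variable {Cl S : ℝ} {Ω u : ℝ × ℝ → ℝ}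

lemma odd' (h : IsReduced Cl S Ω u) {p : ℝ × ℝ} (hp : p ∈ closedHalfPlane) (hl : len p ≤ 1 / Cl) :
    u (-p.1, p.2) = -u p :=
  h.odd p.1 p.2 ((abs_fst_le_len p).trans hl) hp ((le_abs_self _).trans ((abs_snd_le_len p).trans hl))

lemma locFun_odd (h : IsReduced Cl S Ω u) {p : ℝ × ℝ} (hp : p ∈ halfPlane) :
    locFun Cl u (-p.1, p.2) = -locFun Cl u p := by
  have e : locCut Cl (-p.1, p.2) = locCut Cl p := isCutoff_radCut.scl_even h.locRad_pos (halfPlane_subset hp)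
  rw [locFun, locFun, e]
  rcases le_or_gt (len p) (1 / Cl) with hl | hl
  · rw [h.odd' (halfPlane_subset hp) hl]; ring
  · rw [h.locCut_zero (halfPlane_subset hp) (h.two_locRad_lt.le.trans hl.le)]; ring

lemma locFun_eq (h : IsReduced Cl S Ω u) {p : ℝ × ℝ} (hp : p ∈ closedHalfPlane) (hl : len p ≤ locRad Cl) :
    locFun Cl u p = u p := by
  have e : locCut Cl p = 1 := isCutoff_radCut.scl_one h.locRad_pos hp hl
  rw [locFun, e, mul_one]

end IsReduced

lemma gradBound_xy (p : ℝ × ℝ) : GradBound (fun q => q.1 * q.2) p (len p ^ 2) (len p) := by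
  refine ⟨differentiableAt_fst.mul differentiableAt_snd, ?_, ?_, ?_⟩
  · rw [abs_mul]; exact abs_mul_le_sq p
  · rw [dx, deriv_mul_const_field, deriv_id'', one_mul]; exact abs_snd_le_len p
  · rw [dy, deriv_const_mul_field, deriv_id'', mul_one]; exact abs_fst_le_len p

lemma contDiff_xy {n : WithTop ℕ∞} (c : ℝ) : ContDiff ℝ n fun q : ℝ × ℝ => c * (q.1 * q.2) := by fun_prop

lemma lap_xy (c : ℝ) (p : ℝ × ℝ) : lap (fun q => c * (q.1 * q.2)) p = 0 := by
  have e1 : dx (fun q => q.1 * q.2) = fun q => q.2 := by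
    funext q; rw [dx, deriv_mul_const_field, deriv_id'', one_mul]
  have e2 : dy (fun q => q.1 * q.2) = fun q => q.1 := by
    funext q; rw [dy, deriv_const_mul_field, deriv_id'', mul_one]
  rw [lap_const_mul, lap, e1, e2]
  simp [dx, dy]

lemma dxyZero_xy (c : ℝ) : dxyZero (fun q => c * (q.1 * q.2)) = c := by
  have e2 : dy (fun q => c * (q.1 * q.2)) = fun q => c * q.1 := by
    funext q; rw [dy_const_mul, dy, deriv_const_mul_field, deriv_id'', mul_one]
  rw [(dxyZero_of_contDiff (contDiff_xy c)).2, e2, dx_const_mul, dx, deriv_id'', mul_one]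

lemma IsC2AtZero.sub {f g : ℝ × ℝ → ℝ} (hf : IsC2AtZero f) (hg : IsC2AtZero g) :
    IsC2AtZero fun p => f p - g p := by
  obtain ⟨δ, hδ, h⟩ := hf
  obtain ⟨δ', hδ', h'⟩ := hg
  exact ⟨min δ δ', lt_min hδ hδ', fun p hp hl =>
    (h p hp (hl.trans_le (min_le_left _ _))).sub (h' p hp (hl.trans_le (min_le_right _ _)))⟩

/-- The mixed derivative at the origin vanishes if the gradient vanishes to second order. -/
lemma IsC2AtZero.dxyZero_eq_zero {f : ℝ × ℝ → ℝ} (hf : IsC2AtZero f) {K r : ℝ} (hr : 0 < r)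
    (h : ∀ p ∈ halfPlane, len p < r → |dy f p| ≤ K * len p ^ 2) : dxyZero f = 0 := by
  rw [hf.dxyZero_eq]
  obtain ⟨δ, hδ, hc⟩ := hf
  -- The bound on the normal derivative passes to the wall, since that derivative is continuous up
  -- to it.
  have key : ∀ s : ℝ, |s| < min δ r → |pdy f (s, 0)| ≤ K * |s| ^ 2 := by
    intro s hs
    have hl0 : len (s, 0) < min δ r := by rwa [len_axis]
    have hcl : Continuous fun t : ℝ => len (s, t) := continuous_len.comp (by fun_prop)
    have hcont : ContinuousWithinAt (pdy f) closedHalfPlane (s, 0) :=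
      (contDiffWithinAt_pdy (n := 1) (show (0 : ℝ) ≤ 0 from le_rfl)
        (hc (s, 0) (show (0 : ℝ) ≤ 0 from le_rfl) (hl0.trans_le (min_le_left _ _)))).continuousWithinAt
    have ht : Tendsto (fun t : ℝ => (s, t)) (𝓝[>] 0) (𝓝[closedHalfPlane] (s, 0)) :=
      tendsto_nhdsWithin_iff.2 ⟨((by fun_prop : Continuous fun t : ℝ => (s, t)).tendsto 0).mono_left
        nhdsWithin_le_nhds, by filter_upwards [self_mem_nhdsWithin] with t ht using le_of_lt (show 0 < t from ht)⟩
    have h1 : Tendsto (fun t : ℝ => |pdy f (s, t)|) (𝓝[>] 0) (𝓝 |pdy f (s, 0)|) :=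
      (Tendsto.comp hcont ht).abs
    have h2 : Tendsto (fun t : ℝ => K * len (s, t) ^ 2) (𝓝[>] 0) (𝓝 (K * len (s, 0) ^ 2)) :=
      ((hcl.pow 2).const_mul K).continuousAt.tendsto.mono_left nhdsWithin_le_nhds
    rw [← len_axis s]
    refine le_of_tendsto_of_tendsto h1 h2 ?_
    filter_upwards [self_mem_nhdsWithin,
      nhdsWithin_le_nhds (hcl.continuousAt.eventually (gt_mem_nhds hl0))] with t ht hlt
    have hm : ((s, t) : ℝ × ℝ) ∈ halfPlane := ht
    have hd : DifferentiableAt ℝ f (s, t) :=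
      ((hc _ (halfPlane_subset hm) (hlt.trans_le (min_le_left _ _))).contDiffAt
        (closedHalfPlane_mem_nhds hm)).differentiableAt two_ne_zero
    rw [pdy_eq_dy hm hd]
    exact h _ hm (hlt.trans_le (min_le_right _ _))
  -- A quadratic bound forces the tangential derivative at 0 to vanish.
  have hO : (fun s => pdy f (s, 0)) =O[𝓝 0] fun s : ℝ => ‖s - 0‖ ^ 2 := by
    refine Asymptotics.IsBigO.of_bound K ?_
    have : ∀ᶠ s : ℝ in 𝓝 0, |s| < min δ r :=
      continuous_abs.continuousAt.eventually (gt_mem_nhds (by simpa using ⟨hδ, hr⟩))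
    filter_upwards [this] with s hs
    simpa using key s hs
  exact (hO.hasFDerivAt (by norm_num)).hasDerivAt.deriv

/-- The density -Δ(uζ) is odd in x₁ and O(A|x|): the source by its weight with α = 1, the
localization part by its value bound. So uζ has an expansion cxy + O(A|x|³), and ζ = 1 for |x| ≤
`locRad`, which is at least 4. The box estimate at scale |p| differentiates the expansion. -/
theorem exists_stream_expansion {β : ℝ} (hβ : 0 < β) (hβ1 : β < 1) :
    ∃ C : ℝ, 0 < C ∧ ∀ (Cl S A : ℝ) (Ω u : ℝ × ℝ → ℝ), IsReduced Cl S Ω u → 0 ≤ A →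
      SourceBound 1 β A Ω → 256 * S ≤ 1 / Cl → 4096 * Cl ≤ 1 →
        |dxyZero u| ≤ C * A ∧ ∀ p ∈ halfPlane, len p ≤ 2 →
          GradBound (fun q => u q - dxyZero u * (q.1 * q.2)) p (C * A * len p ^ 3) (C * A * len p ^ 2) := by
  obtain ⟨C0, hC0, hexp⟩ := exists_expansion
  obtain ⟨C1, hC1, hsize⟩ := exists_size_bound one_pos le_rfl hβ hβ1
  obtain ⟨C2, hC2, hsrc⟩ := exists_locSource_bound one_pos le_rfl hβ hβ1
  set D := C0 * (1 + C2) with hD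
  have hD0 : 0 < D := by positivity
  refine ⟨500 * D + 4 * C1 + 1, by positivity, fun Cl S A Ω u h hA hΩ hS hCl1 => ?_⟩
  have hCl := h.Cl_pos
  have hSr : S < locRad Cl := by
    have : 0 < 1 / Cl := by positivity
    have e : locRad Cl = (1 / Cl) / 32 := by unfold locRad; field_simp
    rw [e]; linarith
  have hr4 : 4 ≤ locRad Cl := by
    unfold locRad; rw [le_div_iff₀ (by positivity)]; linarith
  have hrC : locRad Cl < 1 / Cl := by linarith [h.two_locRad_lt]
  obtain ⟨B, hB⟩ := h.isTame_locFun.exists_isTest h.locFun_wall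
  obtain ⟨c, hc⟩ := hexp ((1 + C2) * A) (2 * locRad Cl) (fun q => -lap (locFun Cl u) q) (by positivity)
    (hB.cont_dxx.add hB.cont_dyy).neg
    (fun q hq => by rw [lap_odd (fun q hq => h.locFun_odd hq) hq])
    (fun q hq => by
      rw [h.neg_lap_locFun hSr hq]
      have h1 := hΩ.abs_le_rpow' hq
      rw [Real.rpow_one] at h1
      have h2 := (hsrc Cl S A Ω u h hA hΩ hS q hq).val
      have h3 : C2 * A * (Cl * len q) ≤ C2 * A * len q := by
        refine mul_le_mul_of_nonneg_left ?_ (by positivity)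
        have := len_nonneg q
        nlinarith
      refine (abs_add_le _ _).trans ?_
      linarith)
    (fun q hq hl => by
      show -(dx (dx (locFun Cl u)) q + dy (dy (locFun Cl u)) q) = 0
      rw [hB.dxx_zero hq hl, hB.dyy_zero hq hl]; simp)
  set w : ℝ × ℝ → ℝ := fun q => u q - c * (q.1 * q.2) with hw
  have hwall : ∀ q : ℝ × ℝ, len q ≤ locRad Cl → q.2 = 0 → w q = 0 := fun q hl h2 => by
    simp only [hw]; rw [h.wall' h2 (hl.trans hrC.le), h2]; ring
  have hwb : ∀ q ∈ closedHalfPlane, len q ≤ locRad Cl → |w q| ≤ D * A * len q ^ 3 := by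
    intro q hq hl
    rcases eq_or_lt_of_le (show 0 ≤ q.2 from hq) with h0 | h0
    · rw [hwall q hl h0.symm, abs_zero]
      have := len_nonneg q
      positivity
    · have := hc q h0
      rw [h.invLap_locFun h0, h.locFun_eq hq hl] at this
      calc _ ≤ _ := this
        _ = _ := by rw [hD]; ring
  have hgrad : ∀ p ∈ halfPlane, len p ≤ 2 →
      GradBound w p (500 * D * A * len p ^ 3 + A * len p ^ 3 + 4 * C1 * A * len p ^ 3)
        (500 * D * A * len p ^ 2 + A * len p ^ 2 + 4 * C1 * A * len p ^ 2) := by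
    intro p hp hl
    have hρ := len_pos_of_mem hp
    have hbox : ∀ q ∈ upperBox p (2 * (len p / 8)), len q ≤ 3 / 2 * len p := by
      intro q hq
      have := (len_of_mem_upperBox hq).2
      linarith
    have hu : ∀ q ∈ upperBox p (2 * (len p / 8)), 0 < q.2 → ContDiffAt ℝ 2 u q := fun q hq h2 =>
      h.contDiffAt h2 (by linarith [hbox q hq])
    -- As xy is harmonic, Δw = Vu - Ω = O(A|x|), so the box estimate turns w = O(A|x|³) into ∇w =
    -- O(A|x|²).
    have := gradBound_of_box (u := w) (p₀ := p) (d := len p / 8) (M := 4 * (D * A * len p ^ 3))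
      (K := (1 + C1) * A * (2 * len p)) (by positivity) hp
      ((h.cont.mono fun q hq => IsReduced.mem_cell hq.2.2 (by linarith [hbox q hq])).sub
        (contDiff_xy (n := 0) c).continuous.continuousOn)
      (fun q hq h2 => (hu q hq h2).sub (contDiff_xy c).contDiffAt)
      (fun q hq h2 => hwall q (by linarith [hbox q hq]) h2)
      (fun q hq => by
        have hb := hbox q hq
        refine (hwb q hq.2.2 (by linarith)).trans ?_
        have hq0 := len_nonneg q
        calc D * A * len q ^ 3 ≤ D * A * (3 / 2 * len p) ^ 3 := by gcongr
          _ = 27 / 8 * (D * A * len p ^ 3) := by ring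
          _ ≤ _ := by gcongr; norm_num)
      (fun q hq h2 => by
        have hb := hbox q hq
        have hq0 := len_nonneg q
        have hl' : len q < 1 / Cl := by linarith
        rw [hw, lap_sub (hu q hq h2) (contDiff_xy c).contDiffAt, lap_xy, sub_zero, h.lap_eq h2 hl']
        have h1 := hΩ.abs_le_rpow' (show q ∈ halfPlane from h2)
        rw [Real.rpow_one] at h1
        have h3 := (hsize Cl S A Ω u h hA hΩ q (IsReduced.mem_cell hq.2.2 hl'.le)).1
        have hpot : pot Cl q ≤ 1 / 3 := by
          refine (pot_le hCl ?_).trans ?_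
          · have : q.2 < locRad Cl := snd_lt_of_len (by linarith)
            refine this.le.trans ?_
            unfold locRad
            rw [div_le_div_iff₀ (by positivity) (by positivity)]; linarith
          · nlinarith
        refine (abs_sub _ _).trans ?_
        rw [abs_mul, abs_pot]
        have h4 : pot Cl q * |u q| ≤ 1 / 3 * (C1 * A * len q ^ 2) :=
          mul_le_mul hpot h3 (abs_nonneg _) (by norm_num)
        have h5 : C1 * A * len q ^ 2 ≤ C1 * A * (3 * len q) := by
          refine mul_le_mul_of_nonneg_left ?_ (by positivity)
          nlinarith
        have h6 : A * len q ≤ A * (2 * len p) := by gcongr; linarith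
        have h7 : C1 * A * len q ≤ C1 * A * (2 * len p) := by gcongr; linarith
        linarith)
    have hpos : 0 ≤ D * A * len p ^ 3 := by positivity
    refine this.mono ?_ ?_
    · have : 0 ≤ A * len p ^ 3 := by positivity
      have : 0 ≤ C1 * A * len p ^ 3 := by positivity
      linarith
    · have e1 : 8 * (4 * (D * A * len p ^ 3)) / (len p / 8) = 256 * (D * A * len p ^ 2) := by
        field_simp; ring
      have : 0 ≤ A * len p ^ 2 := by positivity
      have : 0 ≤ C1 * A * len p ^ 2 := by positivity
      have : 0 ≤ D * A * len p ^ 2 := by positivity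
      rw [e1]
      linarith
  -- The gradient of w vanishes to second order at 0, so the coefficient of the potential expansion
  -- is the mixed derivative of u.
  have hcc : dxyZero u = c := by
    have h0 : dxyZero w = 0 := (h.isC2AtZero.sub (dxyZero_of_contDiff (contDiff_xy c)).1).dxyZero_eq_zero
      (K := 500 * D * A + A + 4 * C1 * A) two_pos fun p hp hl => by
        have := (hgrad p hp hl.le).dy_le
        linarith
    have h1 := h.isC2AtZero.dxyZero_sub (dxyZero_of_contDiff (contDiff_xy c)).1
    rw [dxyZero_xy] at h1
    have h2 : dxyZero u - c = 0 := h1.symm.trans h0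
    linarith
  rw [hcc]
  constructor
  -- At (1, 1) one has c = u - w, and both terms are already bounded.
  · have hm : ((1, 1) : ℝ × ℝ) ∈ halfPlane := show (0 : ℝ) < 1 from one_pos
    have hl2 : len (1, 1) ≤ 2 := by
      rw [len, show ((1 : ℝ) ^ 2 + 1 ^ 2) = 2 by norm_num]
      exact Real.sqrt_le_iff.2 ⟨by norm_num, by norm_num⟩
    have h1 := hwb (1, 1) (halfPlane_subset hm) (by linarith)
    have h2 := (hsize Cl S A Ω u h hA hΩ (1, 1) (IsReduced.mem_cell zero_le_one (by linarith))).1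
    have e2 : len (1, 1) ^ 2 = 2 := by rw [len_sq]; norm_num
    have e3 : len (1, 1) ^ 3 ≤ 4 := by nlinarith [len_nonneg (1, 1)]
    rw [e2] at h2
    have h3 : D * A * len (1, 1) ^ 3 ≤ D * A * 4 := by gcongr
    have h4 : c = u (1, 1) - w (1, 1) := by simp only [hw]; ring
    have h5 := abs_sub (u (1, 1)) (w (1, 1))
    rw [← h4] at h5
    have : 0 ≤ D * A := by positivity
    have : 0 ≤ C1 * A := by positivity
    linarith
  · intro p hp hl
    exact (hgrad p hp hl).mono (by linarith) (by linarith)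

/-! ### The error terms -/

/-- The cutoff commutator `2 ∇u · ∇χ₄ + u Δχ₄`. -/
noncomputable def commErr (χ : ℝ × ℝ → ℝ) (Cl : ℝ) (u : ℝ × ℝ → ℝ) (p : ℝ × ℝ) : ℝ :=
  2 * (dx u p * dx (cut χ Cl 4) p + dy u p * dy (cut χ Cl 4) p) + u p * lap (cut χ Cl 4) p

/-- The localized lower order term. -/
noncomputable def potErr (χ : ℝ × ℝ → ℝ) (Cl : ℝ) (u : ℝ × ℝ → ℝ) (p : ℝ × ℝ) : ℝ :=
  pot Cl p * u p * cut χ Cl 4 p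

/-- The total error term. -/
noncomputable def totErr (χ η : ℝ × ℝ → ℝ) (Cl : ℝ) (u : ℝ × ℝ → ℝ) (p : ℝ × ℝ) : ℝ :=
  commErr χ Cl u p + potErr χ Cl u p - dxyZero (potErr χ Cl u) * (-lap (kap η) p)

lemma ZTot_eq_totErr (χ η : ℝ × ℝ → ℝ) (Cl : ℝ) (φ : ℝ × ℝ → ℝ) :
    ZTot χ η Cl φ = totErr χ η Cl (streamOne Cl φ) := rfl

lemma R_four {Cl : ℝ} (hCl : 0 < Cl) : R Cl 4 = 1 / (256 * Cl) := by unfold R; field_simp; norm_num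

lemma IsCutoff.isTame_kap {η : ℝ × ℝ → ℝ} (hη : IsCutoff η) : IsTame 3 2 (kap η) := by
  refine ⟨ContDiffOn.mul ?_ (hη.isTame 3).smooth, fun p hp hl => ?_⟩
  · exact ContDiff.contDiffOn (by fun_prop)
  · rw [kap, hη.zero p hp hl.le, mul_zero]

lemma lap_kap_near {η : ℝ × ℝ → ℝ} (hη : IsCutoff η) {p : ℝ × ℝ} (hp : p ∈ halfPlane) (hl : len p < 1) :
    lap (kap η) p = -(p.1 * p.2) := by
  have e : kap η =ᶠ[𝓝 p] fun q => -(1 / 6) * (q.1 * q.2 ^ 3) := by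
    filter_upwards [isOpen_halfPlane.mem_nhds hp,
      continuous_len.continuousAt.eventually (gt_mem_nhds hl)] with q h1 h2
    rw [kap, hη.one q (halfPlane_subset h1) h2.le]; ring
  have e1 : dx (fun q => q.1 * q.2 ^ 3) = fun q => q.2 ^ 3 := by
    funext q
    show deriv (fun t => t * q.2 ^ 3) q.1 = _
    rw [deriv_mul_const_field, deriv_id'', one_mul]
  have e2 : dy (fun q => q.1 * q.2 ^ 3) = fun q => q.1 * (3 * q.2 ^ 2) := by
    funext q
    show deriv (fun t => q.1 * t ^ 3) q.2 = _
    rw [deriv_const_mul_field]; simp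
  rw [lap_congr e, lap_const_mul, lap, e1, e2]
  simp only [dx, dy, deriv_const, deriv_const_mul_field]
  simp
  ring

lemma lap_kap_axis {η : ℝ × ℝ → ℝ} (hη : IsCutoff η) {y : ℝ} (hy : 0 < y) : lap (kap η) (0, y) = 0 := by
  have := lap_odd (f := kap η) (fun q hq => by
    rw [kap, kap, hη.even _ _ (halfPlane_subset hq)]; ring) (p := (0, y)) hy
  simp only [neg_zero] at this
  linarith

lemma dx_cut_axis {χ : ℝ × ℝ → ℝ} (hχ : IsCutoff χ) {r : ℝ} (hr : 0 < r) {y : ℝ} (hy : 0 < y) :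
    dx (scl χ r) (0, y) = 0 := by
  have h1 := dx_reflect (scl χ r) (0, y)
  have h2 : dx (fun q => scl χ r (-q.1, q.2)) (0, y) = dx (scl χ r) (0, y) := dx_congr (by
    filter_upwards [isOpen_halfPlane.mem_nhds (show ((0, y) : ℝ × ℝ) ∈ halfPlane from hy)] with q hq
    exact hχ.scl_even hr (halfPlane_subset hq))
  rw [h2] at h1
  simp only [neg_zero] at h1
  linarith

/-- The potential differs from its value at the wall by a term of higher order. -/
lemma gradBound_pot_sub {Cl : ℝ} (hCl : 0 < Cl) {p : ℝ × ℝ} (h0 : 0 < p.2) (hp : p.2 ≤ 1 / (4 * Cl)) :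
    GradBound (fun q => pot Cl q - 3 / 4 * Cl ^ 2) p (4 * Cl ^ 3 * len p) (4 * Cl ^ 3) := by
  have g := (gradBound_pot hCl hp).sub (g := fun _ => 3 / 4 * Cl ^ 2) (a' := |3 / 4 * Cl ^ 2|) (b' := 0)
    ⟨differentiableAt_const _, le_rfl, by simp [dx], by simp [dy]⟩
  rw [add_zero] at g
  refine ⟨g.diff, ?_, g.dx_le, g.dy_le⟩
  have hr : 3 / 4 ≤ rad Cl p := by
    unfold rad
    rw [le_div_iff₀ (by positivity)] at hp
    linarith
  have hr1 : rad Cl p ≤ 1 := by unfold rad; nlinarith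
  have e : pot Cl p - 3 / 4 * Cl ^ 2 = (3 / 4 * Cl ^ 2 * (1 - rad Cl p ^ 2)) / rad Cl p ^ 2 := by
    unfold pot; field_simp
  have hle : 1 - rad Cl p ^ 2 ≤ 2 * (Cl * len p) := by
    have h1 : p.2 ≤ len p := (le_abs_self _).trans (abs_snd_le_len p)
    have h2 : Cl * p.2 ≤ Cl * len p := by gcongr
    have h3 : 1 - rad Cl p = Cl * p.2 := by unfold rad; ring
    nlinarith
  have h0' : 0 ≤ 1 - rad Cl p ^ 2 := by nlinarith
  rw [e, abs_of_nonneg (by positivity), div_le_iff₀ (by positivity)]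
  have hρ : 0 < len p := len_pos_of_mem h0
  calc 3 / 4 * Cl ^ 2 * (1 - rad Cl p ^ 2) ≤ 3 / 4 * Cl ^ 2 * (2 * (Cl * len p)) := by gcongr
    _ = 4 * Cl ^ 3 * len p * (3 / 8) := by ring
    _ ≤ _ := by gcongr; nlinarith

section

variable {Cl S A C : ℝ} {Ω u : ℝ × ℝ → ℝ}

/-- The lower order term has a second order expansion at the origin. -/
lemma gradBound_pot_expansion (hCl : 0 < Cl) (hCl1 : 4096 * Cl ≤ 1) {c K : ℝ} (hc : |c| ≤ K)
    {p : ℝ × ℝ} (hp : p ∈ halfPlane) (hl : len p ≤ 2)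
    (hw : GradBound (fun q => u q - c * (q.1 * q.2)) p (K * len p ^ 3) (K * len p ^ 2)) :
    GradBound (fun q => pot Cl q * u q - 3 / 4 * Cl ^ 2 * c * (q.1 * q.2)) p
      (6 * K * Cl ^ 2 * len p ^ 3) (6 * K * Cl ^ 2 * len p ^ 2) := by
  have hρ := len_pos_of_mem hp
  have hp4 : p.2 ≤ 1 / (4 * Cl) := by
    have : p.2 ≤ len p := (le_abs_self _).trans (abs_snd_le_len p)
    rw [le_div_iff₀ (by positivity)]
    nlinarith
  have hK : 0 ≤ K := (abs_nonneg c).trans hc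
  have g := ((gradBound_pot hCl hp4).mul hw).add
    ((gradBound_pot_sub hCl hp hp4).mul ((gradBound_xy p).const_mul c))
  -- Freezing V at the wall, the difference is V(u - cxy) + (V - V₀)cxy with V₀ = (3/4)C_l². The
  -- second part gains a factor C_l|x| from V - V₀.
  have e : (fun q => pot Cl q * u q - 3 / 4 * Cl ^ 2 * c * (q.1 * q.2)) = fun q : ℝ × ℝ =>
      pot Cl q * (u q - c * (q.1 * q.2)) + (pot Cl q - 3 / 4 * Cl ^ 2) * (c * (q.1 * q.2)) := by
    funext q; ring
  rw [e]
  have h3 : Cl ^ 3 ≤ Cl ^ 2 * (1 / 4096) := by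
    rw [pow_succ]; exact mul_le_mul_of_nonneg_left (by linarith) (by positivity)
  have t2 : 0 ≤ K * len p ^ 2 := by positivity
  have t3 : 0 ≤ K * len p ^ 3 := by positivity
  have f2 : Cl ^ 3 * (K * len p ^ 2) ≤ Cl ^ 2 * (1 / 4096) * (K * len p ^ 2) := by gcongr
  have f3 : Cl ^ 3 * (K * len p ^ 3) ≤ Cl ^ 2 * (1 / 4096) * (K * len p ^ 3) := by gcongr
  have p2 : 0 ≤ Cl ^ 2 * (K * len p ^ 2) := by positivity
  have p3 : 0 ≤ Cl ^ 2 * (K * len p ^ 3) := by positivity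
  have hc2 : |c| * len p ^ 2 ≤ K * len p ^ 2 := by gcongr
  have hc1 : |c| * len p ≤ K * len p := by gcongr
  refine g.mono ?_ ?_
  · have : 4 * Cl ^ 3 * len p * (|c| * len p ^ 2) ≤ 4 * Cl ^ 3 * len p * (K * len p ^ 2) := by gcongr
    calc _ ≤ 2 * Cl ^ 2 * (K * len p ^ 3) + 4 * Cl ^ 3 * len p * (K * len p ^ 2) := by linarith
      _ = 2 * (Cl ^ 2 * (K * len p ^ 3)) + 4 * (Cl ^ 3 * (K * len p ^ 3)) := by ring
      _ ≤ 6 * (Cl ^ 2 * (K * len p ^ 3)) := by linarith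
      _ = _ := by ring
  · have a1 : 4 * Cl ^ 3 * (|c| * len p ^ 2) ≤ 4 * Cl ^ 3 * (K * len p ^ 2) := by gcongr
    have a2 : 4 * Cl ^ 3 * len p * (|c| * len p) ≤ 4 * Cl ^ 3 * len p * (K * len p) := by gcongr
    have a3 : 4 * Cl ^ 3 * (K * len p ^ 3) ≤ 4 * Cl ^ 3 * (K * (2 * len p ^ 2)) := by
      have : len p ^ 3 ≤ 2 * len p ^ 2 := by
        rw [pow_succ, mul_comm]; gcongr
      gcongr
    calc _ ≤ 4 * Cl ^ 3 * (K * (2 * len p ^ 2)) + 2 * Cl ^ 2 * (K * len p ^ 2)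
          + (4 * Cl ^ 3 * (K * len p ^ 2) + 4 * Cl ^ 3 * len p * (K * len p)) := by linarith
      _ = 16 * (Cl ^ 3 * (K * len p ^ 2)) + 2 * (Cl ^ 2 * (K * len p ^ 2)) := by ring
      _ ≤ 6 * (Cl ^ 2 * (K * len p ^ 2)) := by linarith
      _ = _ := by ring

/-- Near 0 the term is Vu, which equals (3/4)C_l² times the leading term of u up to a function whose
gradient vanishes to second order. -/
lemma dxyZero_potErr {χ : ℝ × ℝ → ℝ} (hχ : IsCutoff χ) (h : IsReduced Cl S Ω u) (hCl1 : 4096 * Cl ≤ 1)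
    {K : ℝ} (hc : |dxyZero u| ≤ K) (hw : ∀ p ∈ halfPlane, len p ≤ 2 →
      GradBound (fun q => u q - dxyZero u * (q.1 * q.2)) p (K * len p ^ 3) (K * len p ^ 2)) :
    dxyZero (potErr χ Cl u) = 3 / 4 * Cl ^ 2 * dxyZero u := by
  have hCl := h.Cl_pos
  have hR : 1 ≤ R Cl 4 := by rw [R_four hCl, le_div_iff₀ (by positivity)]; linarith
  rw [dxyZero_congr (f := potErr χ Cl u) (g := fun q => pot Cl q * u q) one_pos fun p hp hl => by
    rw [potErr, cut_eq_scl, hχ.scl_one (by linarith) hp (by linarith), mul_one]]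
  have h1 : IsC2AtZero fun q => pot Cl q * u q := by
    refine ⟨1 / Cl, by positivity, fun p hp hl => ?_⟩
    exact (contDiffAt_pot hCl (snd_lt_of_len hl)).contDiffWithinAt.mul (h.contDiffWithinAt hp hl)
  have h2 := h1.dxyZero_sub (dxyZero_of_contDiff (contDiff_xy (3 / 4 * Cl ^ 2 * dxyZero u))).1
  rw [dxyZero_xy, (h1.sub (dxyZero_of_contDiff (contDiff_xy _)).1).dxyZero_eq_zero two_pos fun p hp hl =>
    (gradBound_pot_expansion hCl hCl1 hc hp hl.le (hw p hp hl.le)).dy_le] at h2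
  linarith

/-- The error terms near the origin. -/
lemma totErr_near {χ η : ℝ × ℝ → ℝ} (hχ : IsCutoff χ) (hη : IsCutoff η) (hCl : 0 < Cl)
    (hCl1 : 4096 * Cl ≤ 1) {p : ℝ × ℝ} (hp : p ∈ halfPlane) (hl : len p < 1) :
    totErr χ η Cl u =ᶠ[𝓝 p] fun q => pot Cl q * u q - dxyZero (potErr χ Cl u) * (q.1 * q.2) := by
  have hR : 1 ≤ R Cl 4 := by rw [R_four hCl, le_div_iff₀ (by positivity)]; linarith
  have e := hχ.scl_one_ev (r := R Cl 4) (by linarith) hp (hl.trans_le hR)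
  filter_upwards [isOpen_halfPlane.mem_nhds hp, continuous_len.continuousAt.eventually (gt_mem_nhds hl),
    e.eventually_nhds] with q h1 h2 h3
  have h3' : cut χ Cl 4 =ᶠ[𝓝 q] fun _ => 1 := h3
  have d1 : dx (cut χ Cl 4) q = 0 := by rw [dx_congr h3']; simp [dx]
  have d2 : dy (cut χ Cl 4) q = 0 := by rw [dy_congr h3']; simp [dy]
  have d3 : lap (cut χ Cl 4) q = 0 := by rw [lap_congr h3']; simp [lap, dx, dy]
  have d4 : cut χ Cl 4 q = 1 := h3'.self_of_nhds
  rw [totErr, commErr, d1, d2, d3, lap_kap_near hη h1 h2]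
  rw [show potErr χ Cl u q = pot Cl q * u q * 1 by rw [← d4]; rfl]
  ring

/-- On x₁ = 0, u and u_y vanish by oddness, and χ_x and Δκ vanish by symmetry. The oddness of u is
known inside the cell only; beyond it the cutoff is zero. -/
lemma totErr_axis {χ η : ℝ × ℝ → ℝ} (hχ : IsCutoff χ) (hη : IsCutoff η) (h : IsReduced Cl S Ω u)
    {y : ℝ} (hy : 0 < y) : totErr χ η Cl u (0, y) = 0 := by
  have hCl := h.Cl_pos
  have hR : 0 < R Cl 4 := by rw [R_four hCl]; positivity
  have hm : ((0, y) : ℝ × ℝ) ∈ halfPlane := hy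
  rw [totErr, lap_kap_axis hη hy, commErr, potErr, cut_eq_scl, dx_cut_axis hχ hR hy]
  have hly : len (0, y) = y := by simp [len, Real.sqrt_sq hy.le]
  rcases lt_or_ge y (1 / Cl) with h1 | h1
  · have hu : ∀ t, 0 < t → t < 1 / Cl → u (0, t) = 0 := fun t h0 ht => by
      have := h.odd 0 t (by simp; exact hCl.le) h0.le ht.le
      rw [neg_zero] at this
      linarith
    have hd : dy u (0, y) = 0 := by
      have e : (fun t => u (0, t)) =ᶠ[𝓝 y] fun _ => 0 := by
        filter_upwards [lt_mem_nhds hy, gt_mem_nhds h1] with t h0 ht using hu t h0 ht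
      show deriv (fun t => u (0, t)) y = 0
      rw [e.deriv_eq, deriv_const]
    rw [hu y hy h1, hd]; ring
  · have e := hχ.scl_zero_ev hR hm (by
      rw [hly, R_four hCl]
      refine lt_of_lt_of_le ?_ h1
      rw [← mul_div_assoc, div_lt_div_iff₀ (by positivity) hCl]; linarith)
    rw [dy_congr e, lap_congr e, e.self_of_nhds]
    simp [lap, dx, dy]

end

/-- Improved size of the stream function away from the origin. -/
lemma exists_decay_bound {β : ℝ} (hβ : 0 < β) (hβ1 : β < 1) :
    ∃ C : ℝ, 0 < C ∧ ∀ (Cl S A : ℝ) (Ω u : ℝ × ℝ → ℝ), IsReduced Cl S Ω u → 0 ≤ A → 0 < S →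
      SourceBound 1 β A Ω → ∀ p ∈ halfPlane, len p ≤ 1 / (8 * Cl) →
        |u p| ≤ C * A * S ^ 2 * len p ^ (-β) ∧
        (8 * S ≤ len p → GradBound u p (C * A * S ^ 2 * len p ^ (-β))
          (C * A * S ^ 2 * len p ^ (-β) / len p)) := by
  obtain ⟨C1, hC1, hg⟩ := exists_grad_bound one_pos le_rfl hβ hβ1
  obtain ⟨C2, hC2, hf⟩ := exists_far_grad_bound one_pos le_rfl hβ hβ1
  refine ⟨64 * C1 + C2, by positivity, fun Cl S A Ω u h hA hS hΩ p hp hl => ?_⟩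
  have hρ := len_pos_of_mem hp
  have hpw := Real.rpow_pos_of_pos hρ (-β)
  have far : 8 * S ≤ len p → GradBound u p ((64 * C1 + C2) * A * S ^ 2 * len p ^ (-β))
      ((64 * C1 + C2) * A * S ^ 2 * len p ^ (-β) / len p) := by
    intro h8
    -- S ≤ |p| trades S^{1-β} for |p|^{1-β}, giving a decay rate independent of S.
    have hS3 : S ^ (3 - β) ≤ S ^ 2 * (len p * len p ^ (-β)) := by
      rw [← rpow_one_sub hρ, show 3 - β = 2 + (1 - β) by ring, Real.rpow_add hS, Real.rpow_two]
      gcongr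
      linarith
    have hb : C2 * A * S ^ (3 - β) ≤ (64 * C1 + C2) * A * S ^ 2 * len p ^ (-β) * len p := by
      calc C2 * A * S ^ (3 - β) ≤ (64 * C1 + C2) * A * (S ^ 2 * (len p * len p ^ (-β))) := by
            gcongr; linarith
        _ = _ := by ring
    refine (hf Cl S A Ω u h hA hS hΩ p hp h8 hl).mono ?_ ?_
    · rw [div_le_iff₀ hρ]; exact hb
    · rw [div_le_div_iff₀ (by positivity) hρ, pow_two (len p), ← mul_assoc _ (len p) (len p)]
      exact mul_le_mul_of_nonneg_right hb hρ.le
  refine ⟨?_, far⟩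
  rcases le_or_gt (8 * S) (len p) with h8 | h8
  · exact (far h8).val
  -- Inside 8S the bound |p|^{2-β} is at most 64 S²|p|^{-β}.
  · refine ((hg Cl S A Ω u h hA hΩ p hp hl).2.val).trans ?_
    rw [rpow_two_sub hρ]
    calc C1 * A * (len p ^ 2 * len p ^ (-β)) ≤ C1 * A * ((8 * S) ^ 2 * len p ^ (-β)) := by gcongr
      _ = 64 * C1 * (A * S ^ 2 * len p ^ (-β)) := by ring
      _ ≤ (64 * C1 + C2) * (A * S ^ 2 * len p ^ (-β)) := by gcongr; linarith
      _ = _ := by ring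

/-! ### The error terms away from the origin -/

section

variable {Cl S a B w : ℝ} {χ u : ℝ × ℝ → ℝ} {p : ℝ × ℝ}

/-- The value uses the decay of u: C_l²S²w, of which one factor C_lS is at most 1. The gradient uses
the quadratic bounds instead, with C_l|x| ≤ 1/128 on the support of χ₄. -/
lemma gradBound_potErr (hχ : IsCutoff χ) (hCl : 0 < Cl) (hS : 0 ≤ S) (hSC : Cl * S ≤ 1) (ha : 0 ≤ a) (hB : 0 ≤ B)
    (hw : 0 ≤ w) (hcut : CutBound 1 B χ) (hp : p ∈ halfPlane)
    (hu : len p ≤ 1 / (8 * Cl) → |u p| ≤ a * S ^ 2 * w ∧ GradBound u p (a * len p ^ 2) (a * len p)) :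
    GradBound (potErr χ Cl u) p (2 * a * B * (Cl * S) * w) (600 * a * B * Cl) := by
  have hR := R_four hCl
  have hR0 : 0 < R Cl 4 := by rw [hR]; positivity
  have hρ := len_pos_of_mem hp
  rcases lt_or_ge (2 * R Cl 4) (len p) with hl | hl
  · have e : potErr χ Cl u =ᶠ[𝓝 p] fun _ => 0 := by
      filter_upwards [hχ.scl_zero_ev hR0 hp hl] with q hq
      rw [potErr, cut_eq_scl, hq, mul_zero]
    exact (GradBound.of_eventually_zero e).mono (by positivity) (by positivity)
  · have hlC : Cl * len p ≤ 1 / 128 := by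
      calc Cl * len p ≤ Cl * (2 * R Cl 4) := by gcongr
        _ = 1 / 128 := by rw [hR]; field_simp; norm_num
    have hl8 : len p ≤ 1 / (8 * Cl) := by rw [le_div_iff₀ (by positivity)]; linarith
    obtain ⟨hv, hg⟩ := hu hl8
    have hp4 : p.2 ≤ 1 / (4 * Cl) := by
      have : p.2 ≤ len p := (le_abs_self _).trans (abs_snd_le_len p)
      rw [le_div_iff₀ (by positivity)]
      nlinarith
    have hpot := gradBound_pot hCl hp4
    have hc : GradBound (cut χ Cl 4) p B (B / R Cl 4) := (hcut.scl hR0).g0 p hp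
    have g : GradBound (potErr χ Cl u) p _ _ := (hpot.mul hg).mul hc
    have hder : (4 * Cl ^ 3 * (a * len p ^ 2) + 2 * Cl ^ 2 * (a * len p)) * B
        + 2 * Cl ^ 2 * (a * len p ^ 2) * (B / R Cl 4) ≤ 600 * a * B * Cl := by
      have e1 : B / R Cl 4 = 256 * (B * Cl) := by rw [hR]; field_simp
      have h1 : 0 ≤ a * B * Cl := by positivity
      have h2 : (Cl * len p) ^ 2 ≤ 1 := by
        have : 0 ≤ Cl * len p := by positivity
        nlinarith
      have h3 : a * B * Cl * (Cl * len p) ^ 2 ≤ a * B * Cl * 1 := by gcongr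
      have h4 : a * B * Cl * (Cl * len p) ≤ a * B * Cl * 1 := by gcongr; linarith
      rw [e1]
      calc _ = 516 * (a * B * Cl * (Cl * len p) ^ 2) + 2 * (a * B * Cl * (Cl * len p)) := by ring
        _ ≤ _ := by linarith
    refine ⟨g.diff, ?_, g.dx_le.trans hder, g.dy_le.trans hder⟩
    rw [potErr, abs_mul, abs_mul]
    calc |pot Cl p| * |u p| * |cut χ Cl 4 p| ≤ 2 * Cl ^ 2 * (a * S ^ 2 * w) * B := by
          gcongr
          · exact hpot.val
          · exact hc.val
      _ = 2 * a * B * (Cl * S) * w * (Cl * S) := by ring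
      _ ≤ 2 * a * B * (Cl * S) * w * 1 := by gcongr
      _ = _ := by ring

/-- Supported where R₄ ≤ |x| ≤ 2R₄, beyond 8S. Each derivative of χ₄ costs a factor of order C_l, so
the value is O(C_l²S²w). In the gradient the leading term is the Hessian of u, of size aw, times
∇χ₄. -/
lemma gradBound_commErr (hχ : IsCutoff χ) (hCl : 0 < Cl) (hS : 0 ≤ S) (hSC : 4096 * (Cl * S) ≤ 1) (ha : 0 ≤ a)
    (hB : 0 ≤ B) (hw : 0 ≤ w) (hw1 : w ≤ 1) (hcut : CutBound 1 B χ) (hp : p ∈ halfPlane)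
    (hu : 8 * S ≤ len p → len p ≤ 1 / (16 * Cl) → ContDiffAt ℝ 2 u p ∧
      GradBound u p (a * S ^ 2 * w) (a * S ^ 2 * w / len p) ∧ HessBound u p (a * w)) :
    GradBound (commErr χ Cl u) p (327680 * a * B * (Cl * S) * w) (2560 * a * B * Cl) := by
  have hR := R_four hCl
  have hR0 : 0 < R Cl 4 := by rw [hR]; positivity
  have hρ := len_pos_of_mem hp
  have const (c : ℝ) (e : cut χ Cl 4 =ᶠ[𝓝 p] fun _ => c) :
      GradBound (commErr χ Cl u) p (327680 * a * B * (Cl * S) * w) (2560 * a * B * Cl) := by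
    refine (GradBound.of_eventually_zero ?_).mono (by positivity) (by positivity)
    filter_upwards [e.eventually_nhds] with q hq
    rw [commErr, dx_congr hq, dy_congr hq, lap_congr hq]
    simp [lap, dx, dy]
  rcases lt_or_ge (len p) (R Cl 4) with hl | hl
  · exact const 1 (hχ.scl_one_ev hR0 hp hl)
  rcases lt_or_ge (2 * R Cl 4) (len p) with hl2 | hl2
  · exact const 0 (hχ.scl_zero_ev hR0 hp hl2)
  have hSR : 8 * S ≤ R Cl 4 := by rw [hR, le_div_iff₀ (by positivity)]; linarith
  obtain ⟨hd, hg, hh⟩ := hu (hSR.trans hl) (by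
    refine hl2.trans ?_
    rw [hR, ← mul_div_assoc, div_le_div_iff₀ (by positivity) (by positivity)]; linarith)
  have hc := hcut.scl hR0
  set r := R Cl 4 with hr
  set V := a * S ^ 2 * w with hV
  have hV0 : 0 ≤ V := by positivity
  have hVr : V / len p ≤ V / r := by gcongr
  have gx := ((hg.of_contDiffAt_dx hd hh).mono hVr le_rfl).mul (hc.gx p hp)
  have gy := ((hg.of_contDiffAt_dy hd hh).mono hVr le_rfl).mul (hc.gy p hp)
  have g : GradBound (commErr χ Cl u) p _ _ :=
    ((gx.add gy).const_mul 2).add ((hg.mono le_rfl hVr).mul (hc.gl p hp))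
  have hVr2 : V / r ^ 2 ≤ a * w := by
    rw [div_le_iff₀ (by positivity), hV]
    have : S ^ 2 ≤ r ^ 2 := by gcongr; linarith
    nlinarith [mul_nonneg ha hw]
  have er : 1 / r = 256 * Cl := by rw [hR]; field_simp
  refine g.mono ?_ ?_
  · rw [abs_of_pos two_pos]
    calc _ = 5 * V * B * (1 / r) ^ 2 := by field_simp; ring
      _ = 327680 * a * B * (Cl * S) * w * (Cl * S) := by rw [er, hV]; ring
      _ ≤ 327680 * a * B * (Cl * S) * w * 1 := by gcongr; linarith
      _ = _ := by ring
  · rw [abs_of_pos two_pos]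
    calc _ = 4 * (a * w) * (B * (1 / r)) + 6 * (V / r ^ 2) * (B * (1 / r)) := by field_simp; ring
      _ ≤ 4 * (a * w) * (B * (1 / r)) + 6 * (a * w) * (B * (1 / r)) := by gcongr
      _ = 2560 * a * B * Cl * w := by rw [er]; ring
      _ ≤ 2560 * a * B * Cl * 1 := by gcongr
      _ = _ := by ring

end

lemma half_le_rpow {ρ : ℝ} (h1 : 1 ≤ ρ) (h2 : ρ ≤ 2) : 1 / 2 ≤ ρ ^ (-(1 / 16) : ℝ) := by
  have h0 : 0 < ρ := by linarith
  calc (1 / 2 : ℝ) ≤ 1 / ρ := by gcongr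
    _ = ρ ^ (-1 : ℝ) := by rw [Real.rpow_neg_one, one_div]
    _ ≤ _ := Real.rpow_le_rpow_of_exponent_le h1 (by norm_num)

/-- The total error term is controlled together with its gradient. -/
theorem exists_errBound_totErr {χ η : ℝ × ℝ → ℝ} (hχ : IsCutoff χ) (hη : IsCutoff η) :
    ∃ C : ℝ, 0 < C ∧ ∀ (Cl S A : ℝ) (Ω u : ℝ × ℝ → ℝ), IsReduced Cl S Ω u → 0 ≤ A →
      SourceBound 1 (1 / 16) A Ω → 1 ≤ S → 4096 * (Cl * S) ≤ 1 →
        ErrBound (C * (Cl * S) * A) (totErr χ η Cl u) ∧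
        ∀ p ∈ halfPlane, ‖grad (totErr χ η Cl u) p‖ ≤ C * Cl * A := by
  have hβ : (0 : ℝ) < 1 / 16 := by norm_num
  have hβ1 : (1 / 16 : ℝ) < 1 := by norm_num
  obtain ⟨K1, hK1, hexp⟩ := exists_stream_expansion hβ hβ1
  obtain ⟨K2, hK2, hhess⟩ := exists_hess_bound one_pos le_rfl hβ hβ1
  obtain ⟨K3, hK3, hdec⟩ := exists_decay_bound hβ hβ1
  obtain ⟨K4, hK4, hgrad⟩ := exists_grad_bound one_pos le_rfl hβ hβ1
  obtain ⟨B, hB, hcut⟩ := (hχ.isTame 3).exists_cutBound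
  obtain ⟨B', hB', hkap⟩ := hη.isTame_kap.exists_cutBound
  set K := K1 + K2 + K3 + K4 with hK
  set D := 400000 * K * (B + B' + 1) with hD
  have hK0 : 0 < K := by positivity
  have hD0 : 0 < D := by positivity
  refine ⟨2 * D, by positivity, fun Cl S A Ω u h hA hΩ hS hSC => ?_⟩
  have hCl := h.Cl_pos
  have hClS : Cl ≤ Cl * S := le_mul_of_one_le_right hCl.le hS
  have hCl1 : 4096 * Cl ≤ 1 := by linarith
  have hCl2 : Cl ^ 2 ≤ Cl := by nlinarith
  have hSC' : 256 * S ≤ 1 / Cl := by rw [le_div_iff₀ hCl]; linarith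
  obtain ⟨hc, hw⟩ := hexp Cl S A Ω u h hA hΩ hSC' hCl1
  set a := K * A with ha
  have ha0 : 0 ≤ a := by positivity
  have le1 : K1 * A ≤ a := by rw [ha]; gcongr; linarith
  have le2 : K2 * A ≤ a := by rw [ha]; gcongr; linarith
  have le3 : K3 * A ≤ a := by rw [ha]; gcongr; linarith
  have le4 : K4 * A ≤ a := by rw [ha]; gcongr; linarith
  have hc' := hc.trans le1
  have hw' : ∀ p ∈ halfPlane, len p ≤ 2 → GradBound (fun q => u q - dxyZero u * (q.1 * q.2)) p
      (a * len p ^ 3) (a * len p ^ 2) := fun p hp hl =>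
    (hw p hp hl).mono (mul_le_mul_of_nonneg_right le1 (by have := len_nonneg p; positivity))
      (mul_le_mul_of_nonneg_right le1 (by positivity))
  have hd0 := dxyZero_potErr hχ h hCl1 hc' hw'
  have aD : ∀ b : ℝ, 0 ≤ b → b ≤ 400000 * (B + B' + 1) → ∀ t : ℝ, 0 ≤ t → a * b * t ≤ D * t * A := by
    intro b _ hb t ht
    calc a * b * t ≤ a * (400000 * (B + B' + 1)) * t := by gcongr
      _ = _ := by rw [ha, hD]; ring
  -- Here χ₄ = 1 and -Δκ = xy, so the subtracted term removes exactly the leading part of Vu.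
  have near : ∀ p ∈ halfPlane, len p < 1 →
      GradBound (totErr χ η Cl u) p (D * Cl * A) (D * Cl * A * len p ^ 2) := by
    intro p hp hl
    have hρ := len_pos_of_mem hp
    have e := totErr_near (u := u) hχ hη hCl hCl1 hp hl
    rw [hd0] at e
    refine ((gradBound_pot_expansion hCl hCl1 hc' hp (by linarith) (hw' p hp (by linarith))).congr e).mono ?_ ?_
    · calc 6 * a * Cl ^ 2 * len p ^ 3 ≤ 6 * a * Cl * 1 := by
            gcongr
            exact pow_le_one₀ hρ.le hl.le
        _ = a * 6 * Cl := by ring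
        _ ≤ _ := aD 6 (by norm_num) (by linarith) Cl hCl.le
    · calc 6 * a * Cl ^ 2 * len p ^ 2 ≤ 6 * a * Cl * len p ^ 2 := by gcongr
        _ = a * 6 * (Cl * len p ^ 2) := by ring
        _ ≤ D * (Cl * len p ^ 2) * A := aD 6 (by norm_num) (by linarith) _ (by positivity)
        _ = _ := by ring
  -- Three independent pieces: the commutator, the lower order term and the κ correction.
  have far : ∀ p ∈ halfPlane, 1 ≤ len p →
      GradBound (totErr χ η Cl u) p (D * (Cl * S) * A * len p ^ (-(1 / 16) : ℝ)) (D * Cl * A) := by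
    intro p hp hl
    have hρ := len_pos_of_mem hp
    set w := len p ^ (-(1 / 16) : ℝ) with hwdef
    have hw0 : 0 < w := Real.rpow_pos_of_pos hρ _
    have hw1 : w ≤ 1 := Real.rpow_le_one_of_one_le_of_nonpos hl (by norm_num)
    have g1 := gradBound_commErr (a := a) hχ hCl (by linarith) hSC ha0 hB hw0.le hw1 hcut hp
      (u := u) fun h8 h16 => by
        refine ⟨h.contDiffAt hp (h16.trans_lt (by rw [div_lt_div_iff₀ (by positivity) hCl]; linarith)), ?_,
          (hhess Cl S A Ω u h hA hΩ p hp (by linarith) h16).mono (by gcongr)⟩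
        exact ((hdec Cl S A Ω u h hA (by linarith) hΩ p hp (h16.trans (by
          rw [div_le_div_iff₀ (by positivity) (by positivity)]; linarith))).2 h8).mono (by gcongr) (by gcongr)
    have g2 := gradBound_potErr (a := a) hχ hCl (S := S) (by linarith) (by linarith) ha0 hB hw0.le hcut hp
      (u := u) fun h8 =>
        ⟨(hdec Cl S A Ω u h hA (by linarith) hΩ p hp h8).1.trans (by gcongr),
          (hgrad Cl S A Ω u h hA hΩ p hp h8).1.mono (by gcongr) (by gcongr)⟩
    have hd1 : |dxyZero (potErr χ Cl u)| ≤ a * Cl := by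
      rw [hd0, abs_mul, abs_of_nonneg (by positivity)]
      calc 3 / 4 * Cl ^ 2 * |dxyZero u| ≤ 1 * Cl * a := by gcongr; norm_num
        _ = _ := by ring
    -- The correction lives on |x| ≤ 2, where the decay factor w is at least 1/2, and its
    -- coefficient is O(C_l²) ≤ O(C_l).
    have g3 : GradBound (fun q => dxyZero (potErr χ Cl u) * -lap (kap η) q) p (2 * a * B' * (Cl * S) * w)
        (a * B' * Cl) := by
      rcases lt_or_ge 2 (len p) with h2 | h2
      · refine (GradBound.of_eventually_zero ?_).mono (by positivity) (by positivity)
        filter_upwards [isOpen_halfPlane.mem_nhds hp,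
          continuous_len.continuousAt.eventually (lt_mem_nhds h2)] with q hq hlq
        have e : kap η =ᶠ[𝓝 q] fun _ => 0 := by
          filter_upwards [isOpen_halfPlane.mem_nhds hq,
            continuous_len.continuousAt.eventually (lt_mem_nhds hlq)] with z hz hlz
          exact hη.isTame_kap.zero z (halfPlane_subset hz) hlz
        rw [lap_congr e]
        simp [lap, dx, dy]
      · have hwh : 1 / 2 ≤ w := half_le_rpow hl h2
        refine ((hkap.gl p hp).neg.const_mul (dxyZero (potErr χ Cl u))).mono ?_ ?_
        · rw [one_pow, div_one]
          have hs : a * Cl * B' ≤ a * (Cl * S) * B' := by gcongr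
          have hs2 : a * (Cl * S) * B' * (1 / 2) ≤ a * (Cl * S) * B' * w := by gcongr
          calc |dxyZero (potErr χ Cl u)| * B' ≤ a * Cl * B' := by gcongr
            _ ≤ 2 * a * B' * (Cl * S) * w := by linarith
        · rw [one_pow, div_one]
          calc |dxyZero (potErr χ Cl u)| * B' ≤ a * Cl * B' := by gcongr
            _ = _ := by ring
    have g : GradBound (totErr χ η Cl u) p _ _ := (g1.add g2).sub g3
    have hBB : 0 ≤ B + B' := by positivity
    refine g.mono ?_ ?_
    · calc _ = a * (327682 * B + 2 * B') * ((Cl * S) * w) := by ring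
        _ ≤ D * ((Cl * S) * w) * A := aD _ (by positivity) (by linarith) _ (by positivity)
        _ = _ := by ring
    · calc _ = a * (3160 * B + B') * Cl := by ring
        _ ≤ _ := aD _ (by positivity) (by linarith) _ hCl.le
  have hN : D * Cl * A ≤ 2 * D * (Cl * S) * A := by
    have : 0 ≤ D * A := by positivity
    have h1 : D * A * Cl ≤ D * A * (Cl * S) := by gcongr
    have h2 : 0 ≤ D * A * (Cl * S) := by positivity
    linarith
  have hN2 : D * (Cl * S) * A ≤ 2 * D * (Cl * S) * A := by
    have h2 : 0 ≤ D * (Cl * S) * A := by positivity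
    linarith
  refine ⟨⟨fun p hp => ?_, fun y hy => totErr_axis hχ hη h hy, fun p hp hl => ?_, fun p hp hl => ?_,
    fun p hp hl => ?_, fun p hp hl => ?_, fun p hp hl => ?_⟩, fun p hp => ?_⟩
  · rcases lt_or_ge (len p) 1 with hl | hl
    · exact (near p hp hl).diff
    · exact (far p hp hl).diff
  · exact (near p hp hl).dx_le.trans (by gcongr)
  · exact (near p hp hl).dy_le.trans (by gcongr)
  · exact (far p hp hl).val.trans (mul_le_mul_of_nonneg_right hN2 (Real.rpow_nonneg (len_nonneg p) _))
  · exact (far p hp hl).dx_le.trans hN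
  · exact (far p hp hl).dy_le.trans hN
  · rcases lt_or_ge (len p) 1 with hl | hl
    · have h1 : len p ^ 2 ≤ 1 := pow_le_one₀ (len_nonneg p) hl.le
      have h2 : D * Cl * A * len p ^ 2 ≤ D * Cl * A * 1 := by gcongr
      exact (near p hp hl).norm_grad_le.trans (by linarith)
    · exact (far p hp hl).norm_grad_le.trans (by linarith)

/-- The estimates of the error terms in the norm of `X` and of their gradients. -/
theorem error_estimates {χ η : ℝ × ℝ → ℝ} (hχ : IsCutoff χ) (hη : IsCutoff η) :
    ∃ C : ℝ, 0 < C ∧ ∀ (Cl S : ℝ) (Ω u : ℝ × ℝ → ℝ), IsReduced Cl S Ω u → 1 ≤ S → 4096 * (Cl * S) ≤ 1 →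
      xNorm (totErr χ η Cl u) ≤ ENNReal.ofReal (C * (Cl * S)) * wNorm 1 (1 / 16) Ω ∧
      supNorm halfPlane (fun p => ‖grad (totErr χ η Cl u) p‖)
        ≤ ENNReal.ofReal (C * Cl) * wNorm 1 (1 / 16) Ω := by
  obtain ⟨C, hC, hE⟩ := exists_errBound_totErr hχ hη
  refine ⟨80 * C, by positivity, fun Cl S Ω u h hS hSC => ?_⟩
  have hCl := h.Cl_pos
  constructor
  · by_cases hw : wNorm 1 (1 / 16) Ω = ∞
    · rw [hw, ENNReal.mul_top (by simpa using by positivity)]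
      exact le_top
    · rw [← ENNReal.ofReal_toReal hw, ← ENNReal.ofReal_mul (by positivity)]
      refine (hE Cl S _ Ω u h ENNReal.toReal_nonneg (sourceBound_of_wNorm hw) hS hSC).1.xNorm_le.trans
        (ENNReal.ofReal_le_ofReal (le_of_eq (by ring)))
  · refine supNorm_le fun p hp => ofReal_le_mul_wNorm (by positivity) fun A hA hΩ => ?_
    rw [abs_of_nonneg (norm_nonneg _)]
    refine ((hE Cl S A Ω u h hA hΩ hS hSC).2 p hp).trans ?_
    have : 0 ≤ C * Cl * A := by positivity
    linarith

end ElliEst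

end

theorem proposition5p3 (χ η : ℝ × ℝ → ℝ) (hχ : IsCutoff χ) (hη : IsCutoff η) :
    -- gradient estimates
    (∀ α β : ℝ, 0 < α → 0 < β → β < 1 →
      ∃ ν₁ C : ℝ, 0 < ν₁ ∧ ν₁ < 1 / 32 ∧ 0 < C ∧
        ∀ (Cl S : ℝ) (ω φ : ℝ × ℝ → ℝ), 0 < Cl → 1 ≤ S → Cl * (1 + S) < ν₁ →
          IsSource S ω →
          (∃ L γ : ℝ≥0, 0 < γ ∧ HolderOnWith L γ ω halfPlane) →
          IsStream Cl ω φ →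
          (∀ p ∈ halfPlane, len p ≤ 2 * R Cl 2 →
            ENNReal.ofReal (‖grad (streamOne Cl φ) p‖ * (len p ^ (-1 : ℝ) + len p ^ (-1 + β)))
              ≤ ENNReal.ofReal C * wNorm α β (OmOne Cl ω)) ∧
          (∀ p ∈ halfPlane, 8 * S ≤ len p → len p ≤ R Cl 1 / 2 →
            ENNReal.ofReal ‖grad (streamOne Cl φ) p‖
              ≤ ENNReal.ofReal
                  (C * (S ^ (3 - β) / len p ^ 2 + len p ^ (1 - β) * (Cl * S) ^ (2 - β)))
                * wNorm α β (OmOne Cl ω))) ∧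
    ∃ ν₂ : ℝ → ℝ → ℝ,
      -- Hessian estimates
      (∀ α β : ℝ, 0 < α → α ≤ 1 → 0 < β → β < 1 →
        0 < ν₂ α β ∧ ν₂ α β < 1 / 32 ∧ ∃ C : ℝ, 0 < C ∧
          ∀ (Cl S : ℝ) (ω φ : ℝ × ℝ → ℝ), 0 < Cl → 1 ≤ S → Cl * (1 + S) < ν₂ α β →
            IsSource S ω →
            (∃ L γ : ℝ≥0, 0 < γ ∧ HolderOnWith L γ ω halfPlane) →
            IsStream Cl ω φ →
            (∀ p ∈ halfPlane,
              ENNReal.ofReal ‖hess (fun q => streamOne Cl φ q * cut χ Cl 3 q) p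
                  - hess (invLap (OmOne Cl ω)) p‖
                ≤ ENNReal.ofReal (C * Cl ^ β) * wNorm α β (OmOne Cl ω)) ∧
            dxyZero (streamOne Cl φ) = dxyZero φ ∧
            ENNReal.ofReal |dxyZero (streamOne Cl φ) - dxyZero (invLap (OmOne Cl ω))|
              ≤ ENNReal.ofReal (C * Cl ^ β) * wNorm α β (OmOne Cl ω)) ∧
      -- smallness of the error term, with `β = 1/16`
      ∃ C : ℝ, 0 < C ∧
        ∀ (Cl S : ℝ) (ω φ : ℝ × ℝ → ℝ), 0 < Cl → 1 ≤ S → Cl * S < ν₂ 1 (1 / 16) →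
          IsSource S ω →
          xNorm (OmOne Cl ω) < ∞ →
          IsStream Cl ω φ →
          xNorm (ZTot χ η Cl φ) ≤ ENNReal.ofReal (C * (Cl * S)) * MTot χ Cl ω ∧
          supNorm halfPlane (fun p => ‖grad (ZTot χ η Cl φ) p‖)
            ≤ ENNReal.ofReal (C * Cl) * MTot χ Cl ω := by
  -- The single threshold 1/4096 serves all three parts; for the Hessian it keeps the source well
  -- inside the localization radius.
  have small : ∀ Cl S : ℝ, 0 < Cl → 1 ≤ S → Cl * (1 + S) < 1 / 4096 → 256 * S ≤ 1 / Cl :=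
    fun Cl S hCl _ h => by
      rw [le_div_iff₀ hCl]
      have : 0 ≤ Cl * S := by positivity
      linarith
  refine ⟨fun α β hα hβ hβ1 => ?_, fun _ _ => 1 / 4096, fun α β hα hα1 hβ hβ1 => ?_, ?_⟩
  · obtain ⟨C, hC, h⟩ := gradient_estimates hα hβ hβ1
    exact ⟨1 / 4096, C, by norm_num, by norm_num, hC, fun Cl S ω φ hCl hS _ hω _ hφ =>
      h Cl S _ _ (isReduced_streamOne hCl hω hφ) (by linarith)⟩
  · obtain ⟨C, hC, h⟩ := hessian_estimates hχ hα hα1 hβ hβ1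
    refine ⟨by norm_num, by norm_num, C, hC, fun Cl S ω φ hCl hS hsm hω _ hφ => ?_⟩
    obtain ⟨h1, h2⟩ := h Cl S _ _ (isReduced_streamOne hCl hω hφ) (by linarith) (small Cl S hCl hS hsm)
    exact ⟨h1, dxyZero_streamOne hCl hφ, h2⟩
  · obtain ⟨C, hC, h⟩ := error_estimates hχ hη
    refine ⟨C, hC, fun Cl S ω φ hCl hS hsm hω _ hφ => ?_⟩
    obtain ⟨h1, h2⟩ := h Cl S _ _ (isReduced_streamOne hCl hω hφ) hS (by linarith)
    -- The error bounds hold already with the first summand of M alone.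
    have hM : wNorm 1 (1 / 16) (OmOne Cl ω) ≤ MTot χ Cl ω := le_self_add
    rw [ZTot_eq_totErr]
    exact ⟨h1.trans (by gcongr), h2.trans (by gcongr)⟩
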